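/- **Notation.** Let $k$ be a field of characteristic $0$ (for instance $\mathbb C$ or $\mathbb Q$), $q$ an indeterminate, and $m\ge 1$. For $1\le i\le m+1$ put $[i]=0$ if $i\le m$ and $[m+1]=1$, and $q_i=q^{(-1)^{[i]}}$. *The algebra.* $\mathcal O_q(GL_{m|1})$ is the superalgebra over $k(q)$ generated by $x_{ij}$ $(1\le i,j\le m+1)$ of parity $[i]+[j]$ and the inverses of $\det_qA=\sum_{\sigma\in S_m}(-q^2)^{l(\sigma)}x_{1\sigma(1)}\cdots x_{m\sigma(m)}$ and of $x_{m+1,m+1}$, with the relations - $x_{ij}^2=0$ if $[i]+[j]$ is odd; - $x_{ij}x_{il}=(-1)^{([i]+[j])([i]+[l])}q_i^2\,x_{il}x_{ij}$ for $j<l$; - $x_{ij}x_{sj}=(-1)^{([i]+[j])([s]+[j])}q_j^2\,x_{sj}x_{ij}$ for $i<s$; - $x_{ij}x_{sl}=(-1)^{([i]+[j])([s]+[l])}x_{sl}x_{ij}$ for $i<s$, $j>l$; - $x_{ij}x_{sl}=(-1)^{([i]+[j])([s]+[l])}x_{sl}x_{ij}+(-1)^{[s][j]+[s][l]+[j][l]}(q^2-q^{-2})x_{il}x_{sj}$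 for $i<s$, $j<l$. *The action.* $U_q(\mathfrak{gl}_{m|1})$ is the quantized enveloping superalgebra over $k(q)$ with generators $K_a^{\pm1}$ $(1\le a\le m+1)$ and $E_p=E_{p,p+1}$, $F_p=E_{p+1,p}$ $(1\le p\le m)$, where only $E_m$, $F_m$ are odd, and with the usual relations $K_aE_pK_a^{-1}=q_a^{2\delta_{a,p}-2\delta_{a,p+1}}E_p$, $K_aF_pK_a^{-1}=q_a^{-2\delta_{a,p}+2\delta_{a,p+1}}F_p$, $[E_p,F_r\}=\delta_{pr}\frac{K_pK_{p+1}^{-1}-K_p^{-1}K_{p+1}}{q^2-q^{-2}}$ (supercommutator), $E_m^2=F_m^2=0$, commutation of the $K_a^{\pm1}$, of $E_p,E_r$ and of $F_p,F_r$ for $|p-r|\ge2$, and the Serre relations $X_p^2X_{p\pm1}-(q^2+q^{-2})X_pX_{p\pm1}X_p+X_{p\pm1}X_p^2=0$ for $X\in\{E,F\}$, $p\ne m$. Its co-unit is the algebra map $\epsilon$ with $\epsilon(E_p)=\epsilon(F_p)=0$, $\epsilon(K_a^{\pm1})=1$. It acts from the left on $\mathcal O_q(GL_{m|1})$ by $$K_a.x_{ij}=q_a^{2\delta_{ai}}x_{ij},\qquad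 E_p.x_{ij}=\delta_{p+1,i}\,x_{p,j},\qquad F_p.x_{ij}=\delta_{p,i}\,x_{p+1,j},$$ where $K_a$ acts by algebra automorphisms and, for homogeneous $f$, $$E_p.(fg)=(-1)^{[E_p][f]}f\,(E_p.g)+(E_p.f)(K_p^{-1}K_{p+1}.g),\qquad F_p.(fg)=(-1)^{[F_p][f]}(K_pK_{p+1}^{-1}.f)(F_p.g)+(F_p.f)\,g .$$ For a set $S$ of generators let $U_S$ be the subalgebra of $U_q(\mathfrak{gl}_{m|1})$ generated by $S$, and ${}^{L_S}\mathcal O_q(GL_{m|1})=\{f\mid u.f=\epsilon(u)f\ \ \forall u\in U_S\}$, a subalgebra of $\mathcal O_q(GL_{m|1})$. *The dual canonical basis.* Let $f\mapsto\bar f$ be the additive map of $\mathcal O_q(GL_{m|1})$ with $\overline{c(q)f}=c(q^{-1})\bar f$ for $c\in k(q)$, $\overline{fg}=(-1)^{[f][g]}\bar g\bar f$ for homogeneous $f,g$, which fixes all $x_{ij}$, $(\det_qA)^{-1}$ and $x_{m+1,m+1}^{-1}$. Let $\mathbb M$ be the set of $(m+1)\times(m+1)$ matrices $M=\begin{pmatrix}M_1&M_2\\M_3&M_4\end{pmatrix}=(m_{ij})$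 of non-negative integers, in blocks of sizes $m$ and $1$, with all entries of $M_2$, $M_3$ in $\{0,1\}$. Write $T<M$ if $T$ is obtained from $M$ by a non-empty sequence of moves which, for some $i<s$, $j<t$, lower the (positive) entries $(i,j)$ and $(s,t)$ by one and raise the entries $(i,t)$ and $(s,j)$ by one. Let $$x(M)=q^{-\sum_{i,\,j<l}(-1)^{[i]}m_{ij}m_{il}-\sum_{l,\,s<t}(-1)^{[l]}m_{sl}m_{tl}}\;x^M,$$ where $x^M$ is the product of the $x_{ij}^{m_{ij}}$ in the lexicographic order of the pairs $(i,j)$. Below, all sums are finite and range over matrices in $\mathbb M$ of the same block shape. 1. $\Omega_q\begin{pmatrix}M_1&M_2\\0&0\end{pmatrix}$ is the bar-invariant element of the form $x\begin{pmatrix}M_1&M_2\\0&0\end{pmatrix}+\sum_{T<M}h_Tx(T)$ with $h_T\in q\mathbb Z[q]$, and $\Omega_{q^{-1}}\begin{pmatrix}0&0\\M_3&0\end{pmatrix}$ is the bar-invariant element of the form $x\begin{pmatrix}0&0\\M_3&0\end{pmatrix}+\sum_{T<M}h_Tx(T)$ with $h_T\in q^{-1}\mathbb Z[q^{-1}]$.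 2. With $c_i$ the sum of the $i$-th column, put $N\begin{pmatrix}M_1&M_2\\M_3&0\end{pmatrix}=q^{-\sum_{i\le m}c_i(M_1)c_i(M_3)}\,\Omega_q\begin{pmatrix}M_1&M_2\\0&0\end{pmatrix}\Omega_{q^{-1}}\begin{pmatrix}0&0\\M_3&0\end{pmatrix}$. Then $\Omega_q\begin{pmatrix}M_1&M_2\\M_3&0\end{pmatrix}$ is the bar-invariant element of the form $N(M)+\sum_{T<M}h_TN(T)$ with $h_T\in q\mathbb Z[q]$. 3. Let $A=(x_{ij})_{i,j\le m}$ and $y=x_{m+1,m+1}-\sum_{i,j\le m}x_{m+1,i}(A^{-1})_{ij}x_{j,m+1}$, which is invertible. For $a,d\in\mathbb Z$ and $M\in\mathbb M$ with $M_4=0$ and at least one zero diagonal entry in $M_1$, put $$N_{a,d}(M)=q^{(d-a)(S(M_2)+S(M_3))}(\det\nolimits_qA)^a\,\Omega_q\begin{pmatrix}M_1&M_2\\M_3&0\end{pmatrix}\,y^d,$$ with $S$ the sum of all entries; say that $N_{a',d'}(T)<N_{a,d}(M)$ if $a<a'$, or $a=a'$ and $d<d'$, or $a=a'$, $d=d'$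 and $T<M$. The dual canonical basis $B_q^*$ of $\mathcal O_q(GL_{m|1})$ consists of the bar-invariant elements $\Omega_{q,a,d}(M)$, for these $a,d,M$, of the form $N_{a,d}(M)+\sum h\,N_{a',d'}(T)$, a finite sum over $N_{a',d'}(T)<N_{a,d}(M)$ with coefficients $h\in q\mathbb Z[q]$. **Theorem.** Let $S$ be any subset of the generators $\{E_p,F_p\mid 1\le p\le m\}\cup\{K_a^{\pm1}\mid 1\le a\le m+1\}$ of $U_q(\mathfrak{gl}_{m|1})$ which does not contain $F_m$. Then the subalgebra of left invariants ${}^{L_S}\mathcal O_q(GL_{m|1})$ is the $k(q)$-linear span of a subset of the dual canonical basis $B_q^*$. -/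

import Mathlib

set_option linter.unusedSimpArgs false
set_option linter.unnecessarySeqFocus false

noncomputable section

namespace QuantumGL

universe u

/-! ### Scalars: the field `k(q)` -/

section Scalars

variable (k : Type u) [Field k]

/-- The field `k(q)` of rational functions in an indeterminate `q`. -/
def Kq : Type u := RatFunc k

instance : Field (Kq k) := inferInstanceAs (Field (RatFunc k))

/-- The indeterminate `q`. -/
def q : Kq k := (RatFunc.X : RatFunc k)

lemma q_ne_zero : q k ≠ 0 := RatFunc.X_ne_zero

lemma aeval_X_inv_injective :
    Function.Injective (Polynomial.aeval (R := k) ((RatFunc.X : RatFunc k)⁻¹)) := by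
  rw [← transcendental_iff_injective]
  intro h
  exact RatFunc.transcendental_X (by simpa using h.inv)

/-- The involution `q ↦ q⁻¹` of the field `k(q)`, identity on `k`. -/
def barScalar : Kq k →+* Kq k :=
  RatFunc.liftRingHom (Polynomial.aeval (R := k) ((RatFunc.X : RatFunc k)⁻¹)).toRingHom
    (nonZeroDivisors_le_comap_nonZeroDivisors_of_injective _ (aeval_X_inv_injective k))

lemma barScalar_q : barScalar k (q k) = (q k)⁻¹ := by
  refine (RatFunc.liftRingHom_X (K := k) _ _).trans ?_
  exact Polynomial.aeval_X (R := k) ((RatFunc.X : RatFunc k)⁻¹)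

/-- The set `q ℤ[q]`. -/
def qZq : Set (Kq k) := {c | ∃ p : Polynomial ℤ, c = q k * Polynomial.aeval (q k) p}

/-- The set `q⁻¹ ℤ[q⁻¹]`. -/
def qinvZqinv : Set (Kq k) :=
  {c | ∃ p : Polynomial ℤ, c = (q k)⁻¹ * Polynomial.aeval ((q k)⁻¹) p}

end Scalars

/-! ### Inversions and quantum determinants -/

/-- The set of inversions of a permutation. -/
def inversions {r : ℕ} (σ : Equiv.Perm (Fin r)) : Finset (Fin r × Fin r) :=
  Finset.univ.filter fun p => p.1 < p.2 ∧ σ p.2 < σ p.1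

/-- The length `l(σ)`. -/
def len {r : ℕ} (σ : Equiv.Perm (Fin r)) : ℕ := (inversions σ).card

lemma mem_inversions {r : ℕ} (σ : Equiv.Perm (Fin r)) (a b : Fin r) :
    (a, b) ∈ inversions σ ↔ a < b ∧ σ b < σ a := by
  simp [inversions]

lemma len_mul_swap {r : ℕ} (σ : Equiv.Perm (Fin r)) (t t' : Fin r) (ht : (t' : ℕ) = t + 1)
    (h : σ t < σ t') : len (σ * Equiv.swap t t') = len σ + 1 := by
  have key : inversions (σ * Equiv.swap t t') =
      insert (t, t') ((inversions σ).map
        ((Equiv.prodCongr (Equiv.swap t t') (Equiv.swap t t')).toEmbedding)) := by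
    ext ⟨a, b⟩
    simp only [mem_inversions, Finset.mem_insert, Finset.mem_map_equiv, Prod.mk.injEq, Equiv.Perm.mul_apply, Equiv.prodCongr_symm,
      Equiv.symm_swap, Equiv.prodCongr_apply, Prod.map_apply]
    have htt : t < t' := by rw [Fin.lt_def]; omega
    rcases eq_or_ne a t with rfl | ha
    · rcases eq_or_ne b t' with rfl | hb'
      · simp [htt, h]
      · rcases eq_or_ne b a with rfl | hb
        · simp [hb']
        · rw [Equiv.swap_apply_left, Equiv.swap_apply_of_ne_of_ne hb hb']
          have : (a < b) ↔ (t' < b) := by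
            rw [Fin.lt_def, Fin.lt_def]
            have := Fin.val_ne_of_ne hb; have := Fin.val_ne_of_ne hb'; omega
          simp [this, hb']
    · rcases eq_or_ne a t' with rfl | ha'
      · rcases eq_or_ne b t with rfl | hb
        · simp [htt.not_gt, htt.ne', h.not_gt]
        · rcases eq_or_ne b a with rfl | hb'
          · simp [ha]
          · rw [Equiv.swap_apply_right, Equiv.swap_apply_of_ne_of_ne hb hb']
            have : (a < b) ↔ (t < b) := by
              rw [Fin.lt_def, Fin.lt_def]
              have := Fin.val_ne_of_ne hb; have := Fin.val_ne_of_ne hb'; omega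
            simp [this, ha]
      · rw [Equiv.swap_apply_of_ne_of_ne ha ha']
        rcases eq_or_ne b t with rfl | hb
        · rw [Equiv.swap_apply_left]
          have : (a < b) ↔ (a < t') := by
            rw [Fin.lt_def, Fin.lt_def]
            have := Fin.val_ne_of_ne ha; have := Fin.val_ne_of_ne ha'; omega
          simp [this, ha]
        · rcases eq_or_ne b t' with rfl | hb'
          · rw [Equiv.swap_apply_right]
            have : (a < b) ↔ (a < t) := by
              rw [Fin.lt_def, Fin.lt_def]
              have := Fin.val_ne_of_ne ha; have := Fin.val_ne_of_ne ha'; omega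
            simp [this, ha]
          · rw [Equiv.swap_apply_of_ne_of_ne hb hb']
            simp [ha]
  rw [len, key, Finset.card_insert_of_notMem, Finset.card_map, len]
  simp [inversions, Finset.mem_map_equiv, -Finset.mem_map]
  intro h1
  exact absurd h1 (by rw [Fin.lt_def]; omega)

lemma len_mul_rev {r : ℕ} (σ : Equiv.Perm (Fin r)) :
    len (σ * Fin.revPerm) + len σ = len (Fin.revPerm : Equiv.Perm (Fin r)) := by
  have h1 : len (σ * Fin.revPerm) =
      (Finset.univ.filter fun p : Fin r × Fin r => p.1 < p.2 ∧ σ p.1 < σ p.2).card := by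
    rw [len]
    refine Finset.card_bij' (fun p _ => (Fin.rev p.2, Fin.rev p.1))
      (fun p _ => (Fin.rev p.2, Fin.rev p.1)) ?_ ?_ ?_ ?_ <;>
    simp [inversions]
  have h2 : len (Fin.revPerm : Equiv.Perm (Fin r)) =
      (Finset.univ.filter fun p : Fin r × Fin r => p.1 < p.2).card := by
    rw [len, inversions]; congr 1; ext p; simp
  rw [h1, h2, len, inversions, ← Finset.card_union_of_disjoint]
  · congr 1
    ext ⟨a, b⟩
    simp only [Finset.mem_union, Finset.mem_filter, Finset.mem_univ, true_and]
    constructor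
    · rintro (h | h) <;> exact h.1
    · intro h
      rcases lt_trichotomy (σ a) (σ b) with h' | h' | h'
      · exact Or.inl ⟨h, h'⟩
      · exact absurd (σ.injective h') h.ne
      · exact Or.inr ⟨h, h'⟩
  · rw [Finset.disjoint_filter]
    rintro p - h h'
    exact absurd h.2 h'.2.not_gt

section Det

variable {k : Type u} [Field k] {A : Type*} [Ring A] [Algebra (Kq k) A]

/-- The quantum determinant `∑_σ (-q²)^{l(σ)} x_{1σ(1)} ⋯ x_{rσ(r)}` of a matrix with entries in a
not necessarily commutative algebra. -/
def qdet (k : Type u) [Field k] {A : Type*} [Ring A] [Algebra (Kq k) A] {r : ℕ}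
    (X : Fin r → Fin r → A) : A :=
  ∑ σ : Equiv.Perm (Fin r), (-(q k) ^ 2) ^ len σ • (List.ofFn fun i => X i (σ i)).prod

lemma list_prod_two {M : Type*} [Monoid M] : ∀ {r : ℕ} (F : Fin r → M) (t t' : Fin r),
    (t' : ℕ) = t + 1 → ∃ L R : M, ∀ G : Fin r → M, (∀ s, s ≠ t → s ≠ t' → G s = F s) →
      (List.ofFn G).prod = L * (G t * G t') * R
  | 0, _, t, _, _ => t.elim0
  | r + 1, F, t, t', h => by
    obtain ⟨t', rfl⟩ : ∃ s, t' = Fin.succ s := ⟨t'.pred (by rintro rfl; simp at h), by simp⟩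
    induction t using Fin.cases with
    | zero =>
      obtain ⟨r, rfl⟩ : ∃ r', r = r' + 1 := ⟨r - 1, by have := t'.2; omega⟩
      obtain rfl : t' = 0 := by ext; simpa using h
      refine ⟨1, (List.ofFn fun i : Fin r => F i.succ.succ).prod, fun G hG => ?_⟩
      rw [List.ofFn_succ, List.ofFn_succ, List.prod_cons, List.prod_cons, one_mul, mul_assoc]
      congr 4
      funext i
      exact hG _ (by simp) (by simp [Fin.ext_iff])
    | succ t =>
      obtain ⟨L, R, H⟩ := list_prod_two (fun i => F i.succ) t t' (by simpa using h)
      refine ⟨F 0 * L, R, fun G hG => ?_⟩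
      rw [List.ofFn_succ, List.prod_cons, H (fun i => G i.succ), hG 0, mul_assoc, mul_assoc,
        mul_assoc]
      · simp [mul_assoc]
      · exact (Fin.succ_ne_zero _).symm
      · exact (Fin.succ_ne_zero _).symm
      · intro s h1 h2
        exact hG _ (by simpa using h1) (by simpa using h2)

/-- The relations of an ordinary quantum matrix. -/
structure IsQMatrix (k : Type u) [Field k] {A : Type*} [Ring A] [Algebra (Kq k) A] {r : ℕ}
    (X : Fin r → Fin r → A) : Prop where
  anti : ∀ i k' j l, i < k' → l < j → X i j * X k' l = X k' l * X i j
  diag : ∀ i k' j l, i < k' → j < l → X i j * X k' l = X k' l * X i j +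
    ((q k) ^ 2 - ((q k) ^ 2)⁻¹) • (X i l * X k' j)

/-- Auxiliary: the determinant with permuted rows. -/
def qdetRow (k : Type u) [Field k] {A : Type*} [Ring A] [Algebra (Kq k) A] {r : ℕ}
    (X : Fin r → Fin r → A) (ρ : Equiv.Perm (Fin r)) : A :=
  ∑ σ : Equiv.Perm (Fin r), (-(q k) ^ 2) ^ len σ • (List.ofFn fun i => X (ρ i) (σ i)).prod

lemma sum_pair {r : ℕ} (f : Equiv.Perm (Fin r) → A) (t t' : Fin r) (h : t ≠ t') :
    ∑ σ, f σ = ∑ σ with σ t < σ t', (f σ + f (σ * Equiv.swap t t')) := by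
  rw [← Finset.sum_filter_add_sum_filter_not Finset.univ
    (fun σ : Equiv.Perm (Fin r) => σ t < σ t'), Finset.sum_add_distrib]
  congr 1
  symm
  refine Finset.sum_bij' (fun σ _ => σ * Equiv.swap t t') (fun σ _ => σ * Equiv.swap t t')
    ?_ ?_ ?_ ?_ ?_
  · intro σ hσ
    simp only [Finset.mem_filter, Finset.mem_univ, true_and, Equiv.Perm.mul_apply,
      Equiv.swap_apply_left, Equiv.swap_apply_right, not_lt] at hσ ⊢
    exact hσ.le
  · intro σ hσ
    simp only [Finset.mem_filter, Finset.mem_univ, true_and, Equiv.Perm.mul_apply,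
      Equiv.swap_apply_left, Equiv.swap_apply_right, not_lt] at hσ ⊢
    exact lt_of_le_of_ne hσ (fun e => h (σ.injective e).symm)
  · intro σ _; simp [mul_assoc]
  · intro σ _; simp [mul_assoc]
  · intro σ _; rfl

lemma qdetRow_swap {r : ℕ} {X : Fin r → Fin r → A} (hX : IsQMatrix k X)
    (ρ : Equiv.Perm (Fin r)) (t t' : Fin r) (ht : (t' : ℕ) = t + 1) (h : ρ t < ρ t') :
    qdetRow k X (ρ * Equiv.swap t t') = (-(q k) ^ 2) • qdetRow k X ρ := by
  have hne : t ≠ t' := by rintro rfl; omega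
  have hq := q_ne_zero k
  rw [qdetRow, qdetRow, sum_pair _ t t' hne, sum_pair _ t t' hne, Finset.smul_sum]
  refine Finset.sum_congr rfl fun σ hσ => ?_
  simp only [Finset.mem_filter, Finset.mem_univ, true_and] at hσ
  rw [len_mul_swap σ t t' ht hσ]
  obtain ⟨L, R, H⟩ := list_prod_two (fun i => X (ρ i) (σ i)) t t' ht
  have hs : ∀ s, s ≠ t → s ≠ t' → Equiv.swap t t' s = s := fun s h1 h2 =>
    Equiv.swap_apply_of_ne_of_ne h1 h2
  rw [H _ (fun s h1 h2 => by simp [hs s h1 h2]), H _ (fun s h1 h2 => by simp [hs s h1 h2]),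
    H _ (fun s h1 h2 => rfl), H _ (fun s h1 h2 => by simp [hs s h1 h2])]
  simp only [Equiv.Perm.mul_apply, Equiv.swap_apply_left, Equiv.swap_apply_right]
  have e1 := hX.anti _ _ _ _ h hσ
  have e2 := hX.diag _ _ _ _ h hσ
  rw [← e1, e2, ← sub_eq_zero]
  simp only [mul_add, add_mul, mul_smul_comm, smul_mul_assoc, smul_add, smul_smul, pow_succ (-(q k) ^ 2)]
  generalize (-q k ^ 2) ^ len σ = z
  match_scalars <;> field_simp <;> ring

lemma qdetRow_eq {r : ℕ} {X : Fin r → Fin r → A} (hX : IsQMatrix k X) :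
    ∀ (n : ℕ) (ρ : Equiv.Perm (Fin r)), len ρ = n →
      qdetRow k X ρ = (-(q k) ^ 2) ^ n • qdetRow k X 1 := by
  intro n
  induction n with
  | zero =>
    intro ρ hρ
    have hm : StrictMono ρ := by
      intro a b hab
      by_contra hc
      have : (a, b) ∈ inversions ρ := by
        simp only [inversions, Finset.mem_filter, Finset.mem_univ, true_and]
        exact ⟨hab, lt_of_le_of_ne (not_lt.mp hc) (fun e => hab.ne' (ρ.injective e))⟩
      rw [len, Finset.card_eq_zero] at hρ
      simp [hρ] at this
    have : ρ = 1 := by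
      have h1 : (hm.orderIsoOfSurjective ρ ρ.surjective) = OrderIso.refl _ := Subsingleton.elim _ _
      ext a
      have := congrArg (fun f : Fin r ≃o Fin r => f a) h1
      simpa using congrArg Fin.val this
    simp [this]
  | succ n ih =>
    intro ρ hρ
    have hex : ∃ t t' : Fin r, (t' : ℕ) = t + 1 ∧ ρ t' < ρ t := by
      by_contra hc
      push Not at hc
      have hmono : Monotone ρ := by
        rcases r with _ | r
        · intro a; exact a.elim0
        · rw [Fin.monotone_iff_le_succ]
          intro i
          exact hc _ _ (by simp)
      have : inversions ρ = ∅ := by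
        ext ⟨a, b⟩
        simp only [inversions, Finset.mem_filter, Finset.mem_univ, true_and, Finset.notMem_empty,
          iff_false, not_and, not_lt]
        exact fun hab => hmono hab.le
      rw [len, this] at hρ
      simp at hρ
    obtain ⟨t, t', ht, hlt⟩ := hex
    have hlt' : (ρ * Equiv.swap t t') t < (ρ * Equiv.swap t t') t' := by simpa using hlt
    have hρ' : ρ * Equiv.swap t t' * Equiv.swap t t' = ρ := by simp [mul_assoc]
    have hl := len_mul_swap _ t t' ht hlt'
    have hD := qdetRow_swap hX _ t t' ht hlt'
    rw [hρ'] at hl hD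
    rw [hD, ih _ (by omega), smul_smul, pow_succ' (-(q k) ^ 2)]

/-- The quantum determinant read with the factors in the opposite order. -/
lemma qdet_reverse {r : ℕ} {X : Fin r → Fin r → A} (hX : IsQMatrix k X) :
    ∑ σ : Equiv.Perm (Fin r), ((-(q k) ^ 2)⁻¹) ^ len σ •
      (List.ofFn fun i => X i (σ i)).reverse.prod = qdet k X := by
  have hc : -(q k) ^ 2 ≠ 0 := neg_ne_zero.mpr (pow_ne_zero _ (q_ne_zero k))
  have h1 : qdet k X = qdetRow k X 1 := rfl
  have h2 := qdetRow_eq hX _ (Fin.revPerm : Equiv.Perm (Fin r)) rfl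
  have h3 : qdetRow k X Fin.revPerm = (-(q k) ^ 2) ^ len (Fin.revPerm : Equiv.Perm (Fin r)) •
      ∑ σ : Equiv.Perm (Fin r), ((-(q k) ^ 2)⁻¹) ^ len σ •
        (List.ofFn fun i => X i (σ i)).reverse.prod := by
    rw [qdetRow, Finset.smul_sum, ← Equiv.sum_comp (Equiv.mulRight Fin.revPerm)]
    refine Finset.sum_congr rfl fun σ _ => ?_
    rw [smul_smul, ← len_mul_rev σ, pow_add, mul_assoc, ← mul_pow, mul_inv_cancel₀ hc, one_pow,
      mul_one]
    congr 2
    apply List.ext_getElem <;> simp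
    intro n h1
    have : Fin.rev (⟨n, h1⟩ : Fin r) = ⟨r - 1 - n, by omega⟩ := by
      ext; simp; omega
    rw [this]
  rw [h1]
  rw [h3] at h2
  have := congrArg (fun z => ((-(q k) ^ 2) ^ len (Fin.revPerm : Equiv.Perm (Fin r)))⁻¹ • z) h2
  simpa only [smul_smul, inv_mul_cancel₀ (pow_ne_zero _ hc), one_smul] using this

end Det

/-! ### The coordinate superalgebra `𝒪_q(GL_{m|1})` -/

/-- The parity `[i]` of an index `i ∈ {1, …, m+1}`: only the last index is odd. -/
def par {m : ℕ} (i : Fin (m + 1)) : ℕ := if i = Fin.last m then 1 else 0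

lemma par_lt {m : ℕ} {i j : Fin (m + 1)} (h : i < j) : par i = 0 :=
  if_neg (fun e : i = Fin.last m => (Fin.le_last j).not_gt (e ▸ h))

lemma par_last {m : ℕ} : par (Fin.last m) = 1 := if_pos rfl

lemma par_castSucc {m : ℕ} (i : Fin m) : par i.castSucc = 0 := par_lt (Fin.castSucc_lt_last i)

lemma par_cases {m : ℕ} (i : Fin (m + 1)) : par i = 0 ∨ par i = 1 := by
  unfold par; split_ifs <;> simp

lemma par_eq_one {m : ℕ} {i : Fin (m + 1)} (h : par i = 1) : i = Fin.last m := by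
  by_contra hc
  simp [par, hc] at h

section Coord

variable (k : Type u) [Field k] {m : ℕ}

/-- The sign `(-1)^{([i]+[j])([s]+[t])}` of exchanging `x_{ij}` and `x_{st}`. -/
def sgn (i j s t : Fin (m + 1)) : Kq k := (-1) ^ ((par i + par j) * (par s + par t))

/-- The power `q^{2 (-1)^{[i]}}`. -/
def qq (i : Fin (m + 1)) : Kq k := q k ^ (2 * (-1 : ℤ) ^ par i)

/-- The relations of a quantum supermatrix. -/
structure IsQSuperMatrix {A : Type*} [Ring A] [Algebra (Kq k) A]
    (X : Fin (m + 1) → Fin (m + 1) → A) : Prop where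
  odd_sq : ∀ i j, par i + par j = 1 → X i j * X i j = 0
  row : ∀ i j l, j < l → X i j * X i l = (sgn k i j i l * qq k i) • (X i l * X i j)
  col : ∀ i s j, i < s → X i j * X s j = (sgn k i j s j * qq k j) • (X s j * X i j)
  anti : ∀ i s j l, i < s → l < j → X i j * X s l = sgn k i j s l • (X s l * X i j)
  diag : ∀ i s j l, i < s → j < l → X i j * X s l = sgn k i j s l • (X s l * X i j) +
    ((-1) ^ (par s * par j + par s * par l + par j * par l) * (q k ^ 2 - (q k ^ 2)⁻¹)) •
      (X i l * X s j)

variable (m) in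
/-- Generators: the entries `x_{ij}` of the quantum supermatrix, and the inverses of
`det_q A` and of `det_{q⁻¹} D = x_{m+1,m+1}`. -/
inductive Coord : Type
  | x (i j : Fin (m + 1))
  | detInv
  | lastInv

variable (m) in
/-- The free algebra on the generators. -/
abbrev FreeCoord := FreeAlgebra (Kq k) (Coord m)

/-- The generator `x_{ij}` of the free algebra. -/
def fx (i j : Fin (m + 1)) : FreeCoord k m := FreeAlgebra.ι (Kq k) (Coord.x i j)

/-- The block `A` of a supermatrix. -/
def blockA {A : Type*} (X : Fin (m + 1) → Fin (m + 1) → A) : Fin m → Fin m → A :=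
  fun i j => X i.castSucc j.castSucc

variable (m) in
/-- The defining relations of `𝒪_q(GL_{m|1})`: those of the quantum supermatrix, and those making
`det_q A` and `x_{m+1,m+1}` invertible. -/
inductive Rel : FreeCoord k m → FreeCoord k m → Prop
  | odd_sq (i j : Fin (m + 1)) (h : par i + par j = 1) : Rel (fx k i j * fx k i j) 0
  | row (i j l : Fin (m + 1)) (h : j < l) :
      Rel (fx k i j * fx k i l) ((sgn k i j i l * qq k i) • (fx k i l * fx k i j))
  | col (i s j : Fin (m + 1)) (h : i < s) :
      Rel (fx k i j * fx k s j) ((sgn k i j s j * qq k j) • (fx k s j * fx k i j))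
  | anti (i s j l : Fin (m + 1)) (h : i < s) (h' : l < j) :
      Rel (fx k i j * fx k s l) (sgn k i j s l • (fx k s l * fx k i j))
  | diag (i s j l : Fin (m + 1)) (h : i < s) (h' : j < l) :
      Rel (fx k i j * fx k s l) (sgn k i j s l • (fx k s l * fx k i j) +
        ((-1) ^ (par s * par j + par s * par l + par j * par l) * (q k ^ 2 - (q k ^ 2)⁻¹)) •
          (fx k i l * fx k s j))
  | det_mul_inv : Rel (qdet k (blockA (fx k)) * FreeAlgebra.ι _ Coord.detInv) 1
  | inv_mul_det : Rel (FreeAlgebra.ι _ Coord.detInv * qdet k (blockA (fx k))) 1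
  | last_mul_inv :
      Rel (fx k (Fin.last m) (Fin.last m) * FreeAlgebra.ι _ Coord.lastInv) 1
  | inv_mul_last :
      Rel (FreeAlgebra.ι _ Coord.lastInv * fx k (Fin.last m) (Fin.last m)) 1

variable (m) in
/-- The algebra `𝒪_q(GL_{m|1})`: the localization of the coordinate algebra of the quantum
supermatrix at `det_q A` and `det_{q⁻¹} D = x_{m+1,m+1}`. -/
def O : Type u := RingQuot (Rel k m)

instance : Ring (O k m) := inferInstanceAs (Ring (RingQuot (Rel k m)))
instance : Algebra (Kq k) (O k m) := inferInstanceAs (Algebra (Kq k) (RingQuot (Rel k m)))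

variable (m) in
/-- The quotient map. -/
def mk : FreeCoord k m →ₐ[Kq k] O k m := RingQuot.mkAlgHom (Kq k) (Rel k m)

/-- The entries `x_{ij}`. -/
def x (i j : Fin (m + 1)) : O k m := mk k m (fx k i j)

variable (m) in
/-- The inverse of `det_q A`. -/
def detInv : O k m := mk k m (FreeAlgebra.ι _ Coord.detInv)

variable (m) in
/-- The inverse of `x_{m+1,m+1}`. -/
def lastInv : O k m := mk k m (FreeAlgebra.ι _ Coord.lastInv)

variable (m) in
/-- The quantum determinant `det_q A`. -/
def detA : O k m := qdet k (blockA (x k))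

lemma map_qdet {r : ℕ} {A B : Type*} [Ring A] [Algebra (Kq k) A] [Ring B] [Algebra (Kq k) B]
    (f : A →ₐ[Kq k] B) (X : Fin r → Fin r → A) : f (qdet k X) = qdet k fun i j => f (X i j) := by
  simp only [qdet, map_sum, map_smul, map_list_prod, List.map_ofFn]
  rfl

lemma mk_rel {a b : FreeCoord k m} (h : Rel k m a b) : mk k m a = mk k m b :=
  RingQuot.mkAlgHom_rel (Kq k) h

lemma mk_qdet : mk k m (qdet k (blockA (fx k))) = detA k m := map_qdet k _ _

lemma isQSuperMatrix_x : IsQSuperMatrix k (x k : Fin (m + 1) → Fin (m + 1) → O k m) where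
  odd_sq i j h := by simpa [x] using mk_rel k (Rel.odd_sq i j h)
  row i j l h := by simpa [x] using mk_rel k (Rel.row i j l h)
  col i s j h := by simpa [x] using mk_rel k (Rel.col i s j h)
  anti i s j l h h' := by simpa [x] using mk_rel k (Rel.anti i s j l h h')
  diag i s j l h h' := by simpa [x] using mk_rel k (Rel.diag i s j l h h')

lemma detA_mul_detInv : detA k m * detInv k m = 1 := by
  simpa [detInv, mk_qdet] using mk_rel k Rel.det_mul_inv

lemma detInv_mul_detA : detInv k m * detA k m = 1 := by
  simpa [detInv, mk_qdet] using mk_rel k Rel.inv_mul_det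

lemma last_mul_lastInv : x k (Fin.last m) (Fin.last m) * lastInv k m = 1 := by
  simpa [lastInv, x] using mk_rel k Rel.last_mul_inv

lemma lastInv_mul_last : lastInv k m * x k (Fin.last m) (Fin.last m) = 1 := by
  simpa [lastInv, x] using mk_rel k Rel.inv_mul_last

variable (m) in
/-- `det_q A` as a unit. -/
def detUnit : (O k m)ˣ := ⟨detA k m, detInv k m, detA_mul_detInv k, detInv_mul_detA k⟩

section Lift

variable {k} {A : Type*} [Ring A] [Algebra (Kq k) A] (X : Fin (m + 1) → Fin (m + 1) → A)

/-- Values on the generators. -/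
def liftFun (X : Fin (m + 1) → Fin (m + 1) → A) (u v : A) : Coord m → A
  | Coord.x i j => X i j
  | Coord.detInv => u
  | Coord.lastInv => v

/-- The universal property of `𝒪_q(GL_{m|1})`. -/
def lift (hX : IsQSuperMatrix k X) (u v : A)
    (h1 : qdet k (blockA X) * u = 1) (h2 : u * qdet k (blockA X) = 1)
    (h3 : X (Fin.last m) (Fin.last m) * v = 1) (h4 : v * X (Fin.last m) (Fin.last m) = 1) :
    O k m →ₐ[Kq k] A :=
  RingQuot.liftAlgHom (Kq k) ⟨FreeAlgebra.lift (Kq k) (liftFun X u v), by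
    have e1 : ∀ i j, FreeAlgebra.lift (Kq k) (liftFun X u v) (fx k i j) = X i j := by
      intro i j; simp [fx, liftFun]
    have e2 : FreeAlgebra.lift (Kq k) (liftFun X u v) (qdet k (blockA (fx k))) =
        qdet k (blockA X) := by
      rw [map_qdet]; simp only [blockA, e1]; rfl
    intro a b h
    induction h with
    | odd_sq i j h => simpa [e1] using hX.odd_sq i j h
    | row i j l h => simpa [e1] using hX.row i j l h
    | col i s j h => simpa [e1] using hX.col i s j h
    | anti i s j l h h' => simpa [e1] using hX.anti i s j l h h'
    | diag i s j l h h' => simpa [e1] using hX.diag i s j l h h'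
    | det_mul_inv => simpa [e2, liftFun] using h1
    | inv_mul_det => simpa [e2, liftFun] using h2
    | last_mul_inv => simpa [e1, liftFun] using h3
    | inv_mul_last => simpa [e1, liftFun] using h4⟩

lemma lift_mk (hX : IsQSuperMatrix k X) (u v : A) (h1 h2 h3 h4) (a : FreeCoord k m) :
    lift X hX u v h1 h2 h3 h4 (mk k m a) = FreeAlgebra.lift (Kq k) (liftFun X u v) a :=
  RingQuot.liftAlgHom_mkAlgHom_apply (S := Kq k) _ _ a

lemma lift_x (hX : IsQSuperMatrix k X) (u v : A) (h1 h2 h3 h4) (i j : Fin (m + 1)) :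
    lift X hX u v h1 h2 h3 h4 (x k i j) = X i j := by
  rw [x, lift_mk]; simp [fx, liftFun]

end Lift

/-! ### Relations in simplified form -/

section Simplified

variable {k} {A : Type*} [Ring A] [Algebra (Kq k) A] {X : Fin (m + 1) → Fin (m + 1) → A}

lemma IsQSuperMatrix.row_even (hX : IsQSuperMatrix k X) {i j l : Fin (m + 1)} (hi : par i = 0)
    (h : j < l) : X i j * X i l = (q k ^ 2) • (X i l * X i j) := by
  rw [hX.row i j l h]
  simp [sgn, qq, hi, par_lt h]

lemma IsQSuperMatrix.row_odd (hX : IsQSuperMatrix k X) {i j l : Fin (m + 1)} (hi : par i = 1)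
    (h : j < l) : X i j * X i l = ((-1) ^ (1 + par l) * (q k ^ 2)⁻¹) • (X i l * X i j) := by
  rw [hX.row i j l h]
  simp [sgn, qq, hi, par_lt h]

lemma IsQSuperMatrix.col_even (hX : IsQSuperMatrix k X) {i s j : Fin (m + 1)} (hj : par j = 0)
    (h : i < s) : X i j * X s j = (q k ^ 2) • (X s j * X i j) := by
  rw [hX.col i s j h]
  simp [sgn, qq, hj, par_lt h]

lemma IsQSuperMatrix.col_odd (hX : IsQSuperMatrix k X) {i s j : Fin (m + 1)} (hj : par j = 1)
    (h : i < s) : X i j * X s j = ((-1) ^ (1 + par s) * (q k ^ 2)⁻¹) • (X s j * X i j) := by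
  rw [hX.col i s j h]
  simp [sgn, qq, hj, par_lt h, add_comm]

lemma IsQSuperMatrix.anti' (hX : IsQSuperMatrix k X) {i s j l : Fin (m + 1)} (h : i < s)
    (h' : l < j) : X i j * X s l = (-1 : Kq k) ^ (par j * par s) • (X s l * X i j) := by
  rw [hX.anti i s j l h h']
  simp [sgn, par_lt h, par_lt h']

lemma IsQSuperMatrix.diag' (hX : IsQSuperMatrix k X) {i s j l : Fin (m + 1)} (h : i < s)
    (h' : j < l) : X i j * X s l = X s l * X i j +
      ((-1) ^ (par s * par l) * (q k ^ 2 - (q k ^ 2)⁻¹)) • (X i l * X s j) := by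
  rw [hX.diag i s j l h h']
  simp [sgn, par_lt h, par_lt h']

lemma IsQSuperMatrix.blockA (hX : IsQSuperMatrix k X) : IsQMatrix k (blockA X) where
  anti i s j l h h' := by
    have := hX.anti' (i := i.castSucc) (s := s.castSucc) (j := j.castSucc) (l := l.castSucc)
      (by simpa using h) (by simpa using h')
    simpa [par_castSucc, QuantumGL.blockA] using this
  diag i s j l h h' := by
    have := hX.diag' (i := i.castSucc) (s := s.castSucc) (j := j.castSucc) (l := l.castSucc)
      (by simpa using h) (by simpa using h')
    simpa [par_castSucc, QuantumGL.blockA] using this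

end Simplified

/-! ### The bar involution -/

section Bar

variable (m) in
/-- The opposite of the algebra of `2 × 2` matrices over `𝒪_q(GL_{m|1})`, with scalars acting through
`q ↦ q⁻¹`. An element `f` of parity `p` is recorded below as the matrix of
`bar f` times the `p`-th power of the parity operator, so that products are reversed with
the sign rule. -/
def BarTarget : Type u := (Matrix (Fin 2) (Fin 2) (O k m))ᵐᵒᵖ

instance : Ring (BarTarget k m) := inferInstanceAs (Ring (Matrix (Fin 2) (Fin 2) (O k m))ᵐᵒᵖ)

instance : Algebra (Kq k) (BarTarget k m) :=
  RingHom.toAlgebra' ((algebraMap (Kq k) (Matrix (Fin 2) (Fin 2) (O k m))ᵐᵒᵖ).comp (barScalar k))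
    fun c y => Algebra.commutes (A := (Matrix (Fin 2) (Fin 2) (O k m))ᵐᵒᵖ) (barScalar k c) y

/-- The underlying matrix. -/
def BarTarget.mat (T : BarTarget k m) : Matrix (Fin 2) (Fin 2) (O k m) := MulOpposite.unop T

/-- Reading a matrix in the target. -/
def BarTarget.of (T : Matrix (Fin 2) (Fin 2) (O k m)) : BarTarget k m := MulOpposite.op T

variable {k} in
lemma BarTarget.ext {S T : BarTarget k m} (h : S.mat k = T.mat k) : S = T :=
  MulOpposite.unop_injective h

@[simp] lemma BarTarget.mat_of (T : Matrix (Fin 2) (Fin 2) (O k m)) :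
    BarTarget.mat k (BarTarget.of k T) = T := rfl

@[simp] lemma BarTarget.mat_zero : BarTarget.mat k (0 : BarTarget k m) = 0 := rfl

@[simp] lemma BarTarget.mat_one : BarTarget.mat k (1 : BarTarget k m) = 1 := rfl

@[simp] lemma BarTarget.mat_add (S T : BarTarget k m) : (S + T).mat k = S.mat k + T.mat k := rfl

@[simp] lemma BarTarget.mat_neg (T : BarTarget k m) : (-T).mat k = -T.mat k := rfl

@[simp] lemma BarTarget.mat_mul (S T : BarTarget k m) : (S * T).mat k = T.mat k * S.mat k := rfl

@[simp] lemma BarTarget.mat_smul (c : Kq k) (T : BarTarget k m) :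
    (c • T).mat k = barScalar k c • T.mat k := by
  have : (c • T).mat k = T.mat k * algebraMap (Kq k) _ (barScalar k c) := rfl
  rw [this, ← Algebra.commutes, Algebra.smul_def]

lemma BarTarget.mat_sum {ι : Type*} (s : Finset ι) (f : ι → BarTarget k m) :
    (∑ i ∈ s, f i).mat k = ∑ i ∈ s, (f i).mat k :=
  map_sum (⟨⟨BarTarget.mat k, rfl⟩, fun _ _ => rfl⟩ : BarTarget k m →+ _) f s

lemma BarTarget.mat_list_prod (l : List (BarTarget k m)) :
    l.prod.mat k = (l.map (BarTarget.mat k)).reverse.prod := by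
  induction l with
  | nil => rfl
  | cons a l ih => simp [ih]

/-- Value of the bar involution on the entry `x_{ij}`. -/
def barMat (i j : Fin (m + 1)) : BarTarget k m :=
  BarTarget.of k (if par i = par j then !![x k i j, 0; 0, x k i j]
    else !![0, x k i j; -x k i j, 0])

lemma isQSuperMatrix_barMat :
    IsQSuperMatrix k (barMat k : Fin (m + 1) → Fin (m + 1) → BarTarget k m) := by
  have H := isQSuperMatrix_x k (m := m)
  have hq := q_ne_zero k
  have hb := barScalar_q k
  constructor
  · intro i j h
    apply BarTarget.ext
    have : par i ≠ par j := by omega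
    simp [barMat, this, H.odd_sq i j h, ← Matrix.ext_iff, Fin.forall_fin_two]
  · intro i j l h
    apply BarTarget.ext
    have hj := par_lt h
    rcases par_cases i with hi | hi <;> rcases par_cases l with hl | hl
    all_goals
      first
      | have e := H.row_even hi h
      | have e := H.row_odd hi h
      simp [barMat, hi, hj, hl, sgn, qq, ← Matrix.ext_iff, Fin.forall_fin_two, hb, e, hq]
  · intro i s j h
    apply BarTarget.ext
    have hj := par_lt h
    rcases par_cases j with hi | hi <;> rcases par_cases s with hl | hl
    all_goals
      first
      | have e := H.col_even hi h
      | have e := H.col_odd hi h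
      simp [barMat, hi, hj, hl, sgn, qq, ← Matrix.ext_iff, Fin.forall_fin_two, hb, e, hq]
  · intro i s j l h h'
    apply BarTarget.ext
    have hi := par_lt h
    have hl := par_lt h'
    have e := H.anti' h h'
    rcases par_cases j with hj | hj <;> rcases par_cases s with hs | hs <;>
      simp [barMat, hi, hj, hl, hs, sgn, ← Matrix.ext_iff, Fin.forall_fin_two, e]
  · intro i s j l h h'
    apply BarTarget.ext
    have hi := par_lt h
    have hj := par_lt h'
    have e := H.diag' h h'
    have e' := H.anti' h h'
    rcases par_cases l with hl | hl <;> rcases par_cases s with hs | hs <;>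
      simp [barMat, hi, hj, hl, hs, sgn, e, e', hb] <;>
      first | module | (constructor <;> module)

lemma scalar_two (a : O k m) : Matrix.scalar (Fin 2) a = !![a, 0; 0, a] := by
  ext i j
  fin_cases i <;> fin_cases j <;> rfl

lemma qdet_barMat : qdet k (blockA (barMat k : Fin (m + 1) → Fin (m + 1) → BarTarget k m)) =
    BarTarget.of k (Matrix.scalar (Fin 2) (detA k m)) := by
  have h : ∀ i j : Fin m, blockA (barMat k) i j =
      BarTarget.of k (Matrix.scalar (Fin 2) (blockA (x k) i j)) := by
    intro i j
    simp only [blockA, barMat, par_castSucc, if_true, scalar_two]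
  apply BarTarget.ext
  rw [detA, ← qdet_reverse (isQSuperMatrix_x k (m := m)).blockA, qdet, BarTarget.mat_sum,
    BarTarget.mat_of, map_sum]
  refine Finset.sum_congr rfl fun σ _ => ?_
  have hc : barScalar k (-q k ^ 2) = (-q k ^ 2)⁻¹ := by
    rw [map_neg, map_pow, barScalar_q, inv_neg, inv_pow]
  rw [BarTarget.mat_smul, BarTarget.mat_list_prod, map_pow, hc]
  have : ∀ (c : Kq k) (z : O k m), Matrix.scalar (Fin 2) (c • z) =
      c • Matrix.scalar (Fin 2) z := by
    intro c z
    ext a b; simp [Matrix.scalar_apply, Matrix.diagonal_apply]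
  rw [this, map_list_prod, List.map_reverse, List.map_ofFn, List.map_ofFn]
  congr 4
  funext i
  simp [h]

lemma of_scalar_mul {a b : O k m} (h : b * a = 1) :
    BarTarget.of k (Matrix.scalar (Fin 2) a) * BarTarget.of k (Matrix.scalar (Fin 2) b) = 1 := by
  apply BarTarget.ext
  rw [BarTarget.mat_mul, BarTarget.mat_of, BarTarget.mat_of, ← map_mul, h, map_one]
  rfl

lemma barMat_last : barMat k (Fin.last m) (Fin.last m) =
    BarTarget.of k (Matrix.scalar (Fin 2) (x k (Fin.last m) (Fin.last m))) := by
  simp only [barMat, if_true, scalar_two]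

variable (m) in
/-- The algebra morphism underlying the bar involution. -/
def barHom : O k m →ₐ[Kq k] BarTarget k m :=
  lift (barMat k) (isQSuperMatrix_barMat k)
    (BarTarget.of k (Matrix.scalar (Fin 2) (detInv k m)))
    (BarTarget.of k (Matrix.scalar (Fin 2) (lastInv k m)))
    (by rw [qdet_barMat]; exact of_scalar_mul k (detInv_mul_detA k))
    (by rw [qdet_barMat]; exact of_scalar_mul k (detA_mul_detInv k))
    (by rw [barMat_last]; exact of_scalar_mul k (lastInv_mul_last k))
    (by rw [barMat_last]; exact of_scalar_mul k (last_mul_lastInv k))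

/-- The bar involution of `𝒪_q(GL_{m|1})`: the additive map with `bar (c f) = bar c · bar f` for
scalars `c`, `bar (f g) = (-1)^{[f][g]} bar g · bar f`, which fixes all `x_{ij}`, `(det_q A)⁻¹` and
`x_{m+1,m+1}⁻¹`. -/
def bar (f : O k m) : O k m :=
  BarTarget.mat k (barHom k m f) 0 0 + BarTarget.mat k (barHom k m f) 0 1

lemma bar_x (i j : Fin (m + 1)) : bar k (x k i j) = x k i j := by
  rw [bar, barHom, lift_x, barMat]
  split_ifs <;> simp

lemma bar_add (f g : O k m) : bar k (f + g) = bar k f + bar k g := by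
  simp only [bar, map_add, BarTarget.mat_add, Matrix.add_apply]
  abel

lemma bar_smul (c : Kq k) (f : O k m) : bar k (c • f) = barScalar k c • bar k f := by
  simp [bar, smul_add]

lemma bar_detInv : bar k (detInv k m) = detInv k m := by
  have : barHom k m (detInv k m) = BarTarget.of k (Matrix.scalar (Fin 2) (detInv k m)) := by
    refine (lift_mk _ _ _ _ _ _ _ _ (FreeAlgebra.ι _ Coord.detInv)).trans ?_
    simp [liftFun]
  simp [bar, this]

lemma bar_lastInv : bar k (lastInv k m) = lastInv k m := by
  have : barHom k m (lastInv k m) = BarTarget.of k (Matrix.scalar (Fin 2) (lastInv k m)) := by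
    refine (lift_mk _ _ _ _ _ _ _ _ (FreeAlgebra.ι _ Coord.lastInv)).trans ?_
    simp [liftFun]
  simp [bar, this]

end Bar
/-! ### The left action of the Chevalley generators -/

section Skew

variable {k}

/-- Matrices `[[r_i c_j x_{ij}, e_{ij}], [0, s_i x_{ij}]]`, describing a skew derivation with
values `e_{ij}` on the entries `x_{ij}`. -/
def skewMat (r c s : Fin (m + 1) → (Kq k)ˣ) (e : Fin (m + 1) → Fin (m + 1) → O k m)
    (i j : Fin (m + 1)) : Matrix (Fin 2) (Fin 2) (O k m) :=
  !![((r i * c j : (Kq k)ˣ) : Kq k) • x k i j, e i j; 0, (s i : Kq k) • x k i j]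

/-- Compatibility of the values of a skew derivation with the relations. -/
structure IsSkew (r c s : Fin (m + 1) → (Kq k)ˣ) (e : Fin (m + 1) → Fin (m + 1) → O k m) :
    Prop where
  odd_sq : ∀ i j, par i + par j = 1 →
    ((r i * c j : (Kq k)ˣ) : Kq k) • (x k i j * e i j) + (s i : Kq k) • (e i j * x k i j) = 0
  row : ∀ i j l, j < l →
    ((r i * c j : (Kq k)ˣ) : Kq k) • (x k i j * e i l) + (s i : Kq k) • (e i j * x k i l) =
    (sgn k i j i l * qq k i) • (((r i * c l : (Kq k)ˣ) : Kq k) • (x k i l * e i j) +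
      (s i : Kq k) • (e i l * x k i j))
  col : ∀ i t j, i < t →
    ((r i * c j : (Kq k)ˣ) : Kq k) • (x k i j * e t j) + (s t : Kq k) • (e i j * x k t j) =
    (sgn k i j t j * qq k j) • (((r t * c j : (Kq k)ˣ) : Kq k) • (x k t j * e i j) +
      (s i : Kq k) • (e t j * x k i j))
  anti : ∀ i t j l, i < t → l < j →
    ((r i * c j : (Kq k)ˣ) : Kq k) • (x k i j * e t l) + (s t : Kq k) • (e i j * x k t l) =
    sgn k i j t l • (((r t * c l : (Kq k)ˣ) : Kq k) • (x k t l * e i j) +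
      (s i : Kq k) • (e t l * x k i j))
  diag : ∀ i t j l, i < t → j < l →
    ((r i * c j : (Kq k)ˣ) : Kq k) • (x k i j * e t l) + (s t : Kq k) • (e i j * x k t l) =
    sgn k i j t l • (((r t * c l : (Kq k)ˣ) : Kq k) • (x k t l * e i j) +
      (s i : Kq k) • (e t l * x k i j)) +
    ((-1) ^ (par t * par j + par t * par l + par j * par l) * (q k ^ 2 - (q k ^ 2)⁻¹)) •
      (((r i * c l : (Kq k)ˣ) : Kq k) • (x k i l * e t j) + (s t : Kq k) • (e i l * x k t j))

variable {r c s : Fin (m + 1) → (Kq k)ˣ} {e : Fin (m + 1) → Fin (m + 1) → O k m}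

lemma skewMat_mul (i j i' j' : Fin (m + 1)) : skewMat r c s e i j * skewMat r c s e i' j' =
    !![((r i * c j * (r i' * c j') : (Kq k)ˣ) : Kq k) • (x k i j * x k i' j'),
      ((r i * c j : (Kq k)ˣ) : Kq k) • (x k i j * e i' j') +
        (s i' : Kq k) • (e i j * x k i' j');
      0, ((s i * s i' : (Kq k)ˣ) : Kq k) • (x k i j * x k i' j')] := by
  ext a b
  fin_cases a <;> fin_cases b <;> simp [skewMat, smul_smul]

lemma isQSuperMatrix_skewMat (h : IsSkew r c s e) : IsQSuperMatrix k (skewMat r c s e) := by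
  have H := isQSuperMatrix_x k (m := m)
  constructor
  · intro i j hp
    rw [skewMat_mul, H.odd_sq i j hp, h.odd_sq i j hp]
    ext a b; fin_cases a <;> fin_cases b <;> simp
  · intro i j l hj
    rw [skewMat_mul, skewMat_mul, h.row i j l hj, H.row i j l hj, Matrix.smul_of]
    ext a b; fin_cases a <;> fin_cases b <;> simp <;> module
  · intro i t j hi
    rw [skewMat_mul, skewMat_mul, h.col i t j hi, H.col i t j hi, Matrix.smul_of]
    ext a b; fin_cases a <;> fin_cases b <;> simp <;> module
  · intro i t j l hi hj
    rw [skewMat_mul, skewMat_mul, h.anti i t j l hi hj, H.anti i t j l hi hj, Matrix.smul_of]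
    ext a b; fin_cases a <;> fin_cases b <;> simp <;> module
  · intro i t j l hi hj
    rw [skewMat_mul, skewMat_mul, skewMat_mul, h.diag i t j l hi hj, H.diag i t j l hi hj,
      Matrix.smul_of, Matrix.smul_of]
    ext a b; fin_cases a <;> fin_cases b <;> simp <;> module

lemma upper_list_prod (l : List (Matrix (Fin 2) (Fin 2) (O k m))) (h : ∀ M ∈ l, M 1 0 = 0) :
    l.prod 1 0 = 0 ∧ l.prod 0 0 = (l.map fun M => M 0 0).prod ∧
      l.prod 1 1 = (l.map fun M => M 1 1).prod := by
  induction l with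
  | nil => simp
  | cons M l ih =>
    obtain ⟨h1, h2, h3⟩ := ih fun N hN => h N (List.mem_cons_of_mem _ hN)
    have h0 := h M List.mem_cons_self
    simp [Matrix.mul_apply, Fin.sum_univ_two, h0, h1, h2, h3]

lemma list_prod_smul : ∀ {n : ℕ} (a : Fin n → Kq k) (F : Fin n → O k m),
    (List.ofFn fun i => a i • F i).prod = (∏ i, a i) • (List.ofFn F).prod
  | 0, a, F => by simp
  | n + 1, a, F => by
    rw [List.ofFn_succ, List.prod_cons, list_prod_smul (fun i => a i.succ) (fun i => F i.succ),
      List.ofFn_succ, List.prod_cons, Fin.prod_univ_succ, smul_mul_smul_comm]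

/-- The product of the scalars attached to the first `m` indices. -/
def prodFirst (r : Fin (m + 1) → (Kq k)ˣ) : (Kq k)ˣ := ∏ i : Fin m, r i.castSucc

lemma qdet_scaled (r c : Fin (m + 1) → (Kq k)ˣ) :
    qdet k (blockA fun i j => ((r i * c j : (Kq k)ˣ) : Kq k) • x k i j) =
      ((prodFirst r * prodFirst c : (Kq k)ˣ) : Kq k) • detA k m := by
  rw [qdet, detA, qdet, Finset.smul_sum]
  refine Finset.sum_congr rfl fun σ _ => ?_
  simp only [blockA]
  rw [list_prod_smul (fun i => ((r i.castSucc * c (σ i).castSucc : (Kq k)ˣ) : Kq k)), smul_comm]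
  congr 2
  simp only [Units.val_mul, Finset.prod_mul_distrib, prodFirst, Units.coe_prod]
  congr 1
  exact Equiv.prod_comp σ fun i => ((c i.castSucc : (Kq k)ˣ) : Kq k)

lemma qdet_rowScaled (s : Fin (m + 1) → (Kq k)ˣ) :
    qdet k (blockA fun i j => (s i : Kq k) • x k i j) = (prodFirst s : Kq k) • detA k m := by
  have := qdet_scaled s (1 : Fin (m + 1) → (Kq k)ˣ)
  simpa only [Pi.one_apply, mul_one, prodFirst, Finset.prod_const_one] using this

lemma qdet_skewMat : qdet k (blockA (skewMat r c s e)) =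
    !![((prodFirst r * prodFirst c : (Kq k)ˣ) : Kq k) • detA k m,
      qdet k (blockA (skewMat r c s e)) 0 1; 0, (prodFirst s : Kq k) • detA k m] := by
  have key : ∀ σ : Equiv.Perm (Fin m), _ := fun σ =>
    upper_list_prod (List.ofFn fun i => blockA (skewMat r c s e) i (σ i)) (by
      intro M hM
      obtain ⟨i, rfl⟩ := List.mem_ofFn.mp hM
      rfl)
  ext a b
  fin_cases a <;> fin_cases b
  · simp only [Fin.zero_eta, Matrix.of_apply, Matrix.cons_val', Matrix.cons_val_zero,
      Matrix.cons_val_fin_one, ← qdet_scaled]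
    rw [qdet, Matrix.sum_apply, qdet]
    refine Finset.sum_congr rfl fun σ _ => ?_
    rw [Matrix.smul_apply, (key σ).2.1, List.map_ofFn]
    rfl
  · simp
  · simp only [Fin.zero_eta, Fin.mk_one, Matrix.of_apply, Matrix.cons_val', Matrix.cons_val_zero,
      Matrix.cons_val_one, Matrix.cons_val_fin_one]
    rw [qdet, Matrix.sum_apply]
    refine Finset.sum_eq_zero fun σ _ => ?_
    rw [Matrix.smul_apply, (key σ).1, smul_zero]
  · simp only [Fin.mk_one, Matrix.of_apply, Matrix.cons_val', Matrix.cons_val_one,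
      Matrix.cons_val_fin_one, ← qdet_rowScaled]
    rw [qdet, Matrix.sum_apply, qdet]
    refine Finset.sum_congr rfl fun σ _ => ?_
    rw [Matrix.smul_apply, (key σ).2.2, List.map_ofFn]
    rfl

/-- The inverse of an upper triangular matrix `[[α a, e], [0, β a]]`, where `b = a⁻¹`. -/
def upperInv (α β : (Kq k)ˣ) (b e : O k m) : Matrix (Fin 2) (Fin 2) (O k m) :=
  !![((α⁻¹ : (Kq k)ˣ) : Kq k) • b, -(((α⁻¹ * β⁻¹ : (Kq k)ˣ) : Kq k) • (b * e * b));
    0, ((β⁻¹ : (Kq k)ˣ) : Kq k) • b]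

lemma upper_mul_inv (α β : (Kq k)ˣ) {a b : O k m} (e : O k m) (hab : a * b = 1) :
    !![(α : Kq k) • a, e; 0, (β : Kq k) • a] * upperInv α β b e = 1 := by
  have h : a * (b * e * b) = e * b := by rw [← mul_assoc, ← mul_assoc, hab, one_mul]
  ext i j
  fin_cases i <;> fin_cases j <;>
    simp [upperInv, hab, h, smul_smul]

lemma upper_inv_mul (α β : (Kq k)ˣ) {a b : O k m} (e : O k m) (hba : b * a = 1) :
    upperInv α β b e * !![(α : Kq k) • a, e; 0, (β : Kq k) • a] = 1 := by
  have h : b * e * b * a = b * e := by rw [mul_assoc, hba, mul_one]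
  ext i j
  fin_cases i <;> fin_cases j <;>
    simp [upperInv, hba, h, smul_smul]

/-- The algebra morphism `f ↦ [[α f, D f], [0, β f]]` attached to a skew derivation `D`, with
`D (f g) = (α f) (D g) + (D f) (β g)`, where `α x_{ij} = r_i c_j x_{ij}`, `β x_{ij} = s_i x_{ij}`
and `D x_{ij} = e_{ij}`. -/
def skewHom (h : IsSkew r c s e) : O k m →ₐ[Kq k] Matrix (Fin 2) (Fin 2) (O k m) :=
  lift (skewMat r c s e) (isQSuperMatrix_skewMat h)
    (upperInv (prodFirst r * prodFirst c) (prodFirst s) (detInv k m)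
      (qdet k (blockA (skewMat r c s e)) 0 1))
    (upperInv (r (Fin.last m) * c (Fin.last m)) (s (Fin.last m)) (lastInv k m)
      (e (Fin.last m) (Fin.last m)))
    (by rw [qdet_skewMat]; exact upper_mul_inv _ _ _ (detA_mul_detInv k))
    (by rw [qdet_skewMat]; exact upper_inv_mul _ _ _ (detInv_mul_detA k))
    (upper_mul_inv _ _ _ (last_mul_lastInv k))
    (upper_inv_mul _ _ _ (lastInv_mul_last k))

/-- The skew derivation with values `e_{ij}` on the entries `x_{ij}`. -/
def skewDer (h : IsSkew r c s e) : O k m →ₗ[Kq k] O k m where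
  toFun f := skewHom h f 0 1
  map_add' f g := by simp
  map_smul' a f := by simp

lemma skewDer_x (h : IsSkew r c s e) (i j : Fin (m + 1)) : skewDer h (x k i j) = e i j := by
  have this : skewHom h (x k i j) = skewMat r c s e i j := lift_x _ _ _ _ _ _ _ _ _ _
  exact congrFun (congrFun this 0) 1

lemma skewDer_mul (h : IsSkew r c s e) (f g : O k m) : skewDer h (f * g) =
    skewHom h f 0 0 * skewDer h g + skewDer h f * skewHom h g 1 1 := by
  change skewHom h (f * g) 0 1 = _
  rw [map_mul, Matrix.mul_apply, Fin.sum_univ_two]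
  rfl

/-- The automorphism `x_{ij} ↦ r_i c_j x_{ij}`. -/
def scale (r c : Fin (m + 1) → (Kq k)ˣ) : O k m →ₐ[Kq k] O k m :=
  lift (fun i j => ((r i * c j : (Kq k)ˣ) : Kq k) • x k i j)
    (by
      have H := isQSuperMatrix_x k (m := m)
      constructor
      · intro i j hp
        simp only [smul_mul_smul_comm, H.odd_sq i j hp, smul_zero]
      · intro i j l hj
        simp only [smul_mul_smul_comm, H.row i j l hj, Units.val_mul]
        module
      · intro i t j hi
        simp only [smul_mul_smul_comm, H.col i t j hi, Units.val_mul]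
        module
      · intro i t j l hi hj
        simp only [smul_mul_smul_comm, H.anti i t j l hi hj, Units.val_mul]
        module
      · intro i t j l hi hj
        simp only [smul_mul_smul_comm, H.diag i t j l hi hj, Units.val_mul]
        module)
    ((((prodFirst r * prodFirst c)⁻¹ : (Kq k)ˣ) : Kq k) • detInv k m)
    ((((r (Fin.last m) * c (Fin.last m))⁻¹ : (Kq k)ˣ) : Kq k) • lastInv k m)
    (by rw [qdet_scaled, smul_mul_smul_comm, detA_mul_detInv, Units.mul_inv, one_smul])
    (by rw [qdet_scaled, smul_mul_smul_comm, detInv_mul_detA, Units.inv_mul, one_smul])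
    (by rw [smul_mul_smul_comm, last_mul_lastInv, Units.mul_inv, one_smul])
    (by rw [smul_mul_smul_comm, lastInv_mul_last, Units.inv_mul, one_smul])

lemma scale_x (r c : Fin (m + 1) → (Kq k)ˣ) (i j : Fin (m + 1)) :
    scale r c (x k i j) = ((r i * c j : (Kq k)ˣ) : Kq k) • x k i j :=
  lift_x _ _ _ _ _ _ _ _ _ _

lemma O_induction {P : O k m → Prop} (h1 : ∀ a, P (algebraMap (Kq k) _ a))
    (hx : ∀ i j, P (x k i j)) (hd : P (detInv k m)) (hl : P (lastInv k m))
    (hmul : ∀ f g, P f → P g → P (f * g)) (hadd : ∀ f g, P f → P g → P (f + g)) (f : O k m) :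
    P f := by
  obtain ⟨a, rfl⟩ := RingQuot.mkAlgHom_surjective (Kq k) (Rel k m) f
  change P (mk k m a)
  induction a using FreeAlgebra.induction with
  | grade0 c => rw [AlgHom.commutes]; exact h1 c
  | grade1 g =>
    cases g with
    | x i j => exact hx i j
    | detInv => exact hd
    | lastInv => exact hl
  | mul a b ha hb => rw [map_mul]; exact hmul _ _ ha hb
  | add a b ha hb => rw [map_add]; exact hadd _ _ ha hb

lemma algHom_ext {A : Type*} [Ring A] [Algebra (Kq k) A] {φ ψ : O k m →ₐ[Kq k] A}
    (h : ∀ i j, φ (x k i j) = ψ (x k i j)) : φ = ψ := by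
  have hdet : φ (detA k m) = ψ (detA k m) := by
    rw [detA, map_qdet, map_qdet]; simp only [blockA, h]
  have key : ∀ a b : O k m, a * b = 1 → b * a = 1 → φ a = ψ a → φ b = ψ b := by
    intro a b hab hba hφ
    calc φ b = φ b * ψ (a * b) := by rw [hab, map_one, mul_one]
      _ = φ (b * a) * ψ b := by rw [map_mul, map_mul, hφ, mul_assoc]
      _ = ψ b := by rw [hba, map_one, one_mul]
  ext f
  induction f using O_induction with
  | h1 a => simp
  | hx i j => exact h i j
  | hd => exact key _ _ (detA_mul_detInv k) (detInv_mul_detA k) hdet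
  | hl => exact key _ _ (last_mul_lastInv k) (lastInv_mul_last k) (h _ _)
  | hmul f g hf hg => rw [map_mul, map_mul, hf, hg]
  | hadd f g hf hg => rw [map_add, map_add, hf, hg]

/-- A linear map obeying a twisted Leibniz rule and vanishing on the entries is zero. -/
lemma skew_eq_zero (T : O k m →ₗ[Kq k] O k m) (α β : O k m →ₐ[Kq k] O k m)
    (hT : ∀ f g, T (f * g) = α f * T g + T f * β g) (hx : ∀ i j, T (x k i j) = 0) : T = 0 := by
  have h1 : T 1 = 0 := by
    have := hT 1 1
    simpa using this
  have hdet : T (detA k m) = 0 := by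
    have hl : ∀ l : List (O k m), (∀ a ∈ l, T a = 0) → T l.prod = 0 := by
      intro l
      induction l with
      | nil => intro _; simpa using h1
      | cons a l ih =>
        intro h
        rw [List.prod_cons, hT, ih fun b hb => h b (List.mem_cons_of_mem _ hb),
          h a List.mem_cons_self, mul_zero, zero_mul, add_zero]
    rw [detA, qdet, map_sum]
    refine Finset.sum_eq_zero fun σ _ => ?_
    rw [map_smul, hl, smul_zero]
    intro a ha
    obtain ⟨i, rfl⟩ := List.mem_ofFn.mp ha
    exact hx _ _
  have key : ∀ a b : O k m, a * b = 1 → b * a = 1 → T a = 0 → T b = 0 := by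
    intro a b hab hba ha
    have h2 : α a * T b = 0 := by
      have := hT a b
      rwa [hab, h1, ha, zero_mul, add_zero, eq_comm] at this
    calc T b = α (b * a) * T b := by rw [hba, map_one, one_mul]
      _ = 0 := by rw [map_mul, mul_assoc, h2, mul_zero]
  ext f
  induction f using O_induction with
  | h1 a => rw [Algebra.algebraMap_eq_smul_one, map_smul, h1]; simp
  | hx i j => exact hx i j
  | hd => exact key _ _ (detA_mul_detInv k) (detInv_mul_detA k) hdet
  | hl => exact key _ _ (last_mul_lastInv k) (lastInv_mul_last k) (hx _ _)
  | hmul f g hf hg => rw [hT, hf, hg]; simp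
  | hadd f g hf hg => rw [map_add, hf, hg]; simp

lemma scale_scale (r c r' c' : Fin (m + 1) → (Kq k)ˣ) (f : O k m) :
    scale r c (scale r' c' f) = scale (r * r') (c * c') f := by
  have : (scale r c).comp (scale r' c') = scale (r * r') (c * c') := by
    apply algHom_ext
    intro i j
    simp only [AlgHom.comp_apply, scale_x, map_smul, smul_smul, Pi.mul_apply, Units.val_mul]
    congr 1
    ring
  exact congrArg (fun φ => φ f) this

lemma scale_one (f : O k m) : scale (1 : Fin (m + 1) → (Kq k)ˣ) 1 f = f := by
  have : scale (1 : Fin (m + 1) → (Kq k)ˣ) 1 = AlgHom.id (Kq k) (O k m) := by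
    apply algHom_ext
    intro i j
    simp [scale_x]
  exact congrArg (fun φ => φ f) this

lemma skewHom_diag (h : IsSkew r c s e) (f : O k m) :
    skewHom h f 1 0 = 0 ∧ skewHom h f 0 0 = scale r c f ∧ skewHom h f 1 1 = scale s 1 f := by
  have hd : skewHom h (detInv k m) = upperInv (prodFirst r * prodFirst c) (prodFirst s)
      (detInv k m) (qdet k (blockA (skewMat r c s e)) 0 1) := by
    refine (lift_mk _ _ _ _ _ _ _ _ (FreeAlgebra.ι _ Coord.detInv)).trans ?_
    simp [liftFun]
  have hl : skewHom h (lastInv k m) = upperInv (r (Fin.last m) * c (Fin.last m)) (s (Fin.last m))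
      (lastInv k m) (e (Fin.last m) (Fin.last m)) := by
    refine (lift_mk _ _ _ _ _ _ _ _ (FreeAlgebra.ι _ Coord.lastInv)).trans ?_
    simp [liftFun]
  have hd' : ∀ r c : Fin (m + 1) → (Kq k)ˣ, scale r c (detInv k m) =
      (((prodFirst r * prodFirst c)⁻¹ : (Kq k)ˣ) : Kq k) • detInv k m := by
    intro r c
    refine (lift_mk _ _ _ _ _ _ _ _ (FreeAlgebra.ι _ Coord.detInv)).trans ?_
    simp [liftFun]
  have hl' : ∀ r c : Fin (m + 1) → (Kq k)ˣ, scale r c (lastInv k m) =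
      (((r (Fin.last m) * c (Fin.last m))⁻¹ : (Kq k)ˣ) : Kq k) • lastInv k m := by
    intro r c
    refine (lift_mk _ _ _ _ _ _ _ _ (FreeAlgebra.ι _ Coord.lastInv)).trans ?_
    simp [liftFun]
  induction f using O_induction with
  | h1 a => simp [Matrix.algebraMap_matrix_apply]
  | hx i j =>
    have : skewHom h (x k i j) = skewMat r c s e i j := lift_x _ _ _ _ _ _ _ _ _ _
    rw [this, scale_x, scale_x]
    simp [skewMat]
  | hd => rw [hd, hd', hd']; simp [upperInv, prodFirst]
  | hl => rw [hl, hl', hl']; simp [upperInv]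
  | hmul f g hf hg =>
    simp only [map_mul, Matrix.mul_apply, Fin.sum_univ_two, hf.1, hf.2.1, hf.2.2, hg.1, hg.2.1,
      hg.2.2]
    simp
  | hadd f g hf hg =>
    simp only [map_add, Matrix.add_apply, hf.1, hf.2.1, hf.2.2, hg.1, hg.2.1, hg.2.2]
    simp

/-- The twisted Leibniz rule. -/
lemma skewDer_leibniz (h : IsSkew r c s e) (f g : O k m) : skewDer h (f * g) =
    scale r c f * skewDer h g + skewDer h f * scale s 1 g := by
  rw [skewDer_mul, (skewHom_diag h f).2.1, (skewHom_diag h g).2.2]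

end Skew

section Chevalley

variable (m) in
/-- `q²` as a unit. -/
def qsq : (Kq k)ˣ := Units.mk0 (q k ^ 2) (pow_ne_zero 2 (q_ne_zero k))

/-- The scalar by which `K_a` acts on row `i`: it is `q_a^{2 δ_{ai}}`, with `q_a = q^{(-1)^{[a]}}`. -/
def kWeight (a i : Fin (m + 1)) : (Kq k)ˣ :=
  if i = a then qsq k ^ ((-1 : ℤ) ^ par a) else 1

/-- The scalar by which `K_p K_{p+1}⁻¹` acts on row `i`. -/
def kappa (p : Fin m) (i : Fin (m + 1)) : (Kq k)ˣ :=
  kWeight k p.castSucc i * (kWeight k p.succ i)⁻¹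

/-- The sign `(-1)^{[E_p][i]}`, where `E_p` and `F_p` are odd exactly when `p = m`. -/
def pSign (p : Fin m) (i : Fin (m + 1)) : (Kq k)ˣ := (-1) ^ (par p.succ * par i)

variable {k}

lemma kappa_castSucc (p : Fin m) : ((kappa k p p.castSucc : (Kq k)ˣ) : Kq k) = q k ^ 2 := by
  have : p.castSucc ≠ p.succ := (Fin.castSucc_lt_succ (i := p)).ne
  simp [kappa, kWeight, this, par_castSucc, qsq]

lemma kappa_succ_even (p : Fin m) (h : par p.succ = 0) :
    ((kappa k p p.succ : (Kq k)ˣ) : Kq k) = (q k ^ 2)⁻¹ := by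
  have : p.succ ≠ p.castSucc := (Fin.castSucc_lt_succ (i := p)).ne'
  simp [kappa, kWeight, this, h, qsq]

lemma kappa_succ_odd (p : Fin m) (h : par p.succ = 1) :
    ((kappa k p p.succ : (Kq k)ˣ) : Kq k) = q k ^ 2 := by
  have : p.succ ≠ p.castSucc := (Fin.castSucc_lt_succ (i := p)).ne'
  simp [kappa, kWeight, this, h, qsq]

lemma kappa_other (p : Fin m) {i : Fin (m + 1)} (h1 : i ≠ p.castSucc) (h2 : i ≠ p.succ) :
    kappa k p i = 1 := by
  simp [kappa, kWeight, h1, h2]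

/-- The values `E_p . x_{ij} = δ_{p+1,i} x_{p,j}`. -/
def eVal (p : Fin m) (i j : Fin (m + 1)) : O k m := if i = p.succ then x k p.castSucc j else 0

/-- The values `F_p . x_{ij} = δ_{p,i} x_{p+1,j}`. -/
def fVal (p : Fin m) (i j : Fin (m + 1)) : O k m := if i = p.castSucc then x k p.succ j else 0

lemma isSkew_E (p : Fin m) :
    IsSkew (pSign k p) (pSign k p) (fun i => (kappa k p i)⁻¹) (eVal (k := k) p) := by
  have H := isQSuperMatrix_x k (m := m)
  have hq := q_ne_zero k
  have hlt : p.castSucc < p.succ := Fin.castSucc_lt_succ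
  have hpc := par_castSucc p
  have k1 := kappa_castSucc (k := k) p
  have below : ∀ i : Fin (m + 1), i < p.succ → i ≠ p.castSucc → i < p.castSucc := by
    intro i h1 h2
    rw [Fin.lt_def] at *
    have := Fin.val_ne_of_ne h2
    simp at *; omega
  constructor
  · intro i j hp
    by_cases hi : i = p.succ
    · subst hi
      rcases par_cases p.succ with h0 | h0
      · have hj : par j = 1 := by omega
        have k2 := kappa_succ_even (k := k) p h0
        simp [eVal, pSign, h0, hj, k2, H.col_odd hj hlt, hq]
      · have hj : par j = 0 := by omega
        have k2 := kappa_succ_odd (k := k) p h0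
        simp [eVal, pSign, h0, hj, k2, H.col_even hj hlt, hq]
    · simp [eVal, hi]
  · intro i j l hj
    by_cases hi : i = p.succ
    · subst hi
      have pj := par_lt hj
      have e1 := H.anti' hlt hj
      have e2 := H.diag' hlt hj
      rcases par_cases p.succ with h0 | h0
      · have k2 := kappa_succ_even (k := k) p h0
        simp [eVal, pSign, h0, pj, k2, e1, e2, hq, sgn, qq]
        match_scalars <;> field_simp <;> ring
      · have k2 := kappa_succ_odd (k := k) p h0
        rcases par_cases l with hl | hl <;>
        · simp [eVal, pSign, h0, pj, hl, k2, e1, e2, hq, sgn, qq]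
          match_scalars <;> field_simp <;> ring
    · simp [eVal, hi]
  · intro i t j hit
    have hi0 := par_lt hit
    by_cases ht : t = p.succ
    · subst ht
      have k3 : i ≠ p.succ := hit.ne
      by_cases hi : i = p.castSucc
      · subst hi
        rcases par_cases j with hj | hj
        · rcases par_cases p.succ with h0 | h0 <;>
            simp [eVal, pSign, h0, hj, k1, k3, hq, sgn, qq, hpc]
        · have e0 := H.odd_sq p.castSucc j (by omega)
          simp [eVal, e0, k3]
      · have hi' := below i hit hi
        have k2 := kappa_other (k := k) p hi k3
        rcases par_cases j with hj | hj
        · have e1 := H.col_even hj hi'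
          rcases par_cases p.succ with h0 | h0 <;>
            simp [eVal, pSign, h0, hj, hi0, k2, k3, e1, hq, sgn, qq]
        · have e1 := H.col_odd hj hi'
          rcases par_cases p.succ with h0 | h0 <;>
            simp [eVal, pSign, h0, hj, hi0, k2, k3, e1, hq, sgn, qq, hpc]
    · by_cases hi : i = p.succ
      · subst hi
        have htt := hlt.trans hit
        have k2 := kappa_other (k := k) p htt.ne' hit.ne'
        rcases par_cases j with hj | hj
        · have e1 := H.col_even hj htt
          simp [eVal, pSign, hj, hi0, k2, ht, e1, hq, sgn, qq]
        · have e1 := H.col_odd hj htt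
          rcases par_cases t with h0 | h0 <;>
            simp [eVal, pSign, h0, hj, hi0, k2, ht, e1, hq, sgn, qq]
      · simp [eVal, hi, ht]
  · intro i t j l hit hlj
    have hi0 := par_lt hit
    have hl0 := par_lt hlj
    by_cases ht : t = p.succ
    · subst ht
      have k3 : i ≠ p.succ := hit.ne
      by_cases hi : i = p.castSucc
      · subst hi
        have e1 := H.row_even hpc hlj
        rcases par_cases p.succ with h0 | h0 <;> rcases par_cases j with hj | hj <;>
          simp [eVal, pSign, h0, hj, hl0, k1, k3, hq, sgn, e1, hpc]
      · have hi' := below i hit hi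
        have k2 := kappa_other (k := k) p hi k3
        have e1 := H.anti' hi' hlj
        rcases par_cases p.succ with h0 | h0 <;> rcases par_cases j with hj | hj <;>
          simp [eVal, pSign, h0, hj, hl0, hi0, k2, k3, hq, sgn, e1, hpc]
    · by_cases hi : i = p.succ
      · subst hi
        have htt := hlt.trans hit
        have k2 := kappa_other (k := k) p htt.ne' hit.ne'
        have e1 := H.anti' htt hlj
        rcases par_cases t with h0 | h0 <;> rcases par_cases j with hj | hj <;>
          simp [eVal, pSign, h0, hj, hl0, hi0, k2, ht, hq, sgn, e1]
      · simp [eVal, hi, ht]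
  · intro i t j l hit hjl
    have hi0 := par_lt hit
    have hj0 := par_lt hjl
    by_cases ht : t = p.succ
    · subst ht
      have k3 : i ≠ p.succ := hit.ne
      by_cases hi : i = p.castSucc
      · subst hi
        have e1 := H.row_even hpc hjl
        rcases par_cases p.succ with h0 | h0 <;> rcases par_cases l with hl | hl <;>
          simp [eVal, pSign, h0, hj0, hl, k1, k3, hq, sgn, e1, hpc] <;>
          match_scalars <;> field_simp <;> ring
      · have hi' := below i hit hi
        have k2 := kappa_other (k := k) p hi k3
        have e1 := H.diag' hi' hjl
        rcases par_cases p.succ with h0 | h0 <;> rcases par_cases l with hl | hl <;>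
          simp [eVal, pSign, h0, hj0, hl, hi0, k2, k3, hq, sgn, e1, hpc] <;> module
    · by_cases hi : i = p.succ
      · subst hi
        have htt := hlt.trans hit
        have k2 := kappa_other (k := k) p htt.ne' hit.ne'
        have e1 := H.diag' htt hjl
        rcases par_cases t with h0 | h0 <;> rcases par_cases l with hl | hl <;>
          simp [eVal, pSign, h0, hj0, hl, hi0, k2, ht, hq, sgn, e1]
      · simp [eVal, hi, ht]

lemma isSkew_F (p : Fin m) :
    IsSkew (fun i => pSign k p i * kappa k p i) (pSign k p) 1 (fVal (k := k) p) := by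
  have H := isQSuperMatrix_x k (m := m)
  have hq := q_ne_zero k
  have hlt : p.castSucc < p.succ := Fin.castSucc_lt_succ
  have hpc := par_castSucc p
  have k1 := kappa_castSucc (k := k) p
  have above : ∀ i : Fin (m + 1), p.castSucc < i → i ≠ p.succ → p.succ < i := by
    intro i h1 h2
    rw [Fin.lt_def] at *
    have := Fin.val_ne_of_ne h2
    simp at *; omega
  constructor
  · intro i j hp
    by_cases hi : i = p.castSucc
    · subst hi
      have hj : par j = 1 := by omega
      have e1 := H.col_odd hj hlt
      rcases par_cases p.succ with h0 | h0 <;>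
        simp [fVal, pSign, h0, hj, k1, e1, hq, hpc]
    · simp [fVal, hi]
  · intro i j l hj
    by_cases hi : i = p.castSucc
    · subst hi
      have pj := par_lt hj
      have e1 := H.anti' hlt hj
      have e2 := H.diag' hlt hj
      rcases par_cases p.succ with h0 | h0 <;> rcases par_cases l with hl | hl <;>
      · simp [fVal, pSign, h0, pj, hl, hpc, k1, e1, e2, hq, sgn, qq]
        match_scalars <;> field_simp <;> ring
    · simp [fVal, hi]
  · intro i t j hit
    have hi0 := par_lt hit
    by_cases hi : i = p.castSucc
    · subst hi
      have k3 : t ≠ p.castSucc := hit.ne'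
      by_cases ht : t = p.succ
      · subst ht
        rcases par_cases p.succ with h0 | h0 <;> rcases par_cases j with hj | hj
        · have k2 := kappa_succ_even (k := k) p h0
          simp [fVal, pSign, h0, hj, k2, k3, hq, sgn, qq, hpc]
        · have e0 := H.odd_sq p.succ j (by omega)
          simp [fVal, e0, k3]
        · have e0 := H.odd_sq p.succ j (by omega)
          simp [fVal, e0, k3]
        · have k2 := kappa_succ_odd (k := k) p h0
          simp [fVal, pSign, h0, hj, k2, k3, hq, sgn, qq, hpc]
      · have ht' := above t hit ht
        have h0 := par_lt ht'
        have k2 := kappa_other (k := k) p k3 ht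
        rcases par_cases j with hj | hj
        · have e1 := H.col_even hj ht'
          simp [fVal, pSign, h0, hj, hi0, k2, k3, e1, hq, sgn, qq]
        · have e1 := H.col_odd hj ht'
          rcases par_cases t with h1 | h1 <;>
            simp [fVal, pSign, h0, h1, hj, hi0, k2, k3, e1, hq, sgn, qq]
    · by_cases ht : t = p.castSucc
      · subst ht
        have htt := hit.trans hlt
        have k2 := kappa_other (k := k) p hit.ne htt.ne
        rcases par_cases j with hj | hj
        · have e1 := H.col_even hj htt
          rcases par_cases p.succ with h0 | h0 <;>
            simp [fVal, pSign, h0, hj, hi0, k2, hi, e1, hq, sgn, qq, hpc]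
        · have e1 := H.col_odd hj htt
          rcases par_cases p.succ with h0 | h0 <;>
            simp [fVal, pSign, h0, hj, hi0, k2, hi, e1, hq, sgn, qq, hpc]
      · simp [fVal, hi, ht]
  · intro i t j l hit hlj
    have hi0 := par_lt hit
    have hl0 := par_lt hlj
    by_cases hi : i = p.castSucc
    · subst hi
      have k3 : t ≠ p.castSucc := hit.ne'
      by_cases ht : t = p.succ
      · subst ht
        rcases par_cases p.succ with h0 | h0
        · have k2 := kappa_succ_even (k := k) p h0
          have e1 := H.row_even h0 hlj
          rcases par_cases j with hj | hj <;>
            simp [fVal, pSign, h0, hj, hl0, k2, k3, hq, sgn, e1, hpc]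
        · have k2 := kappa_succ_odd (k := k) p h0
          have e1 := H.row_odd h0 hlj
          rcases par_cases j with hj | hj <;>
            simp [fVal, pSign, h0, hj, hl0, k2, k3, hq, sgn, e1, hpc]
      · have ht' := above t hit ht
        have h0 := par_lt ht'
        have k2 := kappa_other (k := k) p k3 ht
        have e1 := H.anti' ht' hlj
        rcases par_cases t with h1 | h1 <;> rcases par_cases j with hj | hj <;>
          simp [fVal, pSign, h0, h1, hj, hl0, hi0, k2, k3, hq, sgn, e1]
    · by_cases ht : t = p.castSucc
      · subst ht
        have htt := hit.trans hlt
        have k2 := kappa_other (k := k) p hit.ne htt.ne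
        have e1 := H.anti' htt hlj
        rcases par_cases p.succ with h0 | h0 <;> rcases par_cases j with hj | hj <;>
          simp [fVal, pSign, h0, hj, hl0, hi0, k2, hi, hq, sgn, e1, hpc]
      · simp [fVal, hi, ht]
  · intro i t j l hit hjl
    have hi0 := par_lt hit
    have hj0 := par_lt hjl
    by_cases hi : i = p.castSucc
    · subst hi
      have k3 : t ≠ p.castSucc := hit.ne'
      by_cases ht : t = p.succ
      · subst ht
        rcases par_cases p.succ with h0 | h0
        · have k2 := kappa_succ_even (k := k) p h0
          have e1 := H.row_even h0 hjl
          rcases par_cases l with hl | hl <;>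
            simp [fVal, pSign, h0, hj0, hl, k2, k3, hq, sgn, e1, hpc] <;>
            match_scalars <;> field_simp <;> ring
        · have k2 := kappa_succ_odd (k := k) p h0
          have e1 := H.row_odd h0 hjl
          rcases par_cases l with hl | hl <;>
            simp [fVal, pSign, h0, hj0, hl, k2, k3, hq, sgn, e1, hpc] <;>
            match_scalars <;> field_simp <;> ring
      · have ht' := above t hit ht
        have h0 := par_lt ht'
        have k2 := kappa_other (k := k) p k3 ht
        have e1 := H.diag' ht' hjl
        rcases par_cases t with h1 | h1 <;> rcases par_cases l with hl | hl <;>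
          simp [fVal, pSign, h0, h1, hj0, hl, hi0, k2, k3, hq, sgn, e1]
    · by_cases ht : t = p.castSucc
      · subst ht
        have htt := hit.trans hlt
        have k2 := kappa_other (k := k) p hit.ne htt.ne
        have e1 := H.diag' htt hjl
        rcases par_cases p.succ with h0 | h0 <;> rcases par_cases l with hl | hl <;>
          simp [fVal, pSign, h0, hj0, hl, hi0, k2, hi, hq, sgn, e1, hpc] <;> module
      · simp [fVal, hi, ht]

end Chevalley
section Action

/-- The generators `E_p = E_{p,p+1}`, `F_p = E_{p+1,p}` (`1 ≤ p ≤ m`), `K_a`, `K_a⁻¹`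
(`1 ≤ a ≤ m+1`) of `U_q(gl_{m|1})`. -/
inductive UGen (m : ℕ) : Type
  | E (p : Fin m)
  | F (p : Fin m)
  | K (a : Fin (m + 1))
  | Kinv (a : Fin (m + 1))

/-- Generators in the free algebra. -/
abbrev fu (g : UGen m) : FreeAlgebra (Kq k) (UGen m) := FreeAlgebra.ι (Kq k) g

variable (m) in
/-- The defining relations of `U_q(gl_{m|1})`. The two quartic relations of `U_q(gl_{m|n})` involve
the indices `m-1, …, m+2`, so that they are void for `n = 1`. -/
inductive URel : FreeAlgebra (Kq k) (UGen m) → FreeAlgebra (Kq k) (UGen m) → Prop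
  | K_Kinv (a : Fin (m + 1)) : URel (fu k (.K a) * fu k (.Kinv a)) 1
  | Kinv_K (a : Fin (m + 1)) : URel (fu k (.Kinv a) * fu k (.K a)) 1
  | K_comm (a b : Fin (m + 1)) : URel (fu k (.K a) * fu k (.K b)) (fu k (.K b) * fu k (.K a))
  | K_E (a : Fin (m + 1)) (p : Fin m) : URel (fu k (.K a) * fu k (.E p) * fu k (.Kinv a))
      ((kWeight k a p.castSucc * (kWeight k a p.succ)⁻¹ : (Kq k)ˣ) • fu k (.E p))
  | K_F (a : Fin (m + 1)) (p : Fin m) : URel (fu k (.K a) * fu k (.F p) * fu k (.Kinv a))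
      ((kWeight k a p.succ * (kWeight k a p.castSucc)⁻¹ : (Kq k)ˣ) • fu k (.F p))
  | E_F (p r : Fin m) : URel
      (fu k (.E p) * fu k (.F r) -
        (-1 : Kq k) ^ (par p.succ * par r.succ) • (fu k (.F r) * fu k (.E p)))
      (if p = r then (q k ^ 2 - (q k ^ 2)⁻¹)⁻¹ •
        (fu k (.K p.castSucc) * fu k (.Kinv p.succ) - fu k (.Kinv p.castSucc) * fu k (.K p.succ))
        else 0)
  | E_sq (p : Fin m) (h : par p.succ = 1) : URel (fu k (.E p) * fu k (.E p)) 0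
  | F_sq (p : Fin m) (h : par p.succ = 1) : URel (fu k (.F p) * fu k (.F p)) 0
  | E_comm (p r : Fin m) (h : (p : ℕ) + 2 ≤ r) :
      URel (fu k (.E p) * fu k (.E r)) (fu k (.E r) * fu k (.E p))
  | F_comm (p r : Fin m) (h : (p : ℕ) + 2 ≤ r) :
      URel (fu k (.F p) * fu k (.F r)) (fu k (.F r) * fu k (.F p))
  | E_serre (p r : Fin m) (hp : par p.succ = 0) (h : (p : ℕ) + 1 = r ∨ (r : ℕ) + 1 = p) : URel
      (fu k (.E p) * fu k (.E p) * fu k (.E r) -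
        (q k ^ 2 + (q k ^ 2)⁻¹) • (fu k (.E p) * fu k (.E r) * fu k (.E p)) +
        fu k (.E r) * fu k (.E p) * fu k (.E p)) 0
  | F_serre (p r : Fin m) (hp : par p.succ = 0) (h : (p : ℕ) + 1 = r ∨ (r : ℕ) + 1 = p) : URel
      (fu k (.F p) * fu k (.F p) * fu k (.F r) -
        (q k ^ 2 + (q k ^ 2)⁻¹) • (fu k (.F p) * fu k (.F r) * fu k (.F p)) +
        fu k (.F r) * fu k (.F p) * fu k (.F p)) 0

variable (m) in
/-- The quantized enveloping superalgebra `U_q(gl_{m|1})`. -/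
def Uq : Type u := RingQuot (URel k m)

instance : Ring (Uq k m) := inferInstanceAs (Ring (RingQuot (URel k m)))
instance : Algebra (Kq k) (Uq k m) := inferInstanceAs (Algebra (Kq k) (RingQuot (URel k m)))

/-- Generators of `U_q(gl_{m|1})`. -/
def ugen (g : UGen m) : Uq k m := RingQuot.mkAlgHom (Kq k) (URel k m) (fu k g)

variable {k}

/-- The operator `E_p` on `𝒪_q(GL_{m|1})`. -/
def opE (p : Fin m) : O k m →ₗ[Kq k] O k m := skewDer (isSkew_E p)

/-- The operator `F_p` on `𝒪_q(GL_{m|1})`. -/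
def opF (p : Fin m) : O k m →ₗ[Kq k] O k m := skewDer (isSkew_F p)

/-- The parity automorphism, to the power of the parity of `E_p`. -/
def opP (p : Fin m) : O k m →ₐ[Kq k] O k m := scale (pSign k p) (pSign k p)

/-- The automorphism `K_p K_{p+1}⁻¹`. -/
def opKK (p : Fin m) : O k m →ₐ[Kq k] O k m := scale (kappa k p) 1

/-- The automorphism `K_p⁻¹ K_{p+1}`. -/
def opKKinv (p : Fin m) : O k m →ₐ[Kq k] O k m := scale (fun i => (kappa k p i)⁻¹) 1

lemma opE_x (p : Fin m) (i j : Fin (m + 1)) :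
    opE p (x k i j) = if i = p.succ then x k p.castSucc j else 0 := skewDer_x _ i j

lemma opF_x (p : Fin m) (i j : Fin (m + 1)) :
    opF p (x k i j) = if i = p.castSucc then x k p.succ j else 0 := skewDer_x _ i j

/-- `E_p (f g) = (-1)^{[E_p][f]} f (E_p g) + (E_p f) (K_p⁻¹ K_{p+1} g)`. -/
lemma opE_mul (p : Fin m) (f g : O k m) :
    opE p (f * g) = opP p f * opE p g + opE p f * opKKinv p g := skewDer_leibniz _ f g

/-- `F_p (f g) = (-1)^{[F_p][f]} (K_p K_{p+1}⁻¹ f) (F_p g) + (F_p f) g`. -/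
lemma opF_mul (p : Fin m) (f g : O k m) :
    opF p (f * g) = opP p (opKK p f) * opF p g + opF p f * g := by
  have := skewDer_leibniz (isSkew_F (k := k) p) f g
  rw [scale_one] at this
  rw [opP, opKK, scale_scale, mul_one]
  exact this

lemma scale_opE (r c : Fin (m + 1) → (Kq k)ˣ) (p : Fin m) (f : O k m) :
    scale r c (opE p f) =
      ((r p.castSucc * (r p.succ)⁻¹ : (Kq k)ˣ) : Kq k) • opE p (scale r c f) := by
  have key : (scale r c).toLinearMap ∘ₗ opE p -
      ((r p.castSucc * (r p.succ)⁻¹ : (Kq k)ˣ) : Kq k) • (opE p ∘ₗ (scale r c).toLinearMap)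
      = 0 := by
    refine skew_eq_zero _ ((opP p).comp (scale r c)) ((opKKinv p).comp (scale r c)) ?_ ?_
    · intro f g
      have e1 : ∀ f, scale r c (opP p f) = opP p (scale r c f) := fun f => by
        rw [opP, scale_scale, scale_scale, mul_comm, mul_comm c]
      have e2 : ∀ f, scale r c (opKKinv p f) = opKKinv p (scale r c f) := fun f => by
        rw [opKKinv, scale_scale, scale_scale, mul_comm, mul_comm c]
      simp only [LinearMap.sub_apply, LinearMap.comp_apply, AlgHom.toLinearMap_apply,
        LinearMap.smul_apply, opE_mul, map_add, map_mul, e1, e2, AlgHom.comp_apply, mul_sub,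
        sub_mul, smul_add, mul_smul_comm, smul_mul_assoc]
      abel
    · intro i j
      simp only [LinearMap.sub_apply, LinearMap.comp_apply, AlgHom.toLinearMap_apply,
        LinearMap.smul_apply, opE_x, scale_x, map_smul]
      split_ifs with h
      · subst h
        rw [scale_x, smul_smul, ← Units.val_mul, sub_eq_zero]
        congr 2
        rw [mul_assoc, inv_mul_cancel_left]
      · simp
  have := congrArg (fun T : O k m →ₗ[Kq k] O k m => T f) key
  simpa [sub_eq_zero] using this

lemma scale_opF (r c : Fin (m + 1) → (Kq k)ˣ) (p : Fin m) (f : O k m) :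
    scale r c (opF p f) =
      ((r p.succ * (r p.castSucc)⁻¹ : (Kq k)ˣ) : Kq k) • opF p (scale r c f) := by
  have key : (scale r c).toLinearMap ∘ₗ opF p -
      ((r p.succ * (r p.castSucc)⁻¹ : (Kq k)ˣ) : Kq k) • (opF p ∘ₗ (scale r c).toLinearMap)
      = 0 := by
    refine skew_eq_zero _ ((opP p).comp ((opKK p).comp (scale r c))) (scale r c) ?_ ?_
    · intro f g
      have e1 : ∀ f, scale r c (opP p f) = opP p (scale r c f) := fun f => by
        rw [opP, scale_scale, scale_scale, mul_comm, mul_comm c]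
      have e2 : ∀ f, scale r c (opKK p f) = opKK p (scale r c f) := fun f => by
        rw [opKK, scale_scale, scale_scale, mul_comm, mul_comm c]
      simp only [LinearMap.sub_apply, LinearMap.comp_apply, AlgHom.toLinearMap_apply,
        LinearMap.smul_apply, opF_mul, map_add, map_mul, e1, e2, AlgHom.comp_apply, mul_sub,
        sub_mul, smul_add, mul_smul_comm, smul_mul_assoc]
      abel
    · intro i j
      simp only [LinearMap.sub_apply, LinearMap.comp_apply, AlgHom.toLinearMap_apply,
        LinearMap.smul_apply, opF_x, scale_x, map_smul]
      split_ifs with h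
      · subst h
        rw [scale_x, smul_smul, ← Units.val_mul, sub_eq_zero]
        congr 2
        rw [mul_assoc, inv_mul_cancel_left]
      · simp
  have := congrArg (fun T : O k m →ₗ[Kq k] O k m => T f) key
  simpa [sub_eq_zero] using this

lemma scale_comm (r c r' c' : Fin (m + 1) → (Kq k)ˣ) (f : O k m) :
    scale r c (scale r' c' f) = scale r' c' (scale r c f) := by
  rw [scale_scale, scale_scale, mul_comm, mul_comm c]

end Action
section Module

variable {k}

lemma qdiff_ne_zero : q k ^ 2 - (q k ^ 2)⁻¹ ≠ 0 := by
  intro h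
  have hq := q_ne_zero k
  have h4 : q k ^ 4 - 1 = 0 := by
    have h' : q k ^ 2 * (q k ^ 2 - (q k ^ 2)⁻¹) = q k ^ 4 - 1 := by
      rw [mul_sub, mul_inv_cancel₀ (pow_ne_zero 2 hq)]; ring
    rw [← h', h, mul_zero]
  have hX : ((RatFunc.X : RatFunc k)) ^ 4 - 1 = 0 := h4
  refine RatFunc.transcendental_X (K := k) ⟨Polynomial.X ^ 4 - 1, ?_, by simpa using hX⟩
  exact Polynomial.X_pow_sub_C_ne_zero (by norm_num) (1 : k)

lemma opP_scale (p : Fin m) (r c : Fin (m + 1) → (Kq k)ˣ) (f : O k m) :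
    opP p (scale r c f) = scale r c (opP p f) := scale_comm _ _ _ _ _

lemma opP_opP (p : Fin m) (f : O k m) : opP p (opP p f) = f := by
  have : pSign k p * pSign k p = 1 := by
    funext i
    rw [Pi.mul_apply, pSign, ← mul_pow, neg_one_mul, neg_neg, one_pow]
    rfl
  rw [opP, scale_scale, this, scale_one]

lemma opP_even (p : Fin m) (h : par p.succ = 0) (f : O k m) : opP p f = f := by
  have : pSign k p = 1 := by
    funext i
    simp [pSign, h]
  rw [opP, this, scale_one]

lemma opKK_opKKinv (p : Fin m) (f : O k m) : opKK p (opKKinv p f) = f := by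
  have : kappa k p * (fun i => (kappa k p i)⁻¹) = 1 := by
    funext i
    simp
  rw [opKK, opKKinv, scale_scale, this, mul_one, scale_one]

lemma opKKinv_opKK (p : Fin m) (f : O k m) : opKKinv p (opKK p f) = f := by
  rw [opKKinv, opKK, scale_comm]
  exact opKK_opKKinv p f

/-- The sign of exchanging `E_p` and `E_r`. -/
def eSign (k : Type u) [Field k] (p r : Fin m) : Kq k := (-1) ^ (par p.succ * par r.succ)

lemma opP_opE (p r : Fin m) (f : O k m) :
    opP p (opE r f) = eSign k p r • opE r (opP p f) := by
  rw [opP, scale_opE]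
  congr 1
  rcases par_cases p.succ with h | h <;> rcases par_cases r.succ with h' | h' <;>
    simp [eSign, pSign, par_castSucc, h, h']

lemma opP_opF (p r : Fin m) (f : O k m) :
    opP p (opF r f) = eSign k p r • opF r (opP p f) := by
  rw [opP, scale_opF]
  congr 1
  rcases par_cases p.succ with h | h <;> rcases par_cases r.succ with h' | h' <;>
    simp [eSign, pSign, par_castSucc, h, h']

/-- The scalar of the commutation of `K_p K_{p+1}⁻¹` and `E_r`. -/
def eCom (k : Type u) [Field k] (p r : Fin m) : (Kq k)ˣ :=
  kappa k p r.castSucc * (kappa k p r.succ)⁻¹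

lemma opKKinv_opE (p r : Fin m) (f : O k m) :
    opKKinv p (opE r f) = ((eCom k p r)⁻¹ : (Kq k)ˣ) • opE r (opKKinv p f) := by
  rw [opKKinv, scale_opE, Units.smul_def]
  congr 2
  simp [eCom, mul_comm]

lemma opKKinv_opF (p r : Fin m) (f : O k m) :
    opKKinv p (opF r f) = (eCom k p r : (Kq k)ˣ) • opF r (opKKinv p f) := by
  rw [opKKinv, scale_opF, Units.smul_def]
  congr 2
  simp [eCom, mul_comm]

lemma opKK_opE (p r : Fin m) (f : O k m) :
    opKK p (opE r f) = (eCom k p r : (Kq k)ˣ) • opE r (opKK p f) := by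
  rw [opKK, scale_opE, Units.smul_def]
  rfl

lemma opKK_opF (p r : Fin m) (f : O k m) :
    opKK p (opF r f) = ((eCom k p r)⁻¹ : (Kq k)ˣ) • opF r (opKK p f) := by
  rw [opKK, scale_opF, Units.smul_def]
  congr 2

lemma eCom_eq (p r : Fin m) : eCom k p r =
    (if (r : ℕ) = p then qsq k * qsq k ^ ((-1 : ℤ) ^ par p.succ) else 1) *
    (if (r : ℕ) + 1 = p then (qsq k)⁻¹ else 1) *
    (if (r : ℕ) = p + 1 then (qsq k ^ ((-1 : ℤ) ^ par p.succ))⁻¹ else 1) := by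
  simp only [eCom, kappa, kWeight, Fin.ext_iff, Fin.val_succ, Fin.val_castSucc, par_castSucc,
    Nat.succ_inj]
  by_cases h1 : (r : ℕ) = p
  · have h2 : (r : ℕ) + 1 ≠ p := by omega
    have h3 : (r : ℕ) ≠ p + 1 := by omega
    simp [h1]
  · by_cases h2 : (r : ℕ) + 1 = p
    · have h3 : (r : ℕ) ≠ p + 1 := by omega
      simp [h1, h2, h3]
    · by_cases h3 : (r : ℕ) = p + 1
      · simp [h3, show (p : ℕ) + 1 + 1 ≠ p by omega]
      · simp [h1, h2, h3]

lemma eCom_symm (p r : Fin m) : eCom k p r = eCom k r p := by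
  rw [eCom_eq, eCom_eq]
  have hr := r.2
  have hp := p.2
  rcases lt_trichotomy (p : ℕ) r with h | h | h
  · by_cases h1 : (p : ℕ) + 1 = r
    · have : par p.succ = 0 := par_lt (j := Fin.last m) (by rw [Fin.lt_def]; simp; omega)
      have h2 : (r : ℕ) ≠ p := by omega
      have h3 : (r : ℕ) + 1 ≠ p := by omega
      have h4 : (p : ℕ) ≠ r := by omega
      have h5 : (p : ℕ) ≠ r + 1 := by omega
      simp [h1.symm, this, add_assoc]
    · have h2 : (r : ℕ) ≠ p := by omega
      have h3 : (r : ℕ) + 1 ≠ p := by omega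
      have h4 : (p : ℕ) ≠ r := by omega
      have h5 : (p : ℕ) ≠ r + 1 := by omega
      have h6 : (r : ℕ) ≠ p + 1 := by omega
      simp [h1, h2, h3, h4, h5, h6]
  · have : p = r := Fin.ext h
    subst this; rfl
  · by_cases h1 : (r : ℕ) + 1 = p
    · have : par r.succ = 0 := par_lt (j := Fin.last m) (by rw [Fin.lt_def]; simp; omega)
      have h2 : (p : ℕ) ≠ r := by omega
      have h3 : (p : ℕ) + 1 ≠ r := by omega
      simp [h1.symm, this, add_assoc]
    · have h2 : (r : ℕ) ≠ p := by omega
      have h3 : (p : ℕ) + 1 ≠ r := by omega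
      have h4 : (p : ℕ) ≠ r := by omega
      have h5 : (p : ℕ) ≠ r + 1 := by omega
      have h6 : (r : ℕ) ≠ p + 1 := by omega
      simp [h1, h2, h3, h4, h5, h6]

lemma eSign_symm (p r : Fin m) : eSign k p r = eSign k r p := by
  rw [eSign, eSign, mul_comm]

lemma eSign_even (p r : Fin m) (h : par p.succ = 0) : eSign k p r = 1 := by
  simp [eSign, h]

lemma eSign_sq (p r : Fin m) : eSign k p r * eSign k p r = 1 := by
  rw [eSign, ← mul_pow, neg_one_mul, neg_neg, one_pow]

/-- `[E_p, F_r} = δ_{pr} (K_p K_{p+1}⁻¹ - K_p⁻¹ K_{p+1}) / (q² - q⁻²)`. -/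
lemma act_E_F (p r : Fin m) : opE p ∘ₗ opF r - eSign k p r • (opF r ∘ₗ opE p) -
    (if p = r then (q k ^ 2 - (q k ^ 2)⁻¹)⁻¹ • ((opKK p).toLinearMap - (opKKinv p).toLinearMap)
      else 0) = (0 : O k m →ₗ[Kq k] O k m) := by
  refine skew_eq_zero _ ((opP p).comp ((opP r).comp (opKK r))) (opKKinv p) ?_ ?_
  · intro f g
    have hP : ∀ f : O k m, opP r (opKK r (opP p f)) = opP p (opP r (opKK r f)) := fun f => by
      rw [opKK, ← opP_scale, opP, opP, scale_comm]
    have hD : ∀ h : p = r, opP p (opP r (opKK r f)) = opKK p f := by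
      rintro rfl; rw [opP_opP]
    have hs := eSign_sq (k := k) p r
    have e1 : opE p (opP r (opKK r f)) =
        (eSign k p r * ((eCom k p r)⁻¹ : (Kq k)ˣ)) • opP r (opKK r (opE p f)) := by
      rw [opKK_opE, Units.smul_def, map_smul, opP_opE, eSign_symm r p, eCom_symm r p, smul_smul,
        smul_smul]
      rw [show eSign k p r * (((eCom k p r)⁻¹ : (Kq k)ˣ) : Kq k) * (eCom k p r : Kq k) *
        eSign k p r = (eSign k p r * eSign k p r) * ((((eCom k p r)⁻¹ : (Kq k)ˣ) : Kq k) *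
        eCom k p r) by ring, hs, Units.inv_mul, one_mul, one_smul]
    have e2 : opKKinv p (opF r g) = (eCom k p r : Kq k) • opF r (opKKinv p g) := by
      rw [opKKinv_opF, Units.smul_def]
    have e3 : opF r (opP p f) = eSign k p r • opP p (opF r f) := by
      rw [opP_opF, smul_smul, hs, one_smul]
    simp only [LinearMap.sub_apply, LinearMap.comp_apply, LinearMap.smul_apply, opE_mul, opF_mul,
      map_add, AlgHom.comp_apply, e1, e2, e3, hP]
    have hc : (((eCom k p r)⁻¹ : (Kq k)ˣ) : Kq k) * eCom k p r = 1 := Units.inv_mul _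
    have e4 : (eSign k p r * (((eCom k p r)⁻¹ : (Kq k)ˣ) : Kq k)) •
        opP r (opKK r (opE p f)) * (eCom k p r : Kq k) • opF r (opKKinv p g) =
        eSign k p r • (opP r (opKK r (opE p f)) * opF r (opKKinv p g)) := by
      rw [smul_mul_smul_comm, mul_assoc, hc, mul_one]
    have e5 : eSign k p r • (eSign k p r • opP p (opF r f) * opE p g) =
        opP p (opF r f) * opE p g := by
      rw [smul_mul_assoc, smul_smul, hs, one_smul]
    simp only [smul_add, e4, e5]
    by_cases h : p = r
    · simp only [if_pos h, LinearMap.smul_apply, LinearMap.sub_apply, AlgHom.toLinearMap_apply,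
        map_mul, hD h]
      simp only [mul_sub, sub_mul, smul_sub, mul_smul_comm, smul_mul_assoc]
      abel
    · simp only [if_neg h, LinearMap.zero_apply]
      simp only [mul_zero, zero_mul, sub_zero, mul_sub, sub_mul, mul_smul_comm, smul_mul_assoc]
      abel
  · intro i j
    have hq := q_ne_zero k
    have hne : ∀ s : Fin m, s.castSucc ≠ s.succ := fun s => Fin.castSucc_lt_succ.ne
    by_cases h : p = r
    · subst h
      by_cases h1 : i = p.castSucc
      · subst h1
        have k1 := kappa_castSucc (k := k) p
        simp only [LinearMap.sub_apply, LinearMap.comp_apply, LinearMap.smul_apply, opE_x, opF_x,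
          if_true, AlgHom.toLinearMap_apply, opKK, opKKinv, scale_x, if_neg (hne p), map_zero,
          smul_zero, sub_zero, Pi.one_apply, mul_one, k1, Units.val_inv_eq_inv_val, ← sub_smul,
          smul_smul, inv_mul_cancel₀ (qdiff_ne_zero (k := k)), one_smul, sub_self]
      · by_cases h2 : i = p.succ
        · subst h2
          simp only [LinearMap.sub_apply, LinearMap.comp_apply, LinearMap.smul_apply, opE_x,
            opF_x, if_true, AlgHom.toLinearMap_apply, opKK, opKKinv, scale_x, if_neg h1,
            map_zero, zero_sub, Pi.one_apply, mul_one, Units.val_inv_eq_inv_val, ← sub_smul,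
            smul_smul]
          rcases par_cases p.succ with h0 | h0
          · rw [kappa_succ_even p h0, inv_inv, ← neg_sub (q k ^ 2), mul_neg,
              inv_mul_cancel₀ (qdiff_ne_zero (k := k)), eSign_even p p h0]
            module
          · rw [kappa_succ_odd p h0, inv_mul_cancel₀ (qdiff_ne_zero (k := k)), eSign, h0]
            module
        · have k2 := kappa_other (k := k) p h1 h2
          simp [opE_x, opF_x, opKK, opKKinv, scale_x, k2, h1, h2]
    · have h' : r ≠ p := Ne.symm h
      have a1 : p.castSucc ≠ r.castSucc := fun e => h (by simpa using e)
      have a2 : r.succ ≠ p.succ := fun e => h' (by simpa using e)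
      simp only [LinearMap.sub_apply, LinearMap.comp_apply, LinearMap.smul_apply, opE_x, opF_x,
        apply_ite (opE p), apply_ite (opF r), map_zero, if_neg h, LinearMap.zero_apply, if_neg a1,
        if_neg a2, ite_self, smul_zero, sub_zero]

lemma act_E_sq (p : Fin m) (h : par p.succ = 1) :
    opE p ∘ₗ opE p = (0 : O k m →ₗ[Kq k] O k m) := by
  have hc : eCom k p p = 1 := by simp [eCom_eq, h]
  have hs : eSign k p p = -1 := by simp [eSign, h]
  refine skew_eq_zero _ ((opP p).comp (opP p)) ((opKKinv p).comp (opKKinv p)) ?_ ?_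
  · intro f g
    simp only [LinearMap.comp_apply, opE_mul, map_add, AlgHom.comp_apply, opP_opE, opKKinv_opE,
      hc, hs, inv_one, one_smul, neg_smul, neg_mul]
    abel
  · intro i j
    have hne : p.castSucc ≠ p.succ := Fin.castSucc_lt_succ.ne
    simp only [LinearMap.comp_apply, opE_x, apply_ite (opE p), map_zero, if_neg hne, ite_self]

lemma act_F_sq (p : Fin m) (h : par p.succ = 1) :
    opF p ∘ₗ opF p = (0 : O k m →ₗ[Kq k] O k m) := by
  have hc : eCom k p p = 1 := by simp [eCom_eq, h]
  have hs : eSign k p p = -1 := by simp [eSign, h]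
  refine skew_eq_zero _ ((opP p).comp ((opKK p).comp ((opP p).comp (opKK p)))) (AlgHom.id _ _)
    ?_ ?_
  · intro f g
    simp only [LinearMap.comp_apply, opF_mul, map_add, AlgHom.comp_apply, AlgHom.id_apply,
      opP_opF, opKK_opF, hc, hs, inv_one, one_smul, neg_smul, map_neg, neg_mul]
    abel
  · intro i j
    have hne : p.succ ≠ p.castSucc := Fin.castSucc_lt_succ.ne'
    simp only [LinearMap.comp_apply, opF_x, apply_ite (opF p), map_zero, if_neg hne, ite_self]

lemma act_E_comm (p r : Fin m) (h : (p : ℕ) + 2 ≤ r) :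
    opE p ∘ₗ opE r - opE r ∘ₗ opE p = (0 : O k m →ₗ[Kq k] O k m) := by
  have hp : par p.succ = 0 := par_lt (j := Fin.last m) (by rw [Fin.lt_def]; simp; omega)
  have hc : eCom k p r = 1 := by
    simp [eCom_eq, show (r : ℕ) ≠ p by omega, show (r : ℕ) + 1 ≠ p by omega,
      show (r : ℕ) ≠ p + 1 by omega]
  have hc' : eCom k r p = 1 := by rw [eCom_symm, hc]
  have hs : eSign k p r = 1 := eSign_even p r hp
  have hs' : eSign k r p = 1 := by rw [eSign_symm, hs]
  have hP : ∀ f : O k m, opP p f = f := opP_even p hp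
  refine skew_eq_zero _ (opP r) ((opKKinv p).comp (opKKinv r)) ?_ ?_
  · intro f g
    have e : opKKinv r (opKKinv p g) = opKKinv p (opKKinv r g) := scale_comm _ _ _ _ _
    simp only [LinearMap.comp_apply, LinearMap.sub_apply, opE_mul, map_add, AlgHom.comp_apply,
      opP_opE, opKKinv_opE, hc, hc', hs, hs', hP, inv_one, one_smul, mul_sub, sub_mul, e]
    abel
  · intro i j
    have h1 : r.castSucc ≠ p.succ := by simp [Fin.ext_iff]; omega
    have h2 : p.castSucc ≠ r.succ := by simp [Fin.ext_iff]; omega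
    simp only [LinearMap.comp_apply, LinearMap.sub_apply, opE_x, apply_ite (opE p),
      apply_ite (opE r), map_zero, if_neg h1, if_neg h2, ite_self, sub_zero]

lemma act_F_comm (p r : Fin m) (h : (p : ℕ) + 2 ≤ r) :
    opF p ∘ₗ opF r - opF r ∘ₗ opF p = (0 : O k m →ₗ[Kq k] O k m) := by
  have hp : par p.succ = 0 := par_lt (j := Fin.last m) (by rw [Fin.lt_def]; simp; omega)
  have hc : eCom k p r = 1 := by
    simp [eCom_eq, show (r : ℕ) ≠ p by omega, show (r : ℕ) + 1 ≠ p by omega,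
      show (r : ℕ) ≠ p + 1 by omega]
  have hc' : eCom k r p = 1 := by rw [eCom_symm, hc]
  have hs : eSign k p r = 1 := eSign_even p r hp
  have hs' : eSign k r p = 1 := by rw [eSign_symm, hs]
  have hP : ∀ f : O k m, opP p f = f := opP_even p hp
  refine skew_eq_zero _ ((opP r).comp ((opKK p).comp (opKK r))) (AlgHom.id _ _) ?_ ?_
  · intro f g
    have e : ∀ f : O k m, opKK p (opP r f) = opP r (opKK p f) := fun f => scale_comm _ _ _ _ _
    have e' : ∀ f : O k m, opKK r (opKK p f) = opKK p (opKK r f) := fun f =>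
      scale_comm _ _ _ _ _
    simp only [LinearMap.comp_apply, LinearMap.sub_apply, opF_mul, map_add, AlgHom.comp_apply,
      AlgHom.id_apply, opP_opF, opKK_opF, hc, hc', hs, hs', hP, inv_one, one_smul, mul_sub,
      sub_mul, e, e']
    abel
  · intro i j
    have h1 : r.succ ≠ p.castSucc := by simp [Fin.ext_iff]; omega
    have h2 : p.succ ≠ r.castSucc := by simp [Fin.ext_iff]; omega
    simp only [LinearMap.comp_apply, LinearMap.sub_apply, opF_x, apply_ite (opF p),
      apply_ite (opF r), map_zero, if_neg h1, if_neg h2, ite_self, sub_zero]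

lemma eCom_adjacent (p r : Fin m) (hp : par p.succ = 0)
    (h : (p : ℕ) + 1 = r ∨ (r : ℕ) + 1 = p) :
    eCom k p r = (qsq k)⁻¹ ∧ eCom k p p = qsq k * qsq k := by
  constructor
  · rcases h with h | h
    · simp [eCom_eq, ← h, hp, show (p : ℕ) + 1 + 1 ≠ p by omega]
    · simp [eCom_eq, ← h, show (r : ℕ) ≠ r + 1 + 1 by omega]
  · simp [eCom_eq, hp]

lemma act_E_serre (p r : Fin m) (hp : par p.succ = 0)
    (h : (p : ℕ) + 1 = r ∨ (r : ℕ) + 1 = p) :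
    opE p ∘ₗ opE p ∘ₗ opE r - (q k ^ 2 + (q k ^ 2)⁻¹) • (opE p ∘ₗ opE r ∘ₗ opE p) +
      opE r ∘ₗ opE p ∘ₗ opE p = (0 : O k m →ₗ[Kq k] O k m) := by
  have hq := q_ne_zero k
  obtain ⟨c1, c2⟩ := eCom_adjacent (k := k) p r hp h
  have c3 : eCom k r p = (qsq k)⁻¹ := by rw [eCom_symm, c1]
  have hs : eSign k p r = 1 := eSign_even p r hp
  have hs' : eSign k r p = 1 := by rw [eSign_symm, hs]
  have hP : ∀ f : O k m, opP p f = f := opP_even p hp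
  have d1 : ∀ f : O k m, opKKinv p (opE r f) = (q k ^ 2) • opE r (opKKinv p f) := by
    intro f; rw [opKKinv_opE, c1, inv_inv]; rfl
  have d2 : ∀ f : O k m, opKKinv r (opE p f) = (q k ^ 2) • opE p (opKKinv r f) := by
    intro f; rw [opKKinv_opE, c3, inv_inv]; rfl
  have d3 : ∀ f : O k m, opKKinv p (opE p f) = ((q k ^ 2)⁻¹ * (q k ^ 2)⁻¹) •
      opE p (opKKinv p f) := by
    intro f; rw [opKKinv_opE, c2, mul_inv]; rfl
  have d4 : ∀ f : O k m, opKKinv r (opKKinv p f) = opKKinv p (opKKinv r f) := fun f =>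
    scale_comm _ _ _ _ _
  have d5 : ∀ f : O k m, opP r (opE p f) = opE p (opP r f) := by
    intro f; rw [opP_opE, hs', one_smul]
  refine skew_eq_zero _ (opP r) ((opKKinv p).comp ((opKKinv p).comp (opKKinv r))) ?_ ?_
  · intro f g
    simp only [LinearMap.comp_apply, LinearMap.sub_apply, LinearMap.add_apply,
      LinearMap.smul_apply, opE_mul, map_add, map_smul, AlgHom.comp_apply, d1, d2, d3, d4, d5, hP,
      mul_sub, sub_mul, mul_add, add_mul, mul_smul_comm, smul_mul_assoc, smul_add, smul_smul]
    match_scalars <;> field_simp <;> ring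
  · intro i j
    have h0 : p.castSucc ≠ p.succ := Fin.castSucc_lt_succ.ne
    simp only [LinearMap.comp_apply, LinearMap.sub_apply, LinearMap.add_apply,
      LinearMap.smul_apply, opE_x, apply_ite (opE p), apply_ite (opE r), map_zero, if_neg h0,
      ite_self]
    have h1 : ¬ (r.castSucc = p.succ ∧ p.castSucc = r.succ) := by
      simp [Fin.ext_iff]; omega
    by_cases h2 : r.castSucc = p.succ
    · have h3 : p.castSucc ≠ r.succ := fun e => h1 ⟨h2, e⟩
      simp [h2, h3, h0]
    · simp [h2]

lemma act_F_serre (p r : Fin m) (hp : par p.succ = 0)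
    (h : (p : ℕ) + 1 = r ∨ (r : ℕ) + 1 = p) :
    opF p ∘ₗ opF p ∘ₗ opF r - (q k ^ 2 + (q k ^ 2)⁻¹) • (opF p ∘ₗ opF r ∘ₗ opF p) +
      opF r ∘ₗ opF p ∘ₗ opF p = (0 : O k m →ₗ[Kq k] O k m) := by
  have hq := q_ne_zero k
  obtain ⟨c1, c2⟩ := eCom_adjacent (k := k) p r hp h
  have c3 : eCom k r p = (qsq k)⁻¹ := by rw [eCom_symm, c1]
  have hs : eSign k p r = 1 := eSign_even p r hp
  have hs' : eSign k r p = 1 := by rw [eSign_symm, hs]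
  have hP : ∀ f : O k m, opP p f = f := opP_even p hp
  have d1 : ∀ f : O k m, opKK p (opF r f) = (q k ^ 2) • opF r (opKK p f) := by
    intro f; rw [opKK_opF, c1, inv_inv]; rfl
  have d2 : ∀ f : O k m, opKK r (opF p f) = (q k ^ 2) • opF p (opKK r f) := by
    intro f; rw [opKK_opF, c3, inv_inv]; rfl
  have d3 : ∀ f : O k m, opKK p (opF p f) = ((q k ^ 2)⁻¹ * (q k ^ 2)⁻¹) •
      opF p (opKK p f) := by
    intro f; rw [opKK_opF, c2, mul_inv]; rfl
  have d4 : ∀ f : O k m, opKK r (opKK p f) = opKK p (opKK r f) := fun f =>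
    scale_comm _ _ _ _ _
  have d5 : ∀ f : O k m, opP r (opF p f) = opF p (opP r f) := by
    intro f; rw [opP_opF, hs', one_smul]
  have d6 : ∀ f : O k m, opKK p (opP r f) = opP r (opKK p f) := fun f => scale_comm _ _ _ _ _
  refine skew_eq_zero _ ((opP r).comp ((opKK p).comp ((opKK p).comp (opKK r)))) (AlgHom.id _ _)
    ?_ ?_
  · intro f g
    simp only [LinearMap.comp_apply, LinearMap.sub_apply, LinearMap.add_apply,
      LinearMap.smul_apply, opF_mul, map_add, map_smul, AlgHom.comp_apply, AlgHom.id_apply, d1,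
      d2, d3, d4, d5, d6, hP,
      mul_sub, sub_mul, mul_add, add_mul, mul_smul_comm, smul_mul_assoc, smul_add, smul_smul]
    match_scalars <;> field_simp <;> ring
  · intro i j
    have h0 : p.succ ≠ p.castSucc := Fin.castSucc_lt_succ.ne'
    simp only [LinearMap.comp_apply, LinearMap.sub_apply, LinearMap.add_apply,
      LinearMap.smul_apply, opF_x, apply_ite (opF p), apply_ite (opF r), map_zero, if_neg h0,
      ite_self]
    have h1 : ¬ (r.succ = p.castSucc ∧ p.succ = r.castSucc) := by
      simp [Fin.ext_iff]; omega
    by_cases h2 : r.succ = p.castSucc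
    · have h3 : p.succ ≠ r.castSucc := fun e => h1 ⟨h2, e⟩
      simp [h2, h3, h0]
    · simp [h2]

variable (k) in
/-- The operators by which the generators act. -/
def actGen : UGen m → Module.End (Kq k) (O k m)
  | .E p => opE p
  | .F p => opF p
  | .K a => (scale (kWeight k a) 1).toLinearMap
  | .Kinv a => (scale (kWeight k a)⁻¹ 1).toLinearMap

lemma scale_kWeight_inv (a : Fin (m + 1)) (f : O k m) :
    scale (kWeight k a) 1 (scale (kWeight k a)⁻¹ 1 f) = f := by
  rw [scale_scale, mul_inv_cancel, mul_one, scale_one]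

lemma opKK_eq (p : Fin m) (f : O k m) :
    opKK p f = scale (kWeight k p.castSucc) 1 (scale (kWeight k p.succ)⁻¹ 1 f) := by
  rw [scale_scale, mul_one]; rfl

lemma opKKinv_eq (p : Fin m) (f : O k m) :
    opKKinv p f = scale (kWeight k p.castSucc)⁻¹ 1 (scale (kWeight k p.succ) 1 f) := by
  rw [scale_scale, mul_one, opKKinv]
  congr 2
  funext i
  simp [kappa, mul_comm]

variable (k m) in
/-- The left action of `U_q(gl_{m|1})` on `𝒪_q(GL_{m|1})`: `K_a x_{ij} = q_a^{2 δ_{ai}} x_{ij}`,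
`E_p x_{ij} = δ_{p+1,i} x_{p,j}`, `F_p x_{ij} = δ_{p,i} x_{p+1,j}`, extended to products by
`K_a (f g) = (K_a f) (K_a g)`,
`E_p (f g) = (-1)^{[E_p][f]} f (E_p g) + (E_p f) (K_p⁻¹ K_{p+1} g)`,
`F_p (f g) = (-1)^{[F_p][f]} (K_p K_{p+1}⁻¹ f) (F_p g) + (F_p f) g`. -/
def act : Uq k m →ₐ[Kq k] Module.End (Kq k) (O k m) :=
  RingQuot.liftAlgHom (Kq k) ⟨FreeAlgebra.lift (Kq k) (actGen k), by
    intro a b h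
    have key : ∀ S T : Module.End (Kq k) (O k m), S - T = 0 → S = T := fun S T => sub_eq_zero.mp
    induction h with
    | K_Kinv a =>
      ext f
      simp [fu, actGen, scale_kWeight_inv]
    | Kinv_K a =>
      ext f
      simp only [fu, map_mul, FreeAlgebra.lift_ι_apply, actGen, Module.End.mul_apply, map_one,
        AlgHom.toLinearMap_apply, Module.End.one_apply]
      rw [scale_comm, scale_kWeight_inv]
    | K_comm a b =>
      ext f
      simp only [fu, map_mul, FreeAlgebra.lift_ι_apply, actGen, Module.End.mul_apply,
        AlgHom.toLinearMap_apply]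
      rw [scale_comm]
    | K_E a p =>
      ext f
      simp only [fu, map_mul, FreeAlgebra.lift_ι_apply, actGen, Module.End.mul_apply, map_smul,
        AlgHom.toLinearMap_apply, scale_opE, scale_kWeight_inv, Units.smul_def,
        LinearMap.smul_apply]
    | K_F a p =>
      ext f
      simp only [fu, map_mul, FreeAlgebra.lift_ι_apply, actGen, Module.End.mul_apply, map_smul,
        AlgHom.toLinearMap_apply, scale_opF, scale_kWeight_inv, Units.smul_def,
        LinearMap.smul_apply]
    | E_F p r =>
      apply key
      rw [← act_E_F p r]
      simp only [fu, map_sub, map_mul, map_smul, FreeAlgebra.lift_ι_apply, actGen, eSign]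
      congr 1
      by_cases h : p = r
      · simp only [if_pos h, map_sub, map_mul, map_smul, FreeAlgebra.lift_ι_apply, actGen]
        congr 2
        · ext f
          exact (opKK_eq p f).symm
        · ext f
          exact (opKKinv_eq p f).symm
      · simp only [if_neg h, map_zero]
    | E_sq p h =>
      rw [map_zero, ← act_E_sq p h]
      simp only [fu, map_mul, FreeAlgebra.lift_ι_apply, actGen]
      rfl
    | F_sq p h =>
      rw [map_zero, ← act_F_sq p h]
      simp only [fu, map_mul, FreeAlgebra.lift_ι_apply, actGen]
      rfl
    | E_comm p r h =>
      apply key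
      rw [← act_E_comm p r h]
      simp only [fu, map_mul, FreeAlgebra.lift_ι_apply, actGen]
      rfl
    | F_comm p r h =>
      apply key
      rw [← act_F_comm p r h]
      simp only [fu, map_mul, FreeAlgebra.lift_ι_apply, actGen]
      rfl
    | E_serre p r hp h =>
      rw [map_zero, ← act_E_serre p r hp h]
      simp only [fu, map_sub, map_add, map_mul, map_smul, FreeAlgebra.lift_ι_apply, actGen]
      rfl
    | F_serre p r hp h =>
      rw [map_zero, ← act_F_serre p r hp h]
      simp only [fu, map_sub, map_add, map_mul, map_smul, FreeAlgebra.lift_ι_apply, actGen]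
      rfl⟩

lemma act_ugen (g : UGen m) : act k m (ugen k g) = actGen k g := by
  refine (RingQuot.liftAlgHom_mkAlgHom_apply (S := Kq k) _ _ _).trans ?_
  simp [fu]

variable (k) in
/-- The values of the co-unit on the generators. -/
def counitGen : UGen m → Kq k
  | .E _ => 0
  | .F _ => 0
  | .K _ => 1
  | .Kinv _ => 1

variable (k m) in
/-- The co-unit of `U_q(gl_{m|1})`. -/
def counit : Uq k m →ₐ[Kq k] Kq k :=
  RingQuot.liftAlgHom (Kq k) ⟨FreeAlgebra.lift (Kq k) (counitGen k), by
    intro a b h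
    induction h with
    | E_F p r =>
      by_cases h : p = r <;> simp [fu, counitGen, h]
    | _ => simp [fu, counitGen, Units.smul_def]⟩

lemma counit_ugen (g : UGen m) : counit k m (ugen k g) = counitGen k g := by
  refine (RingQuot.liftAlgHom_mkAlgHom_apply (S := Kq k) _ _ _).trans ?_
  simp [fu]

variable (k) in
/-- The subalgebra `U_S` of `U_q(gl_{m|1})` generated by a set `S` of generators. -/
def US (S : Set (UGen m)) : Subalgebra (Kq k) (Uq k m) := Algebra.adjoin (Kq k) (ugen k '' S)

lemma US_invariant_iff (S : Set (UGen m)) (f : O k m) :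
    (∀ u ∈ US k S, act k m u f = counit k m u • f) ↔
      ∀ g ∈ S, actGen k g f = counitGen k g • f := by
  constructor
  · intro h g hg
    rw [← act_ugen, ← counit_ugen]
    exact h _ (Algebra.subset_adjoin ⟨g, hg, rfl⟩)
  · intro h u hu
    induction hu using Algebra.adjoin_induction with
    | mem u hu =>
      obtain ⟨g, hg, rfl⟩ := hu
      rw [act_ugen, counit_ugen]
      exact h g hg
    | algebraMap c => simp [Module.algebraMap_end_apply]
    | add u v _ _ hu hv => rw [map_add, map_add, LinearMap.add_apply, hu, hv, add_smul]
    | mul u v _ _ hu hv =>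
      rw [map_mul, map_mul, Module.End.mul_apply, hv, map_smul, hu, smul_smul, mul_comm]

lemma act_one (g : UGen m) : actGen k g (1 : O k m) = counitGen k g • 1 := by
  cases g with
  | E p =>
    have h := opE_mul (k := k) p 1 1
    simpa [actGen, counitGen] using h
  | F p =>
    have h := opF_mul (k := k) p 1 1
    simpa [actGen, counitGen] using h
  | K a => simp [actGen, counitGen]
  | Kinv a => simp [actGen, counitGen]

lemma act_mul_invariant (g : UGen m) (f f' : O k m) (h : actGen k g f = counitGen k g • f)
    (h' : actGen k g f' = counitGen k g • f') :
    actGen k g (f * f') = counitGen k g • (f * f') := by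
  cases g with
  | E p =>
    simp only [actGen, counitGen, zero_smul] at *
    rw [opE_mul, h, h', mul_zero, zero_mul, add_zero]
  | F p =>
    simp only [actGen, counitGen, zero_smul] at *
    rw [opF_mul, h, h', mul_zero, zero_mul, add_zero]
  | K a =>
    simp only [actGen, counitGen, one_smul, AlgHom.toLinearMap_apply] at *
    rw [map_mul, h, h']
  | Kinv a =>
    simp only [actGen, counitGen, one_smul, AlgHom.toLinearMap_apply] at *
    rw [map_mul, h, h']

variable (k) in
/-- The subalgebra of elements `f` of `𝒪_q(GL_{m|1})` such that `u.f = ε(u) f` for all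
`u ∈ U_S`. -/
def invariants (S : Set (UGen m)) : Subalgebra (Kq k) (O k m) where
  carrier := {f | ∀ u ∈ US k S, act k m u f = counit k m u • f}
  mul_mem' {f f'} hf hf' := by
    simp only [Set.mem_ofPred_eq, US_invariant_iff] at *
    exact fun g hg => act_mul_invariant g f f' (hf g hg) (hf' g hg)
  add_mem' {f f'} hf hf' := by
    simp only [Set.mem_ofPred_eq] at *
    intro u hu
    rw [map_add, hf u hu, hf' u hu, smul_add]
  algebraMap_mem' c := by
    simp only [Set.mem_ofPred_eq, US_invariant_iff]
    intro g _
    rw [Algebra.algebraMap_eq_smul_one, map_smul, act_one, smul_comm]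

end Module

end Coord

/-! ### The dual canonical basis -/

section Basis

variable (k : Type u) [Field k] {m : ℕ}

/-- Matrices of exponents. -/
abbrev Mat (m : ℕ) : Type := Matrix (Fin (m + 1)) (Fin (m + 1)) ℕ

/-- The exponents of the odd entries are `0` or `1`. -/
def Admissible (M : Mat m) : Prop := ∀ i j, par i + par j = 1 → M i j ≤ 1

/-- The ordered monomial `x^M`, with factors in the lexicographic order. -/
def xMon (M : Mat m) : O k m :=
  (List.ofFn fun i => (List.ofFn fun j => x k i j ^ M i j).prod).prod

/-- The exponent `-∑_{i, j<l} (-1)^{[i]} m_{ij} m_{il} - ∑_{l, s<t} (-1)^{[l]} m_{sl} m_{tl}`. -/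
def normExp (M : Mat m) : ℤ :=
  -(∑ i, ∑ j, ∑ l, if j < l then (-1 : ℤ) ^ par i * (M i j * M i l : ℕ) else 0) -
    ∑ l, ∑ s, ∑ t, if s < t then (-1 : ℤ) ^ par l * (M s l * M t l : ℕ) else 0

/-- The normalized monomial `x(M)`. -/
def xNorm (M : Mat m) : O k m := q k ^ normExp M • xMon k M

/-- `M'` is obtained from `M` by a `2 × 2` sub-matrix transformation: for some `i < s`, `j < t` with
`m_{ij}, m_{st} ≥ 1`, the entries `m_{ij}`, `m_{st}` are lowered by one, and `m_{it}`, `m_{sj}` are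
raised by one. -/
def Step (M' M : Mat m) : Prop :=
  ∃ i s j t, i < s ∧ j < t ∧ 1 ≤ M i j ∧ 1 ≤ M s t ∧
    M' + Matrix.single i j 1 + Matrix.single s t 1 = M + Matrix.single i t 1 + Matrix.single s j 1

/-- The strict partial order on matrices: `Below T M` if `T` is obtained from `M` by a non-empty
sequence of `2 × 2` sub-matrix transformations. -/
def Below (T M : Mat m) : Prop := Relation.TransGen Step T M

/-- `f` is bar invariant and of the form `N a + ∑_t c_t N t`, a finite sum over elements `t` of the
index set `I` which are below `a`, with all `c_t` in `C`. -/
def IsCanonical {ι : Type*} (I : Set ι) (lt : ι → ι → Prop) (C : Set (Kq k)) (N : ι → O k m)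
    (a : ι) (f : O k m) : Prop :=
  bar k f = f ∧ ∃ h : ι →₀ Kq k, (∀ t ∈ h.support, t ∈ I ∧ lt t a ∧ h t ∈ C) ∧
    f = N a + h.sum fun t c => c • N t

/-- Indices `M = (M₁ M₂; 0 0)`. -/
def indexAB (m : ℕ) : Set (Mat m) := {M | Admissible M ∧ ∀ j, M (Fin.last m) j = 0}

/-- Indices `M = (0 0; M₃ 0)`. -/
def indexC (m : ℕ) : Set (Mat m) :=
  {M | Admissible M ∧ (∀ (i : Fin m) j, M i.castSucc j = 0) ∧ M (Fin.last m) (Fin.last m) = 0}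

/-- Indices `M = (M₁ M₂; M₃ 0)`. -/
def indexABC (m : ℕ) : Set (Mat m) := {M | Admissible M ∧ M (Fin.last m) (Fin.last m) = 0}

/-- The element `Ω_q(M₁ M₂; 0 0)`: the bar invariant element of the form `x(M) + ∑_{T<M} h_T x(T)`
with `h_T ∈ q ℤ[q]`. -/
def omegaAB (M : Mat m) : O k m :=
  Classical.epsilon (IsCanonical k (indexAB m) Below (qZq k) (xNorm k) M)

/-- The element `Ω_{q⁻¹}(0 0; M₃ 0)`: the bar invariant element of the form
`x(M) + ∑_{T<M} h_T x(T)` with `h_T ∈ q⁻¹ ℤ[q⁻¹]`. -/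
def omegaC (M : Mat m) : O k m :=
  Classical.epsilon (IsCanonical k (indexC m) Below (qinvZqinv k) (xNorm k) M)

/-- `(M₁ M₂; 0 0)`. -/
def topRows (M : Mat m) : Mat m := fun i j => if i = Fin.last m then 0 else M i j

/-- `(0 0; M₃ M₄)`. -/
def bottomRow (M : Mat m) : Mat m := fun i j => if i = Fin.last m then M i j else 0

/-- The exponent `-∑_{i ≤ m} c_i(M₁) c_i(M₃)`, with `c_i` the sum of the `i`-th column. -/
def exponentABC (M : Mat m) : ℤ :=
  -∑ j : Fin m, (((∑ i : Fin m, M i.castSucc j.castSucc) * M (Fin.last m) j.castSucc : ℕ) : ℤ)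

/-- `N(M₁ M₂; M₃ 0) = q^{-∑ c_i(M₁) c_i(M₃)} Ω_q(M₁ M₂; 0 0) Ω_{q⁻¹}(0 0; M₃ 0)`. -/
def nABC (M : Mat m) : O k m :=
  q k ^ exponentABC M • (omegaAB k (topRows M) * omegaC k (bottomRow M))

/-- The element `Ω_q(M₁ M₂; M₃ 0)`: the bar invariant element of the form `N(M) + ∑_{T<M} h_T N(T)`
with `h_T ∈ q ℤ[q]`. -/
def omegaABC (M : Mat m) : O k m :=
  Classical.epsilon (IsCanonical k (indexABC m) Below (qZq k) (nABC k) M)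

variable (m) in
/-- The block `A`, as a matrix. -/
def matA : Matrix (Fin m) (Fin m) (O k m) := Matrix.of (blockA (x k))

variable (m) in
/-- The only entry `y` of `D' = D - C A⁻¹ B`. -/
def y : O k m := x k (Fin.last m) (Fin.last m) -
  ∑ i : Fin m, ∑ j : Fin m, x k (Fin.last m) i.castSucc * Ring.inverse (matA k m) i j *
    x k j.castSucc (Fin.last m)

open Classical in
variable (m) in
/-- The powers `(det_{q⁻¹} D')^d = y^d` of the invertible element `y`. -/
def yPow (d : ℤ) : O k m := if h : IsUnit (y k m) then ((h.unit ^ d : (O k m)ˣ) : O k m) else 0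

/-- Indices `(a, d, M)` of the dual canonical basis, with `M ∈ 𝕄` such that `M₁` and `M₄` have at
least one zero diagonal entry each. -/
def indexGL (m : ℕ) : Set (ℤ × ℤ × Mat m) :=
  {t | Admissible t.2.2 ∧ (∃ i : Fin m, t.2.2 i.castSucc i.castSucc = 0) ∧
    t.2.2 (Fin.last m) (Fin.last m) = 0}

/-- `S(M₂) + S(M₃)`, the sum of all odd exponents. -/
def oddSum (M : Mat m) : ℕ :=
  ∑ i : Fin m, M i.castSucc (Fin.last m) + ∑ j : Fin m, M (Fin.last m) j.castSucc

/-- `N_{a,d}(M) = q^{(d-a)(S(M₂)+S(M₃))} (det_q A)^a Ω_q(M₁ M₂; M₃ 0) (det_{q⁻¹} D')^d`. -/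
def nGL (t : ℤ × ℤ × Mat m) : O k m :=
  q k ^ ((t.2.1 - t.1) * (oddSum t.2.2 : ℤ)) •
    (((detUnit k m ^ t.1 : (O k m)ˣ) : O k m) * omegaABC k t.2.2 * yPow k m t.2.1)

/-- The order on indices: `N_{a',d'}(T) < N_{a,d}(M)` if `a < a'`, or `a = a'` and `d < d'`, or
`a = a'`, `d = d'` and `T < M`. -/
def BelowGL (t' t : ℤ × ℤ × Mat m) : Prop :=
  t.1 < t'.1 ∨ t.1 = t'.1 ∧ (t.2.1 < t'.2.1 ∨ t.2.1 = t'.2.1 ∧ Below t'.2.2 t.2.2)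

variable (m) in
/-- The dual canonical basis `B_q^*` of `𝒪_q(GL_{m|1})`: the elements `Ω_{q,a,d}(M)`, which are bar
invariant and of the form `N_{a,d}(M) + ∑ h N_{a',d'}(T)`, with a finite sum over smaller indices
and coefficients `h ∈ q ℤ[q]`. -/
def dualCanonicalBasis : Set (O k m) :=
  {f | ∃ t ∈ indexGL m, IsCanonical k (indexGL m) BelowGL (qZq k) (nGL k) t f}

end Basis

end QuantumGL

end

/-!
The invariants are spanned by a part of the dual canonical basis because, for each generator other
than the odd `F_m`, the kernel is compatible with this basis.

*The basis.* The determinant `D` of the even block and the quasi-determinant `y` commute with the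
even letters and `q²`-commute with the odd ones (`scalesOdd_detUnit`, `scalesOdd_yUnit`), and both are
bar invariant. The normalizing power of `q` makes `N_{a,d}(M) = q^e D^a Ω(M) y^d` bar invariant
(`bar_nGL`), so that it is itself the element `Ω_{q,a,d}(M)` of the dual canonical basis
(`nGL_mem_dualCanonicalBasis`). These elements span the algebra (`span_nGL`), as the span of the
products `D^a r y^d`, with `r` a combination of ordered monomials without the last letter, is stable
under all generators of the algebra (`triSpan_eq_top`).

*Leading terms.* Write a vector in the span of these ordered monomials in the normalized monomials
`x(M)`, with coefficients regular at `q = 0`. If it is killed by an even `E_p` or `F_p`, the matrices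
`M` whose coefficients have nonzero constant terms satisfy the signature rule of crystal theory
(`coeff_eq_zero_of_lt_depth`, `leading_E`, `leading_F`); a similar rule holds for the odd `E_m`
(`leading_E_odd`). As a matrix which satisfies the rules of all `E_p`, together with its transpose, is
diagonal, this also proves the linear independence of the monomials (`eq_zero_of_evalMon_eq_zero`):
relations are stable under the `E_p` and under transposition, and diagonal monomials are independent
on the torus.

*Kernels.* Let `L` be the set of matrices allowed by the rule of a generator `G`. Each `M ∈ L` is the
leading monomial of a vector killed by `G`: for even `G` a product of `2 × 2` quantum minors and
letters, for `E_m` the image of a monomial, since `E_m² = 0`. The kernel of `G` is stable under the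
bar involution. These facts (`HasCrystalKernel`) force `Ω(M)` into the kernel for `M ∈ L`: modify a
kernel vector led by `M` by the kernel elements `Ω(T)`, `T ∈ L`, found before, so that it becomes
`Ω(M) + ∑ a_T Ω(T)` with `T ∉ L`. By the rule, the `a_T` are determined, hence bar invariant, and lie
in `q ℤ[q]`; so they vanish (`HasCrystalKernel.omegaABC_mem`). Hence the kernel on the ordered
monomials is spanned by the `Ω(M)`, `M ∈ L` (`HasCrystalKernel.support_subset`).

*Passing to the whole algebra.* The `E_p` and `F_p` other than `F_m` kill `D` and `y`, and so commute with the
multiplication by `D` and `y` up to scalars (`IsTriLinear`). The powers of `y` are separated by an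
endomorphism `theta` which rescales `y` and fixes all letters but the last. The powers of `D` are
absorbed by the leading terms: `D^n Ω(M)` has the leading term `M + n I`, with `I` the unit matrix of
the even block, and `M + n I ∈ L` implies `M ∈ L`. Thus the kernel of `G` is spanned by elements
`N_{a,d}(M)` (`HasCrystalKernel.nGL_eq_zero`). The `K_a` act diagonally on the `N_{a,d}(M)`, which are
linearly independent. If a combination of them is invariant, so are its members (`actGen_nGL`).
-/

noncomputable section

namespace QuantumGL

universe u

/-! ### Scalars: Laurent expansion at `q = 0` and the ring `ℤ[q, q⁻¹]` -/

section ScalarTools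

variable (k : Type u) [Field k]

open scoped RatFunc in
/-- The Laurent expansion at `q = 0` of a rational function. -/
def laurentExp : Kq k →+* LaurentSeries k := algebraMap (RatFunc k) (LaurentSeries k)

/-- The coefficient of `q ^ i` in the Laurent expansion of `c` at `q = 0`. -/
def co (c : Kq k) (i : ℤ) : k := (laurentExp k c).coeff i

lemma laurentExp_q : laurentExp k (q k) = HahnSeries.single 1 1 :=
  RatFunc.coe_X (F := k)

lemma laurentExp_q_zpow (n : ℤ) : laurentExp k (q k ^ n) = HahnSeries.single n 1 := by
  rw [map_zpow₀, laurentExp_q, RatFunc.single_zpow n]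

variable {k}

lemma co_zpow_mul (n : ℤ) (c : Kq k) (i : ℤ) : co k (q k ^ n * c) i = co k c (i - n) := by
  rw [co, map_mul, laurentExp_q_zpow, co, HahnSeries.coeff_single_mul, one_mul]

lemma co_add (c d : Kq k) (i : ℤ) : co k (c + d) i = co k c i + co k d i := by
  simp [co]

lemma co_neg (c : Kq k) (i : ℤ) : co k (-c) i = - co k c i := by
  simp [co]

lemma co_zero (i : ℤ) : co k 0 i = 0 := by simp [co]

lemma co_sum {ι : Type*} (s : Finset ι) (f : ι → Kq k) (i : ℤ) :
    co k (∑ t ∈ s, f t) i = ∑ t ∈ s, co k (f t) i := by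
  simp [co, HahnSeries.coeff_sum]

lemma co_zpow (n i : ℤ) : co k (q k ^ n) i = if i = n then 1 else 0 := by
  rw [co, laurentExp_q_zpow, HahnSeries.coeff_single]
  congr

lemma exists_min_co {c : Kq k} (hc : c ≠ 0) : ∃ n : ℤ, co k c n ≠ 0 ∧ ∀ i < n, co k c i = 0 := by
  have h : laurentExp k c ≠ 0 := (map_ne_zero _).mpr hc
  exact ⟨(laurentExp k c).order, fun e => h (HahnSeries.coeff_order_eq_zero.mp e),
    fun i hi => HahnSeries.coeff_eq_zero_of_lt_order hi⟩

lemma co_mul_of_local {c d : Kq k} (hc : ∀ i ≤ 0, co k c i = 0) (hd : ∀ i < 0, co k d i = 0)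
    (i : ℤ) (hi : i ≤ 0) : co k (c * d) i = 0 := by
  rw [co, map_mul, HahnSeries.coeff_mul]
  refine Finset.sum_eq_zero fun p hp => ?_
  rw [Finset.mem_antidiagonal] at hp
  obtain ⟨_, _, h3⟩ := hp
  rcases le_or_gt p.1 0 with h | h
  · rw [show (laurentExp k c).coeff p.1 = 0 from hc _ h, zero_mul]
  · rw [show (laurentExp k d).coeff p.2 = 0 from hd _ (by omega), mul_zero]

/-- A family of scalars which do not all vanish can be rescaled by a power of `q` so that all
members are regular at `q = 0` and some member does not vanish there. -/
lemma exists_rescale {ι : Type*} (s : Finset ι) (c : ι → Kq k) (hs : ∃ t ∈ s, c t ≠ 0) :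
    ∃ n : ℤ, (∀ t ∈ s, ∀ i < n, co k (c t) i = 0) ∧ ∃ t ∈ s, co k (c t) n ≠ 0 := by
  classical
  have h : ∀ t, ∃ n : ℤ, c t ≠ 0 → co k (c t) n ≠ 0 ∧ ∀ i < n, co k (c t) i = 0 := fun t => by
    by_cases hc : c t = 0
    · exact ⟨0, fun h => absurd hc h⟩
    · obtain ⟨n, hn⟩ := exists_min_co hc
      exact ⟨n, fun _ => hn⟩
  choose o ho using h
  obtain ⟨t0, ht0, hc0⟩ := hs
  obtain ⟨t, ht, hmin⟩ := Finset.exists_min_image (s.filter fun t => c t ≠ 0) o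
    ⟨t0, Finset.mem_filter.mpr ⟨ht0, hc0⟩⟩
  rw [Finset.mem_filter] at ht
  refine ⟨o t, fun t' ht' i hi => ?_, t, ht.1, (ho t ht.2).1⟩
  by_cases hc : c t' = 0
  · rw [hc, co_zero]
  · exact (ho t' hc).2 i (hi.trans_le (hmin t' (Finset.mem_filter.mpr ⟨ht', hc⟩)))

variable (k)

/-- The indeterminate, as a unit of `k(q)`. -/
def qUnit : (Kq k)ˣ := Units.mk0 (q k) (q_ne_zero k)

lemma qUnit_zpow (n : ℤ) : ((qUnit k ^ n : (Kq k)ˣ) : Kq k) = q k ^ n := by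
  simp [qUnit, Units.val_zpow_eq_zpow_val]

/-- The evaluation of integral Laurent polynomials at `q`. -/
def evalQ : LaurentPolynomial ℤ →+* Kq k := LaurentPolynomial.eval₂ (Int.castRingHom _) (qUnit k)

lemma evalQ_C_mul_T (a n : ℤ) : evalQ k (LaurentPolynomial.C a * LaurentPolynomial.T n) =
    (a : Kq k) * q k ^ n := by
  rw [evalQ, LaurentPolynomial.eval₂_C_mul_T, qUnit_zpow]; rfl

/-- The ring `ℤ[q, q⁻¹]`. -/
def ZQ : Subring (Kq k) := (evalQ k).range

variable {k}

lemma q_zpow_mem_ZQ (n : ℤ) : q k ^ n ∈ ZQ k :=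
  ⟨LaurentPolynomial.C 1 * LaurentPolynomial.T n, by rw [evalQ_C_mul_T]; simp⟩

lemma q_pow_mem_ZQ (n : ℕ) : q k ^ n ∈ ZQ k := by
  simpa using q_zpow_mem_ZQ (k := k) n

lemma q_pow_inv_mem_ZQ (n : ℕ) : (q k ^ n)⁻¹ ∈ ZQ k := by
  simpa using q_zpow_mem_ZQ (k := k) (-n)

lemma neg_one_pow_mem_ZQ (n : ℕ) : (-1 : Kq k) ^ n ∈ ZQ k :=
  pow_mem (neg_mem (one_mem _)) n

lemma co_intCast_mul_zpow (a n i : ℤ) :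
    co k ((a : Kq k) * q k ^ n) i = if i = n then (a : k) else 0 := by
  rw [co, map_mul, laurentExp_q_zpow, map_intCast]
  have : ((a : ℤ) : LaurentSeries k) = HahnSeries.single 0 (a : k) := by
    rw [← map_intCast (HahnSeries.C (Γ := ℤ) (R := k)), HahnSeries.C_apply]
  rw [this, HahnSeries.single_mul_single, HahnSeries.coeff_single]
  simp

lemma co_evalQ (a : LaurentPolynomial ℤ) (i : ℤ) : co k (evalQ k a) i = (a.coeff i : k) := by
  induction a using LaurentPolynomial.induction_on' with
  | add a b ha hb => rw [map_add, co_add, ha, hb]; simp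
  | C_mul_T n a =>
    rw [evalQ_C_mul_T, co_intCast_mul_zpow, ← LaurentPolynomial.single_eq_C_mul_T,
      AddMonoidAlgebra.coeff_single, Finsupp.single_apply]
    by_cases h : i = n
    · rw [if_pos h, if_pos h.symm]
    · rw [if_neg h, if_neg (Ne.symm h), Int.cast_zero]

lemma barScalar_zpow (n : ℤ) : barScalar k (q k ^ n) = q k ^ (-n) := by
  rw [map_zpow₀, barScalar_q, inv_zpow, zpow_neg]

lemma barScalar_evalQ (a : LaurentPolynomial ℤ) :
    barScalar k (evalQ k a) = evalQ k (LaurentPolynomial.invert a) := by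
  induction a using LaurentPolynomial.induction_on' with
  | add a b ha hb => rw [map_add, map_add, ha, hb, map_add, map_add]
  | C_mul_T n a =>
    rw [map_mul LaurentPolynomial.invert, LaurentPolynomial.invert_C, LaurentPolynomial.invert_T,
      evalQ_C_mul_T, evalQ_C_mul_T, map_mul, barScalar_zpow, map_intCast]

lemma barScalar_barScalar (c : Kq k) : barScalar k (barScalar k c) = c := by
  have h : (barScalar k).comp (barScalar k) = RingHom.id (Kq k) := by
    refine IsLocalization.ringHom_ext (nonZeroDivisors (Polynomial k)) (S := RatFunc k) ?_
    have hC : ∀ c : k, barScalar k (RatFunc.C c) = RatFunc.C c := fun c => by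
      refine (RatFunc.liftRingHom_C (K := k) _ _ c).trans ?_
      exact Polynomial.aeval_C (R := k) ((RatFunc.X : RatFunc k)⁻¹) c
    refine Polynomial.ringHom_ext (fun c => ?_) ?_
    · change barScalar k (barScalar k (algebraMap (Polynomial k) (RatFunc k) (Polynomial.C c))) =
        algebraMap (Polynomial k) (RatFunc k) (Polynomial.C c)
      rw [RatFunc.algebraMap_C, hC, hC]
    · change barScalar k (barScalar k (algebraMap (Polynomial k) (RatFunc k) Polynomial.X)) =
        algebraMap (Polynomial k) (RatFunc k) Polynomial.X
      rw [RatFunc.algebraMap_X]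
      change barScalar k (barScalar k (q k)) = q k
      rw [barScalar_q, map_inv₀, barScalar_q, inv_inv]
  exact congrArg (fun f : Kq k →+* Kq k => f c) h

lemma qZq_add {c d : Kq k} (hc : c ∈ qZq k) (hd : d ∈ qZq k) : c + d ∈ qZq k := by
  obtain ⟨p, rfl⟩ := hc
  obtain ⟨r, rfl⟩ := hd
  exact ⟨p + r, by rw [map_add, mul_add]⟩

lemma qZq_neg {c : Kq k} (hc : c ∈ qZq k) : -c ∈ qZq k := by
  obtain ⟨p, rfl⟩ := hc
  exact ⟨-p, by rw [map_neg, mul_neg]⟩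

lemma qZq_zero : (0 : Kq k) ∈ qZq k := ⟨0, by simp⟩

lemma qZq_mul {c d : Kq k} (hc : c ∈ qZq k) (hd : d ∈ qZq k) : c * d ∈ qZq k := by
  obtain ⟨p, rfl⟩ := hc
  obtain ⟨r, rfl⟩ := hd
  exact ⟨p * (Polynomial.X * r), by simp only [map_mul, Polynomial.aeval_X]; ring⟩

lemma qZq_int_zpow (a : ℤ) {n : ℤ} (hn : 0 < n) : (a : Kq k) * q k ^ n ∈ qZq k := by
  obtain ⟨r, rfl⟩ : ∃ r : ℕ, n = r + 1 := ⟨(n - 1).toNat, by omega⟩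
  refine ⟨Polynomial.C a * Polynomial.X ^ r, ?_⟩
  rw [map_mul, Polynomial.aeval_C, map_pow, Polynomial.aeval_X, zpow_add₀ (q_ne_zero k)]
  simp
  ring

lemma qZq_sum {ι : Type*} (s : Finset ι) (f : ι → Kq k) (h : ∀ i ∈ s, f i ∈ qZq k) :
    ∑ i ∈ s, f i ∈ qZq k := by
  classical
  induction s using Finset.induction_on with
  | empty => simpa using qZq_zero
  | insert a s ha ih =>
    rw [Finset.sum_insert ha]
    exact qZq_add (h _ (Finset.mem_insert_self _ _))
      (ih fun i hi => h i (Finset.mem_insert_of_mem hi))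

lemma qZq_subset_ZQ {c : Kq k} (hc : c ∈ qZq k) : c ∈ ZQ k := by
  obtain ⟨p, rfl⟩ := hc
  refine mul_mem (by simpa using q_zpow_mem_ZQ (k := k) 1) ?_
  induction p using Polynomial.induction_on' with
  | add a b ha hb => rw [map_add]; exact add_mem ha hb
  | monomial n a =>
    rw [Polynomial.aeval_monomial]
    refine mul_mem ?_ (by simpa using q_zpow_mem_ZQ (k := k) n)
    simp

lemma co_qZq {c : Kq k} (hc : c ∈ qZq k) (i : ℤ) (hi : i ≤ 0) : co k c i = 0 := by
  obtain ⟨p, rfl⟩ := hc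
  induction p using Polynomial.induction_on' with
  | add a b ha hb => rw [map_add, mul_add, co_add, ha, hb, add_zero]
  | monomial n a =>
    have : q k * Polynomial.aeval (q k) (Polynomial.monomial n a) =
        (a : Kq k) * q k ^ ((n : ℤ) + 1) := by
      rw [Polynomial.aeval_monomial, zpow_add₀ (q_ne_zero k)]
      simp
      ring
    rw [this, co_intCast_mul_zpow, if_neg (by omega)]

variable [CharZero k]

lemma evalQ_injective : Function.Injective (evalQ k) := by
  intro a b h
  refine LaurentPolynomial.ext fun n => ?_
  have := congrArg (fun c => co k c n) h
  simpa [co_evalQ] using this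

/-- A nonzero element of `ℤ[q, q⁻¹]` fixed by `q ↦ q⁻¹` is not in `q k[[q]]`. -/
lemma exists_co_of_barScalar_fixed {c : Kq k} (hc : c ∈ ZQ k) (hσ : barScalar k c = c)
    (h0 : c ≠ 0) : ∃ i ≤ 0, co k c i ≠ 0 := by
  obtain ⟨a, rfl⟩ := hc
  rw [barScalar_evalQ] at hσ
  have hs := evalQ_injective hσ
  by_contra hcon
  push Not at hcon
  apply h0
  have : a = 0 := by
    refine LaurentPolynomial.ext fun n => ?_
    have key : ∀ i ≤ 0, a.coeff i = 0 := fun i hi => by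
      have := hcon i hi
      rw [co_evalQ] at this
      exact_mod_cast this
    rcases le_total n 0 with h | h
    · simpa using key n h
    · rw [← hs, LaurentPolynomial.invert_apply]
      simpa using key (-n) (by omega)
  rw [this, map_zero]

/-- The cohomological step of the construction of canonical bases: an element of `ℤ[q, q⁻¹]`
which is anti-invariant under `q ↦ q⁻¹` is a coboundary of an element of `q ℤ[q]`. -/
lemma exists_qZq_sub_bar {r : Kq k} (hr : r ∈ ZQ k) (hσ : barScalar k r = -r) :
    ∃ h ∈ qZq k, r = h - barScalar k h := by
  obtain ⟨a, rfl⟩ := hr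
  rw [barScalar_evalQ, ← map_neg] at hσ
  have hs := evalQ_injective hσ
  have hc : ∀ n, a.coeff (-n) = - a.coeff n := fun n => by
    have := congrArg (fun f : LaurentPolynomial ℤ => f.coeff n) hs
    simpa using this
  let p : LaurentPolynomial ℤ := ∑ n ∈ a.coeff.support.filter (0 < ·),
    LaurentPolynomial.C (a.coeff n) * LaurentPolynomial.T n
  have hp : ∀ n, p.coeff n = if 0 < n then a.coeff n else 0 := by
    intro n
    have : p.coeff n = ∑ i ∈ a.coeff.support.filter (0 < ·), if i = n then a.coeff i else 0 := by
      simp only [p, AddMonoidAlgebra.coeff_sum, Finsupp.finsetSum_apply]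
      refine Finset.sum_congr rfl fun i _ => ?_
      rw [← LaurentPolynomial.single_eq_C_mul_T, AddMonoidAlgebra.coeff_single,
        Finsupp.single_apply]
    rw [this, Finset.sum_ite_eq']
    by_cases h : 0 < n
    · by_cases h' : a.coeff n = 0 <;> simp [h, h']
    · simp [h]
  refine ⟨evalQ k p, ?_, ?_⟩
  · simp only [p, map_sum]
    refine qZq_sum _ _ fun n hn => ?_
    rw [evalQ_C_mul_T]
    exact qZq_int_zpow _ (Finset.mem_filter.mp hn).2
  · rw [barScalar_evalQ, ← map_sub]
    congr 1
    refine LaurentPolynomial.ext fun n => ?_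
    have e : (p - LaurentPolynomial.invert p).coeff n = p.coeff n - p.coeff (-n) := by simp
    rw [e, hp, hp]
    rcases lt_trichotomy n 0 with h | rfl | h
    · rw [if_neg (by omega), if_pos (by omega), hc]; ring
    · have := hc 0
      simp at this ⊢
      omega
    · rw [if_pos h, if_neg (by omega)]; ring

end ScalarTools

/-! ### Unitriangular families -/

section Triangular

variable {K V ι : Type*} [Field K] [AddCommGroup V] [Module K V]

/-- `b t = (unit) · v t + (lower terms)` for a grading `Φ` of the index set. -/
def IsTriangular (Φ : ι → ℕ) (v b : ι → V) : Prop :=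
  ∀ t, ∃ c : K, c ≠ 0 ∧ b t - c • v t ∈ Submodule.span K (v '' {s | Φ s < Φ t})

lemma IsTriangular.span_le {Φ : ι → ℕ} {v b : ι → V} (h : IsTriangular (K := K) Φ v b) (n : ℕ) :
    Submodule.span K (v '' {s | Φ s < n}) ≤ Submodule.span K (b '' {s | Φ s < n}) := by
  induction n with
  | zero => simp
  | succ n ih =>
    rw [Submodule.span_le]
    rintro _ ⟨t, ht, rfl⟩
    obtain ⟨c, hc, hm⟩ := h t
    have ht' : Φ t ≤ n := Nat.lt_succ_iff.mp ht
    have h1 : b t - c • v t ∈ Submodule.span K (b '' {s | Φ s < n + 1}) := by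
      refine Submodule.span_mono (Set.image_mono ?_) (ih (Submodule.span_mono
        (Set.image_mono ?_) hm))
      · intro s hs; exact Nat.lt_succ_of_lt hs
      · intro s hs; exact lt_of_lt_of_le hs ht'
    have h2 : b t ∈ Submodule.span K (b '' {s | Φ s < n + 1}) :=
      Submodule.subset_span ⟨t, ht, rfl⟩
    have h3 := Submodule.smul_mem _ c⁻¹ (Submodule.sub_mem _ h2 h1)
    rwa [sub_sub_cancel, smul_smul, inv_mul_cancel₀ hc, one_smul] at h3

lemma IsTriangular.mem_span {Φ : ι → ℕ} {v b : ι → V} (h : IsTriangular (K := K) Φ v b) (t : ι) :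
    v t ∈ Submodule.span K (Set.range b) :=
  Submodule.span_mono (Set.image_subset_range _ _)
    (h.span_le (Φ t + 1) (Submodule.subset_span ⟨t, Nat.lt_succ_self _, rfl⟩))

lemma IsTriangular.span_eq {Φ : ι → ℕ} {v b : ι → V} (h : IsTriangular (K := K) Φ v b) :
    Submodule.span K (Set.range b) = Submodule.span K (Set.range v) := by
  refine le_antisymm ?_ ?_
  · rw [Submodule.span_le]
    rintro _ ⟨t, rfl⟩
    obtain ⟨c, -, hm⟩ := h t
    have := Submodule.add_mem _ (Submodule.span_mono (Set.image_subset_range _ _) hm)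
      (Submodule.smul_mem _ c (Submodule.subset_span (Set.mem_range_self t)))
    rwa [sub_add_cancel] at this
  · rw [Submodule.span_le]
    rintro _ ⟨t, rfl⟩
    exact h.mem_span t

/-- A family which is triangular over a linearly independent family is linearly independent. -/
lemma IsTriangular.linearIndependent {Φ : ι → ℕ} {v b : ι → V}
    (h : IsTriangular (K := K) Φ v b) (hv : LinearIndependent K v) : LinearIndependent K b := by
  classical
  rw [linearIndependent_iff']
  intro s g hg
  by_contra hcon
  push Not at hcon
  obtain ⟨i0, hi0, hne⟩ := hcon
  obtain ⟨t, ht, hmax⟩ := Finset.exists_max_image (s.filter fun i => g i ≠ 0) Φ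
    ⟨i0, Finset.mem_filter.mpr ⟨hi0, hne⟩⟩
  rw [Finset.mem_filter] at ht
  choose c hc hm using h
  have hlow : ∀ i ∈ s, i ≠ t → g i • b i ∈ Submodule.span K (v '' {i | i ≠ t}) := by
    intro i hi hit
    by_cases h0 : g i = 0
    · rw [h0, zero_smul]; exact Submodule.zero_mem _
    refine Submodule.smul_mem _ _ ?_
    have hle : Φ i ≤ Φ t := hmax i (Finset.mem_filter.mpr ⟨hi, h0⟩)
    have h1 : b i - c i • v i ∈ Submodule.span K (v '' {i | i ≠ t}) := by
      refine Submodule.span_mono (Set.image_mono ?_) (hm i)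
      rintro j hj rfl
      exact absurd (lt_of_lt_of_le hj hle) (lt_irrefl _)
    have h2 : c i • v i ∈ Submodule.span K (v '' {i | i ≠ t}) :=
      Submodule.smul_mem _ _ (Submodule.subset_span ⟨i, hit, rfl⟩)
    simpa using Submodule.add_mem _ h1 h2
  have hsum : g t • b t ∈ Submodule.span K (v '' {i | i ≠ t}) := by
    have e : g t • b t = - ∑ i ∈ s.erase t, g i • b i := by
      rw [← Finset.add_sum_erase s _ ht.1] at hg
      exact eq_neg_of_add_eq_zero_left hg
    rw [e]
    exact Submodule.neg_mem _ (Submodule.sum_mem _ fun i hi =>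
      hlow i (Finset.mem_of_mem_erase hi) (Finset.ne_of_mem_erase hi))
  have hbt : b t ∈ Submodule.span K (v '' {i | i ≠ t}) := by
    have := Submodule.smul_mem _ (g t)⁻¹ hsum
    rwa [smul_smul, inv_mul_cancel₀ ht.2, one_smul] at this
  have hvt : v t ∈ Submodule.span K (v '' {i | i ≠ t}) := by
    have h1 : b t - c t • v t ∈ Submodule.span K (v '' {i | i ≠ t}) := by
      refine Submodule.span_mono (Set.image_mono ?_) (hm t)
      rintro j (hj : Φ j < Φ t) rfl
      exact lt_irrefl _ hj
    have := Submodule.smul_mem _ (c t)⁻¹ (Submodule.sub_mem _ hbt h1)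
    rwa [sub_sub_cancel, smul_smul, inv_mul_cancel₀ (hc t), one_smul] at this
  exact hv.notMem_span_image (s := {i | i ≠ t}) (x := t) (by simp) hvt

/-- If `b` and `b'` are both triangular over the independent family `v`, and the `b' t` with
`t ∈ L` lie in the span of the `b t` with `t ∈ L`, then a combination of the `b' t` lies in that
span only if it involves no other `t`. -/
lemma IsTriangular.support_subset {Φ : ι → ℕ} {v b b' : ι → V}
    (h : IsTriangular (K := K) Φ v b) (h' : IsTriangular (K := K) Φ v b')
    (hv : LinearIndependent K v) (L : Set ι)
    (hL : ∀ t ∈ L, b' t ∈ Submodule.span K (b '' L)) (f : ι →₀ K)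
    (hf : f.sum (fun t c => c • b' t) ∈ Submodule.span K (b '' L)) : ∀ t ∈ f.support, t ∈ L := by
  classical
  let b'' : ι → V := fun t => if t ∈ L then b t else b' t
  have h'' : IsTriangular (K := K) Φ v b'' := fun t => by
    by_cases ht : t ∈ L
    · simpa [b'', ht] using h t
    · simpa [b'', ht] using h' t
  have hind := h''.linearIndependent hv
  have e1 : b'' '' L = b '' L := Set.image_congr fun t ht => by simp [b'', ht]
  have hmem : (f.filter (· ∉ L)).sum (fun t c => c • b'' t) ∈ Submodule.span K (b'' '' L) := by
    have hsplit : f.sum (fun t c => c • b' t) = (f.filter (· ∈ L)).sum (fun t c => c • b' t) +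
        (f.filter (· ∉ L)).sum (fun t c => c • b' t) := by
      conv_lhs => rw [← Finsupp.filter_add_filter_not f (· ∈ L)]
      rw [Finsupp.sum_add_index'] <;> intros <;> simp [add_smul]
    have h1 : (f.filter (· ∈ L)).sum (fun t c => c • b' t) ∈ Submodule.span K (b '' L) := by
      refine Submodule.sum_mem _ fun t ht => Submodule.smul_mem _ _ (hL t ?_)
      rw [Finsupp.support_filter, Finset.mem_filter] at ht
      exact ht.2
    have h2 : (f.filter (· ∉ L)).sum (fun t c => c • b'' t) =
        (f.filter (· ∉ L)).sum (fun t c => c • b' t) := by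
      refine Finset.sum_congr rfl fun t ht => ?_
      rw [Finsupp.support_filter, Finset.mem_filter] at ht
      simp [b'', ht.2]
    rw [e1, h2]
    have := Submodule.sub_mem _ hf h1
    rwa [hsplit, add_sub_cancel_left] at this
  have hz : f.filter (· ∉ L) = 0 := by
    have hd := hind.disjoint_span_image (s := L) (t := Lᶜ) disjoint_compl_right
    have hm2 : (f.filter (· ∉ L)).sum (fun t c => c • b'' t) ∈ Submodule.span K (b'' '' Lᶜ) := by
      refine Submodule.sum_mem _ fun t ht => Submodule.smul_mem _ _ (Submodule.subset_span ?_)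
      rw [Finsupp.support_filter, Finset.mem_filter] at ht
      exact ⟨t, ht.2, rfl⟩
    have hzero := Submodule.disjoint_def.mp hd _ hmem hm2
    exact (linearIndependent_iff.mp hind) _ hzero
  intro t ht
  by_contra hcon
  have := DFunLike.congr_fun hz t
  rw [Finsupp.filter_apply_pos (· ∉ L) _ hcon] at this
  exact (Finsupp.mem_support_iff.mp ht) this

end Triangular

/-! ### The parity automorphism and multiplicativity of the bar involution -/

section BarMul

variable {k : Type u} [Field k] {m : ℕ}

lemma scale_detA (r c : Fin (m + 1) → (Kq k)ˣ) : scale r c (detA k m) =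
    ((prodFirst r * prodFirst c : (Kq k)ˣ) : Kq k) • detA k m := by
  rw [← qdet_scaled, detA, map_qdet]
  congr 1
  funext i j
  exact scale_x _ _ _ _

lemma scale_detInv (r c : Fin (m + 1) → (Kq k)ˣ) : scale r c (detInv k m) =
    (((prodFirst r * prodFirst c)⁻¹ : (Kq k)ˣ) : Kq k) • detInv k m :=
  (lift_mk _ _ _ _ _ _ _ _ (FreeAlgebra.ι _ Coord.detInv)).trans (by simp [liftFun])

lemma scale_lastInv (r c : Fin (m + 1) → (Kq k)ˣ) : scale r c (lastInv k m) =
    (((r (Fin.last m) * c (Fin.last m))⁻¹ : (Kq k)ˣ) : Kq k) • lastInv k m :=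
  (lift_mk _ _ _ _ _ _ _ _ (FreeAlgebra.ι _ Coord.lastInv)).trans (by simp [liftFun])

/-- The parity automorphism `f ↦ (-1)^{[f]} f`. -/
def parAut : O k m →ₐ[Kq k] O k m :=
  scale (fun i => (-1) ^ par i) (fun j => (-1) ^ par j)

lemma parAut_x (i j : Fin (m + 1)) :
    parAut (x k i j) = (-1 : Kq k) ^ (par i + par j) • x k i j := by
  rw [parAut, scale_x]; simp [pow_add]

lemma prodFirst_par : prodFirst (fun i : Fin (m + 1) => (-1 : (Kq k)ˣ) ^ par i) = 1 := by
  simp [prodFirst, par_castSucc]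

lemma parAut_detInv : parAut (detInv k m) = detInv k m := by
  rw [parAut, scale_detInv, prodFirst_par]; simp

lemma parAut_detA : parAut (detA k m) = detA k m := by
  rw [parAut, scale_detA, prodFirst_par]; simp

lemma parAut_lastInv : parAut (lastInv k m) = lastInv k m := by
  rw [parAut, scale_lastInv]
  have : ((-1 : (Kq k)ˣ) ^ par (Fin.last m)) * (-1) ^ par (Fin.last m) = 1 := by
    rw [← pow_add, par_last]; norm_num
  rw [this]; simp

lemma barHom_detInv : barHom k m (detInv k m) =
    BarTarget.of k (Matrix.scalar (Fin 2) (detInv k m)) :=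
  (lift_mk _ _ _ _ _ _ _ _ (FreeAlgebra.ι _ Coord.detInv)).trans (by simp [liftFun])

lemma barHom_lastInv : barHom k m (lastInv k m) =
    BarTarget.of k (Matrix.scalar (Fin 2) (lastInv k m)) :=
  (lift_mk _ _ _ _ _ _ _ _ (FreeAlgebra.ι _ Coord.lastInv)).trans (by simp [liftFun])

/-- The even part of `bar f`. -/
def barEven (f : O k m) : O k m := BarTarget.mat k (barHom k m f) 0 0

/-- The odd part of `bar f`. -/
def barOdd (f : O k m) : O k m := BarTarget.mat k (barHom k m f) 0 1

lemma bar_eq (f : O k m) : bar k f = barEven f + barOdd f := rfl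

/-- The matrix recording `bar f` is determined by its even and odd parts, which have the expected
parities and are compatible with the parity automorphism. -/
lemma barHom_structure (f : O k m) :
    BarTarget.mat k (barHom k m f) = !![barEven f, barOdd f; -barOdd f, barEven f] ∧
      parAut (barEven f) = barEven f ∧ parAut (barOdd f) = -barOdd f ∧
      barEven (parAut f) = barEven f ∧ barOdd (parAut f) = -barOdd f := by
  have mk : ∀ {A : Matrix (Fin 2) (Fin 2) (O k m)} {a b c d : O k m}, A = !![a, b; c, d] →
      A 0 0 = a ∧ A 0 1 = b := by rintro A a b c d rfl; exact ⟨rfl, rfl⟩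
  induction f using O_induction with
  | h1 a =>
    have h : BarTarget.mat k (barHom k m (algebraMap (Kq k) _ a)) =
        !![algebraMap (Kq k) _ (barScalar k a), 0; -0, algebraMap (Kq k) _ (barScalar k a)] := by
      rw [AlgHom.commutes, Algebra.algebraMap_eq_smul_one, BarTarget.mat_smul]
      ext i j; fin_cases i <;> fin_cases j <;> simp [Algebra.algebraMap_eq_smul_one]
    have h0 := mk h
    simp only [barEven, barOdd, h0.1, h0.2, AlgHom.commutes parAut, h, map_zero, neg_zero,
      and_self]
  | hx i j =>
    have h : BarTarget.mat k (barHom k m (x k i j)) = if par i = par j then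
        !![x k i j, 0; 0, x k i j] else !![0, x k i j; -x k i j, 0] := by
      rw [barHom, lift_x, barMat]; rfl
    have e : parAut (x k i j) = if par i = par j then x k i j else - x k i j := by
      rw [parAut_x]
      rcases par_cases i with hi | hi <;> rcases par_cases j with hj | hj <;> simp [hi, hj]
    by_cases hp : par i = par j
    · rw [if_pos hp] at h e
      have h0 := mk h
      simp [barEven, barOdd, h0.1, h0.2, h, e]
    · rw [if_neg hp] at h e
      have h0 := mk h
      simp [barEven, barOdd, h0.1, h0.2, h, e]
  | hd =>
    have h : BarTarget.mat k (barHom k m (detInv k m)) =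
        !![detInv k m, 0; -0, detInv k m] := by
      rw [barHom_detInv, BarTarget.mat_of, scalar_two, neg_zero]
    have h0 := mk h
    simp only [barEven, barOdd, h0.1, h0.2, parAut_detInv, h, map_zero, neg_zero, and_self]
  | hl =>
    have h : BarTarget.mat k (barHom k m (lastInv k m)) =
        !![lastInv k m, 0; -0, lastInv k m] := by
      rw [barHom_lastInv, BarTarget.mat_of, scalar_two, neg_zero]
    have h0 := mk h
    simp only [barEven, barOdd, h0.1, h0.2, parAut_lastInv, h, map_zero, neg_zero, and_self]
  | hmul f g hf hg =>
    obtain ⟨f1, f2, f3, f4, f5⟩ := hf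
    obtain ⟨g1, g2, g3, g4, g5⟩ := hg
    have key : ∀ f g : O k m,
        BarTarget.mat k (barHom k m f) = !![barEven f, barOdd f; -barOdd f, barEven f] →
        BarTarget.mat k (barHom k m g) = !![barEven g, barOdd g; -barOdd g, barEven g] →
        BarTarget.mat k (barHom k m (f * g)) =
          !![barEven g * barEven f - barOdd g * barOdd f,
            barEven g * barOdd f + barOdd g * barEven f;
            -(barEven g * barOdd f + barOdd g * barEven f),
            barEven g * barEven f - barOdd g * barOdd f] := by
      intro f g hf hg
      rw [map_mul, BarTarget.mat_mul, hf, hg, Matrix.mul_fin_two]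
      ext i j; fin_cases i <;> fin_cases j <;> simp <;> abel
    have h := key f g f1 g1
    have h0 := mk h
    have hmat : ∀ f : O k m,
        BarTarget.mat k (barHom k m f) = !![barEven f, barOdd f; -barOdd f, barEven f] →
        barEven (parAut f) = barEven f → barOdd (parAut f) = - barOdd f →
        BarTarget.mat k (barHom k m (parAut f)) =
        !![barEven (parAut f), barOdd (parAut f); -barOdd (parAut f), barEven (parAut f)] := by
      intro f h1 h2 h3
      -- conjugation by `diag(1, -1)` relates the two matrices
      have hD : ∀ f : O k m, BarTarget.mat k (barHom k m (parAut f)) =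
          !![1, 0; 0, -1] * BarTarget.mat k (barHom k m f) * !![1, 0; 0, -1] := by
        intro f
        have hJ : (!![1, 0; 0, -1] : Matrix (Fin 2) (Fin 2) (O k m)) * !![1, 0; 0, -1] = 1 := by
          rw [Matrix.mul_fin_two]; ext i j; fin_cases i <;> fin_cases j <;> simp
        induction f using O_induction with
        | h1 a =>
          rw [AlgHom.commutes, AlgHom.commutes, Algebra.algebraMap_eq_smul_one,
            BarTarget.mat_smul, BarTarget.mat_one, mul_smul_comm, smul_mul_assoc, mul_one, hJ]
        | hx i j =>
          have e : parAut (x k i j) = if par i = par j then x k i j else - x k i j := by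
            rw [parAut_x]
            rcases par_cases i with hi | hi <;> rcases par_cases j with hj | hj <;> simp [hi, hj]
          have h : BarTarget.mat k (barHom k m (x k i j)) = if par i = par j then
              !![x k i j, 0; 0, x k i j] else !![0, x k i j; -x k i j, 0] := by
            rw [barHom, lift_x, barMat]; rfl
          by_cases hp : par i = par j
          · rw [e, if_pos hp, h, if_pos hp, Matrix.mul_fin_two, Matrix.mul_fin_two]
            ext i j; fin_cases i <;> fin_cases j <;> simp
          · rw [e, if_neg hp, map_neg, BarTarget.mat_neg, h, if_neg hp, Matrix.mul_fin_two,
              Matrix.mul_fin_two]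
            ext i j; fin_cases i <;> fin_cases j <;> simp
        | hd =>
          rw [parAut_detInv, barHom_detInv, BarTarget.mat_of, scalar_two, Matrix.mul_fin_two,
              Matrix.mul_fin_two]
          ext i j; fin_cases i <;> fin_cases j <;> simp
        | hl =>
          rw [parAut_lastInv, barHom_lastInv, BarTarget.mat_of, scalar_two, Matrix.mul_fin_two,
              Matrix.mul_fin_two]
          ext i j; fin_cases i <;> fin_cases j <;> simp
        | hmul f g hf hg =>
          rw [map_mul, map_mul, BarTarget.mat_mul, hf, hg, map_mul, BarTarget.mat_mul]
          simp only [mul_assoc]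
          rw [← mul_assoc !![1, 0; 0, -1] !![1, 0; 0, -1], hJ, one_mul]
        | hadd f g hf hg =>
          rw [map_add, map_add, BarTarget.mat_add, hf, hg, map_add, BarTarget.mat_add, mul_add,
            add_mul]
      rw [hD, h1, h2, h3, Matrix.mul_fin_two, Matrix.mul_fin_two]
      ext i j; fin_cases i <;> fin_cases j <;> simp
    have hp := key (parAut f) (parAut g) (hmat f f1 f4 f5) (hmat g g1 g4 g5)
    rw [← map_mul] at hp
    have hp0 := mk hp
    have e1 : barEven (f * g) = _ := h0.1
    have e2 : barOdd (f * g) = _ := h0.2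
    have e3 : barEven (parAut (f * g)) = _ := hp0.1
    have e4 : barOdd (parAut (f * g)) = _ := hp0.2
    rw [e1, e2, e3, e4]
    refine ⟨h, ?_, ?_, ?_, ?_⟩
    · rw [map_sub, map_mul, map_mul, f2, f3, g2, g3, neg_mul_neg]
    · rw [map_add, map_mul, map_mul, f2, f3, g2, g3]; noncomm_ring
    · rw [f4, f5, g4, g5, neg_mul_neg]
    · rw [f4, f5, g4, g5]; noncomm_ring
  | hadd f g hf hg =>
    obtain ⟨f1, f2, f3, f4, f5⟩ := hf
    obtain ⟨g1, g2, g3, g4, g5⟩ := hg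
    have e1 : ∀ f g : O k m, barEven (f + g) = barEven f + barEven g := fun f g => by
      simp [barEven]
    have e2 : ∀ f g : O k m, barOdd (f + g) = barOdd f + barOdd g := fun f g => by
      simp [barOdd]
    rw [map_add, map_add, e1, e2, e1, e2, f4, f5, g4, g5, map_add, map_add, f2, f3, g2, g3,
      BarTarget.mat_add, f1, g1]
    refine ⟨?_, rfl, ?_, rfl, ?_⟩
    · ext i j; fin_cases i <;> fin_cases j <;> simp; abel
    · abel
    · abel

lemma bar_parAut (f : O k m) : bar k (parAut f) = parAut (bar k f) := by
  obtain ⟨_, h2, h3, h4, h5⟩ := barHom_structure f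
  rw [bar_eq, h4, h5, bar_eq, map_add, h2, h3]

/-- An element of parity `e`. -/
def IsHomog (e : ℕ) (f : O k m) : Prop := parAut f = (-1 : Kq k) ^ e • f

lemma isHomog_x (i j : Fin (m + 1)) : IsHomog (par i + par j) (x k i j) := parAut_x i j

lemma IsHomog.mul {e e' : ℕ} {f g : O k m} (hf : IsHomog e f) (hg : IsHomog e' g) :
    IsHomog (e + e') (f * g) := by
  rw [IsHomog, map_mul, hf, hg, smul_mul_smul_comm, pow_add]

lemma IsHomog.bar {e : ℕ} {f : O k m} (hf : IsHomog e f) : IsHomog e (bar k f) := by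
  rw [IsHomog, ← bar_parAut, hf, bar_smul, map_pow, map_neg, map_one]

lemma barEven_mul (f g : O k m) :
    barEven (f * g) = barEven g * barEven f - barOdd g * barOdd f := by
  have hf := (barHom_structure f).1
  have hg := (barHom_structure g).1
  rw [barEven, map_mul, BarTarget.mat_mul, hf, hg, Matrix.mul_fin_two]
  simp [sub_eq_add_neg]

lemma barOdd_mul (f g : O k m) :
    barOdd (f * g) = barEven g * barOdd f + barOdd g * barEven f := by
  have hf := (barHom_structure f).1
  have hg := (barHom_structure g).1
  rw [barOdd, map_mul, BarTarget.mat_mul, hf, hg, Matrix.mul_fin_two]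
  simp

/-- `bar (f g) = bar g · bar f` if one of the factors is even. -/
lemma bar_mul_even_right (f : O k m) {g : O k m} (hg : barOdd g = 0) :
    bar k (f * g) = bar k g * bar k f := by
  rw [bar_eq, barEven_mul, barOdd_mul, bar_eq, bar_eq, hg]; noncomm_ring

lemma bar_mul_even_left {f : O k m} (g : O k m) (hf : barOdd f = 0) :
    bar k (f * g) = bar k g * bar k f := by
  rw [bar_eq, barEven_mul, barOdd_mul, bar_eq, bar_eq, hf]; noncomm_ring

lemma bar_mul_odd_right (f : O k m) {g : O k m} (hg : barEven g = 0) :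
    bar k (f * g) = bar k g * bar k (parAut f) := by
  obtain ⟨_, -, -, h4, h5⟩ := barHom_structure f
  rw [bar_eq, barEven_mul, barOdd_mul, bar_eq, bar_eq, hg, h4, h5]; noncomm_ring

section
variable [CharZero k]

instance : CharZero (Kq k) := inferInstanceAs (CharZero (RatFunc k))

lemma two_smul_eq_zero {f : O k m} (h : (2 : Kq k) • f = 0) : f = 0 :=
  (smul_eq_zero.mp h).resolve_left two_ne_zero

lemma eq_zero_of_eq_neg {f : O k m} (h : f = -f) : f = 0 := by
  apply two_smul_eq_zero
  rw [two_smul]; nth_rewrite 2 [h]; exact add_neg_cancel f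

lemma IsHomog.barOdd_eq_zero {e : ℕ} {f : O k m} (hf : IsHomog e f) (he : Even e) :
    barOdd f = 0 := by
  obtain ⟨_, -, -, -, h5⟩ := barHom_structure f
  rw [hf, he.neg_one_pow, one_smul] at h5
  exact eq_zero_of_eq_neg h5

lemma IsHomog.barEven_eq_zero {e : ℕ} {f : O k m} (hf : IsHomog e f) (he : Odd e) :
    barEven f = 0 := by
  obtain ⟨_, -, -, h4, -⟩ := barHom_structure f
  rw [hf, he.neg_one_pow, neg_one_smul] at h4
  have : barEven (-f) = -barEven f := by simp [barEven]
  rw [this] at h4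
  exact eq_zero_of_eq_neg h4.symm

/-- `bar (f g) = (-1)^{[f][g]} bar g · bar f`. -/
lemma IsHomog.bar_mul {e e' : ℕ} {f g : O k m} (hf : IsHomog e f) (hg : IsHomog e' g) :
    QuantumGL.bar k (f * g) =
      (-1 : Kq k) ^ (e * e') • (QuantumGL.bar k g * QuantumGL.bar k f) := by
  rcases Nat.even_or_odd e' with h | h
  · rw [bar_mul_even_right _ (hg.barOdd_eq_zero h), (h.mul_left e).neg_one_pow, one_smul]
  · rw [bar_mul_odd_right _ (hg.barEven_eq_zero h), hf, bar_smul, mul_smul_comm, map_pow, map_neg,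
      map_one]
    congr 1
    rcases Nat.even_or_odd e with h' | h'
    · rw [h'.neg_one_pow, (h'.mul_right e').neg_one_pow]
    · rw [h'.neg_one_pow, (h'.mul h).neg_one_pow]

end

lemma bar_zero : bar k (0 : O k m) = 0 := by
  have := bar_smul k (0 : Kq k) (0 : O k m)
  simpa using this

lemma bar_neg (f : O k m) : bar k (-f) = -bar k f := by
  have := bar_smul k (-1 : Kq k) f
  simpa using this

lemma bar_sub (f g : O k m) : bar k (f - g) = bar k f - bar k g := by
  rw [sub_eq_add_neg, bar_add, bar_neg, sub_eq_add_neg]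

lemma bar_sum {ι : Type*} (s : Finset ι) (f : ι → O k m) :
    bar k (∑ i ∈ s, f i) = ∑ i ∈ s, bar k (f i) :=
  map_sum (⟨⟨bar k, bar_zero⟩, bar_add k⟩ : O k m →+ O k m) f s

lemma bar_one : bar k (1 : O k m) = 1 := by
  simp [bar]

end BarMul

/-! ### Ordered monomials -/

section ListProd

/-- A factor multiplied into the `i`-th term of a product comes out on the left, when all earlier terms
are `1`. -/
lemma prod_ofFn_mul_left {A : Type*} [Monoid A] : ∀ {n : ℕ} (F G : Fin n → A) (i : Fin n) (z : A),
    (∀ l < i, F l = 1) → (∀ l, l ≠ i → G l = F l) → G i = z * F i →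
    (List.ofFn G).prod = z * (List.ofFn F).prod
  | 0, _, _, i, _, _, _, _ => i.elim0
  | n + 1, F, G, i, z, h1, h2, h3 => by
    rw [List.ofFn_succ, List.ofFn_succ, List.prod_cons, List.prod_cons]
    induction i using Fin.cases with
    | zero =>
      rw [h3, mul_assoc]
      congr 4
      funext l
      exact h2 _ (Fin.succ_ne_zero l)
    | succ i =>
      rw [h2 0 (Fin.succ_ne_zero i).symm, h1 0 (Fin.succ_pos i), one_mul, one_mul]
      exact prod_ofFn_mul_left _ _ i z (fun l hl => h1 _ (Fin.succ_lt_succ_iff.mpr hl))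
        (fun l hl => h2 _ (fun e => hl (Fin.succ_injective _ e))) h3

lemma prod_ofFn_mul_right {A : Type*} [Monoid A] {n : ℕ} (F G : Fin n → A) (i : Fin n) (z : A)
    (h1 : ∀ l, i < l → F l = 1) (h2 : ∀ l, l ≠ i → G l = F l) (h3 : G i = F i * z) :
    (List.ofFn G).prod = (List.ofFn F).prod * z := by
  have h := prod_ofFn_mul_left (A := Aᵐᵒᵖ) (fun l => MulOpposite.op (F l.rev))
    (fun l => MulOpposite.op (G l.rev)) i.rev (MulOpposite.op z)
    (fun l hl => by rw [h1 _ (by rwa [← Fin.rev_lt_rev, Fin.rev_rev]), MulOpposite.op_one])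
    (fun l hl => by rw [h2 _ (fun e => hl (by rw [← e, Fin.rev_rev]))])
    (by rw [Fin.rev_rev, h3, MulOpposite.op_mul])
  have key : ∀ F : Fin n → A, (List.ofFn fun l : Fin n => MulOpposite.op (F l.rev)).prod =
      MulOpposite.op (List.ofFn F).prod := by
    intro F
    rw [MulOpposite.op_list_prod, List.map_ofFn]
    congr 1
    apply List.ext_getElem
    · simp
    · intro t h1 h2
      simp only [List.getElem_ofFn, List.getElem_reverse, Function.comp, List.length_ofFn]
      congr 2
      ext
      simp [Fin.val_rev]
      omega
  rw [key, key, ← MulOpposite.op_mul] at h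
  exact MulOpposite.op_injective h

end ListProd

section Matrices

variable {m : ℕ}

/-- The matrix unit, the exponent of the single letter `x_{ij}`. -/
abbrev unitMat (i j : Fin (m + 1)) : Mat m := Matrix.single i j 1

lemma unitMat_apply (i j s t : Fin (m + 1)) :
    unitMat i j s t = if i = s ∧ j = t then 1 else 0 := Matrix.single_apply ..

/-- All letters of `M` are lexicographically at or after `(i, j)`. -/
def LettersGE (M : Mat m) (i j : Fin (m + 1)) : Prop :=
  ∀ s t, s < i ∨ s = i ∧ t < j → M s t = 0

/-- All letters of `M` are lexicographically at or before `(i, j)`. -/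
def LettersLE (M : Mat m) (i j : Fin (m + 1)) : Prop :=
  ∀ s t, i < s ∨ s = i ∧ j < t → M s t = 0

/-- The letter of `M` which is extremal for the relation `P` is split off. -/
lemma exists_peel {P : Fin (m + 1) ×ₗ Fin (m + 1) → Fin (m + 1) ×ₗ Fin (m + 1) → Prop}
    (M : Mat m) (hM : M ≠ 0)
    (hmin : ∀ S : Finset (Fin (m + 1) ×ₗ Fin (m + 1)), S.Nonempty → ∃ a ∈ S, ∀ b ∈ S, P a b) :
    ∃ i j M', M = M' + unitMat i j ∧ ∀ s t, M s t ≠ 0 → P (toLex (i, j)) (toLex (s, t)) := by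
  classical
  have hne : (Finset.univ.filter fun a : Fin (m + 1) ×ₗ Fin (m + 1) =>
      M (ofLex a).1 (ofLex a).2 ≠ 0).Nonempty := by
    by_contra hc
    rw [Finset.not_nonempty_iff_eq_empty, Finset.filter_eq_empty_iff] at hc
    apply hM
    ext s t
    have := hc (Finset.mem_univ (toLex (s, t)))
    simpa using this
  obtain ⟨a, ha, hP⟩ := hmin _ hne
  rw [Finset.mem_filter] at ha
  refine ⟨(ofLex a).1, (ofLex a).2, M - unitMat (ofLex a).1 (ofLex a).2, ?_, fun s t h =>
    hP (toLex (s, t)) (Finset.mem_filter.mpr ⟨Finset.mem_univ _, h⟩)⟩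
  ext s t
  rw [Matrix.add_apply, Matrix.sub_apply, unitMat_apply]
  split_ifs with h
  · rw [← h.1, ← h.2]; have := ha.2; omega
  · omega

lemma exists_peel_left (M : Mat m) (hM : M ≠ 0) :
    ∃ i j M', M = M' + unitMat i j ∧ LettersGE M' i j := by
  obtain ⟨i, j, M', h, hP⟩ := exists_peel (P := fun a b => a ≤ b) M hM fun S hS =>
    ⟨S.min' hS, S.min'_mem hS, fun b hb => S.min'_le b hb⟩
  refine ⟨i, j, M', h, fun s t hst => ?_⟩
  by_contra hc
  have h0 : M s t ≠ 0 := by rw [h, Matrix.add_apply]; omega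
  have := hP s t h0
  rw [Prod.Lex.toLex_le_toLex] at this
  rcases this with h1 | ⟨h1, h2⟩ <;> rcases hst with h3 | ⟨h3, h4⟩ <;> simp at * <;> omega

lemma exists_peel_right (M : Mat m) (hM : M ≠ 0) :
    ∃ i j M', M = M' + unitMat i j ∧ LettersLE M' i j := by
  obtain ⟨i, j, M', h, hP⟩ := exists_peel (P := fun a b => b ≤ a) M hM fun S hS =>
    ⟨S.max' hS, S.max'_mem hS, fun b hb => S.le_max' b hb⟩
  refine ⟨i, j, M', h, fun s t hst => ?_⟩
  by_contra hc
  have h0 : M s t ≠ 0 := by rw [h, Matrix.add_apply]; omega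
  have := hP s t h0
  rw [Prod.Lex.toLex_le_toLex] at this
  rcases this with h1 | ⟨h1, h2⟩ <;> rcases hst with h3 | ⟨h3, h4⟩ <;> simp at * <;> omega

/-- A potential on matrices of exponents which strictly decreases along `Below`. -/
def pot (M : Mat m) : ℕ := ∑ i : Fin (m + 1), ∑ j : Fin (m + 1), M i j * ((i + 1) * (j + 1))

lemma pot_add (M N : Mat m) : pot (M + N) = pot M + pot N := by
  simp only [pot, Matrix.add_apply, add_mul, Finset.sum_add_distrib]

lemma sum_unitMat_mul (g : Fin (m + 1) → Fin (m + 1) → ℕ) (i j : Fin (m + 1)) :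
    ∑ s, ∑ t, unitMat i j s t * g s t = g i j := by
  rw [Finset.sum_eq_single i, Finset.sum_eq_single j]
  · simp
  · intro t _ ht; simp [ht.symm]
  · simp
  · intro s _ hs; simp [hs.symm]
  · simp

lemma pot_unitMat (i j : Fin (m + 1)) : pot (unitMat i j) = (i + 1) * (j + 1) :=
  sum_unitMat_mul (fun i j => ((i : ℕ) + 1) * (j + 1)) i j

lemma Step.pot_lt {M' M : Mat m} (h : Step M' M) : pot M' < pot M := by
  obtain ⟨i, s, j, t, his, hjt, -, -, e⟩ := h
  have := congrArg pot e
  simp only [pot_add] at this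
  rw [pot_unitMat, pot_unitMat, pot_unitMat, pot_unitMat] at this
  have h1 : (i : ℕ) < s := his
  have h2 : (j : ℕ) < t := hjt
  nlinarith

lemma Below.pot_lt {M' M : Mat m} (h : Below M' M) : pot M' < pot M := by
  induction h with
  | single h => exact h.pot_lt
  | tail _ h ih => exact ih.trans h.pot_lt

lemma Step.add {M' M : Mat m} (h : Step M' M) (N : Mat m) : Step (M' + N) (M + N) := by
  obtain ⟨i, s, j, t, his, hjt, h1, h2, e⟩ := h
  refine ⟨i, s, j, t, his, hjt, ?_, ?_, ?_⟩
  · rw [Matrix.add_apply]; omega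
  · rw [Matrix.add_apply]; omega
  · rw [add_right_comm M' N, add_right_comm _ N, e, add_right_comm M N, add_right_comm _ N]

lemma Below.add {M' M : Mat m} (h : Below M' M) (N : Mat m) : Below (M' + N) (M + N) := by
  induction h with
  | single h => exact Relation.TransGen.single (h.add N)
  | tail _ h ih => exact Relation.TransGen.tail ih (h.add N)

lemma Below.trans {A B C : Mat m} (h : Below A B) (h' : Below B C) : Below A C :=
  Relation.TransGen.trans h h'

/-- The elementary move, as it occurs on two letters of a monomial. -/
lemma step_units (N : Mat m) {i s j t : Fin (m + 1)} (h : i < s) (h' : j < t) :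
    Below (N + unitMat i t + unitMat s j) (N + unitMat i j + unitMat s t) := by
  refine Relation.TransGen.single ⟨i, s, j, t, h, h', ?_, ?_, ?_⟩
  · rw [Matrix.add_apply, Matrix.add_apply, unitMat_apply i j, if_pos ⟨rfl, rfl⟩]; omega
  · rw [Matrix.add_apply, unitMat_apply s t, if_pos ⟨rfl, rfl⟩]; omega
  · change N + unitMat i t + unitMat s j + unitMat i j + unitMat s t =
      N + unitMat i j + unitMat s t + unitMat i t + unitMat s j
    abel

/-- A quantity which is additive and takes the same value on both sides of a `2 × 2` move is
constant along `Below`. -/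
lemma Below.invariant {A : Type*} [CancelCommMonoid A] (w : Mat m → A)
    (hadd : ∀ M N, w (M + N) = w M * w N)
    (h : ∀ i s j t, w (unitMat i j) * w (unitMat s t) = w (unitMat i t) * w (unitMat s j))
    {T M : Mat m} (hT : Below T M) : w T = w M := by
  have step : ∀ {T M : Mat m}, Step T M → w T = w M := by
    rintro T M ⟨i, s, j, t, -, -, -, -, e⟩
    have := congrArg w e
    rw [hadd, hadd, hadd, hadd, mul_assoc, mul_assoc] at this
    change w T * (w (unitMat i j) * w (unitMat s t)) =
      w M * (w (unitMat i t) * w (unitMat s j)) at this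
    rw [h] at this
    exact mul_right_cancel this
  induction hT with
  | single h => exact step h
  | tail _ h ih => exact ih.trans (step h)

end Matrices

section Monomials

variable {k : Type u} [Field k] {m : ℕ}

lemma xMon_zero : xMon k (0 : Mat m) = 1 := by
  simp [xMon]

lemma xMon_add_left {M : Mat m} {i j : Fin (m + 1)} (h : LettersGE M i j) :
    xMon k (M + unitMat i j) = x k i j * xMon k M := by
  unfold xMon
  refine prod_ofFn_mul_left _ _ i _ (fun s hs => ?_) (fun s hs => ?_) ?_
  · have : ∀ t, M s t = 0 := fun t => h s t (Or.inl hs)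
    simp [this]
  · have : ∀ t, (M + unitMat i j) s t = M s t := fun t => by
      rw [Matrix.add_apply, unitMat_apply, if_neg (fun h => hs h.1.symm), add_zero]
    simp only [this]
  · refine prod_ofFn_mul_left _ _ j _ (fun t ht => ?_) (fun t ht => ?_) ?_
    · rw [h i t (Or.inr ⟨rfl, ht⟩), pow_zero]
    · rw [Matrix.add_apply, unitMat_apply, if_neg (fun h => ht h.2.symm), add_zero]
    · rw [Matrix.add_apply, unitMat_apply, if_pos ⟨rfl, rfl⟩, pow_succ']

lemma xMon_add_right {M : Mat m} {i j : Fin (m + 1)} (h : LettersLE M i j) :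
    xMon k (M + unitMat i j) = xMon k M * x k i j := by
  unfold xMon
  refine prod_ofFn_mul_right _ _ i _ (fun s hs => ?_) (fun s hs => ?_) ?_
  · have : ∀ t, M s t = 0 := fun t => h s t (Or.inl hs)
    simp [this]
  · have : ∀ t, (M + unitMat i j) s t = M s t := fun t => by
      rw [Matrix.add_apply, unitMat_apply, if_neg (fun h => hs h.1.symm), add_zero]
    simp only [this]
  · refine prod_ofFn_mul_right _ _ j _ (fun t ht => ?_) (fun t ht => ?_) ?_
    · rw [h i t (Or.inr ⟨rfl, ht⟩), pow_zero]
    · rw [Matrix.add_apply, unitMat_apply, if_neg (fun h => ht h.2.symm), add_zero]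
    · rw [Matrix.add_apply, unitMat_apply, if_pos ⟨rfl, rfl⟩, pow_succ]

lemma lettersGE_zero (i j : Fin (m + 1)) : LettersGE (0 : Mat m) i j := fun _ _ _ => rfl

lemma xMon_unitMat (i j : Fin (m + 1)) : xMon k (unitMat i j) = x k i j := by
  have := xMon_add_left (k := k) (lettersGE_zero i j)
  rwa [zero_add, xMon_zero, mul_one] at this

lemma pot_lt_add_unitMat (M : Mat m) (i j : Fin (m + 1)) : pot M < pot (M + unitMat i j) := by
  rw [pot_add, pot_unitMat]
  have : 0 < ((i : ℕ) + 1) * (j + 1) := by positivity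
  omega

/-- Induction on ordered monomials by removing the first letter. -/
lemma peel_left_induction {P : Mat m → Prop} (h0 : P 0)
    (h : ∀ M i j, LettersGE M i j → P M → P (M + unitMat i j)) (M : Mat m) : P M := by
  induction hn : pot M using Nat.strong_induction_on generalizing M with
  | _ n ih =>
    by_cases hM : M = 0
    · rw [hM]; exact h0
    · obtain ⟨i, j, M', rfl, hl⟩ := exists_peel_left M hM
      exact h M' i j hl (ih _ (hn ▸ pot_lt_add_unitMat M' i j) M' rfl)

/-- Induction on ordered monomials by removing the last letter. -/
lemma peel_right_induction {P : Mat m → Prop} (h0 : P 0)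
    (h : ∀ M i j, LettersLE M i j → P M → P (M + unitMat i j)) (M : Mat m) : P M := by
  induction hn : pot M using Nat.strong_induction_on generalizing M with
  | _ n ih =>
    by_cases hM : M = 0
    · rw [hM]; exact h0
    · obtain ⟨i, j, M', rfl, hl⟩ := exists_peel_right M hM
      exact h M' i j hl (ih _ (hn ▸ pot_lt_add_unitMat M' i j) M' rfl)

/-- The product of the `g i j ^ M i j`. -/
def wtProd {A : Type*} [CommMonoid A] (g : Fin (m + 1) → Fin (m + 1) → A) (M : Mat m) : A :=
  ∏ i, ∏ j, g i j ^ M i j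

lemma wtProd_add {A : Type*} [CommMonoid A] (g : Fin (m + 1) → Fin (m + 1) → A) (M N : Mat m) :
    wtProd g (M + N) = wtProd g M * wtProd g N := by
  simp only [wtProd, Matrix.add_apply, pow_add, Finset.prod_mul_distrib]

lemma wtProd_zero {A : Type*} [CommMonoid A] (g : Fin (m + 1) → Fin (m + 1) → A) :
    wtProd g (0 : Mat m) = 1 := by
  simp [wtProd]

lemma wtProd_unitMat {A : Type*} [CommMonoid A] (g : Fin (m + 1) → Fin (m + 1) → A)
    (i j : Fin (m + 1)) : wtProd g (unitMat i j) = g i j := by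
  unfold wtProd
  rw [Finset.prod_eq_single i, Finset.prod_eq_single j]
  · simp
  · intro t _ ht; simp [ht.symm]
  · simp
  · intro s _ hs; simp [hs.symm]
  · simp

lemma wtProd_congr {A : Type*} [CommMonoid A] {g g' : Fin (m + 1) → Fin (m + 1) → A} {M : Mat m}
    (h : ∀ i j, M i j ≠ 0 → g i j = g' i j) : wtProd g M = wtProd g' M := by
  refine Finset.prod_congr rfl fun i _ => Finset.prod_congr rfl fun j _ => ?_
  by_cases h0 : M i j = 0
  · rw [h0, pow_zero, pow_zero]
  · rw [h i j h0]

lemma wtProd_one {A : Type*} [CommMonoid A] (M : Mat m) :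
    wtProd (fun _ _ => (1 : A)) M = 1 := by simp [wtProd]

lemma wtProd_mul {A : Type*} [CommMonoid A] (g g' : Fin (m + 1) → Fin (m + 1) → A) (M : Mat m) :
    wtProd (fun i j => g i j * g' i j) M = wtProd g M * wtProd g' M := by
  simp only [wtProd, mul_pow, Finset.prod_mul_distrib]

/-- The weight of a monomial under the torus automorphism `scale r c`. -/
def wt (r c : Fin (m + 1) → (Kq k)ˣ) (M : Mat m) : (Kq k)ˣ := wtProd (fun i j => r i * c j) M

lemma scale_xMon (r c : Fin (m + 1) → (Kq k)ˣ) (M : Mat m) :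
    scale r c (xMon k M) = (wt r c M : Kq k) • xMon k M := by
  induction M using peel_left_induction with
  | h0 => rw [xMon_zero, map_one, wt, wtProd_zero, Units.val_one, one_smul]
  | h M i j hl ih =>
    rw [xMon_add_left hl, map_mul, scale_x, ih, smul_mul_smul_comm, wt, wt, wtProd_add,
      wtProd_unitMat, mul_comm, ← Units.val_mul]

lemma wt_add (r c : Fin (m + 1) → (Kq k)ˣ) (M N : Mat m) : wt r c (M + N) = wt r c M * wt r c N :=
  wtProd_add _ _ _

lemma wt_unitMat (r c : Fin (m + 1) → (Kq k)ˣ) (i j : Fin (m + 1)) :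
    wt r c (unitMat i j) = r i * c j := wtProd_unitMat _ _ _

/-- Moves preserve the weights of the torus. -/
lemma wt_below (r c : Fin (m + 1) → (Kq k)ˣ) {T M : Mat m} (h : Below T M) :
    wt r c T = wt r c M :=
  h.invariant (wt r c) (wt_add r c) fun i s j t => by
    simp only [wt_unitMat]
    rw [mul_mul_mul_comm, mul_comm (c j), mul_mul_mul_comm]

end Monomials

section Straightening

variable {k : Type u} [Field k] {m : ℕ}

lemma sgn_mem_ZQ (i j s t : Fin (m + 1)) : sgn k i j s t ∈ ZQ k := neg_one_pow_mem_ZQ _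

lemma sgn_mul_self (i j s t : Fin (m + 1)) : sgn k i j s t * sgn k i j s t = 1 := by
  rw [sgn, ← mul_pow]; simp

lemma sgn_ne_zero (i j s t : Fin (m + 1)) : sgn k i j s t ≠ 0 := fun h => by
  have := sgn_mul_self (k := k) i j s t
  rw [h, mul_zero] at this
  exact zero_ne_one this

lemma sgn_inv (i j s t : Fin (m + 1)) : (sgn k i j s t)⁻¹ = sgn k i j s t :=
  inv_eq_of_mul_eq_one_left (sgn_mul_self _ _ _ _)

lemma qq_ne_zero (i : Fin (m + 1)) : qq k i ≠ 0 := zpow_ne_zero _ (q_ne_zero k)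

lemma qq_mem_ZQ (i : Fin (m + 1)) : qq k i ∈ ZQ k := q_zpow_mem_ZQ _

lemma qq_inv_mem_ZQ (i : Fin (m + 1)) : (qq k i)⁻¹ ∈ ZQ k := by
  rw [qq, ← zpow_neg]; exact q_zpow_mem_ZQ _

/-- The leading coefficient when `x_{st}` is moved to the right past the smaller letter
`x_{ij}`. -/
def passCoef (k : Type u) [Field k] {m : ℕ} (s t i j : Fin (m + 1)) : Kq k :=
  sgn k i j s t * (if i = s then (qq k i)⁻¹ else if j = t then (qq k j)⁻¹ else 1)

lemma passCoef_mem (s t i j : Fin (m + 1)) : passCoef k s t i j ∈ ZQ k := by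
  unfold passCoef
  refine mul_mem (sgn_mem_ZQ _ _ _ _) ?_
  split_ifs
  · exact qq_inv_mem_ZQ _
  · exact qq_inv_mem_ZQ _
  · exact one_mem _

lemma passCoef_inv_mem (s t i j : Fin (m + 1)) : (passCoef k s t i j)⁻¹ ∈ ZQ k := by
  unfold passCoef
  rw [mul_inv, sgn_inv]
  refine mul_mem (sgn_mem_ZQ _ _ _ _) ?_
  split_ifs
  · rw [inv_inv]; exact qq_mem_ZQ _
  · rw [inv_inv]; exact qq_mem_ZQ _
  · rw [inv_one]; exact one_mem _

lemma passCoef_ne_zero (s t i j : Fin (m + 1)) : passCoef k s t i j ≠ 0 := by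
  unfold passCoef
  refine mul_ne_zero (sgn_ne_zero _ _ _ _) ?_
  split_ifs
  · exact inv_ne_zero (qq_ne_zero _)
  · exact inv_ne_zero (qq_ne_zero _)
  · exact one_ne_zero

/-- Straightening of two letters. -/
lemma exchange {i j s t : Fin (m + 1)} (h : i < s ∨ i = s ∧ j < t) : ∃ μ ∈ ZQ k,
    x k s t * x k i j = passCoef k s t i j • (x k i j * x k s t) +
      if i < s ∧ j < t then μ • (x k i t * x k s j) else 0 := by
  have H := isQSuperMatrix_x k (m := m)
  have key : ∀ {c : Kq k} {u v : O k m}, c ≠ 0 → u = c • v → v = c⁻¹ • u := by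
    rintro c u v hc rfl; rw [smul_smul, inv_mul_cancel₀ hc, one_smul]
  rcases h with h | ⟨rfl, h⟩
  · rcases lt_trichotomy j t with h' | rfl | h'
    · refine ⟨-(sgn k i j s t * ((-1) ^ (par s * par j + par s * par t + par j * par t) *
        (q k ^ 2 - (q k ^ 2)⁻¹))), neg_mem (mul_mem (sgn_mem_ZQ _ _ _ _)
          (mul_mem (neg_one_pow_mem_ZQ _)
          (sub_mem (q_pow_mem_ZQ _) (q_pow_inv_mem_ZQ _)))), ?_⟩
      rw [H.diag i s j t h h', if_pos ⟨h, h'⟩, passCoef, if_neg h.ne, if_neg h'.ne, mul_one,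
        smul_add, smul_smul, sgn_mul_self, one_smul, smul_smul, neg_smul]
      abel
    · refine ⟨0, zero_mem _, ?_⟩
      rw [passCoef, if_neg h.ne, if_pos rfl, if_neg (fun h => lt_irrefl _ h.2), add_zero]
      have := key (mul_ne_zero (sgn_ne_zero _ _ _ _) (qq_ne_zero _)) (H.col i s j h)
      rw [mul_inv, sgn_inv] at this
      exact this
    · refine ⟨0, zero_mem _, ?_⟩
      rw [passCoef, if_neg h.ne, if_neg h'.ne', if_neg (fun h => lt_asymm h'  h.2), add_zero,
        mul_one, ← sgn_inv]
      exact key (sgn_ne_zero _ _ _ _) (H.anti i s j t h h')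
  · refine ⟨0, zero_mem _, ?_⟩
    rw [passCoef, if_pos rfl, if_neg (fun h => lt_irrefl _ h.1), add_zero]
    have := key (mul_ne_zero (sgn_ne_zero _ _ _ _) (qq_ne_zero _)) (H.row i j t h)
    rw [mul_inv, sgn_inv] at this
    exact this

variable (k) in
/-- The `ℤ[q, q⁻¹]`-span of the monomials below `M`. -/
def Low (M : Mat m) : Submodule (ZQ k) (O k m) :=
  Submodule.span (ZQ k) (xMon k '' {T | Below T M})

variable (k) in
/-- The `ℤ[q, q⁻¹]`-span of `x^M` and the monomials below `M`. -/
def LowEq (M : Mat m) : Submodule (ZQ k) (O k m) :=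
  Submodule.span (ZQ k) (xMon k '' {T | T = M ∨ Below T M})

lemma smul_mem_of_ZQ {S : Submodule (ZQ k) (O k m)} {c : Kq k} (hc : c ∈ ZQ k) {f : O k m}
    (hf : f ∈ S) : c • f ∈ S := S.smul_mem ⟨c, hc⟩ hf

lemma Low_le_LowEq (M : Mat m) : Low k M ≤ LowEq k M :=
  Submodule.span_mono (Set.image_mono fun _ h => Or.inr h)

lemma xMon_mem_LowEq (M : Mat m) : xMon k M ∈ LowEq k M :=
  Submodule.subset_span ⟨M, Or.inl rfl, rfl⟩

lemma LowEq_le_Low {T M : Mat m} (h : Below T M) : LowEq k T ≤ Low k M := by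
  refine Submodule.span_mono (Set.image_mono ?_)
  rintro S (rfl | hS)
  · exact h
  · exact hS.trans h

lemma mem_LowEq_of_sub {M : Mat m} {c : Kq k} (hc : c ∈ ZQ k) {f : O k m}
    (h : f - c • xMon k M ∈ Low k M) : f ∈ LowEq k M := by
  have := add_mem (Low_le_LowEq M h) (smul_mem_of_ZQ hc (xMon_mem_LowEq M))
  rwa [sub_add_cancel] at this

/-- The leading coefficient when `x_{st}` is moved to its place in the monomial `x^M`. -/
def passProd (k : Type u) [Field k] {m : ℕ} (s t : Fin (m + 1)) (M : Mat m) : Kq k :=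
  wtProd (fun i j => if i < s ∨ i = s ∧ j < t then passCoef k s t i j else 1) M

lemma wtProd_mem {g : Fin (m + 1) → Fin (m + 1) → Kq k} (hg : ∀ i j, g i j ∈ ZQ k) (M : Mat m) :
    wtProd g M ∈ ZQ k :=
  prod_mem fun _ _ => prod_mem fun _ _ => pow_mem (hg _ _) _

lemma passProd_mem (s t : Fin (m + 1)) (M : Mat m) : passProd k s t M ∈ ZQ k :=
  wtProd_mem (fun i j => by split_ifs; exacts [passCoef_mem _ _ _ _, one_mem _]) M

lemma passProd_inv_mem (s t : Fin (m + 1)) (M : Mat m) : (passProd k s t M)⁻¹ ∈ ZQ k := by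
  simp only [passProd, wtProd, ← Finset.prod_inv_distrib, ← inv_pow]
  refine prod_mem fun _ _ => prod_mem fun _ _ => pow_mem ?_ _
  split_ifs
  · exact passCoef_inv_mem _ _ _ _
  · rw [inv_one]; exact one_mem _

lemma passProd_ne_zero (s t : Fin (m + 1)) (M : Mat m) : passProd k s t M ≠ 0 := by
  simp only [passProd, wtProd]
  refine Finset.prod_ne_zero_iff.mpr fun _ _ => Finset.prod_ne_zero_iff.mpr fun _ _ =>
    pow_ne_zero _ ?_
  split_ifs
  · exact passCoef_ne_zero _ _ _ _
  · exact one_ne_zero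

lemma passProd_of_lettersGE {M : Mat m} {s t : Fin (m + 1)} (h : LettersGE M s t) :
    passProd k s t M = 1 := by
  rw [passProd]
  refine Eq.trans (wtProd_congr (g' := fun _ _ => 1) ?_) (wtProd_one M)
  exact fun i j hij => if_neg fun hlt => hij (h i j hlt)

/-- Multiplication of an ordered monomial by a letter: up to lower monomials, the letter moves to its
place. The induction also straightens the lower terms `x_{it} x_{sj}` of the relation `exchange`,
which have smaller potential. -/
lemma letter_mul (s t : Fin (m + 1)) (M : Mat m) :
    x k s t * xMon k M - passProd k s t M • xMon k (M + unitMat s t) ∈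
      Low k (M + unitMat s t) := by
  induction hn : pot (M + unitMat s t) using Nat.strong_induction_on generalizing M s t with
  | _ n ih =>
  subst hn
  -- the induction hypothesis, applied to all monomials below a given one
  have hlow : ∀ (i j : Fin (m + 1)) (N : Mat m),
      pot (N + unitMat i j) ≤ pot (M + unitMat s t) → ∀ f ∈ Low k N,
      x k i j * f ∈ Low k (N + unitMat i j) := by
    intro i j N hN f hf
    induction hf using Submodule.span_induction with
    | mem f hf =>
      obtain ⟨T, hT, rfl⟩ := hf
      have h1 := (hT.add (unitMat i j)).pot_lt
      exact LowEq_le_Low (hT.add _)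
        (mem_LowEq_of_sub (passProd_mem _ _ _) (ih _ (h1.trans_le hN) i j T rfl))
    | zero => rw [mul_zero]; exact zero_mem _
    | add f g _ _ hf hg => rw [mul_add]; exact add_mem hf hg
    | smul c f _ hf => rw [mul_smul_comm]; exact Submodule.smul_mem _ _ hf
  by_cases hG : LettersGE M s t
  · rw [xMon_add_left hG, passProd_of_lettersGE hG, one_smul, sub_self]
    exact zero_mem _
  have hM : M ≠ 0 := by rintro rfl; exact hG (lettersGE_zero _ _)
  obtain ⟨i, j, M', rfl, hl⟩ := exists_peel_left M hM
  have hlt : i < s ∨ i = s ∧ j < t := by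
    by_contra hcon
    apply hG
    intro a b hab
    rw [Matrix.add_apply, hl a b (by omega), unitMat_apply, if_neg (by rintro ⟨rfl, rfl⟩; omega)]
  obtain ⟨μ, hμ, hex⟩ := exchange (k := k) hlt
  have e1 : M' + unitMat i j + unitMat s t = M' + unitMat s t + unitMat i j := add_right_comm _ _ _
  have hl' : LettersGE (M' + unitMat s t) i j := by
    intro a b hab
    rw [Matrix.add_apply, hl a b hab, unitMat_apply, if_neg (by rintro ⟨rfl, rfl⟩; omega)]
  have hp : passProd k s t (M' + unitMat i j) = passProd k s t M' * passCoef k s t i j := by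
    rw [passProd, wtProd_add, wtProd_unitMat, if_pos hlt]; rfl
  have hlt1 : pot (M' + unitMat s t) < pot (M' + unitMat i j + unitMat s t) := by
    rw [e1]; exact pot_lt_add_unitMat _ _ _
  have h1 := ih _ hlt1 s t M' rfl
  have h2 := hlow i j (M' + unitMat s t) (by rw [e1]) _ h1
  have e2 : x k s t * xMon k (M' + unitMat i j) -
      passProd k s t (M' + unitMat i j) • xMon k (M' + unitMat i j + unitMat s t) =
      passCoef k s t i j • (x k i j * (x k s t * xMon k M' -
        passProd k s t M' • xMon k (M' + unitMat s t))) +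
      (if i < s ∧ j < t then μ • (x k i t * x k s j) else 0) * xMon k M' := by
    rw [e1, xMon_add_left hl', xMon_add_left hl, ← mul_assoc, hex, hp, add_mul, smul_mul_assoc,
      mul_sub, mul_smul_comm, smul_sub, smul_smul, mul_assoc, mul_comm (passProd k s t M')]
    abel
  rw [e2]
  refine add_mem (smul_mem_of_ZQ (passCoef_mem _ _ _ _) (e1 ▸ h2)) ?_
  split_ifs with hd
  · have hb := step_units M' hd.1 hd.2
    have e3 : M' + unitMat i t + unitMat s j = M' + unitMat s j + unitMat i t :=
      add_right_comm _ _ _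
    rw [e3] at hb
    have hb' := hb.pot_lt
    have h3 := ih _ ((pot_lt_add_unitMat _ i t).trans hb') s j M' rfl
    have h4 := hlow i t (M' + unitMat s j) hb'.le _ h3
    have h5 := ih _ hb' i t (M' + unitMat s j) rfl
    rw [smul_mul_assoc, mul_assoc]
    refine smul_mem_of_ZQ hμ (LowEq_le_Low hb ?_)
    have e4 : x k i t * (x k s j * xMon k M') = x k i t * (x k s j * xMon k M' -
        passProd k s j M' • xMon k (M' + unitMat s j)) +
        passProd k s j M' • (x k i t * xMon k (M' + unitMat s j)) := by
      rw [mul_sub, mul_smul_comm, sub_add_cancel]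
    rw [e4]
    exact add_mem (Low_le_LowEq _ h4) (smul_mem_of_ZQ (passProd_mem _ _ _)
      (mem_LowEq_of_sub (passProd_mem _ _ _) h5))
  · rw [zero_mul]; exact zero_mem _

lemma letter_mul_Low (s t : Fin (m + 1)) {M : Mat m} {f : O k m} (hf : f ∈ Low k M) :
    x k s t * f ∈ Low k (M + unitMat s t) := by
  induction hf using Submodule.span_induction with
  | mem f hf =>
    obtain ⟨T, hT, rfl⟩ := hf
    exact LowEq_le_Low (hT.add _) (mem_LowEq_of_sub (passProd_mem _ _ _) (letter_mul s t T))
  | zero => rw [mul_zero]; exact zero_mem _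
  | add f g _ _ hf hg => rw [mul_add]; exact add_mem hf hg
  | smul c f _ hf => rw [mul_smul_comm]; exact Submodule.smul_mem _ _ hf

/-- `f` has leading monomial `x^M`: it is a unit of `ℤ[q, q⁻¹]` times `x^M` plus a combination of
monomials below `M`. -/
def HasLead (f : O k m) (M : Mat m) : Prop :=
  ∃ c ∈ ZQ k, c⁻¹ ∈ ZQ k ∧ c ≠ 0 ∧ f - c • xMon k M ∈ Low k M

lemma HasLead.mem_LowEq {f : O k m} {M : Mat m} (h : HasLead f M) : f ∈ LowEq k M := by
  obtain ⟨c, hc, -, -, h⟩ := h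
  exact mem_LowEq_of_sub hc h

lemma hasLead_xMon (M : Mat m) : HasLead (xMon k M) M :=
  ⟨1, one_mem _, by rw [inv_one]; exact one_mem _, one_ne_zero, by
    rw [one_smul, sub_self]; exact zero_mem _⟩

lemma HasLead.letter_mul {f : O k m} {M : Mat m} (h : HasLead f M) (s t : Fin (m + 1)) :
    HasLead (x k s t * f) (M + unitMat s t) := by
  obtain ⟨c, hc, hc', h0, h⟩ := h
  refine ⟨c * passProd k s t M, mul_mem hc (passProd_mem _ _ _), ?_,
    mul_ne_zero h0 (passProd_ne_zero _ _ _), ?_⟩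
  · rw [mul_inv]; exact mul_mem hc' (passProd_inv_mem _ _ _)
  · have e : x k s t * f - (c * passProd k s t M) • xMon k (M + unitMat s t) =
        x k s t * (f - c • xMon k M) +
        c • (x k s t * xMon k M - passProd k s t M • xMon k (M + unitMat s t)) := by
      rw [mul_sub, mul_smul_comm, smul_sub, smul_smul]; abel
    rw [e]
    exact add_mem (letter_mul_Low s t h) (smul_mem_of_ZQ hc (QuantumGL.letter_mul s t M))

lemma xMon_mul_hasLead (M : Mat m) {f : O k m} {N : Mat m} (h : HasLead f N) :
    HasLead (xMon k M * f) (M + N) := by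
  induction M using peel_left_induction with
  | h0 => rwa [xMon_zero, one_mul, zero_add]
  | h M i j hl ih =>
    rw [xMon_add_left hl, mul_assoc, add_right_comm]
    exact ih.letter_mul i j

/-- Leading monomials are multiplicative. -/
lemma HasLead.mul {f g : O k m} {M N : Mat m} (hf : HasLead f M) (hg : HasLead g N) :
    HasLead (f * g) (M + N) := by
  obtain ⟨c, hc, hc', h0, h⟩ := hf
  obtain ⟨d, hd, hd', hd0, h'⟩ := xMon_mul_hasLead M hg
  refine ⟨c * d, mul_mem hc hd, by rw [mul_inv]; exact mul_mem hc' hd', mul_ne_zero h0 hd0, ?_⟩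
  have key : ∀ r ∈ Low k M, r * g ∈ Low k (M + N) := by
    intro r hr
    induction hr using Submodule.span_induction with
    | mem f hf =>
      obtain ⟨T, hT, rfl⟩ := hf
      exact LowEq_le_Low (hT.add _) (xMon_mul_hasLead T hg).mem_LowEq
    | zero => rw [zero_mul]; exact zero_mem _
    | add f g _ _ hf hg => rw [add_mul]; exact add_mem hf hg
    | smul c f _ hf => rw [smul_mul_assoc]; exact Submodule.smul_mem _ _ hf
  have e : f * g - (c * d) • xMon k (M + N) =
      (f - c • xMon k M) * g + c • (xMon k M * g - d • xMon k (M + N)) := by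
    rw [sub_mul, smul_mul_assoc, smul_sub, smul_smul]; abel
  rw [e]
  exact add_mem (key _ h) (smul_mem_of_ZQ hc h')

lemma HasLead.smul {f : O k m} {M : Mat m} (h : HasLead f M) {c : Kq k} (hc : c ∈ ZQ k)
    (hc' : c⁻¹ ∈ ZQ k) (h0 : c ≠ 0) : HasLead (c • f) M := by
  obtain ⟨d, hd, hd', hd0, h⟩ := h
  refine ⟨c * d, mul_mem hc hd, by rw [mul_inv]; exact mul_mem hc' hd', mul_ne_zero h0 hd0, ?_⟩
  rw [mul_smul, ← smul_sub]
  exact smul_mem_of_ZQ hc h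

lemma HasLead.add_low {f g : O k m} {M : Mat m} (h : HasLead f M) (hg : g ∈ Low k M) :
    HasLead (f + g) M := by
  obtain ⟨d, hd, hd', hd0, h⟩ := h
  refine ⟨d, hd, hd', hd0, ?_⟩
  rw [add_sub_right_comm]
  exact add_mem h hg

end Straightening

/-! ### The normalizing exponent and the bar involution on monomials -/

section NormExp

variable {m : ℕ}

/-- The sum of the products of two distinct entries of a vector. -/
def pairSum {n : ℕ} (v : Fin n → ℤ) : ℤ := ∑ j, ∑ l, if j < l then v j * v l else 0

lemma pairSum_add_single {n : ℕ} (v : Fin n → ℤ) (c : Fin n) :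
    pairSum (fun l => v l + if l = c then 1 else 0) =
      pairSum v + ∑ l, if l = c then 0 else v l := by
  have h1 : ∀ j l : Fin n, (if j < l then
      (v j + if j = c then 1 else 0) * (v l + if l = c then 1 else 0) else 0) =
      (if j < l then v j * v l else 0) + (if j = c then (if c < l then v l else 0) else 0) +
        (if l = c then (if j < c then v j else 0) else 0) := by
    intro j l
    by_cases hj : j = c <;> by_cases hl : l = c
    · subst hj; subst hl; simp
    · subst hj; by_cases h : j < l <;> simp [hl, h]; ring
    · subst hl; by_cases h : j < l <;> simp [hj, h]; ring
    · simp [hj, hl]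
  have h2 : ∀ l : Fin n, (if l = c then 0 else v l) =
      (if c < l then v l else 0) + (if l < c then v l else 0) := by
    intro l
    rcases lt_trichotomy l c with h | rfl | h
    · simp [h, h.ne, h.le]
    · simp
    · simp [h, h.ne', h.le]
  simp only [pairSum, h1, h2, Finset.sum_add_distrib]
  rw [add_assoc]
  congr 2
  · rw [Finset.sum_comm]
    exact Finset.sum_congr rfl fun l _ => by rw [Finset.sum_ite_eq' Finset.univ c]; simp
  · exact Finset.sum_congr rfl fun l _ => by rw [Finset.sum_ite_eq' Finset.univ c]; simp

lemma normExp_eq (M : Mat m) : normExp M =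
    -(∑ i, (-1 : ℤ) ^ par i * pairSum fun j => (M i j : ℤ)) -
      ∑ l, (-1 : ℤ) ^ par l * pairSum fun s => (M s l : ℤ) := by
  simp only [normExp, pairSum, Finset.mul_sum, mul_ite, mul_zero, Nat.cast_mul]

lemma normExp_zero : normExp (0 : Mat m) = 0 := by
  simp [normExp]

/-- The change of the normalizing exponent when a letter is added: the added letter is paired with the
other letters of its row and of its column. -/
lemma normExp_add_unitMat (M : Mat m) (s t : Fin (m + 1)) :
    normExp (M + unitMat s t) = normExp M -
      (-1 : ℤ) ^ par s * (∑ l, if l = t then 0 else (M s l : ℤ)) -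
      (-1 : ℤ) ^ par t * (∑ i, if i = s then 0 else (M i t : ℤ)) := by
  have hr : ∀ i, (pairSum fun j => ((M + unitMat s t) i j : ℤ)) =
      (pairSum fun j => (M i j : ℤ)) + if i = s then (∑ l, if l = t then 0 else (M s l : ℤ))
        else 0 := by
    intro i
    by_cases hi : i = s
    · subst hi
      rw [if_pos rfl, ← pairSum_add_single]
      congr 1
      funext j
      rw [Matrix.add_apply, unitMat_apply]
      by_cases hj : j = t
      · simp [hj]
      · simp [hj, Ne.symm hj]
    · rw [if_neg hi, add_zero]
      congr 1
      funext j
      rw [Matrix.add_apply, unitMat_apply, if_neg fun h => hi h.1.symm, add_zero]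
  have hc : ∀ j, (pairSum fun i => ((M + unitMat s t) i j : ℤ)) =
      (pairSum fun i => (M i j : ℤ)) + if j = t then (∑ i, if i = s then 0 else (M i t : ℤ))
        else 0 := by
    intro j
    by_cases hj : j = t
    · subst hj
      rw [if_pos rfl, ← pairSum_add_single]
      congr 1
      funext i
      rw [Matrix.add_apply, unitMat_apply]
      by_cases hi : i = s
      · simp [hi]
      · simp [hi, Ne.symm hi]
    · rw [if_neg hj, add_zero]
      congr 1
      funext i
      rw [Matrix.add_apply, unitMat_apply, if_neg fun h => hj h.2.symm, add_zero]
  rw [normExp_eq, normExp_eq]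
  simp only [hr, hc, mul_add, Finset.sum_add_distrib, mul_ite, mul_zero, Finset.sum_ite_eq',
    Finset.mem_univ, if_true]
  ring

lemma Admissible.of_add {M N : Mat m} (h : Admissible (M + N)) : Admissible M := fun i j hp =>
  (Nat.le_add_right _ _).trans (by simpa using h i j hp)

/-- The number of odd letters. -/
def oddDeg (M : Mat m) : ℕ := ∑ i, ∑ j, M i j * (par i + par j)

lemma oddDeg_add (M N : Mat m) : oddDeg (M + N) = oddDeg M + oddDeg N := by
  simp only [oddDeg, Matrix.add_apply, add_mul, Finset.sum_add_distrib]

lemma oddDeg_unitMat (i j : Fin (m + 1)) : oddDeg (unitMat i j) = par i + par j :=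
  sum_unitMat_mul (fun i j => par i + par j) i j

end NormExp

section BarMonomials

variable {k : Type u} [Field k] {m : ℕ}

lemma isHomog_xMon (M : Mat m) : IsHomog (oddDeg M) (xMon k M) := by
  induction M using peel_left_induction with
  | h0 => simp [IsHomog, oddDeg, xMon_zero]
  | h M i j hl ih =>
    rw [xMon_add_left hl, oddDeg_add, oddDeg_unitMat, add_comm]
    exact (isHomog_x i j).mul ih

lemma oddDeg_below {T M : Mat m} (h : Below T M) : oddDeg T = oddDeg M :=
  Multiplicative.ofAdd.injective
  (h.invariant (fun M => Multiplicative.ofAdd (oddDeg M)) (fun M N => by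
    rw [oddDeg_add, ofAdd_add]) fun i s j t => by
      simp only [oddDeg_unitMat, ← ofAdd_add]; congr 1; omega)

lemma xMon_eq_zero {M : Mat m} (h : ¬ Admissible M) : xMon k M = 0 := by
  simp only [Admissible, not_forall, not_le] at h
  obtain ⟨i, j, hp, hM⟩ := h
  have hx : x k i j ^ M i j = 0 := by
    obtain ⟨r, hr⟩ : ∃ r, M i j = 2 + r := ⟨M i j - 2, by omega⟩
    rw [hr, pow_add, pow_two, (isQSuperMatrix_x k).odd_sq i j hp, zero_mul]
  refine List.prod_eq_zero (List.mem_ofFn.mpr ⟨i, ?_⟩)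
  exact List.prod_eq_zero (List.mem_ofFn.mpr ⟨j, hx⟩)

lemma xNorm_eq_zero {M : Mat m} (h : ¬ Admissible M) : xNorm k M = 0 := by
  rw [xNorm, xMon_eq_zero h, smul_zero]

lemma wtProd_zpow (e : Fin (m + 1) → Fin (m + 1) → ℤ) (M : Mat m) :
    wtProd (fun i j => q k ^ e i j) M = q k ^ ∑ i, ∑ j, e i j * M i j := by
  have hz : ∀ {ι : Type} (S : Finset ι) (f : ι → ℤ),
      ∏ i ∈ S, q k ^ f i = q k ^ ∑ i ∈ S, f i := by
    intro ι S f
    classical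
    induction S using Finset.induction_on with
    | empty => simp
    | insert a S ha ih =>
      rw [Finset.prod_insert ha, Finset.sum_insert ha, zpow_add₀ (q_ne_zero k), ih]
  simp only [wtProd, ← zpow_natCast, ← zpow_mul, hz]

/-- Moving a letter from the left to the end of an ordered monomial, as the bar involution requires,
produces exactly the power of `q` which is compensated by the normalization of `x(M)`. -/
lemma sign_mul_passProd {M : Mat m} {s t : Fin (m + 1)} (hM : Admissible (M + unitMat s t))
    (hl : LettersLE M s t) :
    (-1 : Kq k) ^ (oddDeg M * (par s + par t)) * passProd k s t M =
      q k ^ (2 * (normExp (M + unitMat s t) - normExp M)) := by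
  have h1 : (-1 : Kq k) ^ (oddDeg M * (par s + par t)) = wtProd (fun i j => sgn k i j s t) M := by
    simp only [wtProd, sgn, ← pow_mul, Finset.prod_pow_eq_pow_sum, oddDeg, Finset.sum_mul]
    congr 1
    exact Finset.sum_congr rfl fun i _ => Finset.sum_congr rfl fun j _ => by ring
  let e : Fin (m + 1) → Fin (m + 1) → ℤ := fun i j =>
    (if i = s then (if j = t then 0 else -2 * (-1) ^ par s) else 0) +
      (if j = t then (if i = s then 0 else -2 * (-1) ^ par t) else 0)
  have h2 : wtProd (fun i j => sgn k i j s t) M * passProd k s t M =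
      wtProd (fun i j => q k ^ e i j) M := by
    rw [passProd, ← wtProd_mul]
    refine wtProd_congr fun i j hij => ?_
    by_cases hlt : i < s ∨ i = s ∧ j < t
    · rw [if_pos hlt, passCoef, ← mul_assoc, sgn_mul_self, one_mul]
      rcases hlt with h | ⟨rfl, h⟩
      · by_cases hj : j = t
        · subst hj
          simp [e, h.ne, qq, ← zpow_neg]
        · simp [e, h.ne, hj]
      · simp [e, h.ne, qq, ← zpow_neg]
    · rw [if_neg hlt, mul_one]
      have : i = s ∧ j = t := by
        have := mt (hl i j) hij
        omega
      obtain ⟨rfl, rfl⟩ := this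
      simp only [e, if_true, add_zero, zpow_zero, sgn]
      have := hM i j
      rw [Matrix.add_apply, unitMat_apply, if_pos ⟨rfl, rfl⟩] at this
      rcases par_cases i with hi | hi <;> rcases par_cases j with hj | hj <;>
        simp only [hi, hj] at this ⊢ <;> norm_num
      · exact (hij (by have := this (by norm_num); omega)).elim
      · exact (hij (by have := this (by norm_num); omega)).elim
  rw [h1, h2, wtProd_zpow, normExp_add_unitMat]
  congr 1
  simp only [e, add_mul, ite_mul, zero_mul, Finset.sum_add_distrib, Finset.sum_ite_eq',
    Finset.mem_univ, if_true]
  rw [Finset.sum_comm (f := fun i j => if i = s then _ else _)]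
  simp only [Finset.sum_ite_eq', Finset.mem_univ, if_true]
  have ha : ∀ (c : ℤ) (f : Fin (m + 1) → ℤ) (a : Fin (m + 1)),
      (∑ l, if l = a then 0 else c * f l) = c * ∑ l, if l = a then 0 else f l := by
    intro c f a
    rw [Finset.mul_sum]
    exact Finset.sum_congr rfl fun l _ => by rw [mul_ite, mul_zero]
  rw [ha, ha]
  ring

variable [CharZero k]

/-- The bar involution is unitriangular, up to a power of `q`, on monomials. -/
lemma bar_xMon (M : Mat m) (hM : Admissible M) :
    bar k (xMon k M) - q k ^ (2 * normExp M) • xMon k M ∈ Low k M := by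
  induction M using peel_right_induction with
  | h0 =>
    rw [xMon_zero, bar_one, normExp_zero, mul_zero, zpow_zero, one_smul, sub_self]
    exact zero_mem _
  | h M s t hl ih =>
    have h1 := ih hM.of_add
    rw [xMon_add_right hl, (isHomog_xMon M).bar_mul (isHomog_x s t), bar_x]
    have e : (-1 : Kq k) ^ (oddDeg M * (par s + par t)) • (x k s t * bar k (xMon k M)) -
        q k ^ (2 * normExp (M + unitMat s t)) • (xMon k M * x k s t) =
        (-1 : Kq k) ^ (oddDeg M * (par s + par t)) • (x k s t * (bar k (xMon k M) -
          q k ^ (2 * normExp M) • xMon k M) + q k ^ (2 * normExp M) • (x k s t * xMon k M -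
          passProd k s t M • xMon k (M + unitMat s t))) := by
      have hq := sign_mul_passProd (k := k) hM hl
      rw [← xMon_add_right hl, mul_sub, mul_smul_comm, smul_sub, smul_smul, sub_add_sub_cancel,
        smul_sub, smul_smul]
      congr 2
      rw [mul_left_comm, hq, ← zpow_add₀ (q_ne_zero k)]
      congr 1; ring
    rw [e]
    exact smul_mem_of_ZQ (neg_one_pow_mem_ZQ _) (add_mem (letter_mul_Low s t h1)
      (smul_mem_of_ZQ (q_zpow_mem_ZQ _) (letter_mul s t M)))

/-- The bar involution is unitriangular on the normalized monomials. -/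
lemma bar_xNorm {M : Mat m} (hM : Admissible M) :
    bar k (xNorm k M) - xNorm k M ∈ Low k M := by
  have h := smul_mem_of_ZQ (q_zpow_mem_ZQ (-normExp M)) (bar_xMon (k := k) M hM)
  rw [smul_sub, smul_smul, ← zpow_add₀ (q_ne_zero k)] at h
  rw [xNorm, bar_smul, barScalar_zpow]
  convert h using 4
  ring

/-- The bar involution is an involution. -/
lemma bar_bar (f : O k m) : bar k (bar k f) = f := by
  have h2 : ∀ f : O k m, ∃ f0 f1 : O k m, f = f0 + f1 ∧ IsHomog 0 f0 ∧ IsHomog 1 f1 ∧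
      (bar k (bar k f) = f → bar k (bar k f0) = f0 ∧ bar k (bar k f1) = f1) := by
    intro f
    have hinv : parAut (parAut f) = f := by
      rw [parAut, scale_scale]
      have : (fun i : Fin (m + 1) => (-1 : (Kq k)ˣ) ^ par i) * (fun i => (-1) ^ par i) = 1 := by
        funext i; simp [← pow_add, ← two_mul]
      rw [this, scale_one]
    have h0 : (2 : Kq k)⁻¹ • (f + parAut f) + (2 : Kq k)⁻¹ • (f - parAut f) = f := by
      rw [← smul_add, add_add_sub_cancel, ← two_smul (Kq k), smul_smul,
        inv_mul_cancel₀ two_ne_zero, one_smul]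
    refine ⟨_, _, h0.symm, ?_, ?_, fun hf => ?_⟩
    · rw [IsHomog, map_smul, map_add, hinv, pow_zero, one_smul, add_comm]
    · rw [IsHomog, map_smul, map_sub, hinv, pow_one, neg_one_smul, ← smul_neg, neg_sub]
    · have h2 : barScalar k (2 : Kq k)⁻¹ = (2 : Kq k)⁻¹ := by rw [map_inv₀, map_ofNat]
      rw [bar_smul, bar_smul, bar_smul, bar_smul, h2, h2, bar_add, bar_add, bar_sub, bar_sub, hf,
        bar_parAut, bar_parAut, hf]
      exact ⟨rfl, rfl⟩
  induction f using O_induction with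
  | h1 a =>
    rw [Algebra.algebraMap_eq_smul_one, bar_smul, bar_smul, bar_one, bar_one, barScalar_barScalar]
  | hx i j => rw [bar_x, bar_x]
  | hd => rw [bar_detInv, bar_detInv]
  | hl => rw [bar_lastInv, bar_lastInv]
  | hmul f g hf hg =>
    obtain ⟨f0, f1, ef, hf0, hf1, hff⟩ := h2 f
    obtain ⟨g0, g1, eg, hg0, hg1, hgg⟩ := h2 g
    obtain ⟨a0, a1⟩ := hff hf
    obtain ⟨b0, b1⟩ := hgg hg
    have key : ∀ {e e' : ℕ} {f g : O k m}, IsHomog e f → IsHomog e' g → bar k (bar k f) = f →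
        bar k (bar k g) = g → bar k (bar k (f * g)) = f * g := by
      intro e e' f g he he' hf hg
      rw [he.bar_mul he', bar_smul, he'.bar.bar_mul he.bar, hf, hg, smul_smul, map_pow, map_neg,
        map_one, ← pow_add, mul_comm e' e, ← two_mul, pow_mul]
      simp
    rw [ef, eg, add_mul, mul_add, mul_add, bar_add, bar_add, bar_add, bar_add, bar_add, bar_add,
      key hf0 hg0 a0 b0, key hf0 hg1 a0 b1, key hf1 hg0 a1 b0, key hf1 hg1 a1 b1]
  | hadd f g hf hg => rw [bar_add, bar_add, hf, hg]

end BarMonomials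

/-! ### The Chevalley generators on monomials -/

section ActionMonomials

variable {k : Type u} [Field k] {m : ℕ}

/-- The quantum integer `q^{2(b-1)} + q^{2(b-3)} + ⋯ + q^{-2(b-1)}`. -/
def qInt (k : Type u) [Field k] (b : ℕ) : Kq k :=
  ∑ s ∈ Finset.range b, q k ^ (2 * ((b : ℤ) - 1) - 4 * s)

lemma qInt_zero : qInt k 0 = 0 := by simp [qInt]

lemma qInt_succ (b : ℕ) : qInt k (b + 1) = q k ^ (-2 : ℤ) * qInt k b + q k ^ (2 * (b : ℤ)) := by
  rw [qInt, Finset.sum_range_succ', qInt, Finset.mul_sum]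
  congr 1
  · refine Finset.sum_congr rfl fun s _ => ?_
    rw [← zpow_add₀ (q_ne_zero k)]
    congr 1; push_cast; ring
  · congr 1; push_cast; ring

/-- Move one letter of column `j` from row `Q` to row `P`. -/
def mv (P Q j : Fin (m + 1)) (T : Mat m) : Mat m := T + unitMat P j - unitMat Q j

lemma mv_add (P Q j : Fin (m + 1)) (N : Mat m) :
    mv P Q j (N + unitMat Q j) = N + unitMat P j := by
  rw [mv, add_right_comm]
  ext s t
  rw [Matrix.sub_apply, Matrix.add_apply _ (unitMat Q j), Nat.add_sub_cancel]

lemma exists_eq_add_unitMat {M : Mat m} {i j : Fin (m + 1)} (h : M i j ≠ 0) :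
    ∃ N, M = N + unitMat i j := by
  refine ⟨M - unitMat i j, ?_⟩
  ext s t
  rw [Matrix.add_apply, Matrix.sub_apply, unitMat_apply]
  split_ifs with h'
  · rw [← h'.1, ← h'.2]; omega
  · omega

lemma LettersGE.of_add {M N : Mat m} {i j : Fin (m + 1)} (h : LettersGE (M + N) i j) :
    LettersGE M i j := fun s t hst => by
  have := h s t hst
  rw [Matrix.add_apply] at this; omega

lemma LettersLE.of_add {M N : Mat m} {i j : Fin (m + 1)} (h : LettersLE (M + N) i j) :
    LettersLE M i j := fun s t hst => by
  have := h s t hst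
  rw [Matrix.add_apply] at this; omega

lemma LettersGE.add_unitMat {M : Mat m} {i j : Fin (m + 1)} (h : LettersGE M i j)
    {s t : Fin (m + 1)} (hst : i < s ∨ i = s ∧ j ≤ t) : LettersGE (M + unitMat s t) i j := by
  intro a b hab
  rw [Matrix.add_apply, h a b hab, unitMat_apply, if_neg (by rintro ⟨rfl, rfl⟩; omega)]

lemma LettersLE.add_unitMat {M : Mat m} {i j : Fin (m + 1)} (h : LettersLE M i j)
    {s t : Fin (m + 1)} (hst : s < i ∨ s = i ∧ t ≤ j) : LettersLE (M + unitMat s t) i j := by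
  intro a b hab
  rw [Matrix.add_apply, h a b hab, unitMat_apply, if_neg (by rintro ⟨rfl, rfl⟩; omega)]

lemma LettersGE.mono {M : Mat m} {i j : Fin (m + 1)} (h : LettersGE M i j)
    {s t : Fin (m + 1)} (hst : s < i ∨ s = i ∧ t ≤ j) : LettersGE M s t := by
  intro a b hab
  exact h a b (by omega)

lemma LettersLE.mono {M : Mat m} {i j : Fin (m + 1)} (h : LettersLE M i j)
    {s t : Fin (m + 1)} (hst : i < s ∨ s = i ∧ j ≤ t) : LettersLE M s t := by
  intro a b hab
  exact h a b (by omega)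

/-- A letter `x_{st}`, moved to its place in an ordered monomial, passes only `x_{ij}`. -/
lemma pass_left {N : Mat m} {i j s t : Fin (m + 1)} (hN : LettersGE N s t)
    (hlt : i < s ∨ i = s ∧ j < t) {c : Kq k}
    (hex : x k s t * x k i j = c • (x k i j * x k s t)) :
    x k s t * xMon k (N + unitMat i j) = c • xMon k (N + unitMat s t + unitMat i j) := by
  have hN' : LettersGE N i j := hN.mono (by omega)
  rw [xMon_add_left hN', xMon_add_left (hN'.add_unitMat (by omega)), xMon_add_left hN,
    ← mul_assoc, hex, smul_mul_assoc, mul_assoc]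

/-- A letter `x_{st}`, moved from the right to its place in an ordered monomial, passes only `x_{ij}`. -/
lemma pass_right {N : Mat m} {i j s t : Fin (m + 1)} (hN : LettersLE N s t)
    (hlt : s < i ∨ s = i ∧ t < j) {c : Kq k}
    (hex : x k i j * x k s t = c • (x k s t * x k i j)) :
    xMon k (N + unitMat i j) * x k s t = c • xMon k (N + unitMat s t + unitMat i j) := by
  have hN' : LettersLE N i j := hN.mono (by omega)
  rw [xMon_add_right hN', xMon_add_right (hN'.add_unitMat (by omega)), xMon_add_right hN,
    mul_assoc, hex, mul_smul_comm, mul_assoc]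

lemma coe_wt (r c : Fin (m + 1) → (Kq k)ˣ) (M : Mat m) :
    ((wt r c M : (Kq k)ˣ) : Kq k) = wtProd (fun i j => (r i : Kq k) * c j) M := by
  simp only [wt, wtProd, Units.coe_prod, Units.val_pow_eq_pow_val, Units.val_mul]

lemma sum_row_eq (a : Fin (m + 1) → ℤ) (M : Mat m) {P Q : Fin (m + 1)} (hPQ : P ≠ Q)
    (h : ∀ i, i ≠ P → i ≠ Q → a i = 0) :
    ∑ i, ∑ j, a i * M i j = a P * (∑ j, (M P j : ℤ)) + a Q * ∑ j, (M Q j : ℤ) := by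
  rw [Finset.sum_eq_add (a := P) (b := Q) hPQ]
  · simp only [Finset.mul_sum]
  · rintro i - ⟨h1, h2⟩
    simp [h i h1 h2]
  · simp
  · simp

/-- The weight of a monomial under the Cartan element `K_p K_{p+1}⁻¹`, whose value at row `p + 1` is
`q ^ e`. -/
lemma wt_kappa (p : Fin m) (M : Mat m) (e : ℤ)
    (he : ((kappa k p p.succ : (Kq k)ˣ) : Kq k) = q k ^ e) :
    ((wt (kappa k p) 1 M : (Kq k)ˣ) : Kq k) =
      q k ^ (2 * (∑ j, (M p.castSucc j : ℤ)) + e * ∑ j, (M p.succ j : ℤ)) := by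
  have hne : p.castSucc ≠ p.succ := Fin.castSucc_lt_succ.ne
  let a : Fin (m + 1) → ℤ := fun i => if i = p.castSucc then 2 else if i = p.succ then e else 0
  have h : ∀ i, ((kappa k p i : (Kq k)ˣ) : Kq k) = q k ^ a i := by
    intro i
    by_cases h1 : i = p.castSucc
    · subst h1; rw [kappa_castSucc]; simp [a]
    · by_cases h2 : i = p.succ
      · subst h2; rw [he]; simp [a, hne.symm]
      · rw [kappa_other p h1 h2]; simp [a, h1, h2]
  rw [coe_wt]
  simp only [Pi.one_apply, Units.val_one, mul_one, h]
  rw [wtProd_zpow, sum_row_eq a M hne (by intro i h1 h2; simp [a, h1, h2])]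
  simp [a, hne.symm]

lemma wt_inv (r : Fin (m + 1) → (Kq k)ˣ) (M : Mat m) :
    wt (fun i => (r i)⁻¹) 1 M = (wt r 1 M)⁻¹ := by
  simp [wt, wtProd, Finset.prod_inv_distrib]

lemma opKK_xMon (p : Fin m) (M : Mat m) (e : ℤ)
    (he : ((kappa k p p.succ : (Kq k)ˣ) : Kq k) = q k ^ e) :
    opKK p (xMon k M) =
      q k ^ (2 * (∑ j, (M p.castSucc j : ℤ)) + e * ∑ j, (M p.succ j : ℤ)) • xMon k M := by
  rw [opKK, scale_xMon, wt_kappa p M e he]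

lemma opKKinv_xMon (p : Fin m) (M : Mat m) (e : ℤ)
    (he : ((kappa k p p.succ : (Kq k)ˣ) : Kq k) = q k ^ e) :
    opKKinv p (xMon k M) =
      q k ^ (-(2 * (∑ j, (M p.castSucc j : ℤ)) + e * ∑ j, (M p.succ j : ℤ))) • xMon k M := by
  rw [opKKinv, scale_xMon, wt_inv, Units.val_inv_eq_inv_val, wt_kappa p M e he, zpow_neg]

lemma kappa_succ_even' (p : Fin m) (h : par p.succ = 0) :
    ((kappa k p p.succ : (Kq k)ˣ) : Kq k) = q k ^ (-2 : ℤ) := by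
  rw [kappa_succ_even p h, zpow_neg]; rfl

lemma kappa_succ_odd' (p : Fin m) (h : par p.succ = 1) :
    ((kappa k p p.succ : (Kq k)ˣ) : Kq k) = q k ^ (2 : ℤ) := by
  rw [kappa_succ_odd p h]; rfl

/-- The coefficient of the monomial obtained by moving a letter of column `j` from row `p + 1` to
row `p` in `E_p x^T`, for `E_p` even. -/
def eCoef (k : Type u) [Field k] (p : Fin m) (j : Fin (m + 1)) (T : Mat m) : Kq k :=
  qInt k (T p.succ j) *
    q k ^ (2 * ∑ l, if j < l then (T p.succ l : ℤ) - T p.castSucc l else 0)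

/-- The coefficient of the monomial obtained by moving a letter of column `j` from row `p` to
row `p + 1` in `F_p x^T`, for `F_p` even. -/
def fCoef (k : Type u) [Field k] (p : Fin m) (j : Fin (m + 1)) (T : Mat m) : Kq k :=
  qInt k (T p.castSucc j) *
    q k ^ (2 * ∑ l, if l < j then (T p.castSucc l : ℤ) - T p.succ l else 0)

lemma sum_ite_unitMat (P : Fin (m + 1) → Prop) [DecidablePred P] (s t i : Fin (m + 1)) :
    (∑ l, if P l then ((unitMat s t i l : ℕ) : ℤ) else 0) = if s = i ∧ P t then 1 else 0 := by
  by_cases h : s = i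
  · subst h
    have : ∀ l, (if P l then ((unitMat s t s l : ℕ) : ℤ) else 0) =
        if l = t then (if P t then 1 else 0) else 0 := by
      intro l
      by_cases hl : l = t
      · subst hl; simp [unitMat_apply]
      · simp [unitMat_apply, hl, Ne.symm hl]
    simp [this]
  · simp [unitMat_apply, h]

lemma sum_ite_sub_add_unitMat (P : Fin (m + 1) → Prop) [DecidablePred P] (T : Mat m)
    (s t i i' : Fin (m + 1)) :
    (∑ l, if P l then ((T + unitMat s t) i l : ℤ) - ((T + unitMat s t) i' l : ℕ) else 0) =
      (∑ l, if P l then (T i l : ℤ) - T i' l else 0) + (if s = i ∧ P t then 1 else 0) -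
        (if s = i' ∧ P t then 1 else 0) := by
  rw [← sum_ite_unitMat P s t i, ← sum_ite_unitMat P s t i', ← Finset.sum_add_distrib,
    ← Finset.sum_sub_distrib]
  refine Finset.sum_congr rfl fun l _ => ?_
  simp only [Matrix.add_apply]
  split_ifs
  · push_cast; ring
  · ring

lemma eCoef_add (p : Fin m) (j : Fin (m + 1)) (T : Mat m) {s t : Fin (m + 1)}
    (h : ¬ (s = p.succ ∧ t = j)) : eCoef k p j (T + unitMat s t) =
    q k ^ (2 * ((if s = p.succ ∧ j < t then (1 : ℤ) else 0) -
      (if s = p.castSucc ∧ j < t then 1 else 0))) * eCoef k p j T := by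
  rw [eCoef, eCoef, sum_ite_sub_add_unitMat (fun l => j < l), Matrix.add_apply, unitMat_apply,
    if_neg h, add_zero, mul_left_comm, ← zpow_add₀ (q_ne_zero k)]
  congr 2; ring

lemma fCoef_add (p : Fin m) (j : Fin (m + 1)) (T : Mat m) {s t : Fin (m + 1)}
    (h : ¬ (s = p.castSucc ∧ t = j)) : fCoef k p j (T + unitMat s t) =
    q k ^ (2 * ((if s = p.castSucc ∧ t < j then (1 : ℤ) else 0) -
      (if s = p.succ ∧ t < j then 1 else 0))) * fCoef k p j T := by
  rw [fCoef, fCoef, sum_ite_sub_add_unitMat (fun l => l < j), Matrix.add_apply, unitMat_apply,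
    if_neg h, add_zero, mul_left_comm, ← zpow_add₀ (q_ne_zero k)]
  congr 2; ring

lemma eCoef_eq_zero {p : Fin m} {j : Fin (m + 1)} {T : Mat m} (h : T p.succ j = 0) :
    eCoef k p j T = 0 := by rw [eCoef, h, qInt_zero, zero_mul]

lemma fCoef_eq_zero {p : Fin m} {j : Fin (m + 1)} {T : Mat m} (h : T p.castSucc j = 0) :
    fCoef k p j T = 0 := by rw [fCoef, h, qInt_zero, zero_mul]

lemma eCoef_add_self (p : Fin m) (j : Fin (m + 1)) (T : Mat m) :
    eCoef k p j (T + unitMat p.succ j) = q k ^ (-2 : ℤ) * eCoef k p j T +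
      q k ^ (2 * (T p.succ j : ℤ)) *
        q k ^ (2 * ∑ l, if j < l then (T p.succ l : ℤ) - T p.castSucc l else 0) := by
  rw [eCoef, eCoef, sum_ite_sub_add_unitMat (fun l => j < l), Matrix.add_apply, unitMat_apply,
    if_pos ⟨rfl, rfl⟩, if_neg (fun h => lt_irrefl _ h.2), if_neg (fun h => lt_irrefl _ h.2),
    qInt_succ, add_zero, sub_zero]
  ring

lemma fCoef_add_self (p : Fin m) (j : Fin (m + 1)) (T : Mat m) :
    fCoef k p j (T + unitMat p.castSucc j) = q k ^ (-2 : ℤ) * fCoef k p j T +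
      q k ^ (2 * (T p.castSucc j : ℤ)) *
        q k ^ (2 * ∑ l, if l < j then (T p.castSucc l : ℤ) - T p.succ l else 0) := by
  rw [fCoef, fCoef, sum_ite_sub_add_unitMat (fun l => l < j), Matrix.add_apply, unitMat_apply,
    if_pos ⟨rfl, rfl⟩, if_neg (fun h => lt_irrefl _ h.2), if_neg (fun h => lt_irrefl _ h.2),
    qInt_succ, add_zero, sub_zero]
  ring

lemma lt_trichotomy_adjacent (p : Fin m) (i : Fin (m + 1)) :
    i < p.castSucc ∨ i = p.castSucc ∨ i = p.succ ∨ p.succ < i := by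
  have h1 : (p.castSucc : ℕ) = p := rfl
  have h2 : (p.succ : ℕ) = p + 1 := rfl
  simp only [Fin.lt_def, Fin.ext_iff, h1, h2]
  omega

lemma smul_q_eq {u v : O k m} {n : ℤ} (h : u = q k ^ n • v) : v = q k ^ (-n) • u := by
  rw [h, smul_smul, ← zpow_add₀ (q_ne_zero k), neg_add_cancel, zpow_zero, one_smul]

lemma row_even_rev {i j l : Fin (m + 1)} (hi : par i = 0) (h : j < l) :
    x k i l * x k i j = q k ^ (-2 : ℤ) • (x k i j * x k i l) :=
  smul_q_eq ((isQSuperMatrix_x k).row_even hi h)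

lemma col_even_rev {i s j : Fin (m + 1)} (hj : par j = 0) (h : i < s) :
    x k s j * x k i j = q k ^ (-2 : ℤ) • (x k i j * x k s j) :=
  smul_q_eq ((isQSuperMatrix_x k).col_even hj h)

lemma anti_comm {i s j l : Fin (m + 1)} (h : i < s) (h' : l < j) (hp : par j * par s = 0) :
    x k s l * x k i j = (1 : Kq k) • (x k i j * x k s l) := by
  rw [(isQSuperMatrix_x k).anti' h h', hp, pow_zero, one_smul, one_smul]

/-- `E_p x^T` for an even generator `E_p`. -/
lemma opE_xMon (p : Fin m) (hp : par p.succ = 0) (T : Mat m) (hT : Admissible T) :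
    opE p (xMon k T) = ∑ j, eCoef k p j T • xMon k (mv p.castSucc p.succ j T) := by
  have hPQ : p.castSucc < p.succ := Fin.castSucc_lt_succ
  have hparP : par p.castSucc = 0 := par_castSucc p
  induction T using peel_left_induction with
  | h0 =>
    rw [xMon_zero]
    have : opE p (1 : O k m) = 0 := by simpa using opE_mul p (1 : O k m) 1
    rw [this]
    exact (Finset.sum_eq_zero fun j _ => by rw [eCoef_eq_zero rfl, zero_smul]).symm
  | h M i c hl ih =>
    have hM := hT.of_add
    rw [xMon_add_left hl, opE_mul, opP_even p hp, opE_x, ih hM, Finset.mul_sum]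
    -- moving the first letter into the term of column `j`
    have hterm : ∀ j, ¬ (i = p.succ ∧ c = j) →
        x k i c * (eCoef k p j M • xMon k (mv p.castSucc p.succ j M)) =
          eCoef k p j (M + unitMat i c) •
            xMon k (mv p.castSucc p.succ j (M + unitMat i c)) := by
      intro j hj
      rw [eCoef_add p j M hj]
      by_cases h0 : M p.succ j = 0
      · rw [eCoef_eq_zero h0, zero_smul, mul_zero, mul_zero, zero_smul]
      obtain ⟨N, rfl⟩ := exists_eq_add_unitMat h0
      have hNi : LettersGE N i c := hl.of_add
      rw [mv_add, add_right_comm N, mv_add, mul_smul_comm, mul_comm, mul_smul]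
      congr 1
      have hji : ¬ (p.succ < i ∨ p.succ = i ∧ j < c) := fun h => h0 (hl _ _ h)
      rcases lt_trichotomy_adjacent p i with h | h | h | h
      · rw [if_neg (fun e => (h.trans hPQ).ne e.1), if_neg (fun e => h.ne e.1), sub_zero, mul_zero,
          zpow_zero, one_smul, add_right_comm,
          xMon_add_left (hNi.add_unitMat (Or.inl h))]
      · subst h
        rw [if_neg (fun e => hPQ.ne e.1)]
        by_cases hjc : j < c
        · rw [if_pos ⟨rfl, hjc⟩]
          exact pass_left hNi (Or.inr ⟨rfl, hjc⟩) (row_even_rev hparP hjc)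
        · rw [if_neg (fun e => hjc e.2), sub_zero, mul_zero, zpow_zero, one_smul, add_right_comm,
            xMon_add_left (hNi.add_unitMat (Or.inr ⟨rfl, not_lt.mp hjc⟩))]
      · subst h
        have hcj : c < j := by omega
        rw [if_neg (fun e => lt_asymm hcj e.2), if_neg (fun e => hPQ.ne' e.1), sub_zero, mul_zero,
          zpow_zero]
        exact pass_left hNi (Or.inl hPQ) (anti_comm hPQ hcj (by rw [hp, mul_zero]))
      · exact absurd (Or.inl h) hji
    by_cases hi : i = p.succ
    · subst hi
      rw [if_pos rfl, ← Finset.add_sum_erase _ _ (Finset.mem_univ c),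
        ← Finset.add_sum_erase Finset.univ (fun j => eCoef k p j (M + unitMat p.succ c) • _)
          (Finset.mem_univ c), add_right_comm]
      congr 1
      · have hP : ∀ l, M p.castSucc l = 0 := fun l => hl _ l (Or.inl hPQ)
        rw [eCoef_add_self, mv_add, add_smul]
        congr 1
        · by_cases h0 : M p.succ c = 0
          · rw [eCoef_eq_zero h0]; simp
          have hc : par c = 0 := by
            rcases par_cases c with h | h
            · exact h
            · have := hT p.succ c (by rw [hp, h])
              rw [Matrix.add_apply, unitMat_apply, if_pos ⟨rfl, rfl⟩] at this
              omega
          obtain ⟨N, rfl⟩ := exists_eq_add_unitMat h0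
          rw [mv_add, mul_smul_comm, pass_left hl.of_add (Or.inl hPQ) (col_even_rev hc hPQ),
            smul_smul, mul_comm]
        -- the letter just added gives the leading term of the quantum integer
        · rw [opKKinv_xMon p M (-2) (kappa_succ_even' p hp), mul_smul_comm,
            ← xMon_add_left (hl.mono (Or.inl hPQ)), ← zpow_add₀ (q_ne_zero k)]
          congr 2
          have e : ∀ l, (M p.succ l : ℤ) = (if l = c then (M p.succ c : ℤ) else 0) +
              if c < l then (M p.succ l : ℤ) - M p.castSucc l else 0 := by
            intro l
            rw [hP]
            rcases lt_trichotomy l c with h | h | h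
            · rw [if_neg h.ne, if_neg h.not_gt, hl _ _ (Or.inr ⟨rfl, h⟩)]; simp
            · subst h; simp
            · rw [if_neg h.ne', if_pos h]; simp
          rw [Finset.sum_congr rfl fun l _ => e l, Finset.sum_add_distrib]
          simp only [hP, Finset.sum_ite_eq', Finset.mem_univ, if_true]
          simp
          ring
      · refine Finset.sum_congr rfl fun j hj => hterm j fun h => ?_
        exact Finset.ne_of_mem_erase hj h.2.symm
    · rw [if_neg hi, zero_mul, add_zero]
      exact Finset.sum_congr rfl fun j _ => hterm j fun h => hi h.1

/-- `F_p x^T` for an even generator `F_p`. -/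
lemma opF_xMon (p : Fin m) (hp : par p.succ = 0) (T : Mat m) (hT : Admissible T) :
    opF p (xMon k T) = ∑ j, fCoef k p j T • xMon k (mv p.succ p.castSucc j T) := by
  have hPQ : p.castSucc < p.succ := Fin.castSucc_lt_succ
  have hparP : par p.castSucc = 0 := par_castSucc p
  induction T using peel_right_induction with
  | h0 =>
    rw [xMon_zero]
    have : opF p (1 : O k m) = 0 := by simpa using opF_mul p (1 : O k m) 1
    rw [this]
    exact (Finset.sum_eq_zero fun j _ => by rw [fCoef_eq_zero rfl, zero_smul]).symm
  | h M i c hl ih =>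
    have hM := hT.of_add
    rw [xMon_add_right hl, opF_mul, opP_even p hp, opF_x, ih hM, Finset.sum_mul]
    have hterm : ∀ j, ¬ (i = p.castSucc ∧ c = j) →
        (fCoef k p j M • xMon k (mv p.succ p.castSucc j M)) * x k i c =
          fCoef k p j (M + unitMat i c) •
            xMon k (mv p.succ p.castSucc j (M + unitMat i c)) := by
      intro j hj
      rw [fCoef_add p j M hj]
      by_cases h0 : M p.castSucc j = 0
      · rw [fCoef_eq_zero h0, zero_smul, zero_mul, mul_zero, zero_smul]
      obtain ⟨N, rfl⟩ := exists_eq_add_unitMat h0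
      have hNi : LettersLE N i c := hl.of_add
      rw [mv_add, add_right_comm N, mv_add, smul_mul_assoc, mul_comm, mul_smul]
      congr 1
      have hji : ¬ (i < p.castSucc ∨ p.castSucc = i ∧ c < j) := fun h => h0 (hl _ _ h)
      rcases lt_trichotomy_adjacent p i with h | h | h | h
      · exact absurd (Or.inl h) hji
      · subst h
        have hcj : j < c := by omega
        rw [if_neg (fun e => lt_asymm hcj e.2), if_neg (fun e => hPQ.ne e.1), sub_zero, mul_zero,
          zpow_zero]
        exact pass_right hNi (Or.inl hPQ) (anti_comm hPQ hcj (by rw [hp, mul_zero]))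
      · subst h
        rw [if_neg (fun e => hPQ.ne' e.1)]
        by_cases hjc : c < j
        · rw [if_pos ⟨rfl, hjc⟩]
          exact pass_right hNi (Or.inr ⟨rfl, hjc⟩) (row_even_rev hp hjc)
        · rw [if_neg (fun e => hjc e.2), sub_zero, mul_zero, zpow_zero, one_smul, add_right_comm,
            xMon_add_right (hNi.add_unitMat (Or.inr ⟨rfl, not_lt.mp hjc⟩))]
      · rw [if_neg (fun e => (hPQ.trans h).ne' e.1), if_neg (fun e => h.ne' e.1), sub_zero,
          mul_zero, zpow_zero, one_smul, add_right_comm,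
          xMon_add_right (hNi.add_unitMat (Or.inl h))]
    by_cases hi : i = p.castSucc
    · subst hi
      rw [if_pos rfl, ← Finset.add_sum_erase _ _ (Finset.mem_univ c),
        ← Finset.add_sum_erase Finset.univ (fun j => fCoef k p j (M + unitMat p.castSucc c) • _)
          (Finset.mem_univ c), ← add_assoc]
      congr 1
      · have hQ : ∀ l, M p.succ l = 0 := fun l => hl _ l (Or.inl hPQ)
        rw [fCoef_add_self, mv_add, add_smul, add_comm]
        congr 1
        · by_cases h0 : M p.castSucc c = 0
          · rw [fCoef_eq_zero h0]; simp
          have hc : par c = 0 := by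
            rcases par_cases c with h | h
            · exact h
            · have := hT p.castSucc c (by rw [hparP, h])
              rw [Matrix.add_apply, unitMat_apply, if_pos ⟨rfl, rfl⟩] at this
              omega
          obtain ⟨N, rfl⟩ := exists_eq_add_unitMat h0
          rw [mv_add, smul_mul_assoc, pass_right hl.of_add (Or.inl hPQ) (col_even_rev hc hPQ),
            smul_smul, mul_comm]
        · rw [opKK_xMon p M (-2) (kappa_succ_even' p hp), smul_mul_assoc,
            ← xMon_add_right (hl.mono (Or.inl hPQ)), ← zpow_add₀ (q_ne_zero k)]
          congr 2
          have e : ∀ l, (M p.castSucc l : ℤ) = (if l = c then (M p.castSucc c : ℤ) else 0) +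
              if l < c then (M p.castSucc l : ℤ) - M p.succ l else 0 := by
            intro l
            rw [hQ]
            rcases lt_trichotomy l c with h | h | h
            · rw [if_neg h.ne, if_pos h]; simp
            · subst h; simp
            · rw [if_neg h.ne', if_neg h.not_gt, hl _ _ (Or.inr ⟨rfl, h⟩)]; simp
          rw [Finset.sum_congr rfl fun l _ => e l, Finset.sum_add_distrib]
          simp only [hQ, Finset.sum_ite_eq', Finset.mem_univ, if_true]
          simp
          ring
      · refine Finset.sum_congr rfl fun j hj => hterm j fun h => ?_
        exact Finset.ne_of_mem_erase hj h.2.symm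
    · rw [if_neg hi, mul_zero, zero_add]
      exact Finset.sum_congr rfl fun j _ => hterm j fun h => hi h.1

end ActionMonomials

section OddAction

variable {k : Type u} [Field k] {m : ℕ}

/-- The coefficient of the monomial obtained by moving a letter of column `j` from the last row to
the row above it in `E_m x^T`. -/
def mCoef (k : Type u) [Field k] (p : Fin m) (j : Fin (m + 1)) (T : Mat m) : Kq k :=
  if T p.succ j = 0 then 0 else
    (-1) ^ ((∑ i, T i (Fin.last m)) + ∑ l, if l < j then T p.succ l else 0) *
      q k ^ (-2 * ∑ l, if j < l then (T p.succ l : ℤ) + T p.castSucc l else 0)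

lemma sum_ite_unitMat_nat (P : Fin (m + 1) → Prop) [DecidablePred P] (s t i : Fin (m + 1)) :
    (∑ l, if P l then unitMat s t i l else 0) = if s = i ∧ P t then 1 else 0 := by
  have := sum_ite_unitMat P s t i
  exact_mod_cast this

lemma mCoef_add (p : Fin m) (j : Fin (m + 1)) (T : Mat m) {s t : Fin (m + 1)}
    (h : ¬ (s = p.succ ∧ t = j)) : mCoef k p j (T + unitMat s t) =
    (-1) ^ (par t + if s = p.succ ∧ t < j then 1 else 0) *
    q k ^ (-2 * ((if s = p.succ ∧ j < t then (1 : ℤ) else 0) +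
      (if s = p.castSucc ∧ j < t then 1 else 0))) * mCoef k p j T := by
  have e0 : (T + unitMat s t) p.succ j = T p.succ j := by
    rw [Matrix.add_apply, unitMat_apply, if_neg h, add_zero]
  have e1 : (∑ i, (T + unitMat s t) i (Fin.last m)) = (∑ i, T i (Fin.last m)) + par t := by
    simp only [Matrix.add_apply, Finset.sum_add_distrib]
    congr 1
    rw [Finset.sum_eq_single s (fun i _ hi => by simp [unitMat_apply, hi.symm]) (by simp),
      unitMat_apply, par]
    simp
  have e2 : (∑ l, if l < j then (T + unitMat s t) p.succ l else 0) =
      (∑ l, if l < j then T p.succ l else 0) + if s = p.succ ∧ t < j then 1 else 0 := by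
    rw [← sum_ite_unitMat_nat (fun l => l < j) s t p.succ, ← Finset.sum_add_distrib]
    exact Finset.sum_congr rfl fun l _ => by rw [Matrix.add_apply]; split_ifs <;> rfl
  have e3 : (∑ l, if j < l then ((T + unitMat s t) p.succ l : ℤ) +
      ((T + unitMat s t) p.castSucc l : ℕ) else 0) =
      (∑ l, if j < l then (T p.succ l : ℤ) + T p.castSucc l else 0) +
        ((if s = p.succ ∧ j < t then (1 : ℤ) else 0) +
      (if s = p.castSucc ∧ j < t then 1 else 0)) := by
    rw [← sum_ite_unitMat (fun l => j < l) s t p.succ,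
      ← sum_ite_unitMat (fun l => j < l) s t p.castSucc, ← Finset.sum_add_distrib,
      ← Finset.sum_add_distrib]
    refine Finset.sum_congr rfl fun l _ => ?_
    simp only [Matrix.add_apply]
    split_ifs
    · push_cast; ring
    · ring
  rw [mCoef, mCoef, e0, e1, e2, e3]
  split_ifs with h0
  · rw [mul_zero]
  · rw [mul_add, zpow_add₀ (q_ne_zero k)]; ring
  all_goals first | rw [mul_zero] | (rw [mul_add, zpow_add₀ (q_ne_zero k)]; ring)

lemma mCoef_eq_zero {p : Fin m} {j : Fin (m + 1)} {T : Mat m} (h : T p.succ j = 0) :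
    mCoef k p j T = 0 := by rw [mCoef, if_pos h]

lemma opP_x (p : Fin m) (hp : par p.succ = 1) (i c : Fin (m + 1)) :
    opP p (x k i c) = (-1 : Kq k) ^ (par i + par c) • x k i c := by
  rw [opP, scale_x]; simp [pSign, hp, pow_add]

lemma opP_eq_parAut (p : Fin m) (hp : par p.succ = 1) (f : O k m) : opP p f = parAut f := by
  have : (opP p : O k m →ₐ[Kq k] O k m) = parAut := algHom_ext fun i c => by
    rw [opP_x p hp, parAut_x]
  rw [this]

/-- `E_m x^T` for the odd generator `E_m`. -/
lemma opE_odd_xMon (p : Fin m) (hp : par p.succ = 1) (T : Mat m) (hT : Admissible T)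
    (hT4 : T (Fin.last m) (Fin.last m) = 0) :
    opE p (xMon k T) = ∑ j, mCoef k p j T • xMon k (mv p.castSucc p.succ j T) := by
  have hPQ : p.castSucc < p.succ := Fin.castSucc_lt_succ
  have hparP : par p.castSucc = 0 := par_castSucc p
  have hQ := par_eq_one hp
  induction T using peel_left_induction with
  | h0 =>
    rw [xMon_zero]
    have : opE p (1 : O k m) = 0 := by simpa using opE_mul p (1 : O k m) 1
    rw [this]
    exact (Finset.sum_eq_zero fun j _ => by rw [mCoef_eq_zero rfl, zero_smul]).symm
  | h M i c hl ih =>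
    have hM := hT.of_add
    have hM4 : M (Fin.last m) (Fin.last m) = 0 := by
      rw [Matrix.add_apply] at hT4; omega
    rw [xMon_add_left hl, opE_mul, opP_x p hp, opE_x, ih hM hM4, Finset.mul_sum]
    have hterm : ∀ j, ¬ (i = p.succ ∧ c = j) →
        ((-1 : Kq k) ^ (par i + par c) • x k i c) *
          (mCoef k p j M • xMon k (mv p.castSucc p.succ j M)) =
          mCoef k p j (M + unitMat i c) •
            xMon k (mv p.castSucc p.succ j (M + unitMat i c)) := by
      intro j hj
      rw [mCoef_add p j M hj]
      by_cases h0 : M p.succ j = 0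
      · rw [mCoef_eq_zero h0, zero_smul, mul_zero, mul_zero, zero_smul]
      have hjl : par j = 0 := par_lt (m := m) (j := Fin.last m) (lt_of_le_of_ne (Fin.le_last j)
        (by rintro rfl; rw [hQ] at h0; exact h0 hM4))
      obtain ⟨N, rfl⟩ := exists_eq_add_unitMat h0
      have hNi : LettersGE N i c := hl.of_add
      rw [mv_add, add_right_comm N, mv_add, smul_mul_smul_comm,
        mul_right_comm, mul_smul _ (q k ^ (_ : ℤ))]
      have hji : ¬ (p.succ < i ∨ p.succ = i ∧ j < c) := fun h => h0 (hl _ _ h)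
      rcases lt_trichotomy_adjacent p i with h | h | h | h
      · rw [if_neg (fun e : i = p.succ ∧ c < j => (h.trans hPQ).ne e.1),
          if_neg (fun e : i = p.castSucc ∧ j < c => h.ne e.1),
          if_neg (fun e : i = p.succ ∧ j < c => (h.trans hPQ).ne e.1), add_zero, add_zero,
          mul_zero, zpow_zero, one_smul, add_right_comm N,
          xMon_add_left (hNi.add_unitMat (Or.inl h)), par_lt h, zero_add]
      · subst h
        rw [if_neg (fun e => hPQ.ne e.1), if_neg (fun e => hPQ.ne e.1), hparP, zero_add, zero_add,
          add_zero]
        congr 1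
        by_cases hjc : j < c
        · rw [if_pos ⟨rfl, hjc⟩]
          exact pass_left hNi (Or.inr ⟨rfl, hjc⟩) (row_even_rev hparP hjc)
        · rw [if_neg (fun e => hjc e.2), mul_zero, zpow_zero, one_smul, add_right_comm,
            xMon_add_left (hNi.add_unitMat (Or.inr ⟨rfl, not_lt.mp hjc⟩))]
      · subst h
        have hcj : c < j := by omega
        rw [if_neg (fun e : p.succ = p.succ ∧ j < c => lt_asymm hcj e.2),
          if_neg (fun e : p.succ = p.castSucc ∧ j < c => hPQ.ne' e.1),
          if_pos (show p.succ = p.succ ∧ c < j from ⟨rfl, hcj⟩),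
          hp, add_comm 1, add_zero, mul_zero, zpow_zero]
        congr 1
        exact pass_left hNi (Or.inl hPQ) (anti_comm hPQ hcj (by rw [hjl, zero_mul]))
      · exact absurd (Or.inl h) hji
    by_cases hi : i = p.succ
    · subst hi
      have hcQ : c ≠ Fin.last m := by
        rintro rfl
        rw [Matrix.add_apply, unitMat_apply, if_pos ⟨hQ, rfl⟩] at hT4; omega
      have hc0 : M p.succ c = 0 := by
        have := hT p.succ c (by rw [hp, par_lt (lt_of_le_of_ne (Fin.le_last c) hcQ)])
        rw [Matrix.add_apply, unitMat_apply, if_pos ⟨rfl, rfl⟩] at this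
        omega
      have hP : ∀ i l, i < p.succ → M i l = 0 := fun i l h => hl _ l (Or.inl h)
      rw [if_pos rfl, ← Finset.add_sum_erase _ _ (Finset.mem_univ c),
        ← Finset.add_sum_erase Finset.univ (fun j => mCoef k p j (M + unitMat p.succ c) • _)
          (Finset.mem_univ c), add_right_comm]
      congr 1
      · rw [mCoef_eq_zero hc0, zero_smul, mul_zero, zero_add, mv_add,
          opKKinv_xMon p M 2 (kappa_succ_odd' p hp), mul_smul_comm,
            ← xMon_add_left (hl.mono (Or.inl hPQ))]
        congr 1
        have e1 : (∑ i, (M + unitMat p.succ c) i (Fin.last m)) = 0 := by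
          refine Finset.sum_eq_zero fun i _ => ?_
          rw [Matrix.add_apply, unitMat_apply, if_neg (fun h => hcQ h.2), add_zero]
          rcases (Fin.le_last i).lt_or_eq with h | h
          · exact hP i _ (hQ ▸ h)
          · rw [h]; exact hM4
        have e2 : (∑ l, if l < c then (M + unitMat p.succ c) p.succ l else 0) = 0 := by
          refine Finset.sum_eq_zero fun l _ => ?_
          split_ifs with h
          · rw [Matrix.add_apply, unitMat_apply, if_neg (fun e => h.ne' e.2),
              hl _ _ (Or.inr ⟨rfl, h⟩), add_zero]
          · rfl
        rw [mCoef, if_neg (by rw [Matrix.add_apply, unitMat_apply, if_pos ⟨rfl, rfl⟩]; omega), e1,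
          e2, add_zero, pow_zero, one_mul]
        congr 1
        have e3 : ∀ l, (if c < l then ((M + unitMat p.succ c) p.succ l : ℤ) +
            ((M + unitMat p.succ c) p.castSucc l : ℕ) else 0) = M p.succ l := by
          intro l
          have hu : (M + unitMat p.succ c) p.castSucc l = 0 := by
            rw [Matrix.add_apply, unitMat_apply, hP _ l hPQ, if_neg (fun e => hPQ.ne' e.1)]
          rw [hu, Matrix.add_apply, unitMat_apply]
          rcases lt_trichotomy l c with h | h | h
          · rw [if_neg h.not_gt, hl _ _ (Or.inr ⟨rfl, h⟩)]; simp
          · subst h; simp [hc0]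
          · rw [if_pos h, if_neg (fun e => h.ne e.2)]; simp
        simp only [e3, hP _ _ hPQ]
        simp
      · refine Finset.sum_congr rfl fun j hj => hterm j fun h => ?_
        exact Finset.ne_of_mem_erase hj h.2.symm
    · rw [if_neg hi, zero_mul, add_zero]
      exact Finset.sum_congr rfl fun j _ => hterm j fun h => hi h.1

end OddAction

/-! ### Move operators in normalized monomials -/

section Moves

variable {k : Type u} [Field k] {m : ℕ}

/-- The partial sum of the entries before `j`. -/
def pre {n : ℕ} (v : Fin n → ℤ) (j : Fin n) : ℤ := ∑ l, if l < j then v l else 0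

/-- The partial sum of the entries after `j`. -/
def post {n : ℕ} (v : Fin n → ℤ) (j : Fin n) : ℤ := ∑ l, if j < l then v l else 0

lemma sum_eq_pre_post {n : ℕ} (v : Fin n → ℤ) (j : Fin n) : ∑ l, v l = pre v j + v j + post v j := by
  have : ∀ l, v l = (if l < j then v l else 0) + (if l = j then v j else 0) +
      (if j < l then v l else 0) := by
    intro l
    rcases lt_trichotomy l j with h | h | h
    · simp [h, h.ne, h.le]
    · simp [h]
    · simp [h, h.ne', h.le]
  rw [Finset.sum_congr rfl fun l _ => this l]
  simp [Finset.sum_add_distrib, pre, post]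

lemma sum_ne_eq {n : ℕ} (v : Fin n → ℤ) (j : Fin n) :
    (∑ l, if l = j then 0 else v l) = pre v j + post v j := by
  have h := sum_eq_pre_post v j
  have h2 : ∑ l, v l = (∑ l, if l = j then 0 else v l) + v j := by
    rw [← Finset.add_sum_erase _ _ (Finset.mem_univ j),
      ← Finset.add_sum_erase Finset.univ (fun l => if l = j then 0 else v l) (Finset.mem_univ j),
      if_pos rfl, zero_add, add_comm]
    congr 1
    exact Finset.sum_congr rfl fun l hl => by rw [if_neg (Finset.ne_of_mem_erase hl)]
  omega

lemma pre_congr {n : ℕ} {v w : Fin n → ℤ} {j : Fin n} (h : ∀ l < j, v l = w l) :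
    pre v j = pre w j :=
  Finset.sum_congr rfl fun l _ => by split_ifs with hl; exacts [h l hl, rfl]

lemma post_congr {n : ℕ} {v w : Fin n → ℤ} {j : Fin n} (h : ∀ l, j < l → v l = w l) :
    post v j = post w j :=
  Finset.sum_congr rfl fun l _ => by split_ifs with hl; exacts [h l hl, rfl]

lemma pre_sub {n : ℕ} (v w : Fin n → ℤ) (j : Fin n) :
    pre (fun l => v l - w l) j = pre v j - pre w j := by
  simp only [pre, ← Finset.sum_sub_distrib]
  exact Finset.sum_congr rfl fun l _ => by split_ifs <;> simp

lemma post_sub {n : ℕ} (v w : Fin n → ℤ) (j : Fin n) :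
    post (fun l => v l - w l) j = post v j - post w j := by
  simp only [post, ← Finset.sum_sub_distrib]
  exact Finset.sum_congr rfl fun l _ => by split_ifs <;> simp

lemma pre_add {n : ℕ} (v w : Fin n → ℤ) (j : Fin n) :
    pre (fun l => v l + w l) j = pre v j + pre w j := by
  simp only [pre, ← Finset.sum_add_distrib]
  exact Finset.sum_congr rfl fun l _ => by split_ifs <;> simp

lemma post_add {n : ℕ} (v w : Fin n → ℤ) (j : Fin n) :
    post (fun l => v l + w l) j = post v j + post w j := by
  simp only [post, ← Finset.sum_add_distrib]
  exact Finset.sum_congr rfl fun l _ => by split_ifs <;> simp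

/-- The change of the normalizing exponent when a letter of column `j` moves from row `Q` to row `P`. -/
lemma normExp_move (N : Mat m) (P Q j : Fin (m + 1)) :
    normExp (N + unitMat Q j) - normExp (N + unitMat P j) =
      (-1) ^ par P * (pre (fun l => (N P l : ℤ)) j + post (fun l => (N P l : ℤ)) j) -
      (-1) ^ par Q * (pre (fun l => (N Q l : ℤ)) j + post (fun l => (N Q l : ℤ)) j) +
        (-1) ^ par j * ((N Q j : ℤ) - N P j) := by
  have h := fun a => sum_ne_eq (fun l => (N a l : ℤ)) j
  have hc : ∀ a, (∑ i, if i = a then 0 else (N i j : ℤ)) = (∑ i, (N i j : ℤ)) - N a j := by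
    intro a
    have := sum_ne_eq (fun i => (N i j : ℤ)) a
    have h2 := sum_eq_pre_post (fun i => (N i j : ℤ)) a
    simp only at this h2
    omega
  rw [normExp_add_unitMat, normExp_add_unitMat, h, h, hc, hc]
  ring

/-- The matrix of a move operator in the normalized monomials. -/
def normCoef (c : Fin (m + 1) → Mat m → Kq k) (P Q : Fin (m + 1)) (j : Fin (m + 1)) (T : Mat m) :
    Kq k := c j T * q k ^ (normExp T - normExp (mv P Q j T))

/-- A linear operator `G` moves letters from row `Q` to row `P`, with coefficients `c` in the
normalized monomials. -/
structure IsMove (G : O k m →ₗ[Kq k] O k m) (P Q : Fin (m + 1))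
    (c : Fin (m + 1) → Mat m → Kq k) : Prop where
  ne : P ≠ Q
  apply : ∀ T ∈ indexABC m, G (xNorm k T) = ∑ j, c j T • xNorm k (mv P Q j T)
  zero : ∀ j T, T Q j = 0 → c j T = 0
  last : ∀ j T, T ∈ indexABC m → T Q j ≠ 0 →
    mv P Q j T (Fin.last m) (Fin.last m) = 0

lemma normalize_move {G : O k m →ₗ[Kq k] O k m} {P Q : Fin (m + 1)}
    {c : Fin (m + 1) → Mat m → Kq k} {T : Mat m}
    (h : G (xMon k T) = ∑ j, c j T • xMon k (mv P Q j T)) :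
    G (xNorm k T) = ∑ j, normCoef c P Q j T • xNorm k (mv P Q j T) := by
  rw [xNorm, map_smul, h, Finset.smul_sum]
  refine Finset.sum_congr rfl fun j _ => ?_
  rw [xNorm, smul_smul, smul_smul, normCoef, mul_assoc, ← zpow_add₀ (q_ne_zero k), sub_add_cancel,
    mul_comm]

lemma succ_ne_last {p : Fin m} (hp : par p.succ = 0) : p.succ ≠ Fin.last m := by
  intro h; rw [h, par_last] at hp; exact one_ne_zero hp

lemma isMove_E (p : Fin m) (hp : par p.succ = 0) :
    IsMove (opE p : O k m →ₗ[Kq k] O k m) p.castSucc p.succ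
      (normCoef (eCoef k p) p.castSucc p.succ) where
  ne := Fin.castSucc_lt_succ.ne
  apply T hT := normalize_move (opE_xMon p hp T hT.1)
  zero j T h := by rw [normCoef, eCoef_eq_zero h, zero_mul]
  last j T hT h := by
    obtain ⟨N, rfl⟩ := exists_eq_add_unitMat h
    have := hT.2
    rw [Matrix.add_apply] at this
    rw [mv_add, Matrix.add_apply, unitMat_apply, if_neg fun e => (Fin.castSucc_lt_last p).ne e.1]
    omega

lemma isMove_F (p : Fin m) (hp : par p.succ = 0) :
    IsMove (opF p : O k m →ₗ[Kq k] O k m) p.succ p.castSucc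
      (normCoef (fCoef k p) p.succ p.castSucc) where
  ne := Fin.castSucc_lt_succ.ne'
  apply T hT := normalize_move (opF_xMon p hp T hT.1)
  zero j T h := by rw [normCoef, fCoef_eq_zero h, zero_mul]
  last j T hT h := by
    obtain ⟨N, rfl⟩ := exists_eq_add_unitMat h
    have := hT.2
    rw [Matrix.add_apply] at this
    rw [mv_add, Matrix.add_apply, unitMat_apply, if_neg fun e => succ_ne_last hp e.1]
    omega

lemma isMove_E_odd (p : Fin m) (hp : par p.succ = 1) :
    IsMove (opE p : O k m →ₗ[Kq k] O k m) p.castSucc p.succ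
      (normCoef (mCoef k p) p.castSucc p.succ) where
  ne := Fin.castSucc_lt_succ.ne
  apply T hT := normalize_move (opE_odd_xMon p hp T hT.1 hT.2)
  zero j T h := by rw [normCoef, mCoef_eq_zero h, zero_mul]
  last j T hT h := by
    obtain ⟨N, rfl⟩ := exists_eq_add_unitMat h
    have := hT.2
    rw [Matrix.add_apply] at this
    rw [mv_add, Matrix.add_apply, unitMat_apply, if_neg fun e => (Fin.castSucc_lt_last p).ne e.1]
    omega

/-- Closed form of the coefficients of an even `E_p` in normalized monomials. -/
lemma normCoef_E (p : Fin m) (hp : par p.succ = 0) {N : Mat m} {j : Fin (m + 1)}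
    (h1 : Admissible (N + unitMat p.succ j)) (h2 : Admissible (N + unitMat p.castSucc j)) :
    normCoef (eCoef k p) p.castSucc p.succ j (N + unitMat p.succ j) = qInt k (N p.succ j + 1) *
      q k ^ (pre (fun l => (N p.castSucc l : ℤ) - N p.succ l) j -
        post (fun l => (N p.castSucc l : ℤ) - N p.succ l) j - ((N p.castSucc j : ℤ) - N p.succ j)) := by
  have hne : p.castSucc ≠ p.succ := Fin.castSucc_lt_succ.ne
  have hd : (-1 : ℤ) ^ par j * ((N p.succ j : ℤ) - N p.castSucc j) =
      (N p.succ j : ℤ) - N p.castSucc j := by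
    rcases par_cases j with hj | hj
    · rw [hj, pow_zero, one_mul]
    · have e1 := h1 p.succ j (by rw [hp, hj])
      have e2 := h2 p.castSucc j (by rw [par_castSucc, hj])
      rw [Matrix.add_apply, unitMat_apply, if_pos ⟨rfl, rfl⟩] at e1 e2
      have e3 : N p.succ j = 0 := by omega
      have e4 : N p.castSucc j = 0 := by omega
      rw [e3, e4]; simp
  rw [normCoef, mv_add, normExp_move, eCoef, sum_ite_sub_add_unitMat (fun l => j < l),
    if_neg (fun h => lt_irrefl _ h.2), if_neg (fun h => lt_irrefl _ h.2), mul_assoc,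
    ← zpow_add₀ (q_ne_zero k), hd, hp, par_castSucc, pow_zero, one_mul, one_mul,
    pre_sub, post_sub]
  have hs : (∑ l, if j < l then (N p.succ l : ℤ) - N p.castSucc l else 0) =
      post (fun l => (N p.succ l : ℤ)) j - post (fun l => (N p.castSucc l : ℤ)) j :=
    (post_sub _ _ _)
  rw [hs, Matrix.add_apply, unitMat_apply, if_pos ⟨rfl, rfl⟩]
  congr 2
  ring

/-- Closed form of the coefficients of an even `F_p` in normalized monomials. -/
lemma normCoef_F (p : Fin m) (hp : par p.succ = 0) {N : Mat m} {j : Fin (m + 1)}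
    (h1 : Admissible (N + unitMat p.succ j)) (h2 : Admissible (N + unitMat p.castSucc j)) :
    normCoef (fCoef k p) p.succ p.castSucc j (N + unitMat p.castSucc j) =
      qInt k (N p.castSucc j + 1) *
      q k ^ (pre (fun l => (N p.castSucc l : ℤ) - N p.succ l) j -
        post (fun l => (N p.castSucc l : ℤ) - N p.succ l) j + ((N p.castSucc j : ℤ) - N p.succ j)) := by
  have hd : (-1 : ℤ) ^ par j * ((N p.castSucc j : ℤ) - N p.succ j) =
      (N p.castSucc j : ℤ) - N p.succ j := by
    rcases par_cases j with hj | hj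
    · rw [hj, pow_zero, one_mul]
    · have e1 := h1 p.succ j (by rw [hp, hj])
      have e2 := h2 p.castSucc j (by rw [par_castSucc, hj])
      rw [Matrix.add_apply, unitMat_apply, if_pos ⟨rfl, rfl⟩] at e1 e2
      have e3 : N p.succ j = 0 := by omega
      have e4 : N p.castSucc j = 0 := by omega
      rw [e3, e4]; simp
  rw [normCoef, mv_add, normExp_move, fCoef, sum_ite_sub_add_unitMat (fun l => l < j),
    if_neg (fun h => lt_irrefl _ h.2), if_neg (fun h => lt_irrefl _ h.2), mul_assoc,
    ← zpow_add₀ (q_ne_zero k), hd, hp, par_castSucc, pow_zero, one_mul, one_mul,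
    pre_sub, post_sub]
  have hs : (∑ l, if l < j then (N p.castSucc l : ℤ) - N p.succ l else 0) =
      pre (fun l => (N p.castSucc l : ℤ)) j - pre (fun l => (N p.succ l : ℤ)) j :=
    (pre_sub _ _ _)
  rw [hs, Matrix.add_apply, unitMat_apply, if_pos ⟨rfl, rfl⟩]
  congr 2
  ring

/-- Closed form of the coefficients of the odd `E_m` in normalized monomials. -/
lemma normCoef_E_odd (p : Fin m) (hp : par p.succ = 1) {N : Mat m} {j : Fin (m + 1)}
    (hj : par j = 0) (h1 : Admissible (N + unitMat p.succ j)) :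
    ∃ s : ℕ, normCoef (mCoef k p) p.castSucc p.succ j (N + unitMat p.succ j) = (-1) ^ s *
      q k ^ (pre (fun l => (N p.castSucc l : ℤ) + N p.succ l) j -
        post (fun l => (N p.castSucc l : ℤ) + N p.succ l) j - N p.castSucc j) := by
  have hne : p.castSucc ≠ p.succ := Fin.castSucc_lt_succ.ne
  have e1 := h1 p.succ j (by rw [hp, hj])
  rw [Matrix.add_apply, unitMat_apply, if_pos ⟨rfl, rfl⟩] at e1
  have e3 : N p.succ j = 0 := by omega
  refine ⟨(∑ i, (N + unitMat p.succ j) i (Fin.last m)) +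
    ∑ l, if l < j then (N + unitMat p.succ j) p.succ l else 0, ?_⟩
  rw [normCoef, mv_add, normExp_move, mCoef, if_neg (by
    rw [Matrix.add_apply, unitMat_apply, if_pos ⟨rfl, rfl⟩]; omega), mul_assoc,
    ← zpow_add₀ (q_ne_zero k), hp, par_castSucc, hj, e3]
  congr 2
  have hs : (∑ l, if j < l then ((N + unitMat p.succ j) p.succ l : ℤ) +
      ((N + unitMat p.succ j) p.castSucc l : ℕ) else 0) =
      post (fun l => (N p.succ l : ℤ)) j + post (fun l => (N p.castSucc l : ℤ)) j := by
    rw [← post_add]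
    refine post_congr fun l hl => ?_
    rw [Matrix.add_apply, Matrix.add_apply, unitMat_apply, unitMat_apply,
      if_neg (fun h => hl.ne h.2), if_neg (fun h => hl.ne h.2), add_zero, add_zero]
  rw [hs, pre_add, post_add]
  push_cast
  ring

end Moves

/-! ### The signature rule -/

section Signature

variable {k : Type u} [Field k] {n : ℕ}

lemma pre_update (v : Fin n → ℤ) (j l : Fin n) (c : ℤ) :
    pre (fun t => v t + if t = j then c else 0) l = pre v l + if j < l then c else 0 := by
  rw [pre_add v (fun t => if t = j then c else 0)]
  congr 1
  rw [pre, Finset.sum_eq_single j (fun b _ hb => by simp [hb]) (by simp), if_pos rfl]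

/-- The number of letters which a lowering of `b` and raising of `a` can move in column `j`: it
is `b j`, except that nothing can move to an occupied odd position. -/
def movable (o : Fin n → Prop) (a b : Fin n → ℕ) (j : Fin n) : ℤ :=
  open Classical in if o j ∧ a j = 1 then 0 else b j

/-- The signature of the pair of rows `a`, `b` at column `j`; the crystal operator moving a letter
from `b` to `a` is undefined exactly when it is nowhere positive. -/
def signature (o : Fin n → Prop) (a b : Fin n → ℕ) (j : Fin n) : ℤ :=
  movable o a b j + pre (fun l => (b l : ℤ) - a l) j

/-- The maximal value of the signature. -/
def depth (o : Fin n → Prop) (a b : Fin n → ℕ) : ℕ :=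
  Finset.univ.sup fun j => (signature o a b j).toNat

lemma signature_le_depth (o : Fin n → Prop) (a b : Fin n → ℕ) (j : Fin n) :
    signature o a b j ≤ depth o a b := by
  have h : (signature o a b j).toNat ≤ depth o a b :=
    Finset.le_sup (f := fun j => (signature o a b j).toNat) (Finset.mem_univ j)
  omega

lemma movable_le (o : Fin n → Prop) (a b : Fin n → ℕ) (j : Fin n) : movable o a b j ≤ b j := by
  rw [movable]; split_ifs <;> omega

lemma movable_nonneg (o : Fin n → Prop) (a b : Fin n → ℕ) (j : Fin n) : 0 ≤ movable o a b j := by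
  rw [movable]; split_ifs <;> omega

/-- The rows `a`, `b` have entries at most `1` at odd positions. -/
def RowsAdmissible (o : Fin n → Prop) (a b : Fin n → ℕ) : Prop :=
  ∀ j, o j → a j ≤ 1 ∧ b j ≤ 1

lemma sub_le_movable {o : Fin n → Prop} {a b : Fin n → ℕ} (h : RowsAdmissible o a b) (j : Fin n) :
    (b j : ℤ) - a j ≤ movable o a b j := by
  rw [movable]
  split_ifs with hj
  · have := (h j hj.1).2; omega
  · omega

lemma pre_le_sum {v : Fin n → ℤ} {b : Fin n → ℕ} (h : ∀ l, v l ≤ b l) (j : Fin n) (c : ℤ)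
    (hc : c ≤ b j) : c + pre v j ≤ ∑ l, (b l : ℤ) := by
  rw [sum_eq_pre_post (fun l => (b l : ℤ)) j]
  have h1 : pre v j ≤ pre (fun l => (b l : ℤ)) j :=
    Finset.sum_le_sum fun l _ => by split_ifs; exacts [h l, le_rfl]
  have h2 : 0 ≤ post (fun l => (b l : ℤ)) j :=
    Finset.sum_nonneg fun l _ => by split_ifs <;> positivity
  linarith

lemma depth_le (o : Fin n → Prop) (a b : Fin n → ℕ) : depth o a b ≤ ∑ l, (a l + b l) := by
  refine Finset.sup_le fun j _ => ?_
  have h := pre_le_sum (v := fun l => (b l : ℤ) - a l) (b := b) (fun l => by omega) j _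
    (movable_le o a b j)
  have h2 : (∑ l, (b l : ℤ)) ≤ ((∑ l, (a l + b l) : ℕ) : ℤ) := by
    push_cast
    exact Finset.sum_le_sum fun l _ => by omega
  have : signature o a b j ≤ ((∑ l, (a l + b l) : ℕ) : ℤ) := h.trans h2
  omega

/-- The first column in which the signature is maximal contains a movable letter. -/
lemma exists_first_max {o : Fin n → Prop} {a b : Fin n → ℕ} (h : RowsAdmissible o a b)
    (hd : 0 < depth o a b) : ∃ J, signature o a b J = depth o a b ∧
      (∀ l < J, signature o a b l < depth o a b) ∧ 1 ≤ movable o a b J := by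
  have hne : (Finset.univ : Finset (Fin n)).Nonempty := by
    by_contra hcon
    rw [Finset.not_nonempty_iff_eq_empty] at hcon
    rw [depth, hcon] at hd
    exact lt_irrefl _ hd
  obtain ⟨j0, -, hj0⟩ := Finset.exists_mem_eq_sup _ hne fun j => (signature o a b j).toNat
  have hj0' : signature o a b j0 = depth o a b := by rw [← depth] at hj0; omega
  obtain ⟨J, hJ, hmin⟩ := wellFounded_lt.has_min {j | signature o a b j = depth o a b} ⟨j0, hj0'⟩
  have hlt : ∀ l < J, signature o a b l < depth o a b := fun l hl =>
    lt_of_le_of_ne (signature_le_depth o a b l) fun e => hmin l e hl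
  refine ⟨J, hJ, hlt, ?_⟩
  have hp : pre (fun l => (b l : ℤ) - a l) J ≤ (depth o a b : ℤ) - 1 := by
    obtain ⟨J, hJn⟩ := J
    cases J with
    | zero =>
      have : pre (fun l => (b l : ℤ) - a l) ⟨0, hJn⟩ = 0 :=
        Finset.sum_eq_zero fun l _ => by rw [if_neg (by simp [Fin.lt_def])]
      omega
    | succ J =>
      let l : Fin n := ⟨J, by omega⟩
      have hl := hlt l (by simp [l, Fin.lt_def])
      have h1 : pre (fun l => (b l : ℤ) - a l) ⟨J + 1, hJn⟩ =
          pre (fun l => (b l : ℤ) - a l) l + ((b l : ℤ) - a l) := by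
        have h0 : (b l : ℤ) - a l = ∑ t, if t = l then (b t : ℤ) - a t else 0 := by simp
        rw [pre, pre, h0, ← Finset.sum_add_distrib]
        refine Finset.sum_congr rfl fun t _ => ?_
        rcases lt_trichotomy t l with ht | ht | ht
        · rw [if_pos (by simp [l, Fin.lt_def] at ht ⊢; omega), if_pos ht, if_neg ht.ne, add_zero]
        · subst ht; rw [if_pos (by simp [l, Fin.lt_def]), if_neg (lt_irrefl _), if_pos rfl,
            zero_add]
        · rw [if_neg (by simp [l, Fin.lt_def] at ht ⊢; omega), if_neg ht.not_gt, if_neg ht.ne',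
            add_zero]
      have h2 := sub_le_movable h l
      rw [signature] at hl
      omega
  have hJ' : signature o a b J = depth o a b := hJ
  rw [signature] at hJ'
  omega

/-- Let `g a b i` be the `i`-th Laurent coefficients of a family of scalars which are regular at
`q = 0` and which satisfy the linear relations expressing that an even Chevalley generator
annihilates the corresponding vector. Then the coefficient at `(a, b)` is divisible by
`q ^ (2 * depth o a b)`. -/
theorem coeff_eq_zero_of_lt_depth (o : Fin n → Prop) (g : (Fin n → ℕ) → (Fin n → ℕ) → ℤ → k)
    (hloc : ∀ a b i, i < 0 → g a b i = 0)
    (hadm : ∀ a b i, ¬ RowsAdmissible o a b → g a b i = 0)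
    (hrel : ∀ a b i, RowsAdmissible o a b → (∑ j, if a j = 0 then 0 else
      ∑ s ∈ Finset.range (b j + 1), g (a - Pi.single j 1) (b + Pi.single j 1)
        (i - 2 * b j + 4 * s - 2 * pre (fun l => (a l : ℤ) - b l) j)) = 0)
    (a b : Fin n → ℕ) (i : ℤ) (hi : i < 2 * depth o a b) : g a b i = 0 := by
  generalize hN : ∑ l, (a l + b l) = N
  -- the induction is lexicographic, on `i - 2 * depth` and then on `depth`
  obtain ⟨u, hu⟩ : ∃ u : ℕ, i + 2 * N - 2 * depth o a b < u :=
    ⟨(i + 2 * N - 2 * depth o a b + 1).toNat, by omega⟩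
  induction u generalizing a b i with
  | zero =>
    have := depth_le o a b
    exact hloc a b i (by omega)
  | succ u ihu =>
    generalize he : depth o a b = e at hi hu
    induction e using Nat.strong_induction_on generalizing a b i with
    | _ e ihe =>
    by_cases hneg : i < 0
    · exact hloc a b i hneg
    by_cases hab : RowsAdmissible o a b
    swap
    · exact hadm a b i hab
    -- the relation used is that of the pair of rows with a letter of the column `J` moved back: the
    -- last of its terms at `J` is the coefficient in question, the others come earlier
    obtain ⟨J, hJ, hJlt, hJm⟩ := exists_first_max hab (by omega)
    have hbJ : 1 ≤ b J := by have := movable_le o a b J; omega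
    have hmJ : movable o a b J = b J ∧ ¬ (o J ∧ a J = 1) := by
      rw [movable] at hJm ⊢
      split_ifs at hJm ⊢ with h
      · omega
      · exact ⟨rfl, h⟩
    set a' := a + Pi.single J 1 with ha'
    set b' := b - Pi.single J 1 with hb'
    have ea : ∀ l, (a' l : ℤ) = a l + if l = J then 1 else 0 := fun l => by
      rw [ha', Pi.add_apply, Pi.single_apply]; split_ifs <;> simp
    have eb : ∀ l, (b' l : ℤ) = b l - if l = J then 1 else 0 := fun l => by
      rw [hb', Pi.sub_apply, Pi.single_apply]
      split_ifs with h
      · subst h; omega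
      · simp
    have hpre : ∀ j, pre (fun l => (a' l : ℤ) - b' l) j =
        - pre (fun l => (b l : ℤ) - a l) j + if J < j then 2 else 0 := by
      intro j
      have e1 := pre_update (fun l => (a l : ℤ) - b l) J j 2
      have e2 : pre (fun l => (a l : ℤ) - b l) j = - pre (fun l => (b l : ℤ) - a l) j := by
        rw [pre_sub (fun l => (a l : ℤ)), pre_sub (fun l => (b l : ℤ))]; ring
      rw [← e2, ← e1]
      refine pre_congr fun l _ => ?_
      rw [ea, eb]; split_ifs <;> ring
    have hadm' : RowsAdmissible o a' b' := by
      intro j hj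
      have h1 := hab j hj
      have h2 := ea j
      have h3 := eb j
      by_cases hjJ : j = J
      · subst hjJ
        have : a j ≠ 1 := fun h => hmJ.2 ⟨hj, h⟩
        rw [if_pos rfl] at h2 h3; omega
      · rw [if_neg hjJ] at h2 h3; omega
    have hrel' := hrel a' b' (i - 2 * (e - 1)) hadm'
    have hb'J : b' J + 1 = b J := by have := eb J; rw [if_pos rfl] at this; omega
    have hback : a' - Pi.single J 1 = a ∧ b' + Pi.single J 1 = b := by
      refine ⟨by rw [ha']; exact add_tsub_cancel_right _ _, ?_⟩
      funext l
      have := eb l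
      by_cases hl : l = J
      · subst hl; rw [if_pos rfl] at this; simp; omega
      · rw [if_neg hl] at this; simp [hl]; omega
    rw [← Finset.add_sum_erase _ _ (Finset.mem_univ J), Finset.sum_eq_zero (s := Finset.univ.erase J),
      add_zero, if_neg (by have := ea J; rw [if_pos rfl] at this; omega), hback.1, hback.2,
      Finset.sum_range_succ, Finset.sum_eq_zero, zero_add] at hrel'
    · rw [← hrel']
      congr 1
      have := hpre J
      rw [if_neg (lt_irrefl _)] at this
      rw [this]
      rw [signature, hmJ.1] at hJ
      omega
    · intro s hs
      rw [Finset.mem_range] at hs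
      have := hpre J
      rw [if_neg (lt_irrefl _)] at this
      rw [this]
      rw [signature, hmJ.1] at hJ
      exact ihu a b _ (by omega) hN (by omega)
    · intro j hj
      have hjJ : j ≠ J := Finset.ne_of_mem_erase hj
      split_ifs with haj
      · rfl
      refine Finset.sum_eq_zero fun s hs => ?_
      rw [Finset.mem_range] at hs
      set a2 := a' - Pi.single j 1 with ha2
      set b2 := b' + Pi.single j 1 with hb2
      have ea2 : ∀ l, (a2 l : ℤ) = a' l - if l = j then 1 else 0 := fun l => by
        rw [ha2, Pi.sub_apply, Pi.single_apply]
        split_ifs with h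
        · subst h; omega
        · simp
      have eb2 : ∀ l, (b2 l : ℤ) = b' l + if l = j then 1 else 0 := fun l => by
        rw [hb2, Pi.add_apply, Pi.single_apply]
        split_ifs <;> simp
      have hadm2 : RowsAdmissible o a2 b2 ∨ g a2 b2
          (i - 2 * (e - 1) - 2 * b' j + 4 * s - 2 * pre (fun l => (a' l : ℤ) - b' l) j) = 0 := by
        by_cases h : RowsAdmissible o a2 b2
        · exact Or.inl h
        · exact Or.inr (hadm _ _ _ h)
      rcases hadm2 with hadm2 | h
      swap
      · exact h
      have hb'j : b' j = b j ∧ a' j = a j := by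
        have h1 := eb j; have h2 := ea j
        rw [if_neg hjJ] at h1 h2; omega
      have hmj : movable o a b j = b j := by
        rw [movable]
        split_ifs with h
        · have := (hadm2 j h.1).2
          have h2 := eb2 j
          rw [if_pos rfl] at h2; omega
        · rfl
      have hN2 : ∑ l, (a2 l + b2 l) = N := by
        have : (∑ l, ((a2 l : ℤ) + b2 l)) = ∑ l, ((a l : ℤ) + b l) :=
          Finset.sum_congr rfl fun l _ => by rw [ea2, eb2, ea, eb]; ring
        have h2 : ((∑ l, (a2 l + b2 l) : ℕ) : ℤ) = ((∑ l, (a l + b l) : ℕ) : ℤ) := by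
          push_cast; exact this
        rw [← hN]; exact_mod_cast h2
      have hpre2 : pre (fun l => (b2 l : ℤ) - a2 l) J =
          pre (fun l => (b l : ℤ) - a l) J + if j < J then 2 else 0 := by
        rw [← pre_update]
        refine pre_congr fun l hl => ?_
        rw [ea2, eb2, ea, eb, if_neg hl.ne]; split_ifs <;> ring
      have hmJ2 : movable o a2 b2 J = (b J : ℤ) - 1 := by
        have h1 := ea2 J; have h2 := eb2 J; have h3 := ea J; have h4 := eb J
        rw [if_neg hjJ.symm] at h1 h2
        rw [if_pos rfl] at h3 h4
        rw [movable]
        split_ifs with h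
        · have := (hab J h.1).2; omega
        · omega
      have hsig2 := signature_le_depth o a2 b2 J
      rw [signature, hmJ2, hpre2] at hsig2
      have hJ2 := hJ
      rw [signature, hmJ.1] at hJ2
      have hj1 := signature_le_depth o a b j
      have hprej := hpre j
      rw [hprej]
      rcases lt_or_gt_of_ne hjJ with hlt | hgt
      · have hj2 := hJlt j hlt
        rw [signature, hmj] at hj2
        rw [if_pos hlt] at hsig2
        rw [if_neg hlt.not_gt]
        exact ihu a2 b2 _ (by omega) hN2 (by omega)
      · rw [signature, hmj] at hj1
        rw [if_neg hgt.not_gt] at hsig2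
        rw [if_pos hgt]
        rcases lt_or_ge (depth o a2 b2) e with h | h
        · exact ihe _ h a2 b2 _ hN2 rfl (by omega) (by omega)
        · exact ihu a2 b2 _ (by omega) hN2 (by omega)

end Signature

/-! ### Formal combinations of monomials -/

section Formal

variable {k : Type u} [Field k] {m : ℕ}

/-- The formal counterpart of a move operator, on formal combinations of matrices. -/
def formalMove (c : Fin (m + 1) → Mat m → Kq k) (P Q : Fin (m + 1)) :
    (Mat m →₀ Kq k) →ₗ[Kq k] (Mat m →₀ Kq k) :=
  open Classical in Finsupp.linearCombination (Kq k) fun T =>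
    ∑ j, if Admissible (mv P Q j T) then Finsupp.single (mv P Q j T) (c j T) else 0

variable (k m) in
/-- The evaluation of formal combinations of matrices at the normalized monomials. -/
def evalMon : (Mat m →₀ Kq k) →ₗ[Kq k] O k m := Finsupp.linearCombination (Kq k) (xNorm k)

lemma evalMon_formalMove {G : O k m →ₗ[Kq k] O k m} {P Q : Fin (m + 1)}
    {c : Fin (m + 1) → Mat m → Kq k} (h : IsMove G P Q c) (v : Mat m →₀ Kq k)
    (hv : ∀ T ∈ v.support, T ∈ indexABC m) :
    evalMon k m (formalMove c P Q v) = G (evalMon k m v) := by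
  classical
  rw [formalMove, Finsupp.linearCombination_apply, Finsupp.sum, map_sum]
  conv_rhs => rw [evalMon, Finsupp.linearCombination_apply, Finsupp.sum, map_sum]
  refine Finset.sum_congr rfl fun T hT => ?_
  rw [map_smul, map_smul, h.apply T (hv T hT), map_sum]
  congr 1
  refine Finset.sum_congr rfl fun j _ => ?_
  split_ifs with hadm
  · rw [evalMon, Finsupp.linearCombination_single]
  · rw [map_zero, xNorm_eq_zero hadm, smul_zero]

lemma formalMove_apply {c : Fin (m + 1) → Mat m → Kq k} {P Q : Fin (m + 1)}
    (hz : ∀ j T, T Q j = 0 → c j T = 0) (v : Mat m →₀ Kq k) {S : Mat m} (hS : Admissible S) :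
    formalMove c P Q v S =
      ∑ j, if S P j = 0 then 0 else v (mv Q P j S) * c j (mv Q P j S) := by
  classical
  have h1 : ∀ T j, v T * ((if Admissible (mv P Q j T) then
      Finsupp.single (mv P Q j T) (c j T) else 0 : Mat m →₀ Kq k) S) =
      if T = mv Q P j S ∧ S P j ≠ 0 then v T * c j T else 0 := by
    intro T j
    by_cases hc : T Q j = 0
    · rw [hz j T hc]; simp
    obtain ⟨N, rfl⟩ := exists_eq_add_unitMat hc
    rw [mv_add]
    by_cases hNS : N + unitMat P j = S
    · subst hNS
      rw [if_pos hS, Finsupp.single_eq_same, mv_add, if_pos ⟨rfl, by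
        rw [Matrix.add_apply, unitMat_apply, if_pos ⟨rfl, rfl⟩]; omega⟩]
    · have hcon : ¬ (N + unitMat Q j = mv Q P j S ∧ S P j ≠ 0) := fun h => by
        obtain ⟨N', hN'⟩ := exists_eq_add_unitMat h.2
        rw [hN', mv_add] at h
        exact hNS (by rw [add_right_cancel h.1, hN'])
      rw [if_neg hcon]
      by_cases h2 : Admissible (N + unitMat P j)
      · rw [if_pos h2, Finsupp.single_eq_of_ne (Ne.symm hNS), mul_zero]
      · rw [if_neg h2, Finsupp.zero_apply, mul_zero]
  rw [formalMove, Finsupp.linearCombination_apply, Finsupp.sum, Finsupp.finsetSum_apply]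
  simp only [Finsupp.smul_apply, Finsupp.finsetSum_apply, smul_eq_mul, Finset.mul_sum, h1]
  rw [Finset.sum_comm]
  refine Finset.sum_congr rfl fun j _ => ?_
  by_cases h0 : S P j = 0
  · rw [if_pos h0]
    exact Finset.sum_eq_zero fun T _ => if_neg fun h => h.2 h0
  · rw [if_neg h0, Finset.sum_eq_single (mv Q P j S)]
    · rw [if_pos ⟨rfl, h0⟩]
    · intro T _ hT
      rw [if_neg fun h => hT h.1]
    · intro hT
      rw [Finsupp.notMem_support_iff.mp hT, zero_mul, ite_self]

lemma formalMove_support {G : O k m →ₗ[Kq k] O k m} {P Q : Fin (m + 1)}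
    {c : Fin (m + 1) → Mat m → Kq k} (h : IsMove G P Q c) (v : Mat m →₀ Kq k)
    (hv : ∀ T ∈ v.support, T ∈ indexABC m) {S : Mat m} (hS : S ∈ (formalMove c P Q v).support) :
    S ∈ indexABC m ∧ ∃ N j, S = N + unitMat P j ∧ N + unitMat Q j ∈ v.support := by
  classical
  have hadm : Admissible S := by
    by_contra hcon
    refine Finsupp.mem_support_iff.mp hS ?_
    rw [formalMove, Finsupp.linearCombination_apply, Finsupp.sum, Finsupp.finsetSum_apply]
    refine Finset.sum_eq_zero fun T _ => ?_
    rw [Finsupp.smul_apply, Finsupp.finsetSum_apply]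
    rw [Finset.sum_eq_zero, smul_zero]
    intro j _
    split_ifs with h1
    · exact Finsupp.single_eq_of_ne fun e => hcon (e ▸ h1)
    · rfl
  rw [Finsupp.mem_support_iff, formalMove_apply h.zero v hadm] at hS
  obtain ⟨j, -, hj⟩ := Finset.exists_ne_zero_of_sum_ne_zero hS
  by_cases h0 : S P j = 0
  · rw [if_pos h0] at hj; exact absurd rfl hj
  rw [if_neg h0] at hj
  obtain ⟨N, rfl⟩ := exists_eq_add_unitMat h0
  rw [mv_add] at hj
  have hmem : N + unitMat Q j ∈ v.support :=
    Finsupp.mem_support_iff.mpr (left_ne_zero_of_mul hj)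
  refine ⟨⟨hadm, ?_⟩, N, j, rfl, hmem⟩
  have := h.last j (N + unitMat Q j) (hv _ hmem) (by
    rw [Matrix.add_apply, unitMat_apply, if_pos ⟨rfl, rfl⟩]; omega)
  rwa [mv_add] at this

/-- A formal combination of matrices of `indexABC` with coefficients regular at `q = 0`. -/
structure IsRegular (v : Mat m →₀ Kq k) : Prop where
  support : ∀ T ∈ v.support, T ∈ indexABC m
  coeff : ∀ T, ∀ i < 0, co k (v T) i = 0

/-- Rescaling by a power of `q`, the leading coefficients become visible. -/
lemma exists_regular_rescale {z : Mat m →₀ Kq k} (hz : ∀ T ∈ z.support, T ∈ indexABC m)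
    (h0 : z ≠ 0) : ∃ n : ℤ, IsRegular (q k ^ (-n) • z) ∧ (∃ T, co k (z T) n ≠ 0) ∧
      (∀ T, ∀ i < n, co k (z T) i = 0) ∧ ∀ T, co k ((q k ^ (-n) • z) T) 0 = co k (z T) n := by
  obtain ⟨T0, hT0⟩ := Finsupp.support_nonempty_iff.mpr h0
  obtain ⟨n, h1, T, hT, h2⟩ := exists_rescale z.support z ⟨T0, hT0, Finsupp.mem_support_iff.mp hT0⟩
  have h1' : ∀ T, ∀ i < n, co k (z T) i = 0 := by
    intro S i hi
    by_cases hS : S ∈ z.support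
    · exact h1 S hS i hi
    · rw [Finsupp.notMem_support_iff.mp hS, co_zero]
  have hco : ∀ S i, co k ((q k ^ (-n) • z) S) i = co k (z S) (i + n) := fun S i => by
    rw [Finsupp.smul_apply, smul_eq_mul, co_zpow_mul, sub_neg_eq_add]
  refine ⟨n, ⟨fun S hS => hz S (Finsupp.support_smul hS), fun S i hi => ?_⟩, ⟨T, h2⟩, h1', fun S => ?_⟩
  · rw [hco]; exact h1' S _ (by omega)
  · rw [hco, zero_add]

/-- The matrices which can occur with a nonzero constant coefficient in regular vectors killed by
the move operator belong to `L`. -/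
def Leading (c : Fin (m + 1) → Mat m → Kq k) (P Q : Fin (m + 1)) (L : Set (Mat m)) : Prop :=
  ∀ v : Mat m →₀ Kq k, IsRegular v → formalMove c P Q v = 0 → ∀ T, co k (v T) 0 ≠ 0 → T ∈ L

/-- The matrices such that the signature of the rows `P`, `Q`, read in the order of columns given
by `σ`, is nowhere positive. -/
def signatureSet (m : ℕ) (σ : Fin (m + 1) ≃ Fin (m + 1)) (P Q : Fin (m + 1)) : Set (Mat m) :=
  {T | ∀ j, signature (fun l => par (σ l) = 1) (fun l => T P (σ l)) (fun l => T Q (σ l)) j ≤ 0}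

lemma co_smul_qInt (c : Kq k) (e : ℤ) (b : ℕ) (i : ℤ) : co k (c * (qInt k (b + 1) * q k ^ e)) i =
    ∑ s ∈ Finset.range (b + 1), co k c (i - e - 2 * b + 4 * s) := by
  rw [qInt, Finset.sum_mul, Finset.mul_sum, co_sum]
  refine Finset.sum_congr rfl fun s _ => ?_
  rw [← zpow_add₀ (q_ne_zero k), mul_comm, co_zpow_mul]
  congr 1
  push_cast; ring

/-- A move operator between even rows, whose coefficients have the shape of those of an even Chevalley
generator, satisfies the signature rule. The rows `P` and `Q` of the matrices vary, all other entries
being fixed, and `coeff_eq_zero_of_lt_depth` is applied to the columns in the order `σ`. -/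
lemma leading_signatureSet {c : Fin (m + 1) → Mat m → Kq k} {P Q : Fin (m + 1)} (hPQ : P ≠ Q)
    (hP : par P = 0) (hQ : par Q = 0) (σ : Fin (m + 1) ≃ Fin (m + 1))
    (hz : ∀ j T, T Q j = 0 → c j T = 0) (e : Mat m → ℤ)
    (hc : ∀ S j, Admissible S → S P j ≠ 0 → Admissible (mv Q P j S) →
      c j (mv Q P j S) = qInt k (S Q j + 1) *
        q k ^ (e S + 2 * pre (fun l => (S P (σ l) : ℤ) - S Q (σ l)) (σ.symm j))) :
    Leading c P Q (signatureSet m σ P Q) := by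
  classical
  intro v hv hker T hT
  have hTmem : T ∈ v.support := by
    rw [Finsupp.mem_support_iff]; intro h; rw [h, co_zero] at hT; exact hT rfl
  -- the matrix `T` with its rows `P`, `Q` replaced by `a`, `b`
  let X : (Fin (m + 1) → ℕ) → (Fin (m + 1) → ℕ) → Mat m := fun a b =>
    Matrix.of fun i j => if i = P then a (σ.symm j) else if i = Q then b (σ.symm j) else T i j
  have hXP : ∀ a b j, X a b P j = a (σ.symm j) := fun a b j => by simp [X]
  have hXQ : ∀ a b j, X a b Q j = b (σ.symm j) := fun a b j => by simp [X, hPQ.symm]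
  have hXT : X (fun l => T P (σ l)) (fun l => T Q (σ l)) = T := by
    ext i j
    by_cases h1 : i = P
    · rw [h1]; exact (hXP (fun l => T P (σ l)) (fun l => T Q (σ l)) j).trans (by simp)
    by_cases h2 : i = Q
    · rw [h2]; exact (hXQ (fun l => T P (σ l)) (fun l => T Q (σ l)) j).trans (by simp)
    simp [X, h1, h2]
  have hXadm : ∀ a b, Admissible (X a b) ↔ RowsAdmissible (fun l => par (σ l) = 1) a b := by
    intro a b
    constructor
    · intro h l hl
      have h1 := h P (σ l) (by rw [hP, zero_add]; exact hl)
      have h2 := h Q (σ l) (by rw [hQ, zero_add]; exact hl)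
      rw [hXP, Equiv.symm_apply_apply] at h1
      rw [hXQ, Equiv.symm_apply_apply] at h2
      exact ⟨h1, h2⟩
    · intro h i j hij
      by_cases h1 : i = P
      · rw [h1, hXP]
        rw [h1] at hij
        exact (h (σ.symm j) (by simp only [Equiv.apply_symm_apply]; omega)).1
      by_cases h2 : i = Q
      · rw [h2, hXQ]
        rw [h2] at hij
        exact (h (σ.symm j) (by simp only [Equiv.apply_symm_apply]; omega)).2
      have := (hv.support T hTmem).1 i j hij
      simpa [X, h1, h2] using this
  have hXmv : ∀ a b l, mv Q P (σ l) (X a b) = X (a - Pi.single l 1) (b + Pi.single l 1) := by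
    intro a b l
    ext i j
    rw [mv, Matrix.sub_apply, Matrix.add_apply, unitMat_apply, unitMat_apply]
    have hs : σ l = j ↔ σ.symm j = l := by rw [Equiv.symm_apply_eq, eq_comm]
    by_cases h1 : i = P
    · rw [h1, hXP, hXP, if_neg (fun h : Q = P ∧ σ l = j => hPQ h.1.symm), Pi.sub_apply, Pi.single_apply]
      simp [hs]
    by_cases h2 : i = Q
    · rw [h2, hXQ, hXQ, if_neg (fun h : P = Q ∧ σ l = j => hPQ h.1), Pi.add_apply, Pi.single_apply]
      simp [hs]
    simp [X, h1, h2, Ne.symm h1, Ne.symm h2]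
  have key := coeff_eq_zero_of_lt_depth (k := k) (fun l => par (σ l) = 1)
    (fun a b i => co k (v (X a b)) i) (fun a b i hi => hv.coeff _ i hi) (by
      intro a b i h
      have : v (X a b) = 0 := by
        by_contra hcon
        exact h ((hXadm a b).mp (hv.support _ (Finsupp.mem_support_iff.mpr hcon)).1)
      simp only [this, co_zero]) (by
      intro a b i hab
      have hS := (hXadm a b).mpr hab
      have h0 := formalMove_apply (P := P) hz v hS
      rw [hker, Finsupp.zero_apply, ← Equiv.sum_comp σ] at h0
      have h1 := congrArg (fun z => co k z (i + e (X a b))) h0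
      simp only [co_zero, co_sum] at h1
      refine Eq.trans ?_ h1.symm
      refine Finset.sum_congr rfl fun l _ => ?_
      rw [hXP, Equiv.symm_apply_apply]
      split_ifs with hal
      · rw [co_zero]
      by_cases hadm : Admissible (mv Q P (σ l) (X a b))
      · rw [hc _ _ hS (by rwa [hXP, Equiv.symm_apply_apply]) hadm, co_smul_qInt, hXmv, hXQ,
          Equiv.symm_apply_apply]
        refine Finset.sum_congr rfl fun s _ => ?_
        congr 1
        simp only [hXP, hXQ, Equiv.symm_apply_apply]
        ring
      · have : v (mv Q P (σ l) (X a b)) = 0 := by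
          by_contra hcon
          exact hadm (hv.support _ (Finsupp.mem_support_iff.mpr hcon)).1
        rw [this, zero_mul, co_zero, ← hXmv, this]
        simp only [co_zero, Finset.sum_const_zero])
    (fun l => T P (σ l)) (fun l => T Q (σ l)) 0
  rw [hXT] at key
  intro j
  have h1 := signature_le_depth (fun l => par (σ l) = 1) (fun l => T P (σ l))
    (fun l => T Q (σ l)) j
  by_contra hcon
  exact hT (key (by omega))

lemma pre_rev {n : ℕ} (v : Fin n → ℤ) (j : Fin n) :
    pre (fun l => v (Fin.rev l)) (Fin.rev j) = post v j := by
  rw [pre, post, ← Equiv.sum_comp Fin.revPerm]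
  exact Finset.sum_congr rfl fun l _ => by simp [Fin.rev_lt_rev]

/-- The signature rule for `E_p`, with the columns read from left to right. -/
lemma leading_E (p : Fin m) (hp : par p.succ = 0) :
    Leading (normCoef (eCoef k p) p.castSucc p.succ) p.castSucc p.succ
      (signatureSet m (Equiv.refl _) p.castSucc p.succ) := by
  have hne : p.castSucc ≠ p.succ := Fin.castSucc_lt_succ.ne
  refine leading_signatureSet hne (par_castSucc p) hp _ (isMove_E (k := k) p hp).zero
    (fun S => 1 - ∑ l, ((S p.castSucc l : ℤ) - S p.succ l)) fun S j hS h0 hT => ?_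
  obtain ⟨N, rfl⟩ := exists_eq_add_unitMat h0
  rw [mv_add] at hT ⊢
  have hQ : (N + unitMat p.castSucc j) p.succ j = N p.succ j := by
    rw [Matrix.add_apply, unitMat_apply, if_neg fun h => hne h.1, add_zero]
  have hd : ∀ l, ((N + unitMat p.castSucc j) p.castSucc l : ℤ) -
      ((N + unitMat p.castSucc j) p.succ l : ℕ) =
      ((N p.castSucc l : ℤ) - N p.succ l) + if l = j then 1 else 0 := by
    intro l
    rw [Matrix.add_apply, Matrix.add_apply, unitMat_apply, unitMat_apply,
      if_neg (fun h : p.castSucc = p.succ ∧ j = l => hne h.1)]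
    by_cases h : l = j
    · subst h; simp; ring
    · simp [h, Ne.symm h]
  rw [normCoef_E p hp hT hS, hQ]
  congr 2
  simp only [Equiv.refl_apply, Equiv.refl_symm, hd]
  rw [pre_update, if_neg (lt_irrefl _), Finset.sum_add_distrib,
    sum_eq_pre_post (fun l => (N p.castSucc l : ℤ) - N p.succ l) j]
  simp
  ring

/-- The signature rule for `F_p`, with the columns read from right to left. -/
lemma leading_F (p : Fin m) (hp : par p.succ = 0) :
    Leading (normCoef (fCoef k p) p.succ p.castSucc) p.succ p.castSucc
      (signatureSet m Fin.revPerm p.succ p.castSucc) := by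
  have hne : p.castSucc ≠ p.succ := Fin.castSucc_lt_succ.ne
  refine leading_signatureSet hne.symm hp (par_castSucc p) _ (isMove_F (k := k) p hp).zero
    (fun S => 1 - ∑ l, ((S p.succ l : ℤ) - S p.castSucc l)) fun S j hS h0 hT => ?_
  obtain ⟨N, rfl⟩ := exists_eq_add_unitMat h0
  rw [mv_add] at hT ⊢
  have hQ : (N + unitMat p.succ j) p.castSucc j = N p.castSucc j := by
    rw [Matrix.add_apply, unitMat_apply, if_neg fun h => hne h.1.symm, add_zero]
  have hd : ∀ l, ((N + unitMat p.succ j) p.succ l : ℤ) -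
      ((N + unitMat p.succ j) p.castSucc l : ℕ) =
      ((N p.succ l : ℤ) - N p.castSucc l) + if l = j then 1 else 0 := by
    intro l
    rw [Matrix.add_apply, Matrix.add_apply, unitMat_apply, unitMat_apply,
      if_neg (fun h : p.succ = p.castSucc ∧ j = l => hne h.1.symm)]
    by_cases h : l = j
    · subst h; simp; ring
    · simp [h, Ne.symm h]
  rw [normCoef_F p hp hS hT, hQ]
  congr 2
  have hrev := pre_rev (fun l => ((N + unitMat p.succ j) p.succ l : ℤ) -
      ((N + unitMat p.succ j) p.castSucc l : ℕ)) j
  rw [show (Equiv.symm Fin.revPerm) j = Fin.rev j from rfl]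
  simp only [Fin.revPerm_apply]
  rw [hrev]
  simp only [hd]
  have hpost : post (fun l => ((N p.succ l : ℤ) - N p.castSucc l) + if l = j then 1 else 0) j =
      post (fun l => (N p.succ l : ℤ) - N p.castSucc l) j :=
    post_congr fun l hl => by rw [if_neg hl.ne', add_zero]
  rw [hpost, Finset.sum_add_distrib, sum_eq_pre_post (fun l => (N p.succ l : ℤ) - N p.castSucc l) j]
  simp only [pre_sub, post_sub]
  simp
  ring

/-- The matrices which can lead vectors killed by the odd generator `E_m`: either the last row is
zero, or the first nonzero column of the last two rows has its letters in the upper one. -/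
def oddSet (m : ℕ) (P Q : Fin (m + 1)) : Set (Mat m) :=
  {T | (∀ j, T Q j = 0) ∨ ∃ j, (∀ l < j, T P l = 0 ∧ T Q l = 0) ∧ T P j ≠ 0 ∧ T Q j = 0}

/-- The rule for `E_m`. If the first nonzero column `J` of the last two rows has its letter in the last
row, the relation at the monomial with this letter moved up determines the constant term of the
coefficient, since every other term carries a positive power of `q`. -/
lemma leading_E_odd (p : Fin m) (hp : par p.succ = 1) :
    Leading (normCoef (mCoef k p) p.castSucc p.succ) p.castSucc p.succ
      (oddSet m p.castSucc p.succ) := by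
  have hne : p.castSucc ≠ p.succ := Fin.castSucc_lt_succ.ne
  have hQ := par_eq_one hp
  intro v hv hker T hT
  have hTmem : T ∈ v.support := by
    rw [Finsupp.mem_support_iff]; intro h; rw [h, co_zero] at hT; exact hT rfl
  have hTABC := hv.support T hTmem
  by_contra hcon
  rw [oddSet, Set.mem_ofPred_eq, not_or, not_forall, not_exists] at hcon
  obtain ⟨⟨j1, hj1⟩, hcon⟩ := hcon
  obtain ⟨J, hJ, hmin⟩ := wellFounded_lt.has_min {j | T p.castSucc j ≠ 0 ∨ T p.succ j ≠ 0}
    ⟨j1, Or.inr hj1⟩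
  have hbelow : ∀ l < J, T p.castSucc l = 0 ∧ T p.succ l = 0 := fun l hl => by
    have := hmin l
    by_contra h
    exact this (by rw [Set.mem_ofPred_eq]; tauto) hl
  have hJQ : T p.succ J ≠ 0 := fun h => hcon J ⟨hbelow, hJ.resolve_right (not_not.mpr h), h⟩
  have hpar : ∀ {N : Mat m} {j}, N + unitMat p.succ j ∈ indexABC m → par j = 0 := by
    intro N j h
    refine par_lt (j := Fin.last m) (lt_of_le_of_ne (Fin.le_last j) ?_)
    rintro rfl
    have := h.2
    rw [Matrix.add_apply, unitMat_apply, if_pos ⟨hQ, rfl⟩] at this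
    omega
  obtain ⟨N, rfl⟩ := exists_eq_add_unitMat hJQ
  have hparJ := hpar hTABC
  have hNadm : Admissible N := hTABC.1.of_add
  have hS : Admissible (N + unitMat p.castSucc J) := by
    intro i j hij
    rw [Matrix.add_apply, unitMat_apply, if_neg, add_zero]
    · exact hNadm i j hij
    · rintro ⟨rfl, rfl⟩
      rw [par_castSucc, hparJ] at hij; omega
  have h0 := formalMove_apply (P := p.castSucc) (isMove_E_odd (k := k) p hp).zero v hS
  rw [hker, Finsupp.zero_apply, ← Finset.add_sum_erase _ _ (Finset.mem_univ J), if_neg (by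
    rw [Matrix.add_apply, unitMat_apply, if_pos ⟨rfl, rfl⟩]; omega), mv_add] at h0
  have hN0 : ∀ l < J, N p.castSucc l = 0 ∧ N p.succ l = 0 := fun l hl => by
    have := hbelow l hl
    simp only [Matrix.add_apply] at this
    omega
  have hNQJ : N p.succ J = 0 := by
    have := hTABC.1 p.succ J (by rw [hp, hparJ])
    rw [Matrix.add_apply, unitMat_apply, if_pos ⟨rfl, rfl⟩] at this
    omega
  obtain ⟨s, hs⟩ := normCoef_E_odd (k := k) p hp hparJ hTABC.1
  set W : ℤ := ∑ l, ((N p.castSucc l : ℤ) + N p.succ l) with hW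
  have hWJ := sum_eq_pre_post (fun l => (N p.castSucc l : ℤ) + N p.succ l) J
  have hpre0 : pre (fun l => (N p.castSucc l : ℤ) + N p.succ l) J = 0 :=
    Finset.sum_eq_zero fun l _ => by
      split_ifs with h
      · simp only [(hN0 l h).1, (hN0 l h).2]; rfl
      · rfl
  have hexp : pre (fun l => (N p.castSucc l : ℤ) + N p.succ l) J -
        post (fun l => (N p.castSucc l : ℤ) + N p.succ l) J - N p.castSucc J = - W := by
    rw [hpre0, hW, hWJ, hpre0, hNQJ]; push_cast; ring
  rw [hs, hexp] at h0
  have h1 := congrArg (fun z => co k (q k ^ W * ((-1) ^ s * z)) 0) h0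
  simp only [mul_zero, co_zero] at h1
  have hq : q k ^ W * q k ^ (-W) = 1 := by
    rw [← zpow_add₀ (q_ne_zero k), add_neg_cancel, zpow_zero]
  have hsq : ((-1 : Kq k) ^ s) * (-1) ^ s = 1 := by
    rw [← mul_pow]; simp
  rw [mul_add, mul_add, show q k ^ W * ((-1) ^ s * (v (N + unitMat p.succ J) * ((-1) ^ s *
    q k ^ (-W)))) = (q k ^ W * q k ^ (-W)) * (((-1) ^ s) * (-1) ^ s) * v (N + unitMat p.succ J) by
      ring, hq, hsq, one_mul, one_mul, co_add, Finset.mul_sum, Finset.mul_sum, co_sum] at h1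
  rw [Finset.sum_eq_zero, add_zero] at h1
  · exact hT h1.symm
  · intro j hj
    have hjJ := Finset.ne_of_mem_erase hj
    split_ifs with hz
    · rw [mul_zero, mul_zero, co_zero]
    obtain ⟨N', hN'⟩ := exists_eq_add_unitMat hz
    rw [hN', mv_add]
    by_cases hv0 : v (N' + unitMat p.succ j) = 0
    · rw [hv0, zero_mul, mul_zero, mul_zero, co_zero]
    have hmem := hv.support _ (Finsupp.mem_support_iff.mpr hv0)
    have hparj := hpar hmem
    obtain ⟨s', hs'⟩ := normCoef_E_odd (k := k) p hp hparj hmem.1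
    rw [hs']
    have hN'j : N' p.succ j = 0 := by
      have := hmem.1 p.succ j (by rw [hp, hparj])
      rw [Matrix.add_apply, unitMat_apply, if_pos ⟨rfl, rfl⟩] at this
      omega
    have hrow : ∀ i l, N' i l + (unitMat p.castSucc j : Mat m) i l =
        N i l + (unitMat p.castSucc J : Mat m) i l := fun i l =>
      (congrFun (congrFun hN' i) l).symm
    have hJj : J < j := by
      refine lt_of_le_of_ne (not_lt.mp fun h => ?_) hjJ.symm
      have := hrow p.castSucc j
      rw [unitMat_apply, if_pos ⟨rfl, rfl⟩, unitMat_apply, if_neg (fun e => hjJ e.2.symm),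
        (hN0 j h).1] at this
      omega
    have hd : ∀ l, (N' p.castSucc l : ℤ) + N' p.succ l =
        ((N p.castSucc l : ℤ) + N p.succ l + if l = J then 1 else 0) +
          if l = j then -1 else 0 := by
      intro l
      have h2 := hrow p.castSucc l
      have h3 := hrow p.succ l
      rw [unitMat_apply, unitMat_apply] at h2
      rw [unitMat_apply, unitMat_apply, if_neg (fun e => hne e.1), if_neg (fun e => hne e.1)] at h3
      by_cases hlJ : l = J
      · subst hlJ
        rw [if_neg (fun e => hjJ e.2), if_pos ⟨rfl, rfl⟩] at h2
        rw [if_pos rfl, if_neg (Ne.symm hjJ)]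
        omega
      · rw [if_neg (fun e : p.castSucc = p.castSucc ∧ J = l => hlJ e.2.symm)] at h2
        rw [if_neg hlJ]
        by_cases hlj : l = j
        · subst hlj
          rw [if_pos ⟨rfl, rfl⟩] at h2
          rw [if_pos rfl]; omega
        · rw [if_neg (fun e => hlj e.2.symm)] at h2
          rw [if_neg hlj]; omega
    have hpre : pre (fun l => (N' p.castSucc l : ℤ) + N' p.succ l) j =
        pre (fun l => (N p.castSucc l : ℤ) + N p.succ l) j + 1 := by
      simp only [hd]
      rw [pre_update, pre_update, if_pos hJj, if_neg (lt_irrefl _), add_zero]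
    have hprenn : 0 ≤ pre (fun l => (N p.castSucc l : ℤ) + N p.succ l) j :=
      Finset.sum_nonneg fun l _ => by split_ifs <;> positivity
    have hWj := sum_eq_pre_post (fun l => (N' p.castSucc l : ℤ) + N' p.succ l) j
    have hW' : (∑ l, ((N' p.castSucc l : ℤ) + N' p.succ l)) = W := by
      simp only [hd]
      rw [Finset.sum_add_distrib, Finset.sum_add_distrib, ← hW]
      simp
    have hexp' : pre (fun l => (N' p.castSucc l : ℤ) + N' p.succ l) j -
        post (fun l => (N' p.castSucc l : ℤ) + N' p.succ l) j - N' p.castSucc j =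
        2 * pre (fun l => (N p.castSucc l : ℤ) + N p.succ l) j + 2 - W := by
      rw [← hW', hWj, hpre, hN'j]; push_cast; ring
    rw [hexp']
    have hz : q k ^ W * ((-1) ^ s * (v (N' + unitMat p.succ j) * ((-1) ^ s' *
        q k ^ (2 * pre (fun l => (N p.castSucc l : ℤ) + N p.succ l) j + 2 - W)))) =
        q k ^ (2 * pre (fun l => (N p.castSucc l : ℤ) + N p.succ l) j + 2) *
          (((-1 : ℤ) ^ (s + s') : ℤ) * v (N' + unitMat p.succ j)) := by
      rw [sub_eq_add_neg, zpow_add₀ (q_ne_zero k) _ (-W)]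
      calc _ = (q k ^ W * q k ^ (-W)) * (q k ^ (2 * pre (fun l => (N p.castSucc l : ℤ) +
        N p.succ l) j + 2) * ((-1) ^ (s + s') * v (N' + unitMat p.succ j))) := by rw [pow_add]; ring
        _ = _ := by rw [hq, one_mul]; push_cast; rfl
    rw [hz, co_zpow_mul]
    have hl := hv.coeff (N' + unitMat p.succ j)
      (0 - (2 * pre (fun l => (N p.castSucc l : ℤ) + N p.succ l) j + 2)) (by omega)
    rcases neg_one_pow_eq_or ℤ (s + s') with h | h
    · rw [h, Int.cast_one, one_mul, hl]
    · rw [h, Int.cast_neg, Int.cast_one, neg_one_mul, co_neg, hl, neg_zero]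

end Formal

/-! ### Quantum determinants with repeated rows and the adjoint matrix -/

section Minors

variable {k : Type u} [Field k] {A : Type*} [Ring A] [Algebra (Kq k) A]

/-- The quantum determinant of the matrix with rows `ρ 0, ρ 1, …` of `X`, possibly repeated. -/
def qdetFun (k : Type u) [Field k] {A : Type*} [Ring A] [Algebra (Kq k) A] {r : ℕ}
    (X : Fin r → Fin r → A) (ρ : Fin r → Fin r) : A :=
  ∑ σ : Equiv.Perm (Fin r), (-(q k) ^ 2) ^ len σ • (List.ofFn fun i => X (ρ i) (σ i)).prod

/-- Exchanging two adjacent rows. -/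
lemma qdetFun_swap {r : ℕ} {X : Fin r → Fin r → A} (hX : IsQMatrix k X)
    (ρ : Fin r → Fin r) (t t' : Fin r) (ht : (t' : ℕ) = t + 1) (h : ρ t < ρ t') :
    qdetFun k X (ρ ∘ Equiv.swap t t') = (-(q k) ^ 2) • qdetFun k X ρ := by
  have hne : t ≠ t' := by rintro rfl; omega
  have hq := q_ne_zero k
  rw [qdetFun, qdetFun, sum_pair _ t t' hne, sum_pair _ t t' hne, Finset.smul_sum]
  refine Finset.sum_congr rfl fun σ hσ => ?_
  simp only [Finset.mem_filter, Finset.mem_univ, true_and] at hσ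
  rw [len_mul_swap σ t t' ht hσ]
  obtain ⟨L, R, H⟩ := list_prod_two (fun i => X (ρ i) (σ i)) t t' ht
  have hs : ∀ s, s ≠ t → s ≠ t' → Equiv.swap t t' s = s := fun s h1 h2 =>
    Equiv.swap_apply_of_ne_of_ne h1 h2
  rw [H _ (fun s h1 h2 => by simp [hs s h1 h2]), H _ (fun s h1 h2 => by simp [hs s h1 h2]),
    H _ (fun s h1 h2 => rfl), H _ (fun s h1 h2 => by simp [hs s h1 h2])]
  simp only [Function.comp_apply, Equiv.Perm.mul_apply, Equiv.swap_apply_left,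
    Equiv.swap_apply_right]
  have e1 := hX.anti _ _ _ _ h hσ
  have e2 := hX.diag _ _ _ _ h hσ
  rw [← e1, e2, ← sub_eq_zero]
  simp only [mul_add, add_mul, mul_smul_comm, smul_mul_assoc, smul_add, smul_smul,
    pow_succ (-(q k) ^ 2)]
  generalize (-q k ^ 2) ^ len σ = z
  match_scalars <;> field_simp <;> ring

lemma qdetFun_eq_zero_of_adjacent {r : ℕ} {X : Fin r → Fin r → A}
    (hrow : ∀ i j l, j < l → X i j * X i l = (q k ^ 2) • (X i l * X i j))
    (ρ : Fin r → Fin r) (t t' : Fin r) (ht : (t' : ℕ) = t + 1) (h : ρ t = ρ t') :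
    qdetFun k X ρ = 0 := by
  have hne : t ≠ t' := by rintro rfl; omega
  rw [qdetFun, sum_pair _ t t' hne]
  refine Finset.sum_eq_zero fun σ hσ => ?_
  simp only [Finset.mem_filter, Finset.mem_univ, true_and] at hσ
  rw [len_mul_swap σ t t' ht hσ]
  obtain ⟨L, R, H⟩ := list_prod_two (fun i => X (ρ i) (σ i)) t t' ht
  have hs : ∀ s, s ≠ t → s ≠ t' → Equiv.swap t t' s = s := fun s h1 h2 =>
    Equiv.swap_apply_of_ne_of_ne h1 h2
  rw [H _ (fun s h1 h2 => rfl), H _ (fun s h1 h2 => by simp [hs s h1 h2])]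
  simp only [Equiv.Perm.mul_apply, Equiv.swap_apply_left, Equiv.swap_apply_right]
  rw [← h, hrow _ _ _ hσ]
  simp only [mul_smul_comm, smul_mul_assoc, smul_smul, pow_succ (-(q k) ^ 2)]
  module

/-- A quantum determinant with two equal rows vanishes. -/
lemma qdetFun_eq_zero {r : ℕ} {X : Fin r → Fin r → A} (hX : IsQMatrix k X)
    (hrow : ∀ i j l, j < l → X i j * X i l = (q k ^ 2) • (X i l * X i j))
    (ρ : Fin r → Fin r) (a b : Fin r) (hab : a < b) (h : ρ a = ρ b) : qdetFun k X ρ = 0 := by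
  obtain ⟨n, hn⟩ : ∃ n : ℕ, (b : ℕ) = a + 1 + n := ⟨b - a - 1, by have : (a : ℕ) < b := hab; omega⟩
  have hc : -(q k) ^ 2 ≠ 0 := neg_ne_zero.mpr (pow_ne_zero _ (q_ne_zero k))
  induction n generalizing ρ b with
  | zero => exact qdetFun_eq_zero_of_adjacent hrow ρ a b (by omega) h
  | succ n ih =>
    let b' : Fin r := ⟨b - 1, by omega⟩
    have hb' : (b : ℕ) = b' + 1 := by simp only [b']; omega
    have hab' : a < b' := by rw [Fin.lt_def]; simp only [b']; omega
    have hs : Equiv.swap b' b a = a :=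
      Equiv.swap_apply_of_ne_of_ne hab'.ne hab.ne
    have key : qdetFun k X (ρ ∘ Equiv.swap b' b) = 0 :=
      ih _ b' hab' (by simp [hs, h]) (by simp only [b']; omega)
    rcases lt_trichotomy (ρ b') (ρ b) with h1 | h1 | h1
    · rw [qdetFun_swap hX ρ b' b hb' h1] at key
      exact (smul_eq_zero.mp key).resolve_left hc
    · exact qdetFun_eq_zero_of_adjacent hrow ρ b' b hb' h1
    · have h2 := qdetFun_swap hX (ρ ∘ Equiv.swap b' b) b' b hb' (by simpa using h1)
      rw [key, smul_zero] at h2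
      have h3 : (ρ ∘ Equiv.swap b' b) ∘ Equiv.swap b' b = ρ := by funext s; simp
      rwa [h3] at h2

/-- A quantum matrix has a right adjoint. -/
lemma exists_right_adjoint {r : ℕ} {X : Fin r → Fin r → A} (hX : IsQMatrix k X)
    (hrow : ∀ i j l, j < l → X i j * X i l = (q k ^ 2) • (X i l * X i j)) :
    ∃ R : Fin r → Fin r → A, (∀ i l, ∑ j, X i j * R j l = if i = l then qdet k X else 0) ∧
      ∀ j l, R j l ∈ Algebra.adjoin (Kq k) (Set.range fun p : Fin r × Fin r => X p.1 p.2) := by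
  have hc : -(q k) ^ 2 ≠ 0 := neg_ne_zero.mpr (pow_ne_zero _ (q_ne_zero k))
  rcases r with _ | n
  · exact ⟨fun i => i.elim0, fun i => i.elim0, fun i => i.elim0⟩
  let adj : Fin (n + 1) → Fin (n + 1) → A := fun j l =>
    ∑ σ : Equiv.Perm (Fin (n + 1)) with σ 0 = j, (-(q k) ^ 2) ^ len σ •
      (List.ofFn fun t : Fin n => X (l.succAbove t) (σ t.succ)).prod
  have h1 : ∀ i l, ∑ j, X i j * adj j l = qdetFun k X (Fin.cons i l.succAbove) := by
    intro i l
    rw [qdetFun, ← Finset.sum_fiberwise Finset.univ (fun σ : Equiv.Perm (Fin (n + 1)) => σ 0)]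
    refine Finset.sum_congr rfl fun j _ => ?_
    rw [Finset.mul_sum]
    refine Finset.sum_congr rfl fun σ hσ => ?_
    rw [Finset.mem_filter] at hσ
    rw [List.ofFn_succ, List.prod_cons, Fin.cons_zero, hσ.2, mul_smul_comm]
    simp only [Fin.cons_succ]
  have h2 : ∀ l : Fin (n + 1), ∃ c : Kq k, c ≠ 0 ∧
      qdetFun k X (Fin.cons l l.succAbove) = c • qdet k X := by
    intro l
    have hinj : Function.Injective (Fin.cons l l.succAbove : Fin (n + 1) → Fin (n + 1)) :=
      Fin.cons_injective_iff.mpr ⟨fun ⟨t, ht⟩ => Fin.succAbove_ne l t ht,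
        Fin.succAbove_right_injective⟩
    let ρ : Equiv.Perm (Fin (n + 1)) := Equiv.ofBijective _ (Finite.injective_iff_bijective.mp hinj)
    exact ⟨_, pow_ne_zero (len ρ) hc, qdetRow_eq hX _ ρ rfl⟩
  choose c hc0 hc1 using h2
  refine ⟨fun j l => (c l)⁻¹ • adj j l, fun i l => ?_, fun j l => ?_⟩
  swap
  · refine Subalgebra.smul_mem _ (sum_mem fun σ _ => Subalgebra.smul_mem _ (list_prod_mem ?_) _) _
    intro z hz
    obtain ⟨t, rfl⟩ := List.mem_ofFn.mp hz
    exact Algebra.subset_adjoin ⟨(_, _), rfl⟩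
  simp only [mul_smul_comm, ← Finset.smul_sum, h1]
  split_ifs with h
  · subst h
    rw [hc1, smul_smul, inv_mul_cancel₀ (hc0 i), one_smul]
  · obtain ⟨t, ht⟩ := Fin.exists_succAbove_eq h
    rw [qdetFun_eq_zero hX hrow _ 0 t.succ (Fin.succ_pos t) (by simp [ht]), smul_zero]

end Minors

/-! ### The transposed determinant -/

section Transpose

variable {k : Type u} [Field k] {A : Type*} [Ring A] [Algebra (Kq k) A]

lemma len_inv {r : ℕ} (σ : Equiv.Perm (Fin r)) : len σ⁻¹ = len σ := by
  rw [len, len]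
  refine Finset.card_bij' (fun p _ => (σ⁻¹ p.2, σ⁻¹ p.1)) (fun p _ => (σ p.2, σ p.1)) ?_ ?_ ?_ ?_
  · rintro ⟨a, b⟩ h
    simp only [mem_inversions] at h ⊢
    exact ⟨h.2, by simpa using h.1⟩
  · rintro ⟨a, b⟩ h
    simp only [mem_inversions] at h ⊢
    exact ⟨h.2, by simpa using h.1⟩
  · rintro ⟨a, b⟩ -
    simp
  · rintro ⟨a, b⟩ -
    simp

/-- A permutation other than the identity has a descent. -/
lemma exists_descent {r : ℕ} {σ : Equiv.Perm (Fin r)} (h : σ ≠ 1) :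
    ∃ t t' : Fin r, (t' : ℕ) = t + 1 ∧ σ t' < σ t := by
  by_contra hc
  push Not at hc
  have hmono : Monotone σ := by
    rcases r with _ | r
    · intro a; exact a.elim0
    · rw [Fin.monotone_iff_le_succ]
      intro i
      exact hc _ _ (by simp)
  have hm : StrictMono σ := hmono.strictMono_of_injective σ.injective
  have h1 : (hm.orderIsoOfSurjective σ σ.surjective) = OrderIso.refl _ := Subsingleton.elim _ _
  refine h (Equiv.ext fun a => ?_)
  exact congrArg (fun f : Fin r ≃o Fin r => f a) h1

lemma prod_eq_prod_of_sorted {r : ℕ} {X : Fin r → Fin r → A}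
    (hanti : ∀ i s j l, i < s → l < j → X i j * X s l = X s l * X i j) (σ : Equiv.Perm (Fin r)) :
    ∀ (n : ℕ) (ρ : Equiv.Perm (Fin r)), len (σ * ρ) = n →
      (∀ a b, a < b → σ (ρ b) < σ (ρ a) → ρ a < ρ b) →
      (List.ofFn fun i => X (ρ i) (σ (ρ i))).prod = (List.ofFn fun j => X (σ⁻¹ j) j).prod := by
  intro n
  induction n with
  | zero =>
    intro ρ hρ _
    have : σ * ρ = 1 := by
      by_contra hcon
      obtain ⟨t, t', ht, hlt⟩ := exists_descent hcon
      rw [len, Finset.card_eq_zero] at hρ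
      have : (t, t') ∈ inversions (σ * ρ) := (mem_inversions _ _ _).mpr
        ⟨by rw [Fin.lt_def]; omega, hlt⟩
      simp [hρ] at this
    obtain rfl : ρ = σ⁻¹ := eq_inv_of_mul_eq_one_right this
    simp
  | succ n ih =>
    intro ρ hρ hsort
    have hne : σ * ρ ≠ 1 := by
      intro h
      rw [h, len, Finset.card_eq_zero.mpr] at hρ
      · omega
      · ext ⟨a, b⟩
        simp only [mem_inversions, Equiv.Perm.one_apply, Finset.notMem_empty, iff_false, not_and,
          not_lt]
        exact fun hab => hab.le
    obtain ⟨t, t', ht, hlt⟩ := exists_descent hne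
    have htt : t < t' := by rw [Fin.lt_def]; omega
    have hlt' : (σ * ρ * Equiv.swap t t') t < (σ * ρ * Equiv.swap t t') t' := by
      simpa using hlt
    have hl := len_mul_swap _ t t' ht hlt'
    rw [show σ * ρ * Equiv.swap t t' * Equiv.swap t t' = σ * ρ by simp [mul_assoc]] at hl
    have hs : ∀ s, s ≠ t → s ≠ t' → Equiv.swap t t' s = s := fun s h1 h2 =>
      Equiv.swap_apply_of_ne_of_ne h1 h2
    rw [← ih (ρ * Equiv.swap t t') (by rw [← mul_assoc]; omega)]
    · obtain ⟨L, R, H⟩ := list_prod_two (fun i => X (ρ i) (σ (ρ i))) t t' ht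
      rw [H _ (fun s h1 h2 => rfl), H _ (fun s h1 h2 => by simp [hs s h1 h2])]
      simp only [Equiv.Perm.mul_apply, Equiv.swap_apply_left, Equiv.swap_apply_right]
      have hcomm := hanti _ _ _ _ (hsort t t' htt hlt) hlt
      simp only [Equiv.Perm.mul_apply] at hcomm
      rw [hcomm]
    · intro a b hab h
      simp only [Equiv.Perm.mul_apply] at h ⊢
      have hmono : Equiv.swap t t' a < Equiv.swap t t' b := by
        by_cases hat : a = t
        · subst hat
          by_cases hbt : b = t'
          · subst hbt
            simp only [Equiv.swap_apply_left, Equiv.swap_apply_right] at h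
            exact absurd h (not_lt.mpr hlt.le)
          · rw [Equiv.swap_apply_left, hs b hab.ne' hbt, Fin.lt_def]
            have : (b : ℕ) ≠ t' := fun e => hbt (Fin.ext e)
            have : (a : ℕ) < b := hab
            omega
        · by_cases hat' : a = t'
          · subst hat'
            rw [Equiv.swap_apply_right, hs b (htt.trans hab).ne' hab.ne']
            exact htt.trans hab
          · rw [hs a hat hat']
            by_cases hbt : b = t
            · subst hbt
              rw [Equiv.swap_apply_left]; exact hab.trans htt
            · by_cases hbt' : b = t'
              · subst hbt'
                rw [Equiv.swap_apply_right, Fin.lt_def]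
                have : (a : ℕ) ≠ t := fun e => hat (Fin.ext e)
                have : (a : ℕ) < b := hab
                omega
              · rwa [hs b hbt hbt']
      exact hsort _ _ hmono h

/-- The quantum determinant of the transposed matrix. -/
lemma qdet_transpose {r : ℕ} {X : Fin r → Fin r → A} (hX : IsQMatrix k X) :
    qdet k (fun i j => X j i) = qdet k X := by
  rw [qdet, qdet, ← Equiv.sum_comp (Equiv.inv (Equiv.Perm (Fin r)))]
  refine Finset.sum_congr rfl fun σ _ => ?_
  simp only [Equiv.inv_apply, len_inv]
  congr 1
  exact (prod_eq_prod_of_sorted hX.anti σ _ 1 rfl fun a b hab _ => hab).symm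

end Transpose

/-! ### Transposition -/

section Transposition

variable {k : Type u} [Field k] {m : ℕ}

lemma isQMatrix_blockA : IsQMatrix k (blockA (x k) : Fin m → Fin m → O k m) :=
  (isQSuperMatrix_x k).blockA

lemma blockA_row (i j l : Fin m) (h : j < l) : (blockA (x k) i j : O k m) * blockA (x k) i l =
    (q k ^ 2) • (blockA (x k) i l * blockA (x k) i j) :=
  (isQSuperMatrix_x k).row_even (par_castSucc i) (by simpa using h)

/-- The sign attached to the entry `(i, j)` by transposition: `-1` exactly for `i < j = last`. -/
def transSign (k : Type u) [Field k] {m : ℕ} (i j : Fin (m + 1)) : Kq k :=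
  (-1) ^ (par j * (1 + par i))

variable (k m) in
/-- The transposed supermatrix. -/
def transX (i j : Fin (m + 1)) : O k m := transSign k i j • x k j i

lemma isQSuperMatrix_trans : IsQSuperMatrix k (transX k m) := by
  have H := isQSuperMatrix_x k (m := m)
  have hs : ∀ i j s l : Fin (m + 1), sgn k j i l s = sgn k i j s l := fun i j s l => by
    rw [sgn, sgn, add_comm (par j), add_comm (par l)]
  constructor
  · intro i j h
    rw [transX, smul_mul_smul_comm, H.odd_sq j i (by omega), smul_zero]
  · intro i j l h
    rw [transX, transX, smul_mul_smul_comm, smul_mul_smul_comm, H.col j l i h, smul_comm,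
      mul_comm (transSign k i l), hs]
  · intro i s j h
    rw [transX, transX, smul_mul_smul_comm, smul_mul_smul_comm, H.row j i s h, smul_comm,
      mul_comm (transSign k s j), hs]
  · intro i s j l his hlj
    have := H.anti l j s i hlj his
    have h2 : x k j i * x k l s = sgn k i j s l • (x k l s * x k j i) := by
      rw [this, smul_smul, show sgn k l s j i = sgn k i j s l by
        rw [sgn, sgn, mul_comm, add_comm (par j), add_comm (par l)], sgn_mul_self, one_smul]
    rw [transX, transX, smul_mul_smul_comm, smul_mul_smul_comm, h2, smul_comm,
      mul_comm (transSign k s l)]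
  · intro i s j l his hjl
    have hi := par_lt his
    have hj := par_lt hjl
    have h1 := H.diag' (i := j) (s := l) (j := i) (l := s) hjl his
    have h2 := H.anti' (i := j) (s := l) (j := s) (l := i) hjl his
    rw [transX, transX, transX, transX, smul_mul_smul_comm, smul_mul_smul_comm,
      smul_mul_smul_comm, h1, h2]
    rcases par_cases s with hs | hs <;> rcases par_cases l with hl | hl <;>
    simp [transSign, sgn, hi, hj, hs, hl]

lemma qdet_trans : qdet k (blockA (transX k m)) = detA k m := by
  rw [detA, ← qdet_transpose isQMatrix_blockA]
  congr 1
  funext i j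
  simp [blockA, transX, transSign, par_castSucc]

/-- The transposition of the quantum supermatrix, as an algebra homomorphism. -/
def trans : O k m →ₐ[Kq k] O k m :=
  lift (transX k m) isQSuperMatrix_trans (detInv k m) (lastInv k m)
    (by rw [qdet_trans, detA_mul_detInv]) (by rw [qdet_trans, detInv_mul_detA])
    (by simp [transX, transSign, par_last, last_mul_lastInv])
    (by simp [transX, transSign, par_last, lastInv_mul_last])

lemma trans_x (i j : Fin (m + 1)) : trans (x k i j) = transSign k i j • x k j i :=
  lift_x _ _ _ _ _ _ _ _ _ _

lemma trans_detA : trans (detA k m) = detA k m := by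
  rw [detA, map_qdet]
  refine Eq.trans ?_ qdet_trans
  congr 1
  funext i j
  exact trans_x _ _

/-- Moving a letter to its place across letters with which it commutes up to a sign. -/
lemma letter_mul_of_commute (s t : Fin (m + 1)) (N : Mat m)
    (h : ∀ i j, (i < s ∨ i = s ∧ j < t) → N i j ≠ 0 →
      ∃ e : ℕ, x k s t * x k i j = (-1 : Kq k) ^ e • (x k i j * x k s t)) :
    ∃ e : ℕ, x k s t * xMon k N = (-1 : Kq k) ^ e • xMon k (N + unitMat s t) := by
  induction N using peel_left_induction with
  | h0 => exact ⟨0, by rw [xMon_zero, mul_one, zero_add, xMon_unitMat, pow_zero, one_smul]⟩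
  | h M i j hl ih =>
    by_cases hlt : i < s ∨ i = s ∧ j < t
    · obtain ⟨e, he⟩ := h i j hlt (by rw [Matrix.add_apply, unitMat_apply, if_pos ⟨rfl, rfl⟩]; omega)
      obtain ⟨e', he'⟩ := ih fun a b hab hM => h a b hab (by rw [Matrix.add_apply]; omega)
      refine ⟨e + e', ?_⟩
      rw [xMon_add_left hl, ← mul_assoc, he, smul_mul_assoc, mul_assoc, he', mul_smul_comm,
        smul_smul, ← pow_add, add_right_comm, xMon_add_left (hl.add_unitMat (by omega))]
    · refine ⟨0, ?_⟩
      rw [pow_zero, one_smul, xMon_add_left ((hl.mono (s := s) (t := t) (by omega)).add_unitMat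
        (s := i) (t := j) (by omega))]

lemma unitMat_transpose (i j : Fin (m + 1)) : (unitMat i j : Mat m).transpose = unitMat j i := by
  ext s t
  rw [Matrix.transpose_apply, unitMat_apply, unitMat_apply]
  simp only [and_comm]

/-- Transposition permutes the ordered monomials up to sign: it exchanges the lexicographic orders by
rows and by columns, and the letters which change their relative order commute up to sign. -/
lemma trans_xMon (M : Mat m) :
    ∃ e : ℕ, trans (xMon k M) = (-1 : Kq k) ^ e • xMon k M.transpose := by
  induction M using peel_left_induction with
  | h0 => exact ⟨0, by simp [xMon_zero]⟩
  | h N i j hl ih =>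
    obtain ⟨e, he⟩ := ih
    obtain ⟨e', he'⟩ := letter_mul_of_commute (k := k) j i N.transpose fun s t hst hN => by
      rw [Matrix.transpose_apply] at hN
      have hit : i < t ∧ s < j := by
        by_contra hcon
        exact hN (hl t s (by omega))
      have := (isQSuperMatrix_x k (m := m)).anti t i s j
      have h2 := (isQSuperMatrix_x k (m := m)).anti s j t i hit.2 hit.1
      refine ⟨(par s + par t) * (par j + par i), ?_⟩
      rw [h2, smul_smul, sgn, ← pow_add, Even.neg_one_pow ⟨_, rfl⟩, one_smul]
    obtain ⟨e'', he''⟩ : ∃ e : ℕ, transSign k i j = (-1) ^ e := ⟨_, rfl⟩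
    refine ⟨e'' + (e + e'), ?_⟩
    rw [xMon_add_left hl, map_mul, trans_x, he, smul_mul_smul_comm, he', smul_smul, he'',
      ← pow_add, ← pow_add, add_assoc, Matrix.transpose_add, unitMat_transpose]

lemma normExp_transpose (M : Mat m) : normExp M.transpose = normExp M := by
  rw [normExp, normExp]
  have h : ∀ M : Mat m, (∑ i, ∑ j, ∑ l, if j < l then (-1 : ℤ) ^ par i * (M i j * M i l : ℕ) else 0)
      = ∑ l, ∑ s, ∑ t, if s < t then (-1 : ℤ) ^ par l * (M.transpose s l * M.transpose t l : ℕ)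
        else 0 := fun M => rfl
  rw [h, h]
  simp only [Matrix.transpose_transpose]
  ring

lemma trans_xNorm (M : Mat m) :
    ∃ e : ℕ, trans (xNorm k M) = (-1 : Kq k) ^ e • xNorm k M.transpose := by
  obtain ⟨e, he⟩ := trans_xMon (k := k) M
  exact ⟨e, by rw [xNorm, xNorm, map_smul, he, normExp_transpose, smul_comm]⟩

end Transposition

/-! ### The determinant of the even block -/

section Determinant

variable {k : Type u} [Field k] {m : ℕ}

lemma opE_one (p : Fin m) : opE p (1 : O k m) = 0 := by simpa using opE_mul p (1 : O k m) 1

lemma opF_one (p : Fin m) : opF p (1 : O k m) = 0 := by simpa using opF_mul p (1 : O k m) 1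

/-- A skew derivation of a product all but one of whose factors it kills. -/
lemma skew_prod_one (T : O k m →ₗ[Kq k] O k m) (α β : O k m →ₐ[Kq k] O k m)
    (hT : ∀ f g, T (f * g) = α f * T g + T f * β g) : ∀ {r : ℕ} (F : Fin r → O k m) (t : Fin r),
    (∀ s, s ≠ t → T (F s) = 0) → (∀ s, s < t → α (F s) = F s) → (∀ s, t < s → β (F s) = F s) →
      T (List.ofFn F).prod = (List.ofFn (Function.update F t (T (F t)))).prod
  | 0, _, t, _, _, _ => t.elim0
  | r + 1, F, t, h1, h2, h3 => by
    rw [List.ofFn_succ, List.prod_cons, hT, List.ofFn_succ, List.prod_cons]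
    have hT1 : T 1 = 0 := by simpa using hT 1 1
    induction t using Fin.cases with
    | zero =>
      have hz : ∀ l : List (O k m), (∀ a ∈ l, T a = 0) → T l.prod = 0 := by
        intro l
        induction l with
        | nil => intro _; simpa using hT1
        | cons a l ih =>
          intro hl
          rw [List.prod_cons, hT, ih fun b hb => hl b (List.mem_cons_of_mem _ hb),
            hl a List.mem_cons_self, mul_zero, zero_mul, add_zero]
      rw [hz _ (by
        intro a ha
        rw [List.mem_ofFn] at ha
        obtain ⟨i, rfl⟩ := ha
        exact h1 _ (Fin.succ_ne_zero i)), mul_zero, zero_add, Function.update_self, map_list_prod,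
        List.map_ofFn]
      congr 3
      funext i
      rw [Function.comp_apply, h3 _ (Fin.succ_pos i),
        Function.update_of_ne (Fin.succ_ne_zero i)]
    | succ t =>
      rw [h1 0 (Fin.succ_ne_zero t).symm, zero_mul, add_zero, h2 0 (Fin.succ_pos t),
        Function.update_of_ne (Fin.succ_ne_zero t).symm,
        skew_prod_one T α β hT (fun i => F i.succ) t (fun s hs => h1 _ (by simpa using hs))
        (fun s hs => h2 _ (by simpa using hs)) (fun s hs => h3 _ (by simpa using hs))]
      congr 3
      funext i
      by_cases h : i = t
      · subst h; simp
      · rw [Function.update_of_ne h, Function.update_of_ne (by simpa using h)]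

/-- An operator which replaces row `b` by row `a` kills the determinant. -/
lemma skew_detA (T : O k m →ₗ[Kq k] O k m) (α β : O k m →ₐ[Kq k] O k m)
    (hT : ∀ f g, T (f * g) = α f * T g + T f * β g) (a b : Fin m) (hab : a ≠ b)
    (hx : ∀ i j : Fin m, T (blockA (x k) i j) = if i = b then blockA (x k) a j else 0)
    (hα : ∀ i j : Fin m, i < b → α (blockA (x k) i j) = blockA (x k) i j)
    (hβ : ∀ i j : Fin m, b < i → β (blockA (x k) i j) = blockA (x k) i j) :
    T (detA k m) = 0 := by
  have h : T (detA k m) = qdetFun k (blockA (x k)) (Function.update id b a) := by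
    rw [detA, qdet, map_sum, qdetFun]
    refine Finset.sum_congr rfl fun σ _ => ?_
    rw [map_smul, skew_prod_one T α β hT _ b (fun s hs => by rw [hx, if_neg hs])
      (fun s hs => hα _ _ hs) (fun s hs => hβ _ _ hs)]
    congr 3
    funext i
    by_cases hi : i = b
    · subst hi; rw [Function.update_self, Function.update_self, hx, if_pos rfl]
    · rw [Function.update_of_ne hi, Function.update_of_ne hi, id]
  rw [h]
  rcases lt_or_gt_of_ne hab with h | h
  · refine qdetFun_eq_zero isQMatrix_blockA blockA_row _ a b h ?_
    rw [Function.update_self, Function.update_of_ne hab, id]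
  · refine qdetFun_eq_zero isQMatrix_blockA blockA_row _ b a h ?_
    rw [Function.update_self, Function.update_of_ne hab, id]

lemma exists_castSucc_eq_succ (p : Fin m) (hp : par p.succ = 0) : ∃ p' : Fin m, p'.castSucc = p.succ ∧
    (p' : ℕ) = p + 1 := by
  have h : p.succ ≠ Fin.last m := succ_ne_last hp
  exact ⟨p.succ.castPred h, Fin.castSucc_castPred _ h, rfl⟩

lemma opKKinv_x (p : Fin m) (i j : Fin (m + 1)) :
    opKKinv p (x k i j) = (((kappa k p i)⁻¹ : (Kq k)ˣ) : Kq k) • x k i j := by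
  rw [opKKinv, scale_x, Pi.one_apply, mul_one]

lemma opKK_x (p : Fin m) (i j : Fin (m + 1)) :
    opKK p (x k i j) = ((kappa k p i : (Kq k)ˣ) : Kq k) • x k i j := by
  rw [opKK, scale_x, Pi.one_apply, mul_one]

lemma kappa_eq_one (p : Fin m) {i : Fin (m + 1)} (h1 : i ≠ p.castSucc) (h2 : i ≠ p.succ) :
    kappa k p i = 1 := by
  ext; rw [kappa_other p h1 h2, Units.val_one]

lemma opE_detA (p : Fin m) : opE p (detA k m) = 0 := by
  rcases par_cases p.succ with hp | hp
  · obtain ⟨p', hp', hp''⟩ := exists_castSucc_eq_succ p hp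
    refine skew_detA (opE p) (opP p) (opKKinv p) (opE_mul p) p p' (by
      intro h; rw [h] at hp''; omega) (fun i j => ?_) (fun i j _ => opP_even p hp _)
      (fun i j hi => ?_)
    · rw [blockA, opE_x, ← hp']
      simp [blockA]
    · rw [blockA, opKKinv_x, kappa_eq_one, inv_one, Units.val_one, one_smul]
      · rw [Ne, Fin.castSucc_inj]; rintro rfl; rw [Fin.lt_def] at hi; omega
      · rw [← hp', Ne, Fin.castSucc_inj]; exact hi.ne'
  · have hz : ∀ l : List (O k m), (∀ a ∈ l, opE p a = 0) → opE p l.prod = 0 := by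
      intro l
      induction l with
      | nil => intro _; exact opE_one p
      | cons a l ih =>
        intro hl
        rw [List.prod_cons, opE_mul, ih fun b hb => hl b (List.mem_cons_of_mem _ hb),
          hl a List.mem_cons_self, mul_zero, zero_mul, add_zero]
    rw [detA, qdet, map_sum]
    refine Finset.sum_eq_zero fun σ _ => ?_
    rw [map_smul, hz, smul_zero]
    intro a ha
    rw [List.mem_ofFn] at ha
    obtain ⟨i, rfl⟩ := ha
    rw [blockA, opE_x, par_eq_one hp, if_neg (Fin.castSucc_lt_last i).ne]

lemma opF_detA (p : Fin m) (hp : par p.succ = 0) : opF p (detA k m) = 0 := by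
  obtain ⟨p', hp', hp''⟩ := exists_castSucc_eq_succ p hp
  refine skew_detA (opF p) ((opP p).comp (opKK p)) (AlgHom.id _ _) (opF_mul p) p' p (by
    intro h; rw [h] at hp''; omega) (fun i j => ?_) (fun i j hi => ?_)
    (fun i j _ => rfl)
  · rw [blockA, opF_x, ← hp']
    simp [blockA]
  · rw [AlgHom.comp_apply, opP_even p hp, blockA, opKK_x, kappa_eq_one, Units.val_one, one_smul]
    · rw [Ne, Fin.castSucc_inj]; exact hi.ne
    · rw [← hp', Ne, Fin.castSucc_inj]; rintro rfl; rw [Fin.lt_def] at hi; omega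

/-! ### Commutation with the determinant -/

lemma prodFirst_kappa (p : Fin m) (hp : par p.succ = 0) : prodFirst (kappa k p) = 1 := by
  obtain ⟨p', hp', hp''⟩ := exists_castSucc_eq_succ p hp
  have hne : p ≠ p' := by intro h; rw [h] at hp''; omega
  rw [prodFirst, Finset.prod_eq_mul p p' hne]
  · ext
    rw [hp', Units.val_mul, kappa_castSucc, kappa_succ_even p hp,
      mul_inv_cancel₀ (pow_ne_zero 2 (q_ne_zero k)), Units.val_one]
  · rintro i - ⟨h1, h2⟩
    exact kappa_eq_one p (by simpa using h1) (by rw [← hp']; simpa using h2)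
  · simp
  · simp

lemma opKK_detA (p : Fin m) (hp : par p.succ = 0) : opKK p (detA k m) = detA k m := by
  rw [opKK, scale_detA, prodFirst_kappa p hp]; simp [prodFirst]

lemma opKKinv_detA (p : Fin m) (hp : par p.succ = 0) : opKKinv p (detA k m) = detA k m := by
  nth_rw 1 [← opKK_detA p hp]
  exact opKKinv_opKK p _

/-- Relations of commutation with the determinant are transported by the generators, which kill it. -/
lemma detA_comm_opF (p : Fin m) (hp : par p.succ = 0) {z : O k m} {c : Kq k}
    (h : detA k m * z = c • (z * detA k m)) :
    detA k m * opF p z = c • (opF p z * detA k m) := by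
  have := congrArg (opF p) h
  rwa [map_smul, opF_mul, opF_mul, opF_detA p hp, zero_mul, mul_zero, add_zero, zero_add,
    opKK_detA p hp, opP_even p hp] at this

lemma detA_comm_opE (p : Fin m) (hp : par p.succ = 0) {z : O k m} {c : Kq k}
    (h : detA k m * z = c • (z * detA k m)) :
    detA k m * opE p z = c • (opE p z * detA k m) := by
  have := congrArg (opE p) h
  rwa [map_smul, opE_mul, opE_mul, opE_detA p, zero_mul, mul_zero, add_zero, zero_add,
    opKKinv_detA p hp, opP_even p hp] at this

lemma list_prod_comm {A : Type*} [Ring A] [Algebra (Kq k) A] (z : A) : ∀ {r : ℕ} (F : Fin r → A)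
    (c : Fin r → Kq k), (∀ s, F s * z = c s • (z * F s)) →
      (List.ofFn F).prod * z = (∏ s, c s) • (z * (List.ofFn F).prod)
  | 0, F, c, _ => by simp
  | r + 1, F, c, h => by
    rw [List.ofFn_succ, List.prod_cons, mul_assoc,
      list_prod_comm z (fun i => F i.succ) (fun i => c i.succ) (fun s => h _), mul_smul_comm,
      ← mul_assoc, h, smul_mul_assoc, smul_smul, Fin.prod_univ_succ, mul_comm (c 0), mul_assoc]

/-- A relation of commutation for the first row holds for all rows, by the action of the `F_p`. -/
lemma detA_comm_of_rows {j : Fin (m + 1)} {c : Kq k}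
    (h0 : ∀ i : Fin m, (i : ℕ) = 0 → detA k m * x k i.castSucc j = c • (x k i.castSucc j * detA k m))
    (i : Fin m) : detA k m * x k i.castSucc j = c • (x k i.castSucc j * detA k m) := by
  obtain ⟨n, hn⟩ : ∃ n, (i : ℕ) = n := ⟨_, rfl⟩
  induction n generalizing i with
  | zero => exact h0 i hn
  | succ n ih =>
    let p : Fin m := ⟨n, by omega⟩
    have hps : p.succ = i.castSucc := by ext; simp [p, hn]
    have hp : par p.succ = 0 := by rw [hps, par_castSucc]
    have := detA_comm_opF p hp (ih p rfl)
    rwa [opF_x, if_pos rfl, hps] at this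

/-- For the first row, the last column is passed factor by factor in each term of the determinant. -/
lemma detA_comm_B (i : Fin m) : detA k m * x k i.castSucc (Fin.last m) =
    (q k ^ 2) • (x k i.castSucc (Fin.last m) * detA k m) := by
  refine detA_comm_of_rows (fun i hi => ?_) i
  have H := isQSuperMatrix_x k (m := m)
  rw [detA, qdet, Finset.sum_mul, Finset.mul_sum, Finset.smul_sum]
  refine Finset.sum_congr rfl fun σ _ => ?_
  rw [smul_mul_assoc, list_prod_comm (k := k) _ _ (fun s => if s = i then q k ^ 2 else 1)]
  · rw [Finset.prod_ite_eq' Finset.univ i, if_pos (Finset.mem_univ _), mul_smul_comm, smul_comm]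
  · intro s
    split_ifs with hs
    · subst hs
      exact H.row_even (par_castSucc s) (Fin.castSucc_lt_last _)
    · rw [one_smul]
      have hlt : i.castSucc < s.castSucc := by
        rw [Fin.castSucc_lt_castSucc_iff, Fin.lt_def]
        have : (s : ℕ) ≠ i := fun e => hs (Fin.ext e)
        omega
      have := H.anti' (j := Fin.last m) (l := (σ s).castSucc) hlt (Fin.castSucc_lt_last _)
      rw [par_castSucc, mul_zero, pow_zero, one_smul] at this
      exact this.symm

/-- For the first row and the last even column, the letter can be passed factor by factor in each term
of the determinant, and the two powers of `q` which occur cancel. -/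
lemma detA_comm_last_col (i j : Fin m) (hj : (j : ℕ) + 1 = m) :
    detA k m * x k i.castSucc j.castSucc = x k i.castSucc j.castSucc * detA k m := by
  have hq := pow_ne_zero 2 (q_ne_zero k)
  rw [detA_comm_of_rows (c := 1) (fun i hi => ?_) i, one_smul]
  have H := isQSuperMatrix_x k (m := m)
  rw [detA, qdet, Finset.sum_mul, Finset.mul_sum, Finset.smul_sum]
  refine Finset.sum_congr rfl fun σ _ => ?_
  rw [smul_mul_assoc, list_prod_comm (k := k) _ _ (fun s => (if s = i then q k ^ 2 else 1) *
    if s = σ.symm j then (q k ^ 2)⁻¹ else 1)]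
  · rw [Finset.prod_mul_distrib, Finset.prod_ite_eq' Finset.univ i,
      Finset.prod_ite_eq' Finset.univ (σ.symm j), if_pos (Finset.mem_univ _),
      if_pos (Finset.mem_univ _), mul_inv_cancel₀ hq, mul_smul_comm, smul_comm]
  · intro s
    have hσ : s = σ.symm j ↔ σ s = j := by rw [Equiv.eq_symm_apply]
    have hle : σ s ≠ j → (σ s).castSucc < j.castSucc := fun h => by
      rw [Fin.castSucc_lt_castSucc_iff, Fin.lt_def]
      have : (σ s : ℕ) ≠ j := fun e => h (Fin.ext e)
      omega
    have hlt : s ≠ i → i.castSucc < s.castSucc := fun hs => by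
      rw [Fin.castSucc_lt_castSucc_iff, Fin.lt_def]
      have : (s : ℕ) ≠ i := fun e => hs (Fin.ext e)
      omega
    by_cases hs : s = i
    · subst hs
      rw [if_pos rfl]
      by_cases h2 : σ s = j
      · rw [if_pos (hσ.mpr h2), mul_inv_cancel₀ hq, one_smul, blockA, h2]
      · rw [if_neg (fun e => h2 (hσ.mp e)), mul_one]
        exact H.row_even (par_castSucc s) (hle h2)
    · rw [if_neg hs, one_mul]
      by_cases h2 : σ s = j
      · rw [if_pos (hσ.mpr h2), blockA, h2, H.col_even (par_castSucc j) (hlt hs), smul_smul,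
          inv_mul_cancel₀ hq, one_smul]
      · rw [if_neg (fun e => h2 (hσ.mp e)), one_smul]
        have := H.anti' (hlt hs) (hle h2)
        rw [par_castSucc, zero_mul, pow_zero, one_smul] at this
        exact this.symm

/-- The quantum determinant of the even block commutes with the entries of this block. -/
lemma detA_comm_A (i j : Fin m) :
    detA k m * x k i.castSucc j.castSucc = x k i.castSucc j.castSucc * detA k m := by
  obtain ⟨n, hn⟩ : ∃ n, (i : ℕ) + 1 + n = m := ⟨m - 1 - i, by omega⟩
  induction n generalizing i with
  | zero =>
    have := congrArg trans (detA_comm_last_col (k := k) j i hn)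
    simpa [trans_x, trans_detA, transSign, par_castSucc] using this
  | succ n ih =>
    let p' : Fin m := ⟨i + 1, by omega⟩
    have hps : i.succ = p'.castSucc := by ext; simp [p']
    have hp : par i.succ = 0 := by rw [hps, par_castSucc]
    have := detA_comm_opE i hp (z := x k p'.castSucc j.castSucc) (c := 1) (by
      rw [one_smul]; exact ih p' (by simp only [p']; omega))
    rwa [opE_x, if_pos hps.symm, one_smul] at this

lemma detA_comm_C (j : Fin m) : detA k m * x k (Fin.last m) j.castSucc =
    (q k ^ 2) • (x k (Fin.last m) j.castSucc * detA k m) := by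
  have := congrArg trans (detA_comm_B (k := k) j)
  simpa [trans_x, trans_detA, transSign, par_castSucc, par_last] using this

/-- The weight with which an entry commutes with the determinant of the even block. -/
lemma detA_comm_x (i j : Fin (m + 1)) (h : ¬ (i = Fin.last m ∧ j = Fin.last m)) :
    detA k m * x k i j = q k ^ (2 * (par i + par j)) • (x k i j * detA k m) := by
  rcases Fin.eq_castSucc_or_eq_last i with ⟨i, rfl⟩ | rfl <;>
    rcases Fin.eq_castSucc_or_eq_last j with ⟨j, rfl⟩ | rfl
  · rw [detA_comm_A, par_castSucc, par_castSucc, pow_zero, one_smul]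
  · rw [detA_comm_B, par_castSucc, par_last]
  · rw [detA_comm_C, par_castSucc, par_last]
  · exact absurd ⟨rfl, rfl⟩ h

/-! ### The leading term of the determinant -/

/-- The permutation matrix of `σ`, inside the even block. -/
def permMat (σ : Equiv.Perm (Fin m)) : Mat m := ∑ i, unitMat i.castSucc (σ i).castSucc

lemma permMat_apply (σ : Equiv.Perm (Fin m)) (i j : Fin m) :
    permMat σ i.castSucc j.castSucc = if σ i = j then 1 else 0 := by
  rw [permMat, Matrix.sum_apply, Finset.sum_eq_single i]
  · simp [unitMat_apply]
  · intro s _ hs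
    simp [unitMat_apply, hs]
  · simp

lemma permMat_last_row (σ : Equiv.Perm (Fin m)) (j : Fin (m + 1)) :
    permMat σ (Fin.last m) j = 0 := by
  rw [permMat, Matrix.sum_apply]
  exact Finset.sum_eq_zero fun s _ => by
    rw [unitMat_apply, if_neg fun h => (Fin.castSucc_lt_last s).ne h.1]

lemma permMat_last_col (σ : Equiv.Perm (Fin m)) (i : Fin (m + 1)) :
    permMat σ i (Fin.last m) = 0 := by
  rw [permMat, Matrix.sum_apply]
  exact Finset.sum_eq_zero fun s _ => by
    rw [unitMat_apply, if_neg fun h => (Fin.castSucc_lt_last _).ne h.2]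

lemma prod_ofFn_ite {A : Type*} [Monoid A] : ∀ {r : ℕ} (F : Fin r → A) (j : Fin r),
    (List.ofFn fun t => F t ^ (if j = t then 1 else 0)).prod = F j
  | 0, _, j => j.elim0
  | r + 1, F, j => by
    rw [List.ofFn_succ, List.prod_cons]
    induction j using Fin.cases with
    | zero =>
      rw [if_pos rfl, pow_one, List.prod_eq_one, mul_one]
      intro a ha
      rw [List.mem_ofFn] at ha
      obtain ⟨i, rfl⟩ := ha
      rw [if_neg (Fin.succ_ne_zero i).symm, pow_zero]
    | succ j =>
      rw [if_neg (Fin.succ_ne_zero j), pow_zero, one_mul]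
      simpa using prod_ofFn_ite (fun t => F t.succ) j

lemma xMon_permMat (σ : Equiv.Perm (Fin m)) :
    xMon k (permMat σ) = (List.ofFn fun i => blockA (x k) i (σ i)).prod := by
  rw [xMon, List.ofFn_succ', List.concat_eq_append, List.prod_append, List.prod_singleton]
  have hlast : (List.ofFn fun j => x k (Fin.last m) j ^ permMat σ (Fin.last m) j).prod = 1 := by
    simp [permMat_last_row]
  rw [hlast, mul_one]
  congr 2
  funext i
  rw [List.ofFn_succ', List.concat_eq_append, List.prod_append, List.prod_singleton,
    permMat_last_col, pow_zero, mul_one]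
  simp only [permMat_apply]
  exact prod_ofFn_ite (fun j : Fin m => x k i.castSucc j.castSucc) (σ i)

lemma permMat_below {σ : Equiv.Perm (Fin m)} (h : σ ≠ 1) : Below (permMat σ) (permMat 1) := by
  induction hn : len σ generalizing σ with
  | zero =>
    obtain ⟨t, t', ht, hlt⟩ := exists_descent h
    have : (t, t') ∈ inversions σ := (mem_inversions _ _ _).mpr ⟨by rw [Fin.lt_def]; omega, hlt⟩
    rw [len, Finset.card_eq_zero] at hn
    simp [hn] at this
  | succ n ih =>
    obtain ⟨t, t', ht, hlt⟩ := exists_descent h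
    have htt : t < t' := by rw [Fin.lt_def]; omega
    have hl := len_mul_swap (σ * Equiv.swap t t') t t' ht (by simpa using hlt)
    rw [show σ * Equiv.swap t t' * Equiv.swap t t' = σ by simp [mul_assoc]] at hl
    have hmem : t' ∈ Finset.univ.erase t := Finset.mem_erase.mpr ⟨htt.ne', Finset.mem_univ _⟩
    have split : ∀ π : Equiv.Perm (Fin m), permMat π =
        (∑ i ∈ (Finset.univ.erase t).erase t', unitMat i.castSucc (π i).castSucc) +
          unitMat t'.castSucc (π t').castSucc + unitMat t.castSucc (π t).castSucc := fun π => by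
      rw [permMat, ← Finset.sum_erase_add _ _ (Finset.mem_univ t), ← Finset.sum_erase_add _ _ hmem]
    have hstep : Below (permMat σ) (permMat (σ * Equiv.swap t t')) := by
      rw [split, split (σ * Equiv.swap t t')]
      have hsum : (∑ i ∈ (Finset.univ.erase t).erase t',
          (unitMat i.castSucc ((σ * Equiv.swap t t') i).castSucc : Mat m)) =
          ∑ i ∈ (Finset.univ.erase t).erase t', unitMat i.castSucc (σ i).castSucc := by
        refine Finset.sum_congr rfl fun i hi => ?_
        rw [Equiv.Perm.mul_apply, Equiv.swap_apply_of_ne_of_ne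
          (Finset.ne_of_mem_erase (Finset.mem_of_mem_erase hi)) (Finset.ne_of_mem_erase hi)]
      rw [hsum, Equiv.Perm.mul_apply, Equiv.Perm.mul_apply, Equiv.swap_apply_left,
        Equiv.swap_apply_right, add_right_comm, add_right_comm (∑ i ∈ _, _) _
        (unitMat t.castSucc (σ t').castSucc)]
      exact step_units _ (by simpa using htt) (by simpa using hlt)
    by_cases h1 : σ * Equiv.swap t t' = 1
    · rwa [h1] at hstep
    · exact hstep.trans (ih h1 (by omega))

lemma hasLead_detA : HasLead (detA k m) (permMat 1) := by
  refine ⟨1, one_mem _, by rw [inv_one]; exact one_mem _, one_ne_zero, ?_⟩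
  rw [detA, qdet, ← Finset.add_sum_erase _ _ (Finset.mem_univ 1)]
  have h1 : len (1 : Equiv.Perm (Fin m)) = 0 := by
    rw [len, Finset.card_eq_zero]
    ext ⟨a, b⟩
    simp only [mem_inversions, Equiv.Perm.one_apply, Finset.notMem_empty, iff_false, not_and,
      not_lt]
    exact fun hab => hab.le
  rw [h1, pow_zero, ← xMon_permMat, add_sub_cancel_left]
  refine sum_mem fun σ hσ => ?_
  rw [← xMon_permMat]
  refine smul_mem_of_ZQ (pow_mem (neg_mem (q_pow_mem_ZQ _)) _) ?_
  exact Submodule.subset_span ⟨_, permMat_below (Finset.ne_of_mem_erase hσ), rfl⟩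

end Determinant

/-! ### Linear independence of the monomials -/

section Independence

variable {k : Type u} [Field k] {m : ℕ}

/-- A matrix satisfying the lattice conditions of all generators `E_p` is upper triangular. -/
lemma upper_of_lattice {T : Mat m}
    (hE : ∀ p : Fin m, par p.succ = 0 → T ∈ signatureSet m (Equiv.refl _) p.castSucc p.succ)
    (hO : ∀ p : Fin m, par p.succ = 1 → T ∈ oddSet m p.castSucc p.succ) (i : Fin (m + 1)) :
    ∀ j < i, T i j = 0 := by
  induction i using Fin.induction with
  | zero => exact fun j hj => absurd hj (Fin.not_lt_zero j)
  | succ p ih =>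
    intro j hj
    have hjp : ∀ l < j, l < p.castSucc := fun l hl => by
      rw [Fin.lt_def] at *; simp at *; omega
    rcases par_cases p.succ with hp | hp
    · have h := hE p hp j
      have hpre : 0 ≤ pre (fun l => (T p.succ l : ℤ) - T p.castSucc l) j := by
        refine Finset.sum_nonneg fun l _ => ?_
        split_ifs with hl
        · simp only [ih l (hjp l hl)]; simp
        · exact le_rfl
      have hm : movable (fun l => par l = 1) (T p.castSucc) (T p.succ) j = T p.succ j := by
        rw [movable, if_neg]
        rintro ⟨h1, -⟩
        rw [par_lt hj] at h1
        exact zero_ne_one h1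
      have h' : movable (fun l => par l = 1) (T p.castSucc) (T p.succ) j +
        pre (fun l => (T p.succ l : ℤ) - T p.castSucc l) j ≤ 0 := h
      rw [hm] at h'
      omega
    · rcases hO p hp with h | ⟨J, h1, h2, h3⟩
      · exact h j
      · have hJ : p.castSucc ≤ J := not_lt.mp fun h => h2 (ih J h)
        have hjJ : j ≤ J := by
          rw [Fin.lt_def] at hj; rw [Fin.le_def] at *; simp at *; omega
        rcases hjJ.lt_or_eq with h | rfl
        · exact (h1 j h).2
        · exact h3

/-- The field containing the coordinate ring of the diagonal torus. -/
abbrev TorusField (k : Type u) [Field k] (m : ℕ) : Type u :=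
  FractionRing (MvPolynomial (Fin (m + 1)) (Kq k))

variable (k m) in
/-- The generic diagonal matrix. -/
def torusX (i j : Fin (m + 1)) : TorusField k m :=
  if i = j then algebraMap _ _ (MvPolynomial.X i : MvPolynomial (Fin (m + 1)) (Kq k)) else 0

lemma torusX_self_ne_zero (i : Fin (m + 1)) : torusX k m i i ≠ 0 := by
  rw [torusX, if_pos rfl]
  exact (map_ne_zero_iff _ (IsFractionRing.injective _ _)).mpr (MvPolynomial.X_ne_zero i)

lemma torusX_of_ne {i j : Fin (m + 1)} (h : i ≠ j) : torusX k m i j = 0 := if_neg h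

lemma isQSuperMatrix_torus : IsQSuperMatrix k (torusX k m) where
  odd_sq i j h := by
    rw [torusX_of_ne, mul_zero]
    rintro rfl; omega
  row i j l h := by
    by_cases h1 : i = j
    · rw [torusX_of_ne (h1.trans_lt h).ne, mul_zero, zero_mul, smul_zero]
    · rw [torusX_of_ne h1, mul_zero, zero_mul, smul_zero]
  col i s j h := by
    by_cases h1 : i = j
    · rw [torusX_of_ne (i := s) (j := j) (fun e => h.ne (h1.trans e.symm)), mul_zero, zero_mul,
        smul_zero]
    · rw [torusX_of_ne h1, mul_zero, zero_mul, smul_zero]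
  anti i s j l h h' := by
    by_cases h1 : i = j
    · rw [torusX_of_ne (h'.trans (h1 ▸ h)).ne', mul_zero, zero_mul, smul_zero]
    · rw [torusX_of_ne h1, mul_zero, zero_mul, smul_zero]
  diag i s j l h h' := by
    have h0 : torusX k m i l * torusX k m s j = 0 := by
      by_cases h1 : i = l
      · rw [torusX_of_ne (h'.trans (h1 ▸ h)).ne', mul_zero]
      · rw [torusX_of_ne h1, zero_mul]
    rw [h0, smul_zero, add_zero]
    by_cases h1 : i = j
    · by_cases h2 : s = l
      · rw [h1, h2, sgn, Even.neg_one_pow, one_smul, mul_comm]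
        exact Even.mul_right ⟨_, rfl⟩ _
      · rw [torusX_of_ne h2, mul_zero, zero_mul, smul_zero]
    · rw [torusX_of_ne h1, mul_zero, zero_mul, smul_zero]

lemma qdet_torus_ne_zero : qdet k (blockA (torusX k m)) ≠ 0 := by
  rw [qdet, Finset.sum_eq_single 1]
  · rw [Ne, smul_eq_zero, not_or]
    refine ⟨pow_ne_zero _ (neg_ne_zero.mpr (pow_ne_zero _ (q_ne_zero k))), ?_⟩
    rw [List.prod_ofFn]
    exact Finset.prod_ne_zero_iff.mpr fun i _ => torusX_self_ne_zero _
  · intro σ _ hσ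
    have : ∃ i, σ i ≠ i := by
      by_contra hcon
      push Not at hcon
      exact hσ (Equiv.ext hcon)
    obtain ⟨i, hi⟩ := this
    rw [List.prod_ofFn, Finset.prod_eq_zero (Finset.mem_univ i), smul_zero]
    rw [blockA, torusX_of_ne]
    rw [Ne, Fin.castSucc_inj]; exact hi.symm
  · intro h; exact absurd (Finset.mem_univ _) h

/-- The restriction of functions to the diagonal torus. -/
def torusHom : O k m →ₐ[Kq k] TorusField k m :=
  lift (torusX k m) isQSuperMatrix_torus (qdet k (blockA (torusX k m)))⁻¹
    (torusX k m (Fin.last m) (Fin.last m))⁻¹ (mul_inv_cancel₀ qdet_torus_ne_zero)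
    (inv_mul_cancel₀ qdet_torus_ne_zero) (mul_inv_cancel₀ (torusX_self_ne_zero _))
    (inv_mul_cancel₀ (torusX_self_ne_zero _))

lemma torusHom_x (i j : Fin (m + 1)) : torusHom (x k i j) = torusX k m i j :=
  lift_x _ _ _ _ _ _ _ _ _ _

lemma torusHom_xMon (M : Mat m) : torusHom (xMon k M) = ∏ i, ∏ j, torusX k m i j ^ M i j := by
  rw [xMon, map_list_prod, List.map_ofFn, List.prod_ofFn]
  refine Finset.prod_congr rfl fun i _ => ?_
  rw [Function.comp_apply, map_list_prod, List.map_ofFn, List.prod_ofFn]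
  refine Finset.prod_congr rfl fun j _ => ?_
  rw [Function.comp_apply, map_pow, torusHom_x]

lemma torusHom_xMon_of_not_diag {M : Mat m} {i j : Fin (m + 1)} (hij : i ≠ j) (h : M i j ≠ 0) :
    torusHom (xMon k M) = 0 := by
  rw [torusHom_xMon]
  refine Finset.prod_eq_zero (Finset.mem_univ i) (Finset.prod_eq_zero (Finset.mem_univ j) ?_)
  rw [torusX_of_ne hij, zero_pow h]

lemma torusHom_xMon_of_diag {M : Mat m} (h : ∀ i j, i ≠ j → M i j = 0) :
    torusHom (xMon k M) = algebraMap _ (TorusField k m) (MvPolynomial.monomial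
      (Finsupp.equivFunOnFinite.symm fun i => M i i) (1 : Kq k)) := by
  rw [torusHom_xMon, MvPolynomial.monomial_eq, map_one, one_mul, Finsupp.prod_fintype _ _ (by simp),
    map_prod]
  refine Finset.prod_congr rfl fun i _ => ?_
  rw [Finset.prod_eq_single i, torusX, if_pos rfl, map_pow]
  · rfl
  · intro j _ hj
    rw [h i j hj.symm, pow_zero]
  · simp

/-- A combination of monomials which vanishes has no diagonal terms. -/
lemma eq_zero_of_diag {v : Mat m →₀ Kq k} (hv : evalMon k m v = 0) {T : Mat m}
    (hT : ∀ i j, i ≠ j → T i j = 0) : v T = 0 := by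
  classical
  have h := congrArg torusHom hv
  rw [evalMon, Finsupp.linearCombination_apply, Finsupp.sum, map_sum, map_zero] at h
  let D : Finset (Mat m) := v.support.filter fun M => ∀ i j, i ≠ j → M i j = 0
  let P : MvPolynomial (Fin (m + 1)) (Kq k) := ∑ M ∈ D, MvPolynomial.monomial
      (Finsupp.equivFunOnFinite.symm fun i => M i i) (v M * q k ^ normExp M)
  have hP : algebraMap _ (TorusField k m) P = 0 := by
    rw [← h, map_sum, ← Finset.sum_filter_add_sum_filter_not v.support
      (fun M => ∀ i j, i ≠ j → M i j = 0), Finset.sum_eq_zero (f := fun M =>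
        torusHom (v M • xNorm k M)) (s := v.support.filter fun M => ¬ ∀ i j, i ≠ j → M i j = 0),
      add_zero]
    · refine Finset.sum_congr rfl fun M hM => ?_
      rw [xNorm, smul_smul, map_smul, torusHom_xMon_of_diag (Finset.mem_filter.mp hM).2]
      rw [← mul_one (v M * q k ^ normExp M), ← smul_eq_mul, ← MvPolynomial.smul_monomial,
        smul_eq_mul, mul_one]
      exact algebraMap.coe_smul ..
    · intro M hM
      have := (Finset.mem_filter.mp hM).2
      push Not at this
      obtain ⟨i, j, hij, h0⟩ := this
      rw [xNorm, map_smul, map_smul, torusHom_xMon_of_not_diag hij h0, smul_zero, smul_zero]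
  have hP0 : P = 0 := (map_eq_zero_iff _ (IsFractionRing.injective _ _)).mp hP
  by_contra hcon
  have hTD : T ∈ D := Finset.mem_filter.mpr ⟨Finsupp.mem_support_iff.mpr hcon, hT⟩
  have hc := congrArg (MvPolynomial.coeff (Finsupp.equivFunOnFinite.symm fun i => T i i)) hP0
  rw [MvPolynomial.coeff_sum, MvPolynomial.coeff_zero, Finset.sum_eq_single T] at hc
  · rw [MvPolynomial.coeff_monomial, if_pos rfl] at hc
    exact hcon ((mul_eq_zero.mp hc).resolve_right (zpow_ne_zero _ (q_ne_zero k)))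
  · intro M hM hMT
    rw [MvPolynomial.coeff_monomial, if_neg]
    intro e
    refine hMT ?_
    ext i j
    by_cases hij : i = j
    · subst hij
      exact congrFun (Finsupp.equivFunOnFinite.symm.injective e) i
    · rw [hT i j hij, (Finset.mem_filter.mp hM).2 i j hij]
  · exact fun h => absurd hTD h

/-- The sum of `i + j` over the letters `x_{ij}`. -/
def height (M : Mat m) : ℕ := ∑ i : Fin (m + 1), ∑ j : Fin (m + 1), M i j * (i + j)

lemma height_add (M N : Mat m) : height (M + N) = height M + height N := by
  simp only [height, Matrix.add_apply, add_mul, Finset.sum_add_distrib]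

lemma height_unitMat (i j : Fin (m + 1)) : height (unitMat i j) = i + j :=
  sum_unitMat_mul (fun i j => (i : ℕ) + j) i j

lemma height_transpose (M : Mat m) : height M.transpose = height M := by
  unfold height
  rw [Finset.sum_comm]
  simp only [Matrix.transpose_apply, add_comm]

/-- The formal counterpart of transposition. -/
lemma exists_formal_trans (v : Mat m →₀ Kq k) : ∃ w : Mat m →₀ Kq k,
    evalMon k m w = trans (evalMon k m v) ∧ ∀ T, ∃ e : ℕ, w T.transpose = (-1) ^ e * v T := by
  classical
  choose e he using fun T : Mat m => trans_xNorm (k := k) T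
  refine ⟨Finsupp.linearCombination (Kq k)
    (fun T : Mat m => Finsupp.single T.transpose ((-1 : Kq k) ^ e T)) v, ?_, fun T => ⟨e T, ?_⟩⟩
  · rw [Finsupp.linearCombination_apply, Finsupp.sum, map_sum]
    conv_rhs => rw [evalMon, Finsupp.linearCombination_apply, Finsupp.sum, map_sum]
    refine Finset.sum_congr rfl fun T _ => ?_
    rw [map_smul, map_smul, he, evalMon, Finsupp.linearCombination_single]
  · rw [Finsupp.linearCombination_apply, Finsupp.sum, Finsupp.finsetSum_apply]
    have h1 : ∀ S ∈ v.support, (v S • Finsupp.single S.transpose ((-1 : Kq k) ^ e S)) T.transpose =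
        if S = T then (-1) ^ e T * v T else 0 := by
      intro S _
      rw [Finsupp.smul_apply, smul_eq_mul]
      split_ifs with h
      · subst h; rw [Finsupp.single_eq_same, mul_comm]
      · rw [Finsupp.single_eq_of_ne, mul_zero]
        exact fun h' => h (Matrix.transpose_injective h').symm
    rw [Finset.sum_congr rfl h1, Finset.sum_ite_eq' v.support T]
    split_ifs with h
    · rfl
    · rw [Finsupp.notMem_support_iff.mp h, mul_zero]

lemma transpose_mem_indexABC {T : Mat m} : T.transpose ∈ indexABC m ↔ T ∈ indexABC m := by
  have h : ∀ T : Mat m, T ∈ indexABC m → T.transpose ∈ indexABC m := fun T hT =>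
    ⟨fun i j hij => hT.1 j i (by omega), hT.2⟩
  exact ⟨fun hT => by simpa using h _ hT, h T⟩

/-- A formal combination which evaluates to zero, and which is killed by all formal generators
`E_p`, has only upper triangular leading terms. -/
lemma upper_of_formalMove {v : Mat m →₀ Kq k} (hv : IsRegular v)
    (hE : ∀ p : Fin m, par p.succ = 0 →
      formalMove (normCoef (eCoef k p) p.castSucc p.succ) p.castSucc p.succ v = 0)
    (hO : ∀ p : Fin m, par p.succ = 1 →
      formalMove (normCoef (mCoef k p) p.castSucc p.succ) p.castSucc p.succ v = 0) {T : Mat m}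
    (hT : co k (v T) 0 ≠ 0) (i j : Fin (m + 1)) (hij : j < i) : T i j = 0 :=
  upper_of_lattice (fun p hp => leading_E p hp v hv (hE p hp) T hT)
    (fun p hp => leading_E_odd p hp v hv (hO p hp) T hT) i j hij

lemma height_formalMove {G : O k m →ₗ[Kq k] O k m} {p : Fin m}
    {c : Fin (m + 1) → Mat m → Kq k} (h : IsMove G p.castSucc p.succ c) {v : Mat m →₀ Kq k}
    (hv : ∀ T ∈ v.support, T ∈ indexABC m) {n : ℕ} (hn : ∀ T ∈ v.support, height T < n + 1)
    (S : Mat m) (hS : S ∈ (formalMove c p.castSucc p.succ v).support) : height S < n := by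
  obtain ⟨-, N, j, rfl, hN⟩ := formalMove_support h v hv hS
  have := hn _ hN
  rw [height_add, height_unitMat] at this ⊢
  simp at this ⊢
  omega

/-- The normalized monomials `x(M)`, `M ∈ indexABC`, are linearly independent. By induction on the
height, a relation is killed by all formal `E_p`, so that its leading terms are upper triangular; the
same holds for the transposed relation. The leading terms are therefore diagonal, which the torus
excludes. -/
theorem eq_zero_of_evalMon_eq_zero (v : Mat m →₀ Kq k) (hv : ∀ T ∈ v.support, T ∈ indexABC m)
    (h0 : evalMon k m v = 0) : v = 0 := by
  obtain ⟨n, hn⟩ : ∃ n, ∀ T ∈ v.support, height T < n :=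
    ⟨v.support.sup height + 1, fun T hT => Nat.lt_succ_of_le (Finset.le_sup hT)⟩
  induction n generalizing v with
  | zero =>
    rw [← Finsupp.support_eq_empty]
    exact Finset.eq_empty_of_forall_notMem fun T hT => absurd (hn T hT) (Nat.not_lt_zero _)
  | succ n ih =>
    have kill : ∀ w : Mat m →₀ Kq k, (∀ T ∈ w.support, T ∈ indexABC m) → evalMon k m w = 0 →
        (∀ T ∈ w.support, height T < n + 1) → ∀ {G : O k m →ₗ[Kq k] O k m} {p : Fin m}
        {c : Fin (m + 1) → Mat m → Kq k}, IsMove G p.castSucc p.succ c →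
        formalMove c p.castSucc p.succ w = 0 := by
      intro w hw hw0 hwn G p c hG
      refine ih _ (fun S hS => (formalMove_support hG w hw hS).1) ?_ (height_formalMove hG hw hwn)
      rw [evalMon_formalMove hG w hw, hw0, map_zero]
    have smul_formal : ∀ {c : Fin (m + 1) → Mat m → Kq k} {P Q : Fin (m + 1)} (a : Kq k)
        {w : Mat m →₀ Kq k}, formalMove c P Q w = 0 → formalMove c P Q (a • w) = 0 := by
      intro c P Q a w hw; rw [map_smul, hw, smul_zero]
    by_contra hcon
    obtain ⟨N, hregv, ⟨T, hT⟩, hN1, hN2⟩ := exists_regular_rescale hv hcon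
    obtain ⟨w, hw1, hw2⟩ := exists_formal_trans v
    have hwsupp : ∀ S ∈ w.support, S.transpose ∈ v.support := by
      intro S hS
      obtain ⟨e, he⟩ := hw2 S.transpose
      rw [Matrix.transpose_transpose] at he
      rw [Finsupp.mem_support_iff] at hS ⊢
      intro h; rw [h, mul_zero] at he; exact hS he
    have hwABC : ∀ S ∈ w.support, S ∈ indexABC m := fun S hS =>
      transpose_mem_indexABC.mp (hv _ (hwsupp S hS))
    have hw0 : evalMon k m w = 0 := by rw [hw1, h0, map_zero]
    have hwn : ∀ S ∈ w.support, height S < n + 1 := fun S hS => by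
      rw [← height_transpose]; exact hn _ (hwsupp S hS)
    have hcow : ∀ S i, co k ((q k ^ (-N) • w) S) i = co k (v S.transpose) (i + N) ∨
        co k ((q k ^ (-N) • w) S) i = - co k (v S.transpose) (i + N) := by
      intro S i
      obtain ⟨e, he⟩ := hw2 S.transpose
      rw [Matrix.transpose_transpose] at he
      rw [Finsupp.smul_apply, smul_eq_mul, co_zpow_mul, sub_neg_eq_add]
      rcases neg_one_pow_eq_or (Kq k) e with h | h
      · left; rw [he, h, one_mul]
      · right; rw [he, h, neg_one_mul, co_neg]
    have hregw : IsRegular (q k ^ (-N) • w) := by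
      refine ⟨fun S hS => hwABC S (Finsupp.support_smul hS), fun S i hi => ?_⟩
      have := hN1 S.transpose (i + N) (by omega)
      rcases hcow S i with h | h
      · rw [h, this]
      · rw [h, this, neg_zero]
    have hdiag : ∀ i j, i ≠ j → T i j = 0 := by
      intro i j hij
      rcases lt_or_gt_of_ne hij with h | h
      · refine upper_of_formalMove hregw
          (fun p hp => smul_formal _ (kill w hwABC hw0 hwn (isMove_E p hp)))
          (fun p hp => smul_formal _ (kill w hwABC hw0 hwn (isMove_E_odd p hp)))
          (T := T.transpose) ?_ j i h
        rcases hcow T.transpose 0 with h' | h'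
        · rw [h', zero_add]; exact hT
        · rw [h', neg_ne_zero, zero_add]; exact hT
      · refine upper_of_formalMove hregv
          (fun p hp => smul_formal _ (kill v hv h0 hn (isMove_E p hp)))
          (fun p hp => smul_formal _ (kill v hv h0 hn (isMove_E_odd p hp))) ?_ i j h
        rw [hN2]; exact hT
    refine hT ?_
    rw [eq_zero_of_diag h0 hdiag, co_zero]

lemma linearIndependent_xNorm :
    LinearIndependent (Kq k) (fun T : indexABC m => xNorm k (T : Mat m)) := by
  rw [linearIndependent_iff]
  intro l hl
  have h := eq_zero_of_evalMon_eq_zero (l.mapDomain Subtype.val) (fun T hT => by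
    classical
    obtain ⟨S, -, rfl⟩ := Finset.mem_image.mp (Finsupp.mapDomain_support hT)
    exact S.2) (by rw [evalMon, Finsupp.linearCombination_mapDomain]; exact hl)
  exact Finsupp.mapDomain_injective Subtype.val_injective (by rw [h, Finsupp.mapDomain_zero])

end Independence

/-! ### The relations of the blocks -/

section Blocks

variable {k : Type u} [Field k] {m : ℕ}

variable (k) in
/-- The entries of the block `A`. -/
def xA (i j : Fin m) : O k m := x k i.castSucc j.castSucc

variable (k) in
/-- The entries of the block `B`. -/
def xB (i : Fin m) : O k m := x k i.castSucc (Fin.last m)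

variable (k) in
/-- The entries of the block `C`. -/
def xC (j : Fin m) : O k m := x k (Fin.last m) j.castSucc

variable (k m) in
/-- The entry of the block `D`. -/
def xD : O k m := x k (Fin.last m) (Fin.last m)

variable (k) in
/-- The structure constant `q² - q⁻²`. -/
def lam : Kq k := q k ^ 2 - (q k ^ 2)⁻¹

lemma AA_row (i : Fin m) {j l : Fin m} (h : j < l) :
    xA k i j * xA k i l = q k ^ 2 • (xA k i l * xA k i j) :=
  (isQSuperMatrix_x k).row_even (par_castSucc i) (by simpa using h)

lemma AA_col {i s : Fin m} (j : Fin m) (h : i < s) :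
    xA k i j * xA k s j = q k ^ 2 • (xA k s j * xA k i j) :=
  (isQSuperMatrix_x k).col_even (par_castSucc j) (by simpa using h)

lemma AA_anti {i s j l : Fin m} (h : i < s) (h' : l < j) :
    xA k i j * xA k s l = xA k s l * xA k i j := by
  have := (isQSuperMatrix_x (m := m) k).anti' (i := i.castSucc) (s := s.castSucc)
    (j := j.castSucc) (l := l.castSucc) (by simpa using h) (by simpa using h')
  simpa [par_castSucc, xA, xB, xC, xD, lam] using this

lemma AA_diag {i s j l : Fin m} (h : i < s) (h' : j < l) :
    xA k i j * xA k s l = xA k s l * xA k i j + lam k • (xA k i l * xA k s j) := by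
  have := (isQSuperMatrix_x (m := m) k).diag' (i := i.castSucc) (s := s.castSucc)
    (j := j.castSucc) (l := l.castSucc) (by simpa using h) (by simpa using h')
  simpa [par_castSucc, xA, xB, xC, xD, lam] using this

lemma AB_row (i j : Fin m) : xA k i j * xB k i = q k ^ 2 • (xB k i * xA k i j) :=
  (isQSuperMatrix_x k).row_even (par_castSucc i) (Fin.castSucc_lt_last j)

lemma BA_anti {i s : Fin m} (l : Fin m) (h : i < s) : xB k i * xA k s l = xA k s l * xB k i := by
  have := (isQSuperMatrix_x (m := m) k).anti' (i := i.castSucc) (s := s.castSucc)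
    (j := Fin.last m) (l := l.castSucc) (by simpa using h) (Fin.castSucc_lt_last l)
  simpa [par_castSucc, xA, xB, xC, xD, lam] using this

lemma AB_diag {i s : Fin m} (j : Fin m) (h : i < s) :
    xA k i j * xB k s = xB k s * xA k i j + lam k • (xB k i * xA k s j) := by
  have := (isQSuperMatrix_x (m := m) k).diag' (i := i.castSucc) (s := s.castSucc)
    (j := j.castSucc) (l := Fin.last m) (by simpa using h) (Fin.castSucc_lt_last j)
  simpa [par_castSucc, xA, xB, xC, xD, lam] using this

lemma AC_col (i j : Fin m) : xA k i j * xC k j = q k ^ 2 • (xC k j * xA k i j) :=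
  (isQSuperMatrix_x k).col_even (par_castSucc j) (Fin.castSucc_lt_last i)

lemma AC_anti (i : Fin m) {j l : Fin m} (h : l < j) : xA k i j * xC k l = xC k l * xA k i j := by
  have := (isQSuperMatrix_x (m := m) k).anti' (i := i.castSucc) (s := Fin.last m)
    (j := j.castSucc) (l := l.castSucc) (Fin.castSucc_lt_last i) (by simpa using h)
  simpa [par_castSucc, xA, xB, xC, xD, lam] using this

lemma AC_diag (i : Fin m) {j l : Fin m} (h : j < l) :
    xA k i j * xC k l = xC k l * xA k i j + lam k • (xA k i l * xC k j) := by
  have := (isQSuperMatrix_x (m := m) k).diag' (i := i.castSucc) (s := Fin.last m)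
    (j := j.castSucc) (l := l.castSucc) (Fin.castSucc_lt_last i) (by simpa using h)
  simpa [par_castSucc, xA, xB, xC, xD, lam] using this

lemma BB_self (i : Fin m) : xB k i * xB k i = 0 :=
  (isQSuperMatrix_x k).odd_sq _ _ (by rw [par_castSucc, par_last])

lemma BB {i s : Fin m} (h : i < s) : xB k i * xB k s = (-(q k ^ 2)⁻¹) • (xB k s * xB k i) := by
  have := (isQSuperMatrix_x (m := m) k).col_odd (i := i.castSucc) (s := s.castSucc)
    (j := Fin.last m) par_last (by simpa using h)
  simpa [par_castSucc, xA, xB, xC, xD, lam] using this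

lemma CC_self (i : Fin m) : xC k i * xC k i = 0 :=
  (isQSuperMatrix_x k).odd_sq _ _ (by rw [par_castSucc, par_last])

lemma CC {i s : Fin m} (h : i < s) : xC k i * xC k s = (-(q k ^ 2)⁻¹) • (xC k s * xC k i) := by
  have := (isQSuperMatrix_x (m := m) k).row_odd (i := Fin.last m) (j := i.castSucc)
    (l := s.castSucc) par_last (by simpa using h)
  simpa [par_castSucc, xA, xB, xC, xD, lam] using this

lemma BC (i l : Fin m) : xB k i * xC k l = -(xC k l * xB k i) := by
  have := (isQSuperMatrix_x (m := m) k).anti' (i := i.castSucc) (s := Fin.last m)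
    (j := Fin.last m) (l := l.castSucc) (Fin.castSucc_lt_last i) (Fin.castSucc_lt_last l)
  simpa [par_last, xA, xB, xC, xD, lam] using this

lemma CB (i l : Fin m) : xC k l * xB k i = -(xB k i * xC k l) := by rw [BC, neg_neg]

lemma BD (i : Fin m) : xB k i * xD k m = (q k ^ 2)⁻¹ • (xD k m * xB k i) := by
  have := (isQSuperMatrix_x (m := m) k).col_odd (i := i.castSucc) (s := Fin.last m)
    (j := Fin.last m) par_last (Fin.castSucc_lt_last i)
  simpa [par_last, xA, xB, xC, xD, lam] using this

lemma CD (j : Fin m) : xC k j * xD k m = (q k ^ 2)⁻¹ • (xD k m * xC k j) := by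
  have := (isQSuperMatrix_x (m := m) k).row_odd (i := Fin.last m) (j := j.castSucc)
    (l := Fin.last m) par_last (Fin.castSucc_lt_last j)
  simpa [par_last, xA, xB, xC, xD, lam] using this

lemma AD (i j : Fin m) :
    xA k i j * xD k m = xD k m * xA k i j - lam k • (xB k i * xC k j) := by
  have := (isQSuperMatrix_x (m := m) k).diag' (i := i.castSucc) (s := Fin.last m)
    (j := j.castSucc) (l := Fin.last m) (Fin.castSucc_lt_last i) (Fin.castSucc_lt_last j)
  rw [sub_eq_add_neg, ← neg_smul]
  simpa [par_last, xA, xB, xC, xD, lam] using this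

variable (k m) in
/-- The subalgebra generated by the entries of `A` and by the inverse of its determinant. -/
def evenPart : Subalgebra (Kq k) (O k m) :=
  Algebra.adjoin (Kq k) (insert (detInv k m) (Set.range fun p : Fin m × Fin m => xA k p.1 p.2))

variable (k m) in
lemma exists_right_inverse : ∃ R : Fin m → Fin m → O k m,
    (∀ i l, ∑ j, xA k i j * R j l = if i = l then 1 else 0) ∧ ∀ j l, R j l ∈ evenPart k m := by
  obtain ⟨R, hR, hR'⟩ := exists_right_adjoint (k := k) isQMatrix_blockA (fun i j l h => AA_row i h)
  refine ⟨fun j l => R j l * detInv k m, fun i l => ?_, fun j l => ?_⟩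
  · simp only [← mul_assoc, ← Finset.sum_mul]
    rw [show ∑ j, xA k i j * R j l = _ from hR i l]
    split_ifs
    · exact detA_mul_detInv k
    · exact zero_mul _
  · refine mul_mem (Algebra.adjoin_mono (Set.subset_insert _ _) (hR' j l)) ?_
    exact Algebra.subset_adjoin (Set.mem_insert _ _)

end Blocks

/-! ### The inverse of the block `A` -/

section Inverse

variable {k : Type u} [Field k] {m : ℕ}

variable (k m) in
/-- Transposition turns a right inverse into an inverse for the opposite product. -/
lemma exists_opposite_inverse : ∃ R : Fin m → Fin m → O k m,
    ∀ i l, ∑ j, xA k j i * R j l = if i = l then 1 else 0 := by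
  obtain ⟨R, hR, -⟩ := exists_right_inverse k m
  refine ⟨fun j l => trans (R j l), fun i l => ?_⟩
  have h := congrArg trans (hR i l)
  rw [map_sum, apply_ite trans, map_one, map_zero] at h
  rw [← h]
  refine Finset.sum_congr rfl fun j _ => ?_
  rw [map_mul]
  congr 1
  rw [xA, xA, trans_x]
  simp [transSign, par_castSucc]

lemma right_cancel_eq {γ γ' : Fin m → O k m} (h : ∀ s, ∑ j, γ j * xA k s j = ∑ j, γ' j * xA k s j)
    (j : Fin m) : γ j = γ' j := by
  obtain ⟨R, hR⟩ := exists_opposite_inverse k m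
  have h1 : ∑ s, (∑ i, γ i * xA k s i) * R s j = ∑ s, (∑ i, γ' i * xA k s i) * R s j := by
    simp only [h]
  simp only [Finset.sum_mul, mul_assoc] at h1
  rw [Finset.sum_comm, Finset.sum_comm (f := fun s i => γ' i * (xA k s i * R s j))] at h1
  simp only [← Finset.mul_sum, hR, mul_ite, mul_one, mul_zero] at h1
  simpa using h1

variable [CharZero k]

lemma barOdd_xA (i j : Fin m) : barOdd (xA k i j) = 0 := by
  have := isHomog_x (k := k) i.castSucc j.castSucc
  exact IsHomog.barOdd_eq_zero this (by simp [par_castSucc])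

variable (k m) in
/-- The bar involution turns the opposite right inverse into a left inverse. -/
lemma exists_left_inverse : ∃ L : Fin m → Fin m → O k m,
    ∀ l i, ∑ j, L l j * xA k j i = if l = i then 1 else 0 := by
  obtain ⟨R, hR⟩ := exists_opposite_inverse k m
  refine ⟨fun l j => bar k (R j l), fun l i => ?_⟩
  have h := congrArg (bar k) (hR i l)
  rw [bar_sum, apply_ite (bar k), bar_one, bar_zero] at h
  rw [← (show (if i = l then (1 : O k m) else 0) = if l = i then 1 else 0 by simp [eq_comm]), ← h]
  refine Finset.sum_congr rfl fun j _ => ?_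
  rw [bar_mul_even_left _ (barOdd_xA j i), xA, bar_x]

variable (k m) in
lemma isUnit_matA : IsUnit (matA k m) := by
  obtain ⟨R, hR, -⟩ := exists_right_inverse k m
  obtain ⟨L, hL⟩ := exists_left_inverse k m
  refine isUnit_iff_exists_and_exists.mpr ⟨⟨Matrix.of R, ?_⟩, ⟨Matrix.of L, ?_⟩⟩
  · ext i l
    rw [Matrix.mul_apply, Matrix.one_apply]
    exact hR i l
  · ext i l
    rw [Matrix.mul_apply, Matrix.one_apply]
    exact hL i l

lemma sum_matA_inverse (i l : Fin m) :
    ∑ j, xA k i j * Ring.inverse (matA k m) j l = if i = l then 1 else 0 := by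
  have h := congrArg (fun M : Matrix (Fin m) (Fin m) (O k m) => M i l)
    (Ring.mul_inverse_cancel _ (isUnit_matA k m))
  simp only [Matrix.mul_apply, Matrix.one_apply] at h
  exact h

lemma inverse_mem_evenPart (i l : Fin m) : Ring.inverse (matA k m) i l ∈ evenPart k m := by
  obtain ⟨R, hR, hR'⟩ := exists_right_inverse k m
  have h : matA k m * Matrix.of R = 1 := by
    ext i l
    rw [Matrix.mul_apply, Matrix.one_apply]
    exact hR i l
  have h2 := (isUnit_matA k m).mul_left_cancel
    (h.trans (Ring.mul_inverse_cancel _ (isUnit_matA k m)).symm)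
  rw [← h2]
  exact hR' i l

lemma left_cancel {γ : Fin m → O k m} (h : ∀ s, ∑ j, xA k s j * γ j = 0) (j : Fin m) :
    γ j = 0 := by
  obtain ⟨L, hL⟩ := exists_left_inverse k m
  have h1 : ∑ s, L j s * ∑ i, xA k s i * γ i = 0 := by simp only [h, mul_zero, Finset.sum_const_zero]
  simp only [Finset.mul_sum, ← mul_assoc] at h1
  rw [Finset.sum_comm] at h1
  simp only [← Finset.sum_mul, hL, ite_mul, one_mul, zero_mul] at h1
  simpa using h1

lemma left_cancel_eq {γ γ' : Fin m → O k m} (h : ∀ s, ∑ j, xA k s j * γ j = ∑ j, xA k s j * γ' j)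
    (j : Fin m) : γ j = γ' j := by
  refine sub_eq_zero.mp (left_cancel (γ := fun j => γ j - γ' j) (fun s => ?_) j)
  simp only [mul_sub, Finset.sum_sub_distrib, h, sub_self]

end Inverse

/-! ### The quasi-determinant `y` -/

section Beta

variable {k : Type u} [Field k] {m : ℕ}

variable (k) in
/-- The entries of `A⁻¹ B`. -/
def beta (a : Fin m) : O k m := ∑ j, Ring.inverse (matA k m) a j * xB k j

variable (k m) in
/-- The element `C A⁻¹ B`, so that `y = d - C A⁻¹ B`. -/
def cab : O k m := ∑ a, xC k a * beta k a

lemma y_eq : y k m = xD k m - cab k m := by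
  rw [y, cab]
  congr 1
  refine Finset.sum_congr rfl fun a _ => ?_
  rw [beta, Finset.mul_sum]
  exact Finset.sum_congr rfl fun j _ => mul_assoc _ _ _

/-- Collects the coefficients of the entries of `A⁻¹ B` after moving a letter through them. -/
lemma sum_mul_pass {R : Type*} [Ring R] [Algebra (Kq k) R] (X V b : Fin m → R) (Z : R)
    (c : Fin m → Kq k) (w : Kq k) (j : Fin m) :
    ∑ a, X a * (c a • (Z * b a) + if a = j then w • ∑ i ∈ Finset.Iio j, V i * b i else 0) =
      ∑ a, (c a • (X a * Z) + if a < j then w • (X j * V a) else 0) * b a := by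
  simp only [mul_add, add_mul, Finset.sum_add_distrib, mul_smul_comm, smul_mul_assoc, mul_assoc]
  congr 1
  simp only [mul_ite, mul_zero, Finset.sum_ite_eq', Finset.mem_univ, if_true, ite_mul, zero_mul]
  rw [← Finset.sum_filter, mul_smul_comm, Finset.mul_sum, Finset.smul_sum]
  refine Finset.sum_congr (by ext; simp) fun a _ => ?_
  rw [smul_mul_assoc, mul_assoc]

lemma isHomog_xC (i : Fin m) : IsHomog 1 (xC k i) := by
  have := isHomog_x (k := k) (Fin.last m) i.castSucc
  rwa [par_castSucc, par_last] at this

end Beta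

section Relations

variable {k : Type u} [Field k] [CharZero k] {m : ℕ}

lemma sum_xA_mul_beta (s : Fin m) : ∑ a, xA k s a * beta k a = xB k s := by
  simp only [beta, Finset.mul_sum, ← mul_assoc]
  rw [Finset.sum_comm]
  simp only [← Finset.sum_mul, sum_matA_inverse, ite_mul, one_mul, zero_mul]
  simp

/-- The scalar `q⁻²` on the diagonal and `1` off the diagonal. -/
def passScalar (k : Type u) [Field k] {m : ℕ} (a j : Fin m) : Kq k :=
  if a = j then (q k ^ 2)⁻¹ else 1

/-- The relations of `A⁻¹ B` with the letters are found by multiplying with `A` from the left, where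
`A (A⁻¹ B) = B` turns them into relations of the generators; multiplication by `A` is injective. -/
lemma beta_mul_xA (a i j : Fin m) : beta k a * xA k i j =
    passScalar k a j • (xA k i j * beta k a) +
      if a = j then (-lam k) • ∑ t ∈ Finset.Iio j, xA k i t * beta k t else 0 := by
  have hq := q_ne_zero k
  refine left_cancel_eq (γ := fun a => beta k a * xA k i j) (γ' := fun a =>
    passScalar k a j • (xA k i j * beta k a) +
      if a = j then (-lam k) • ∑ t ∈ Finset.Iio j, xA k i t * beta k t else 0) (fun s => ?_) a
  simp only [sum_mul_pass]
  simp only [← mul_assoc, ← Finset.sum_mul, sum_xA_mul_beta]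
  have key : ∀ (c : Kq k) (w : Kq k), (∀ a, passScalar k a j • (xA k s a * xA k i j) +
      (if a < j then (-lam k) • (xA k s j * xA k i a) else 0) =
      c • (xA k i j * xA k s a) + w • (xA k s j * xA k i a)) →
      ∑ a, (passScalar k a j • (xA k s a * xA k i j) +
      (if a < j then (-lam k) • (xA k s j * xA k i a) else 0)) * beta k a =
      c • (xA k i j * xB k s) + w • (xA k s j * xB k i) := by
    intro c w h
    simp only [h, add_mul, Finset.sum_add_distrib, smul_mul_assoc, ← Finset.smul_sum, mul_assoc,
      ← Finset.mul_sum, sum_xA_mul_beta]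
  rcases lt_trichotomy s i with h | rfl | h
  · rw [key 1 0]
    · rw [one_smul, zero_smul, add_zero, BA_anti j h]
    · intro a
      rcases lt_trichotomy a j with h' | rfl | h'
      · simp only [passScalar, if_neg h'.ne, if_pos h', AA_diag h h']
        module
      · simp only [passScalar, if_true, lt_irrefl, if_false, AA_col _ h]
        match_scalars; field_simp; ring
      · simp only [passScalar, if_neg h'.ne', if_neg h'.not_gt, AA_anti h h']
        module
  · rw [key (q k ^ 2)⁻¹ 0]
    · rw [AB_row]
      match_scalars; field_simp; ring
    · intro a
      rcases lt_trichotomy a j with h' | rfl | h'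
      · simp only [passScalar, if_neg h'.ne, if_pos h', AA_row _ h', lam]
        match_scalars; field_simp; ring
      · simp only [passScalar, if_true, lt_irrefl, if_false]
        module
      · simp only [passScalar, if_neg h'.ne', if_neg h'.not_gt, AA_row _ h']
        match_scalars; field_simp; ring
  · rw [key 1 (-lam k)]
    · rw [AB_diag j h, BA_anti j h]
      module
    · intro a
      rcases lt_trichotomy a j with h' | rfl | h'
      · simp only [passScalar, if_neg h'.ne, if_pos h', AA_anti h h']
      · simp only [passScalar, if_true, lt_irrefl, if_false, AA_col _ h, lam]
        match_scalars; field_simp; ring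
      · simp only [passScalar, if_neg h'.ne', if_neg h'.not_gt, AA_diag h h', AA_anti h h']
        module

lemma beta_mul_xB (a i : Fin m) : beta k a * xB k i = (-(q k ^ 2)) • (xB k i * beta k a) := by
  have hq := q_ne_zero k
  refine left_cancel_eq (γ := fun a => beta k a * xB k i) (γ' := fun a =>
    (-(q k ^ 2)) • (xB k i * beta k a)) (fun s => ?_) a
  simp only [← mul_assoc, ← Finset.sum_mul, sum_xA_mul_beta, mul_smul_comm, ← Finset.smul_sum]
  rcases lt_trichotomy s i with h | rfl | h
  · simp only [AB_diag _ h, add_mul, Finset.sum_add_distrib, mul_assoc, smul_mul_assoc,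
      ← Finset.smul_sum, ← Finset.mul_sum, sum_xA_mul_beta, BB h, lam]
    match_scalars; field_simp; ring
  · simp only [AB_row, smul_mul_assoc, mul_assoc, ← Finset.smul_sum, ← Finset.mul_sum,
      sum_xA_mul_beta, BB_self, smul_zero]
  · simp only [← BA_anti _ h, mul_assoc, ← Finset.mul_sum, sum_xA_mul_beta, BB h]
    match_scalars; field_simp

lemma beta_mul_xC (a l : Fin m) : beta k a * xC k l =
    (-passScalar k a l) • (xC k l * beta k a) +
      if a = l then lam k • ∑ t ∈ Finset.Iio l, xC k t * beta k t else 0 := by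
  have hq := q_ne_zero k
  refine left_cancel_eq (γ := fun a => beta k a * xC k l) (γ' := fun a =>
    (-passScalar k a l) • (xC k l * beta k a) +
      if a = l then lam k • ∑ t ∈ Finset.Iio l, xC k t * beta k t else 0) (fun s => ?_) a
  simp only [sum_mul_pass (c := fun a => -passScalar k a l)]
  simp only [← mul_assoc, ← Finset.sum_mul, sum_xA_mul_beta]
  have key : ∀ a, (-passScalar k a l) • (xA k s a * xC k l) +
      (if a < l then lam k • (xA k s l * xC k a) else 0) = (-1 : Kq k) • (xC k l * xA k s a) := by
    intro a
    rcases lt_trichotomy a l with h' | rfl | h'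
    · simp only [passScalar, if_neg h'.ne, if_pos h', AC_diag _ h']
      module
    · simp only [passScalar, if_true, lt_irrefl, if_false, AC_col]
      match_scalars; field_simp
    · simp only [passScalar, if_neg h'.ne', if_neg h'.not_gt, AC_anti _ h']
      module
  simp only [key, smul_mul_assoc, ← Finset.smul_sum, mul_assoc, ← Finset.mul_sum, sum_xA_mul_beta,
    BC]
  module

/-- `C A⁻¹ B` satisfies the relation of `d` with the even letters, so that `y` commutes with these. -/
lemma cab_mul_xA (i j : Fin m) :
    cab k m * xA k i j = xA k i j * cab k m + lam k • (xB k i * xC k j) := by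
  have hq := q_ne_zero k
  rw [BC, ← sum_xA_mul_beta i]
  simp only [cab, Finset.sum_mul, Finset.mul_sum, mul_assoc, beta_mul_xA]
  rw [sum_mul_pass, ← Finset.sum_neg_distrib, Finset.smul_sum, ← Finset.sum_add_distrib]
  refine Finset.sum_congr rfl fun a _ => ?_
  have key : passScalar k a j • (xC k a * xA k i j) +
      (if a < j then (-lam k) • (xC k j * xA k i a) else 0) =
      xA k i j * xC k a + (-lam k) • (xC k j * xA k i a) := by
    rcases lt_trichotomy a j with h' | rfl | h'
    · simp only [passScalar, if_neg h'.ne, if_pos h', AC_anti _ h']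
      module
    · simp only [passScalar, if_true, lt_irrefl, if_false, AC_col, lam]
      match_scalars; field_simp; ring
    · simp only [passScalar, if_neg h'.ne', if_neg h'.not_gt, AC_diag _ h', AC_anti _ h']
      module
  rw [key]
  simp only [add_mul, smul_mul_assoc, mul_assoc]
  module

lemma cab_mul_xB (i : Fin m) : cab k m * xB k i = q k ^ 2 • (xB k i * cab k m) := by
  simp only [cab, Finset.sum_mul, Finset.mul_sum, mul_assoc, beta_mul_xB, Finset.smul_sum]
  refine Finset.sum_congr rfl fun a _ => ?_
  rw [mul_smul_comm, ← mul_assoc, CB, neg_mul, mul_assoc]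
  module

lemma cab_mul_xC (l : Fin m) : cab k m * xC k l = q k ^ 2 • (xC k l * cab k m) := by
  have hq := q_ne_zero k
  simp only [cab, Finset.sum_mul, Finset.mul_sum, mul_assoc, beta_mul_xC]
  rw [sum_mul_pass (c := fun a => -passScalar k a l), Finset.smul_sum]
  refine Finset.sum_congr rfl fun a _ => ?_
  have key : (-passScalar k a l) • (xC k a * xC k l) +
      (if a < l then lam k • (xC k l * xC k a) else 0) = q k ^ 2 • (xC k l * xC k a) := by
    rcases lt_trichotomy a l with h' | rfl | h'
    · simp only [passScalar, if_neg h'.ne, if_pos h', CC h', lam]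
      match_scalars; field_simp; ring
    · simp only [CC_self, smul_zero, lt_irrefl, if_false, add_zero]
    · simp only [passScalar, if_neg h'.ne', if_neg h'.not_gt, CC h']
      match_scalars; field_simp
  rw [key, smul_mul_assoc, mul_assoc]

lemma y_mul_xA (i j : Fin m) : y k m * xA k i j = xA k i j * y k m := by
  rw [y_eq, sub_mul, mul_sub, cab_mul_xA, AD]
  abel

lemma y_mul_xB (i : Fin m) : y k m * xB k i = q k ^ 2 • (xB k i * y k m) := by
  have hq := q_ne_zero k
  rw [y_eq, sub_mul, mul_sub, cab_mul_xB, BD, smul_sub, smul_smul, mul_inv_cancel₀ (pow_ne_zero _ hq),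
    one_smul]

lemma y_mul_xC (i : Fin m) : y k m * xC k i = q k ^ 2 • (xC k i * y k m) := by
  have hq := q_ne_zero k
  rw [y_eq, sub_mul, mul_sub, cab_mul_xC, CD, smul_sub, smul_smul, mul_inv_cancel₀ (pow_ne_zero _ hq),
    one_smul]

/-! #### Torus action, parity and the bar involution -/

lemma scale_beta (r c : Fin (m + 1) → (Kq k)ˣ) (a : Fin m) :
    scale r c (beta k a) = ((c a.castSucc)⁻¹ * c (Fin.last m)) • beta k a := by
  have h := left_cancel_eq (γ := fun a => (c a.castSucc) • scale r c (beta k a))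
    (γ' := fun a => c (Fin.last m) • beta k a) (fun s => by
      simp only [mul_smul_comm, ← Finset.smul_sum, sum_xA_mul_beta]
      have h1 := congrArg (scale r c) (sum_xA_mul_beta (k := k) s)
      simp only [map_sum, map_mul, xA, xB, scale_x, smul_mul_assoc, mul_smul, Units.val_mul] at h1 ⊢
      rw [← Finset.smul_sum] at h1
      exact smul_left_cancel (r s.castSucc) h1) a
  rw [mul_smul, ← h, inv_smul_smul]

lemma scale_cab (r c : Fin (m + 1) → (Kq k)ˣ) :
    scale r c (cab k m) = (r (Fin.last m) * c (Fin.last m)) • cab k m := by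
  simp only [cab, map_sum, map_mul, scale_beta, xC, scale_x, Finset.smul_sum]
  refine Finset.sum_congr rfl fun a _ => ?_
  rw [← Units.smul_def, smul_mul_smul_comm, mul_assoc, mul_inv_cancel_left]

lemma scale_y (r c : Fin (m + 1) → (Kq k)ˣ) :
    scale r c (y k m) = (r (Fin.last m) * c (Fin.last m)) • y k m := by
  rw [y_eq, map_sub, scale_cab, xD, scale_x, smul_sub, ← Units.smul_def]

end Relations

section BarY

variable {k : Type u} [Field k] {m : ℕ}

/-- The scalars by which the bar involution acts on the entries of `A⁻¹ B`. -/
def barCoef (k : Type u) [Field k] {m : ℕ} (a : Fin m) : Kq k :=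
  q k ^ 2 * (q k ^ 4) ^ (m - 1 - (a : ℕ))

lemma lam_mul_sum_barCoef (t : Fin m) :
    lam k * ∑ a ∈ Finset.Ioi t, barCoef k a = (q k ^ 4) ^ (m - 1 - (t : ℕ)) - 1 := by
  have hq := q_ne_zero k
  have h1 : ∑ a ∈ Finset.Ioi t, barCoef k a =
      ∑ i ∈ Finset.range (m - 1 - (t : ℕ)), q k ^ 2 * (q k ^ 4) ^ i := by
    refine Finset.sum_nbij (fun a => m - 1 - (a : ℕ)) (fun a ha => ?_) (fun a ha b hb hab => ?_)
      (fun i hi => ?_) (fun a _ => rfl)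
    · rw [Finset.mem_Ioi, Fin.lt_def] at ha
      rw [Finset.mem_range]; omega
    · ext
      have : m - 1 - (a : ℕ) = m - 1 - (b : ℕ) := hab
      omega
    · rw [Finset.mem_coe, Finset.mem_range] at hi
      refine ⟨⟨m - 1 - i, by omega⟩, ?_, ?_⟩
      · rw [Finset.mem_coe, Finset.mem_Ioi, Fin.lt_def]
        change (t : ℕ) < m - 1 - i
        omega
      · change m - 1 - (m - 1 - i) = i
        omega
  have h2 : lam k * q k ^ 2 = q k ^ 4 - 1 := by
    rw [lam]; field_simp
  rw [h1, ← Finset.mul_sum, ← mul_assoc, h2, mul_geom_sum]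

/-- The scalars `barCoef` undo the triangular change of coefficients caused by moving `A⁻¹ B` across the
letters of a column. -/
lemma sum_barCoef_smul (z : Fin m → O k m) :
    ∑ a, barCoef k a • ((q k ^ 2)⁻¹ • z a - lam k • ∑ t ∈ Finset.Iio a, z t) = ∑ t, z t := by
  have hq := q_ne_zero k
  simp only [smul_sub, Finset.sum_sub_distrib, smul_smul, Finset.smul_sum]
  rw [Finset.sum_comm' (s := Finset.univ) (t := fun a => Finset.Iio a) (t' := Finset.univ)
    (s' := fun t => Finset.Ioi t) (by simp), ← Finset.sum_sub_distrib]
  refine Finset.sum_congr rfl fun t _ => ?_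
  rw [← Finset.sum_smul, ← sub_smul, ← Finset.sum_mul, mul_comm _ (lam k), lam_mul_sum_barCoef,
    barCoef]
  have : q k ^ 2 * (q k ^ 4) ^ (m - 1 - (t : ℕ)) * (q k ^ 2)⁻¹ -
    ((q k ^ 4) ^ (m - 1 - (t : ℕ)) - 1) = 1 := by field_simp; ring
  rw [this, one_smul]

lemma opP_xA (p i j : Fin m) : opP p (xA k i j) = xA k i j := by
  rw [opP, xA, scale_x]; simp [pSign, par_castSucc]

lemma list_xC_mul_self (a : Fin m) (l : List (Fin m)) (h : a ∈ l) :
    xC k a * (l.map (xC k)).prod = 0 := by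
  induction l with
  | nil => exact absurd h List.not_mem_nil
  | cons b l ih =>
    rw [List.map_cons, List.prod_cons, ← mul_assoc]
    by_cases hab : a = b
    · rw [hab, CC_self, zero_mul]
    · have hl := ih ((List.mem_cons.mp h).resolve_left hab)
      have hc : ∃ c : Kq k, xC k a * xC k b = c • (xC k b * xC k a) := by
        rcases lt_or_gt_of_ne hab with h | h
        · exact ⟨_, CC h⟩
        · refine ⟨(-(q k ^ 2)⁻¹)⁻¹, ?_⟩
          rw [CC h, smul_smul, inv_mul_cancel₀, one_smul]
          exact neg_ne_zero.mpr (inv_ne_zero (pow_ne_zero _ (q_ne_zero k)))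
      obtain ⟨c, hc⟩ := hc
      rw [hc, smul_mul_assoc, mul_assoc, hl, mul_zero, smul_zero]

lemma list_xC_prod (l : List (Fin m)) (h : ¬ l.Nodup) : (l.map (xC k)).prod = 0 := by
  induction l with
  | nil => exact absurd List.nodup_nil h
  | cons b l ih =>
    rw [List.map_cons, List.prod_cons]
    by_cases hb : b ∈ l
    · exact list_xC_mul_self b l hb
    · rw [ih fun hl => h (List.nodup_cons.mpr ⟨hb, hl⟩), mul_zero]

lemma isUnit_xD : IsUnit (xD k m) :=
  ⟨⟨xD k m, lastInv k m, last_mul_lastInv k, lastInv_mul_last k⟩, rfl⟩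

/-- Products of more than `m` entries of `C` vanish, so that an element `∑ C_a γ_a` which commutes
with the entries of `C` is nilpotent. -/
lemma isNilpotent_of_commute {u : O k m} {γ : Fin m → O k m} (hu : u = ∑ a, xC k a * γ a)
    (hc : ∀ l, u * xC k l = xC k l * u) : IsNilpotent u := by
  have hlist : ∀ l : List (Fin m), u * (l.map (xC k)).prod = (l.map (xC k)).prod * u := by
    intro l
    induction l with
    | nil => simp
    | cons b l ih => rw [List.map_cons, List.prod_cons, ← mul_assoc, hc, mul_assoc, ih, mul_assoc]
  have key : ∀ n, u ^ n ∈ Submodule.span (Kq k) {f : O k m |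
      ∃ l : List (Fin m), l.length = n ∧ ∃ g, f = (l.map (xC k)).prod * g} := by
    intro n
    induction n with
    | zero => exact Submodule.subset_span ⟨[], rfl, 1, by simp⟩
    | succ n ih =>
      rw [pow_succ']
      refine Submodule.span_induction (p := fun f _ => u * f ∈ Submodule.span (Kq k)
        {f : O k m | ∃ l : List (Fin m), l.length = n + 1 ∧ ∃ g, f = (l.map (xC k)).prod * g})
        ?_ ?_ ?_ ?_ ih
      · rintro f ⟨l, hl, g, rfl⟩
        rw [← mul_assoc, hlist, mul_assoc, hu, Finset.sum_mul, Finset.mul_sum]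
        refine sum_mem fun a _ => Submodule.subset_span ⟨l ++ [a], by simp [hl], γ a * g, ?_⟩
        simp [mul_assoc]
      · rw [mul_zero]; exact zero_mem _
      · intro f g _ _ hf hg; rw [mul_add]; exact add_mem hf hg
      · intro c f _ hf; rw [mul_smul_comm]; exact Submodule.smul_mem _ _ hf
  refine ⟨m + 1, ?_⟩
  have h := key (m + 1)
  rw [Submodule.span_eq_bot.mpr] at h
  · exact (Submodule.mem_bot _).mp h
  · rintro f ⟨l, hl, g, rfl⟩
    rw [list_xC_prod, zero_mul]
    intro hn
    have := hn.length_le_card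
    rw [hl, Fintype.card_fin] at this
    omega

variable [CharZero k]

lemma isHomog_beta (a : Fin m) : IsHomog 1 (beta k a) := by
  rw [IsHomog, parAut, scale_beta]
  simp only [par_castSucc, par_last, Units.smul_def]
  congr 1
  simp

lemma parAut_y : parAut (y k m) = y k m := by
  rw [parAut, scale_y]
  simp [par_last]

/-- The family `bar β` is determined by `∑ (bar β)_a a_{sa} = b_s`, and `barCoef a • β_a` is the solution. -/
lemma bar_beta (a : Fin m) : bar k (beta k a) = barCoef k a • beta k a := by
  refine right_cancel_eq (γ := fun a => bar k (beta k a)) (γ' := fun a => barCoef k a • beta k a)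
    (fun s => ?_) a
  have h := congrArg (bar k) (sum_xA_mul_beta (k := k) s)
  rw [bar_sum, xB, bar_x] at h
  have h1 : ∑ a, bar k (beta k a) * xA k s a = xB k s := by
    rw [xB, ← h]
    refine Finset.sum_congr rfl fun a _ => ?_
    rw [bar_mul_even_left _ (barOdd_xA s a), xA, bar_x]
  rw [h1, ← sum_xA_mul_beta s, ← sum_barCoef_smul]
  refine Finset.sum_congr rfl fun a _ => ?_
  rw [smul_mul_assoc, beta_mul_xA, passScalar, if_pos rfl, if_pos rfl, neg_smul, sub_eq_add_neg]

lemma bar_cab : bar k (cab k m) = cab k m := by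
  rw [cab, bar_sum, ← sum_barCoef_smul fun a => xC k a * beta k a]
  refine Finset.sum_congr rfl fun a _ => ?_
  rw [(isHomog_xC a).bar_mul (isHomog_beta a), bar_beta, xC, bar_x, ← xC, smul_mul_assoc,
    beta_mul_xC, passScalar, if_pos rfl, if_pos rfl]
  module

lemma bar_y : bar k (y k m) = y k m := by
  rw [y_eq, bar_sub, bar_cab, xD, bar_x]

/-! #### The action of the generators -/

lemma opKKinv_beta (p a : Fin m) : opKKinv p (beta k a) = beta k a := by
  rw [opKKinv, scale_beta]; simp

lemma opE_beta (p a : Fin m) : opE p (beta k a) = 0 := by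
  refine left_cancel (γ := fun a => opE p (beta k a)) (fun s => ?_) a
  have h := congrArg (opE p) (sum_xA_mul_beta (k := k) s)
  simp only [map_sum, opE_mul, opP_xA, opKKinv_beta, Finset.sum_add_distrib] at h
  rw [xB, opE_x] at h
  have h1 : ∑ a, opE p (xA k s a) * beta k a =
      if s.castSucc = p.succ then x k p.castSucc (Fin.last m) else 0 := by
    simp only [xA, opE_x]
    split_ifs
    · exact sum_xA_mul_beta p
    · simp
  rw [h1] at h
  exact add_eq_right.mp h

/-- `E_p` kills `y`: for `p = m`, the terms `E_m d` and `(E_m C) A⁻¹ B` cancel. -/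
lemma opE_y (p : Fin m) : opE p (y k m) = 0 := by
  rw [y_eq, map_sub, cab, map_sum]
  simp only [opE_mul, opE_beta, mul_zero, zero_add, opKKinv_beta]
  simp only [xC, xD, opE_x]
  split_ifs
  · rw [sub_eq_zero]
    exact (sum_xA_mul_beta p).symm
  · simp

lemma opF_beta (p a : Fin m) (hp : par p.succ = 0) : opF p (beta k a) = 0 := by
  refine left_cancel (γ := fun a => opF p (beta k a)) (fun s => ?_) a
  obtain ⟨p', hp', -⟩ := exists_castSucc_eq_succ p hp
  have h := congrArg (opF p) (sum_xA_mul_beta (k := k) s)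
  have h0 : ∀ a, opP p (opKK p (xA k s a)) = (kappa k p s.castSucc : Kq k) • xA k s a := by
    intro a
    rw [opP_even p hp, xA, opKK_x]
  simp only [map_sum, opF_mul, h0, Finset.sum_add_distrib, smul_mul_assoc, ← Finset.smul_sum] at h
  rw [xB, opF_x] at h
  have h1 : ∑ a, opF p (xA k s a) * beta k a =
      if s.castSucc = p.castSucc then x k p.succ (Fin.last m) else 0 := by
    simp only [xA, opF_x]
    split_ifs
    · rw [← hp']; exact sum_xA_mul_beta p'
    · simp
  rw [h1, add_eq_right, smul_eq_zero] at h
  exact h.resolve_left (Units.ne_zero _)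

lemma opF_y (p : Fin m) (hp : par p.succ = 0) : opF p (y k m) = 0 := by
  have h : Fin.last m ≠ p.castSucc := (Fin.castSucc_lt_last p).ne'
  rw [y_eq, map_sub, cab, map_sum]
  simp only [opF_mul, opF_beta _ _ hp, mul_zero, zero_add]
  simp only [xC, xD, opF_x, if_neg h, zero_mul, Finset.sum_const_zero, sub_zero]

/-! #### Invertibility -/

lemma isNilpotent_inv_mul_cab (w : (O k m)ˣ)
    (hc : ∀ l, (w : O k m) * xC k l = q k ^ 2 • (xC k l * (w : O k m))) :
    IsNilpotent ((↑w⁻¹ : O k m) * cab k m) := by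
  have hq := q_ne_zero k
  have hw : ∀ l, (↑w⁻¹ : O k m) * xC k l = (q k ^ 2)⁻¹ • (xC k l * (↑w⁻¹ : O k m)) := by
    intro l
    have h := congrArg (fun z => (↑w⁻¹ : O k m) * z * ↑w⁻¹) (hc l)
    simp only [mul_smul_comm, smul_mul_assoc, mul_assoc, Units.inv_mul_cancel_left,
      Units.mul_inv, mul_one] at h
    rw [h, smul_smul, inv_mul_cancel₀ (pow_ne_zero _ hq), one_smul]
  refine isNilpotent_of_commute (γ := fun a => (q k ^ 2)⁻¹ • ((↑w⁻¹ : O k m) * beta k a)) ?_ ?_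
  · rw [cab, Finset.mul_sum]
    refine Finset.sum_congr rfl fun a _ => ?_
    rw [← mul_assoc, hw, mul_smul_comm, smul_mul_assoc, mul_assoc]
  · intro l
    rw [mul_assoc, cab_mul_xC, mul_smul_comm, ← mul_assoc, hw, smul_mul_assoc, smul_smul,
      mul_inv_cancel₀ (pow_ne_zero _ hq), one_smul, mul_assoc]

/-- Adding a multiple of `C A⁻¹ B` to a unit with the commutation relations of `d` gives a unit. -/
lemma isUnit_add_cab {v : O k m} (hv : IsUnit v)
    (hc : ∀ l, v * xC k l = q k ^ 2 • (xC k l * v)) (c : Kq k) : IsUnit (v + c • cab k m) := by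
  obtain ⟨w, rfl⟩ := hv
  have h2 : (w : O k m) + c • cab k m = w * (1 + c • ((↑w⁻¹ : O k m) * cab k m)) := by
    rw [mul_add, mul_one, mul_smul_comm, Units.mul_inv_cancel_left]
  rw [h2]
  exact w.isUnit.mul ((isNilpotent_inv_mul_cab w hc).smul c).isUnit_one_add

variable (k m) in
lemma isUnit_y : IsUnit (y k m) := by
  have hq := q_ne_zero k
  rw [y_eq, sub_eq_add_neg, ← neg_one_smul (Kq k)]
  refine isUnit_add_cab isUnit_xD (fun l => ?_) _
  rw [CD, smul_smul, mul_inv_cancel₀ (pow_ne_zero _ hq), one_smul]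

variable (k m) in
/-- The element `y` as a unit. -/
def yUnit : (O k m)ˣ := (isUnit_y k m).unit

lemma val_yUnit : (yUnit k m : O k m) = y k m := rfl

lemma yPow_eq (d : ℤ) : yPow k m d = ((yUnit k m ^ d : (O k m)ˣ) : O k m) := by
  rw [yPow, dif_pos (isUnit_y k m)]; rfl

lemma commute_y_detA : Commute (y k m) (detA k m) := by
  rw [detA, qdet]
  refine Commute.sum_right _ _ _ fun σ _ => Commute.smul_right (Commute.list_prod_right _ _ ?_) _
  intro z hz
  obtain ⟨i, rfl⟩ := List.mem_ofFn.mp hz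
  exact y_mul_xA _ _

lemma commute_yUnit_detUnit : Commute (yUnit k m) (detUnit k m) :=
  Units.ext commute_y_detA

/-- The powers of an even bar-invariant unit are even and bar invariant. -/
lemma bar_unit_zpow {w : (O k m)ˣ} (hp : parAut (w : O k m) = w) (hb : bar k (w : O k m) = w)
    (d : ℤ) : parAut ((w ^ d : (O k m)ˣ) : O k m) = ((w ^ d : (O k m)ˣ) : O k m) ∧
      bar k ((w ^ d : (O k m)ˣ) : O k m) = ((w ^ d : (O k m)ˣ) : O k m) := by
  have hpar : ∀ d : ℤ, parAut ((w ^ d : (O k m)ˣ) : O k m) = ((w ^ d : (O k m)ˣ) : O k m) := by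
    intro d
    have h : Units.map (parAut (k := k) (m := m) : O k m →* O k m) w = w := Units.ext hp
    have h2 := map_zpow (Units.map (parAut (k := k) (m := m) : O k m →* O k m)) w d
    rw [h] at h2
    exact congrArg Units.val h2
  have hodd : ∀ d : ℤ, barOdd ((w ^ d : (O k m)ˣ) : O k m) = 0 := fun d =>
    IsHomog.barOdd_eq_zero (e := 0) (by rw [IsHomog, hpar, pow_zero, one_smul]) Even.zero
  refine ⟨hpar d, ?_⟩
  have hnat : ∀ n : ℕ, bar k ((w ^ (n : ℤ) : (O k m)ˣ) : O k m) =
      ((w ^ (n : ℤ) : (O k m)ˣ) : O k m) := by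
    intro n
    induction n with
    | zero => simp [bar_one]
    | succ n ih =>
      rw [Nat.cast_succ, zpow_add, Units.val_mul, bar_mul_even_left _ (hodd n), ih, zpow_one, hb,
        ← Units.val_mul, ← Units.val_mul, (Commute.refl w).zpow_right n]
  obtain ⟨n, rfl | rfl⟩ := d.eq_nat_or_neg
  · exact hnat n
  · have h1 : ((w ^ (n : ℤ) : (O k m)ˣ) : O k m) * ((w ^ (-n : ℤ) : (O k m)ˣ) : O k m) = 1 := by
      rw [← Units.val_mul, ← zpow_add, add_neg_cancel, zpow_zero, Units.val_one]
    have h2 := congrArg (bar k) h1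
    rw [bar_mul_even_left _ (hodd n), hnat, bar_one] at h2
    rw [zpow_neg] at h2 ⊢
    exact (Units.inv_eq_of_mul_eq_one_left h2).symm

end BarY

/-! ### The automorphism rescaling `y` -/

section Theta

variable {k : Type u} [Field k] {m : ℕ}

/-- The generic matrix with its last entry replaced. -/
def replaceLast (d : O k m) (i j : Fin (m + 1)) : O k m :=
  if i = Fin.last m ∧ j = Fin.last m then d else x k i j

lemma replaceLast_last (d : O k m) : replaceLast d (Fin.last m) (Fin.last m) = d :=
  if_pos ⟨rfl, rfl⟩

lemma replaceLast_of_ne (d : O k m) {i j : Fin (m + 1)} (h : ¬ (i = Fin.last m ∧ j = Fin.last m)) :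
    replaceLast d i j = x k i j := if_neg h

/-- The last entry can be replaced by any element satisfying its relations. -/
lemma isQSuperMatrix_replaceLast {d : O k m}
    (hA : ∀ i j, xA k i j * d = d * xA k i j - lam k • (xB k i * xC k j))
    (hB : ∀ i, xB k i * d = (q k ^ 2)⁻¹ • (d * xB k i))
    (hC : ∀ i, xC k i * d = (q k ^ 2)⁻¹ • (d * xC k i)) :
    IsQSuperMatrix k (replaceLast d) := by
  have H := isQSuperMatrix_x k (m := m)
  have lt_ne : ∀ {i j : Fin (m + 1)}, i < j → i ≠ Fin.last m := fun h => (h.trans_le (Fin.le_last _)).ne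
  refine ⟨fun i j h => ?_, fun i j l h => ?_, fun i s j h => ?_, fun i s j l h h' => ?_,
    fun i s j l h h' => ?_⟩
  · rw [replaceLast_of_ne]
    · exact H.odd_sq i j h
    · rintro ⟨rfl, rfl⟩; rw [par_last] at h; omega
  · rw [replaceLast_of_ne (j := j) d fun e => lt_ne h e.2]
    by_cases hl : i = Fin.last m ∧ l = Fin.last m
    · obtain ⟨rfl, rfl⟩ := hl
      obtain ⟨j, rfl⟩ := Fin.exists_castSucc_eq.mpr (lt_ne h)
      rw [replaceLast_last]
      refine (hC j).trans ?_
      simp [sgn, qq, par_last, par_castSucc, xC]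
    · rw [replaceLast_of_ne _ hl]; exact H.row i j l h
  · rw [replaceLast_of_ne (i := i) d fun e => lt_ne h e.1]
    by_cases hl : s = Fin.last m ∧ j = Fin.last m
    · obtain ⟨rfl, rfl⟩ := hl
      obtain ⟨i, rfl⟩ := Fin.exists_castSucc_eq.mpr (lt_ne h)
      rw [replaceLast_last]
      refine (hB i).trans ?_
      simp [sgn, qq, par_last, par_castSucc, xB]
    · rw [replaceLast_of_ne _ hl]; exact H.col i s j h
  · rw [replaceLast_of_ne (i := i) d fun e => lt_ne h e.1,
      replaceLast_of_ne (j := l) d fun e => lt_ne h' e.2]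
    exact H.anti i s j l h h'
  · rw [replaceLast_of_ne (i := i) (j := j) d fun e => lt_ne h e.1,
      replaceLast_of_ne (i := i) (j := l) d fun e => lt_ne h e.1,
      replaceLast_of_ne (i := s) (j := j) d fun e => lt_ne h' e.2]
    by_cases hl : s = Fin.last m ∧ l = Fin.last m
    · obtain ⟨rfl, rfl⟩ := hl
      obtain ⟨i, rfl⟩ := Fin.exists_castSucc_eq.mpr (lt_ne h)
      obtain ⟨j, rfl⟩ := Fin.exists_castSucc_eq.mpr (lt_ne h')
      rw [replaceLast_last]
      refine (hA i j).trans ?_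
      simp only [sgn, par_last, par_castSucc, xA, xB, xC, lam]
      norm_num
      module
    · rw [replaceLast_of_ne _ hl]; exact H.diag i s j l h h'

lemma qdet_replaceLast (d : O k m) : qdet k (blockA (replaceLast d)) = detA k m := by
  have : (blockA (replaceLast d) : Fin m → Fin m → O k m) = blockA (x k) := by
    funext i j
    exact replaceLast_of_ne d fun e => (Fin.castSucc_lt_last i).ne e.1
  rw [this, detA]

lemma map_unit_zpow (φ : O k m →ₐ[Kq k] O k m) {u : (O k m)ˣ} {c : Kq k} (hc : c ≠ 0)
    (h : φ (u : O k m) = c • (u : O k m)) (d : ℤ) :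
    φ ((u ^ d : (O k m)ˣ) : O k m) = c ^ d • ((u ^ d : (O k m)ˣ) : O k m) := by
  have hinv : φ ((u⁻¹ : (O k m)ˣ) : O k m) = c⁻¹ • ((u⁻¹ : (O k m)ˣ) : O k m) := by
    have h1 := congrArg φ (Units.inv_mul u)
    rw [map_mul, h, map_one, mul_smul_comm, ← smul_mul_assoc, ← Units.eq_mul_inv_iff_mul_eq,
      one_mul] at h1
    conv_rhs => rw [← h1]
    rw [inv_smul_smul₀ hc]
  induction d with
  | zero => simp
  | succ n ih => rw [zpow_add_one, zpow_add_one₀ hc, Units.val_mul, map_mul, ih, h,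
      smul_mul_smul_comm]
  | pred n ih => rw [zpow_sub_one, zpow_sub_one₀ hc, Units.val_mul, map_mul, ih, hinv,
      smul_mul_smul_comm]

variable [CharZero k]

variable (k m) in
/-- The image `q y + C A⁻¹ B` of the last entry. -/
def thetaLast : O k m := q k • y k m + cab k m

variable (k m) in
lemma isUnit_thetaLast : IsUnit (thetaLast k m) := by
  have h := isUnit_add_cab (v := q k • y k m) ?_ (fun l => ?_) 1
  · rwa [one_smul] at h
  · exact (isUnit_y k m).smul (Units.mk0 _ (q_ne_zero k))
  · rw [smul_mul_assoc, y_mul_xC, mul_smul_comm, smul_comm]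

variable (k m) in
/-- The algebra endomorphism which fixes all `x_{ij}` but the last one, and multiplies `y` by
`q`. -/
def theta : O k m →ₐ[Kq k] O k m :=
  lift (replaceLast (thetaLast k m))
    (isQSuperMatrix_replaceLast
      (fun i j => by
        rw [thetaLast, mul_add, add_mul, smul_mul_assoc, y_mul_xA, cab_mul_xA, mul_smul_comm]; abel)
      (fun i => by
        rw [thetaLast, mul_add, add_mul, smul_mul_assoc, y_mul_xB, cab_mul_xB, mul_smul_comm,
          smul_add, smul_comm (q k) (q k ^ 2), inv_smul_smul₀ (pow_ne_zero _ (q_ne_zero k)),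
          inv_smul_smul₀ (pow_ne_zero _ (q_ne_zero k))])
      (fun i => by
        rw [thetaLast, mul_add, add_mul, smul_mul_assoc, y_mul_xC, cab_mul_xC, mul_smul_comm,
          smul_add, smul_comm (q k) (q k ^ 2), inv_smul_smul₀ (pow_ne_zero _ (q_ne_zero k)),
          inv_smul_smul₀ (pow_ne_zero _ (q_ne_zero k))]))
    (detInv k m) (↑(isUnit_thetaLast k m).unit⁻¹)
    (by rw [qdet_replaceLast]; exact detA_mul_detInv k)
    (by rw [qdet_replaceLast]; exact detInv_mul_detA k)
    (by rw [replaceLast_last]; exact (isUnit_thetaLast k m).mul_val_inv)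
    (by rw [replaceLast_last]; exact (isUnit_thetaLast k m).val_inv_mul)

lemma theta_x (i j : Fin (m + 1)) (h : ¬ (i = Fin.last m ∧ j = Fin.last m)) :
    theta k m (x k i j) = x k i j := by
  rw [theta, lift_x, replaceLast_of_ne _ h]

lemma theta_xA (i j : Fin m) : theta k m (xA k i j) = xA k i j :=
  theta_x _ _ fun e => (Fin.castSucc_lt_last i).ne e.1

lemma theta_xB (i : Fin m) : theta k m (xB k i) = xB k i :=
  theta_x _ _ fun e => (Fin.castSucc_lt_last i).ne e.1

lemma theta_xC (i : Fin m) : theta k m (xC k i) = xC k i :=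
  theta_x _ _ fun e => (Fin.castSucc_lt_last i).ne e.2

lemma theta_beta (a : Fin m) : theta k m (beta k a) = beta k a := by
  refine left_cancel_eq (γ := fun a => theta k m (beta k a)) (γ' := beta k) (fun s => ?_) a
  have h := congrArg (theta k m) (sum_xA_mul_beta (k := k) s)
  simp only [map_sum, map_mul, theta_xA, theta_xB] at h
  rw [h, sum_xA_mul_beta]

/-- `theta` fixes `C A⁻¹ B`, so that the choice of `thetaLast` amounts to rescaling `y`. -/
lemma theta_y : theta k m (y k m) = q k • y k m := by
  have h : theta k m (xD k m) = thetaLast k m := by rw [theta, xD, lift_x, replaceLast_last]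
  have h2 : theta k m (cab k m) = cab k m := by
    simp only [cab, map_sum, map_mul, theta_xC, theta_beta]
  rw [y_eq, map_sub, h, h2, thetaLast, y_eq, add_sub_cancel_right]

lemma theta_yUnit_zpow (d : ℤ) : theta k m ((yUnit k m ^ d : (O k m)ˣ) : O k m) =
    q k ^ d • ((yUnit k m ^ d : (O k m)ˣ) : O k m) :=
  map_unit_zpow _ (q_ne_zero k) theta_y d

lemma theta_xMon {M : Mat m} (h : M (Fin.last m) (Fin.last m) = 0) :
    theta k m (xMon k M) = xMon k M := by
  rw [xMon, map_list_prod, List.map_ofFn]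
  congr 2
  funext i
  rw [Function.comp_apply, map_list_prod, List.map_ofFn]
  congr 2
  funext j
  rw [Function.comp_apply, map_pow]
  by_cases hij : i = Fin.last m ∧ j = Fin.last m
  · rw [hij.1, hij.2, h, pow_zero, pow_zero]
  · rw [theta_x _ _ hij]

lemma q_zpow_injective {d e : ℤ} (h : q k ^ d = q k ^ e) : d = e := by
  by_contra hne
  have h1 := congrArg (fun c => co k c d) h
  simp only [co_zpow, if_true, if_neg hne] at h1
  exact one_ne_zero h1

/-- Eigenvectors of `theta` for distinct powers of `q` are independent. -/
lemma eq_zero_of_sum_theta (s : Finset ℤ) : ∀ f : ℤ → O k m,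
    (∀ d, theta k m (f d) = q k ^ d • f d) → ∑ d ∈ s, f d = 0 → ∀ d ∈ s, f d = 0 := by
  classical
  induction s using Finset.induction_on with
  | empty => exact fun f _ _ d hd => absurd hd (Finset.notMem_empty d)
  | insert e s he ih =>
    intro f hf h0
    have hs : ∀ d ∈ s, f d = 0 := by
      intro d hd
      have h1 := congrArg (theta k m) h0
      rw [map_sum, map_zero] at h1
      have h2 : ∑ d ∈ s, (q k ^ d - q k ^ e) • f d = 0 := by
        have : ∑ d ∈ insert e s, (q k ^ d - q k ^ e) • f d = 0 := by
          simp only [sub_smul, Finset.sum_sub_distrib, ← Finset.smul_sum, h0, smul_zero, sub_zero]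
          rw [← h1]
          exact Finset.sum_congr rfl fun d _ => (hf d).symm
        rwa [Finset.sum_insert he, sub_self, zero_smul, zero_add] at this
      have h3 := ih (fun d => (q k ^ d - q k ^ e) • f d)
        (fun d => by rw [map_smul, hf, smul_comm]) h2 d hd
      refine (smul_eq_zero.mp h3).resolve_left (sub_ne_zero.mpr fun h => ?_)
      refine he ?_
      rw [← q_zpow_injective h]; exact hd
    intro d hd
    rcases Finset.mem_insert.mp hd with rfl | hd
    · rwa [Finset.sum_insert he, Finset.sum_eq_zero hs, add_zero] at h0
    · exact hs d hd

end Theta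

/-! ### Unitriangular families -/

section Pos

variable {k : Type u} [Field k] {m : ℕ}

lemma Step.last_le {T M : Mat m} (h : Step T M) :
    T (Fin.last m) (Fin.last m) ≤ M (Fin.last m) (Fin.last m) := by
  obtain ⟨i, s, j, t, his, hjt, -, -, e⟩ := h
  have hi : i ≠ Fin.last m := (his.trans_le (Fin.le_last s)).ne
  have hj : j ≠ Fin.last m := (hjt.trans_le (Fin.le_last t)).ne
  have := congrArg (fun M : Mat m => M (Fin.last m) (Fin.last m)) e
  simp only [Matrix.add_apply, Matrix.single_apply, hi, hj, false_and, and_false, if_false] at this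
  omega

lemma Below.last_le {T M : Mat m} (h : Below T M) :
    T (Fin.last m) (Fin.last m) ≤ M (Fin.last m) (Fin.last m) := by
  induction h with
  | single h => exact h.last_le
  | tail _ h ih => exact ih.trans h.last_le

lemma Below.mem_indexABC {T M : Mat m} (h : Below T M) (hM : M ∈ indexABC m)
    (hT : Admissible T) : T ∈ indexABC m :=
  ⟨hT, Nat.le_zero.mp (h.last_le.trans hM.2.le)⟩

lemma Below.row_sum {T M : Mat m} (h : Below T M) (i : Fin (m + 1)) :
    ∑ j, T i j = ∑ j, M i j :=
  Multiplicative.ofAdd.injective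
    (h.invariant (fun M => Multiplicative.ofAdd (∑ j, M i j)) (fun M N => by
      rw [← ofAdd_add, ← Finset.sum_add_distrib]; rfl) fun a s j t => by
        simp only [← ofAdd_add, ← Finset.sum_add_distrib, unitMat_apply]
        congr 1
        by_cases h1 : a = i <;> by_cases h2 : s = i <;>
          simp [h1, h2, Finset.sum_add_distrib])

lemma Below.col_sum {T M : Mat m} (h : Below T M) (j : Fin (m + 1)) :
    ∑ i, T i j = ∑ i, M i j :=
  Multiplicative.ofAdd.injective
    (h.invariant (fun M => Multiplicative.ofAdd (∑ i, M i j)) (fun M N => by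
      rw [← ofAdd_add, ← Finset.sum_add_distrib]; rfl) fun a s l t => by
        simp only [← ofAdd_add, unitMat_apply]
        congr 1
        by_cases h1 : l = j <;> by_cases h2 : t = j <;>
          simp [h1, h2])

/-- The combinations of the `N T`, with `T` below `M`, with coefficients in `q ℤ[q]`. -/
def Pos (N : Mat m → O k m) (M : Mat m) : AddSubgroup (O k m) :=
  AddSubgroup.closure {f | ∃ T ∈ indexABC m, Below T M ∧ ∃ c ∈ qZq k, f = c • N T}

lemma smul_mem_Pos_of_below {N : Mat m → O k m} {M T : Mat m} (hT : T ∈ indexABC m)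
    (h : Below T M) {c : Kq k} (hc : c ∈ qZq k) : c • N T ∈ Pos N M :=
  AddSubgroup.subset_closure ⟨T, hT, h, c, hc, rfl⟩

lemma smul_mem_Pos {N : Mat m → O k m} {M : Mat m} {c : Kq k} (hc : c ∈ qZq k) {f : O k m}
    (hf : f ∈ Pos N M) : c • f ∈ Pos N M := by
  induction hf using AddSubgroup.closure_induction with
  | mem f hf =>
    obtain ⟨T, hT, h, d, hd, rfl⟩ := hf
    rw [smul_smul]
    exact smul_mem_Pos_of_below hT h (qZq_mul hc hd)
  | zero => rw [smul_zero]; exact zero_mem _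
  | add f g _ _ hf hg => rw [smul_add]; exact add_mem hf hg
  | neg f _ hf => rw [smul_neg]; exact neg_mem hf

lemma Pos_mono {N : Mat m → O k m} {T M : Mat m} (h : Below T M) : Pos N T ≤ Pos N M :=
  AddSubgroup.closure_mono fun _ ⟨S, hS, h', hc⟩ => ⟨S, hS, h'.trans h, hc⟩

lemma Pos_le_of_sub {N N' : Mat m → O k m} (h : ∀ T ∈ indexABC m, N' T - N T ∈ Pos N T)
    (M : Mat m) : Pos N' M ≤ Pos N M := by
  rw [Pos, AddSubgroup.closure_le]
  rintro _ ⟨T, hT, hTM, c, hc, rfl⟩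
  have h1 := add_mem (smul_mem_Pos_of_below (N := N) hT hTM hc)
    (smul_mem_Pos hc (Pos_mono hTM (h T hT)))
  rwa [← smul_add, add_sub_cancel] at h1

/-- The inverse of a unitriangular change of families is unitriangular. -/
lemma sub_mem_Pos_symm {N N' : Mat m → O k m} (h : ∀ T ∈ indexABC m, N' T - N T ∈ Pos N T)
    (M : Mat m) (hM : M ∈ indexABC m) : N M - N' M ∈ Pos N' M := by
  induction hn : pot M using Nat.strong_induction_on generalizing M with
  | _ n ih =>
    have hle : Pos N M ≤ Pos N' M := by
      rw [Pos, AddSubgroup.closure_le]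
      rintro _ ⟨T, hT, hTM, c, hc, rfl⟩
      have h1 := add_mem (smul_mem_Pos_of_below (N := N') hT hTM hc)
        (smul_mem_Pos hc (Pos_mono hTM (ih _ (hn ▸ hTM.pot_lt) T hT rfl)))
      rwa [← smul_add, add_sub_cancel] at h1
    rw [← neg_sub]
    exact neg_mem (hle (h M hM))

lemma exists_finsupp_of_mem_Pos {N : Mat m → O k m} {M : Mat m} {f : O k m} (hf : f ∈ Pos N M) :
    ∃ v : Mat m →₀ Kq k, (∀ T, v T ∈ qZq k) ∧ (∀ T ∈ v.support, T ∈ indexABC m ∧ Below T M) ∧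
      f = Finsupp.linearCombination (Kq k) N v := by
  classical
  induction hf using AddSubgroup.closure_induction with
  | mem f hf =>
    obtain ⟨T, hT, h, c, hc, rfl⟩ := hf
    refine ⟨Finsupp.single T c, fun S => ?_, fun S hS => ?_, ?_⟩
    · rw [Finsupp.single_apply]; split_ifs; exacts [hc, qZq_zero]
    · rw [Finset.mem_singleton.mp (Finsupp.support_single_subset hS)]; exact ⟨hT, h⟩
    · rw [Finsupp.linearCombination_single]
  | zero => exact ⟨0, fun _ => qZq_zero, by simp, by simp⟩
  | add f g _ _ hf hg =>
    obtain ⟨v, h1, h2, rfl⟩ := hf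
    obtain ⟨w, h3, h4, rfl⟩ := hg
    refine ⟨v + w, fun T => qZq_add (h1 T) (h3 T), fun T hT => ?_, (map_add _ _ _).symm⟩
    rcases Finset.mem_union.mp (Finsupp.support_add hT) with h | h
    exacts [h2 T h, h4 T h]
  | neg f _ hf =>
    obtain ⟨v, h1, h2, rfl⟩ := hf
    refine ⟨-v, fun T => qZq_neg (h1 T), fun T hT => h2 T ?_, (map_neg _ _).symm⟩
    rwa [Finsupp.support_neg] at hT

lemma Pos_le_span {N : Mat m → O k m} {M : Mat m} {f : O k m} (hf : f ∈ Pos N M) :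
    f ∈ Submodule.span (ZQ k) (N '' {T | T ∈ indexABC m ∧ Below T M}) := by
  induction hf using AddSubgroup.closure_induction with
  | mem f hf =>
    obtain ⟨T, hT, h, c, hc, rfl⟩ := hf
    exact smul_mem_of_ZQ (qZq_subset_ZQ hc) (Submodule.subset_span ⟨T, ⟨hT, h⟩, rfl⟩)
  | zero => exact zero_mem _
  | add f g _ _ hf hg => exact add_mem hf hg
  | neg f _ hf => exact neg_mem hf

lemma xNorm_mem_LowEq (M : Mat m) : xNorm k M ∈ LowEq k M :=
  smul_mem_of_ZQ (q_zpow_mem_ZQ _) (xMon_mem_LowEq M)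

lemma xMon_eq (M : Mat m) : xMon k M = q k ^ (-normExp M) • xNorm k M := by
  rw [xNorm, smul_smul, ← zpow_add₀ (q_ne_zero k), neg_add_cancel, zpow_zero, one_smul]

lemma Pos_xNorm_le_Low {M : Mat m} {f : O k m} (hf : f ∈ Pos (xNorm k) M) : f ∈ Low k M := by
  refine (Submodule.span_le.mpr ?_ : Submodule.span (ZQ k) _ ≤ Low k M) (Pos_le_span hf)
  rintro _ ⟨T, ⟨-, hT⟩, rfl⟩
  exact LowEq_le_Low hT (xNorm_mem_LowEq T)

lemma hasLead_xNorm (M : Mat m) : HasLead (xNorm k M) M :=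
  (hasLead_xMon M).smul (q_zpow_mem_ZQ _) (by rw [← zpow_neg]; exact q_zpow_mem_ZQ _)
    (zpow_ne_zero _ (q_ne_zero k))

lemma hasLead_of_sub_mem_Pos {M : Mat m} {f : O k m} (h : f - xNorm k M ∈ Pos (xNorm k) M) :
    HasLead f M := by
  have := (hasLead_xNorm (k := k) M).add_low (Pos_xNorm_le_Low h)
  rwa [add_sub_cancel] at this

/-- A family whose members have the leading monomials of `indexABC` is triangular over the
normalized monomials. -/
lemma isTriangular_of_hasLead {b : indexABC m → O k m} (hb : ∀ T, HasLead (b T) (T : Mat m)) :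
    IsTriangular (K := Kq k) (fun T : indexABC m => pot (T : Mat m))
      (fun T : indexABC m => xNorm k (T : Mat m)) b := by
  intro T
  obtain ⟨c, -, -, h0, h⟩ := hb T
  refine ⟨c * q k ^ (-normExp (T : Mat m)),
    mul_ne_zero h0 (zpow_ne_zero _ (q_ne_zero k)), ?_⟩
  rw [mul_smul, ← xMon_eq]
  refine Submodule.span_induction (R := ZQ k) (p := fun f _ => f ∈ Submodule.span (Kq k)
    ((fun T : indexABC m => xNorm k (T : Mat m)) '' {S | pot (S : Mat m) < pot (T : Mat m)})) ?_
    (zero_mem _) (fun _ _ _ _ => add_mem) (fun c f _ hf => Submodule.smul_mem _ (c : Kq k) hf) h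
  rintro _ ⟨S, hS, rfl⟩
  by_cases hadm : Admissible S
  · rw [xMon_eq]
    exact Submodule.smul_mem _ _ (Submodule.subset_span
      ⟨⟨S, hS.mem_indexABC T.2 hadm⟩, hS.pot_lt, rfl⟩)
  · rw [xMon_eq_zero hadm]; exact zero_mem _

end Pos

/-! ### Existence of the canonical bases -/

section Existence

variable {k : Type u} [Field k] {m : ℕ}

lemma linearIndepOn_of_hasLead {b : Mat m → O k m} (hb : ∀ T ∈ indexABC m, HasLead (b T) T) :
    LinearIndepOn (Kq k) b (indexABC m) :=
  (isTriangular_of_hasLead (b := fun T : indexABC m => b T) fun T => hb T T.2).linearIndependent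
    linearIndependent_xNorm

lemma Low_le_span {b : Mat m → O k m}
    (hb : ∀ T ∈ indexABC m, b T - xNorm k T ∈ Pos (xNorm k) T) {M : Mat m} (hM : M ∈ indexABC m) :
    Low k M ≤ Submodule.span (ZQ k) (b '' {T | T ∈ indexABC m ∧ Below T M}) := by
  rw [Low, Submodule.span_le]
  rintro _ ⟨T, hT, rfl⟩
  by_cases hadm : Admissible T
  · have hTI := hT.mem_indexABC hM hadm
    rw [xMon_eq]
    refine smul_mem_of_ZQ (q_zpow_mem_ZQ _) ?_
    have h1 := Pos_le_span (Pos_mono hT (sub_mem_Pos_symm hb T hTI))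
    have h2 := add_mem h1 (Submodule.subset_span (R := ZQ k) (s := b '' _)
      ⟨T, ⟨hTI, hT⟩, rfl⟩)
    rwa [sub_add_cancel] at h2
  · rw [xMon_eq_zero hadm]; exact zero_mem _

lemma bar_linearCombination {b : Mat m → O k m} (v : Mat m →₀ Kq k)
    (hv : ∀ T ∈ v.support, bar k (b T) = b T) : bar k (Finsupp.linearCombination (Kq k) b v) =
      ∑ T ∈ v.support, barScalar k (v T) • b T := by
  rw [Finsupp.linearCombination_apply, Finsupp.sum, bar_sum]
  exact Finset.sum_congr rfl fun T hT => by rw [bar_smul, hv T hT]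

lemma eq_zero_of_sum_eq_zero {b : Mat m → O k m} (hb : LinearIndepOn (Kq k) b (indexABC m))
    (s : Finset (Mat m)) (hs : ∀ T ∈ s, T ∈ indexABC m) (c : Mat m → Kq k)
    (h : ∑ T ∈ s, c T • b T = 0) : ∀ T ∈ s, c T = 0 := by
  classical
  intro T hT
  have h1 := linearIndepOn_iff.mp hb (Finsupp.onFinset s (fun T => if T ∈ s then c T else 0)
    (fun T hT => by by_contra hn; exact hT (if_neg hn))) ?_ ?_
  · have := DFunLike.congr_fun h1 T
    rwa [Finsupp.onFinset_apply, if_pos hT] at this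
  · intro S hS
    exact hs S (Finsupp.support_onFinset_subset hS)
  · rw [Finsupp.linearCombination_apply, Finsupp.onFinset_sum _ (fun T => zero_smul _ (b T)), ← h]
    exact Finset.sum_congr rfl fun T hT => by rw [if_pos hT]

lemma isCanonical_of_sub_mem_Pos {I : Set (Mat m)} {N : Mat m → O k m} {M : Mat m} {f : O k m}
    (hI : ∀ T ∈ indexABC m, Below T M → T ∈ I) (hf : bar k f = f) (h : f - N M ∈ Pos N M) :
    IsCanonical k I Below (qZq k) N M f := by
  obtain ⟨v, h1, h2, h3⟩ := exists_finsupp_of_mem_Pos h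
  exact ⟨hf, v, fun T hT => ⟨hI T (h2 T hT).1 (h2 T hT).2, (h2 T hT).2, h1 T⟩,
    sub_eq_iff_eq_add'.mp h3⟩

variable [CharZero k]

/-- One step of the construction of the canonical basis: correct `x(M)` by canonical elements below
it. -/
lemma exists_canonical_step {b : Mat m → O k m}
    (hb : ∀ T ∈ indexABC m, b T - xNorm k T ∈ Pos (xNorm k) T) {M : Mat m} (hM : M ∈ indexABC m)
    (hbar : ∀ T ∈ indexABC m, Below T M → bar k (b T) = b T) :
    ∃ f, bar k f = f ∧ f - xNorm k M ∈ Pos (xNorm k) M := by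
  obtain ⟨l, hl, hl2⟩ := (Finsupp.mem_span_image_iff_linearCombination (ZQ k)).mp
    (Low_le_span hb hM (bar_xNorm hM.1))
  have hl' : ∀ T ∈ l.support, T ∈ indexABC m ∧ Below T M := fun T hT => hl hT
  have hz : bar k (xNorm k M) - xNorm k M = ∑ T ∈ l.support, (l T : Kq k) • b T := by
    rw [← hl2, Finsupp.linearCombination_apply]; rfl
  have hneg : ∑ T ∈ l.support, ((l T : Kq k) + barScalar k (l T : Kq k)) • b T = 0 := by
    have h1 := congrArg (bar k) hz
    rw [bar_sub, bar_bar, bar_sum] at h1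
    simp only [add_smul, Finset.sum_add_distrib]
    rw [← hz, show ∑ T ∈ l.support, barScalar k (l T : Kq k) • b T = xNorm k M - bar k (xNorm k M)
      from ?_]
    · abel
    · rw [h1]
      refine Finset.sum_congr rfl fun T hT => ?_
      rw [bar_smul, hbar T (hl' T hT).1 (hl' T hT).2]
  have hind := linearIndepOn_of_hasLead fun T hT => hasLead_of_sub_mem_Pos (hb T hT)
  have h0 := eq_zero_of_sum_eq_zero hind _ (fun T hT => (hl' T hT).1) _ hneg
  have hex : ∀ T, ∃ h ∈ qZq k, T ∈ l.support → (l T : Kq k) = h - barScalar k h := by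
    intro T
    by_cases hT : T ∈ l.support
    · obtain ⟨h, hh, he⟩ := exists_qZq_sub_bar (l T).2 (eq_neg_of_add_eq_zero_right (h0 T hT))
      exact ⟨h, hh, fun _ => he⟩
    · exact ⟨0, qZq_zero, fun h => absurd h hT⟩
  choose h hh he using hex
  refine ⟨xNorm k M + ∑ T ∈ l.support, h T • b T, ?_, ?_⟩
  · rw [bar_add, bar_sum, ← sub_eq_zero]
    have h1 : ∑ T ∈ l.support, bar k (h T • b T) =
        ∑ T ∈ l.support, h T • b T - ∑ T ∈ l.support, (l T : Kq k) • b T := by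
      rw [← Finset.sum_sub_distrib]
      refine Finset.sum_congr rfl fun T hT => ?_
      rw [bar_smul, hbar T (hl' T hT).1 (hl' T hT).2, ← sub_smul, he T hT, sub_sub_cancel]
    rw [h1, ← hz]
    abel
  · rw [add_sub_cancel_left]
    exact Pos_le_of_sub hb M (sum_mem fun T hT =>
      smul_mem_Pos_of_below (hl' T hT).1 (hl' T hT).2 (hh T))

/-- Existence of the canonical basis relative to the normalized monomials of `indexABC`. -/
theorem exists_canonical : ∃ b : Mat m → O k m, ∀ T ∈ indexABC m,
    bar k (b T) = b T ∧ b T - xNorm k T ∈ Pos (xNorm k) T := by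
  have key : ∀ n, ∃ b : Mat m → O k m, (∀ T ∈ indexABC m, b T - xNorm k T ∈ Pos (xNorm k) T) ∧
      ∀ T ∈ indexABC m, pot T < n → bar k (b T) = b T := by
    intro n
    induction n with
    | zero =>
      exact ⟨xNorm k, fun T _ => by rw [sub_self]; exact zero_mem _,
        fun T _ h => absurd h (Nat.not_lt_zero _)⟩
    | succ n ih =>
      obtain ⟨b, hb, hbar⟩ := ih
      have h1 : ∀ T, ∃ f, T ∈ indexABC m → f - xNorm k T ∈ Pos (xNorm k) T ∧
          (pot T < n + 1 → bar k f = f) := by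
        intro T
        by_cases hT : T ∈ indexABC m
        · by_cases hp : pot T < n + 1
          · obtain ⟨f, hf, hf'⟩ := exists_canonical_step hb hT fun S hS hST =>
              hbar S hS (hST.pot_lt.trans_le (Nat.lt_succ_iff.mp hp))
            exact ⟨f, fun _ => ⟨hf', fun _ => hf⟩⟩
          · exact ⟨b T, fun _ => ⟨hb T hT, fun h => absurd h hp⟩⟩
        · exact ⟨0, fun h => absurd h hT⟩
      choose f hf using h1
      exact ⟨f, fun T hT => (hf T hT).1, fun T hT hp => (hf T hT).2 hp⟩
  have h1 : ∀ T, ∃ f, T ∈ indexABC m → bar k f = f ∧ f - xNorm k T ∈ Pos (xNorm k) T := by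
    intro T
    obtain ⟨b, hb, hbar⟩ := key (pot T + 1)
    exact ⟨b T, fun hT => ⟨hbar T hT (Nat.lt_succ_self _), hb T hT⟩⟩
  choose b hb using h1
  exact ⟨b, hb⟩

/-! #### Identification of the canonical elements -/

omit [CharZero k] in
lemma IsCanonical.sub_mem_Pos {I : Set (Mat m)} {N : Mat m → O k m} {M : Mat m} {f : O k m}
    (hI : I ⊆ indexABC m) (h : IsCanonical k I Below (qZq k) N M f) : f - N M ∈ Pos N M := by
  obtain ⟨-, v, h1, rfl⟩ := h
  rw [add_sub_cancel_left]
  exact sum_mem fun T hT => smul_mem_Pos_of_below (hI (h1 T hT).1) (h1 T hT).2.1 (h1 T hT).2.2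

lemma indexAB_subset : indexAB m ⊆ indexABC m := fun _ h => ⟨h.1, h.2 _⟩

lemma Below.mem_indexAB {T M : Mat m} (h : Below T M) (hM : M ∈ indexAB m) (hT : Admissible T) :
    T ∈ indexAB m := by
  refine ⟨hT, fun j => ?_⟩
  have h1 := h.row_sum (Fin.last m)
  simp only [hM.2, Finset.sum_const_zero] at h1
  exact (Finset.sum_eq_zero_iff.mp h1) j (Finset.mem_univ j)

lemma isCanonical_omegaAB {M : Mat m} (hM : M ∈ indexAB m) :
    IsCanonical k (indexAB m) Below (qZq k) (xNorm k) M (omegaAB k M) := by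
  obtain ⟨b, hb⟩ := exists_canonical (k := k) (m := m)
  have h := hb M (indexAB_subset hM)
  exact Classical.epsilon_spec ⟨b M,
    isCanonical_of_sub_mem_Pos (fun T hT h => h.mem_indexAB hM hT.1) h.1 h.2⟩

lemma not_below_of_mem_indexC {M : Mat m} (hM : M ∈ indexC m) (T : Mat m) : ¬ Below T M := by
  have : ∀ S, ¬ Step S M := by
    rintro S ⟨i, s, j, t, his, -, h, -⟩
    obtain ⟨i, rfl⟩ := Fin.exists_castSucc_eq.mpr (his.trans_le (Fin.le_last s)).ne
    rw [hM.2.1 i j] at h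
    omega
  intro h
  cases h with
  | single h => exact this _ h
  | tail _ h => exact this _ h

/-- Nothing lies below a matrix with a single nonzero row. -/
lemma omegaC_eq {M : Mat m} (hM : M ∈ indexC m) : omegaC k M = xNorm k M := by
  have hbar : bar k (xNorm k M) = xNorm k M := by
    have h := bar_xNorm (k := k) hM.1
    have h0 : {T | Below T M} = ∅ := Set.eq_empty_of_forall_notMem (not_below_of_mem_indexC hM)
    rw [Low, h0, Set.image_empty, Submodule.span_empty, Submodule.mem_bot] at h
    exact sub_eq_zero.mp h
  have h : IsCanonical k (indexC m) Below (qinvZqinv k) (xNorm k) M (omegaC k M) :=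
    Classical.epsilon_spec ⟨xNorm k M, hbar, 0, by simp, by simp⟩
  obtain ⟨-, v, hv, h2⟩ := h
  have hv0 : v = 0 := Finsupp.support_eq_empty.mp (Finset.eq_empty_of_forall_notMem fun T hT =>
    not_below_of_mem_indexC hM T (hv T hT).2.1)
  rw [h2, hv0, Finsupp.sum_zero_index, add_zero]

omit [CharZero k] in
/-- Splitting off the last row of a monomial. -/
lemma xMon_normExp_add_bottom {T : Mat m} (hT : ∀ j, T (Fin.last m) j = 0) (C : Mat m)
    (hC : ∀ (i : Fin m) j, C i.castSucc j = 0) : xMon k (T + C) = xMon k T * xMon k C ∧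
    normExp (T + C) = normExp T + normExp C -
      ∑ t, (-1 : ℤ) ^ par t * ((∑ i, T i t : ℕ) * C (Fin.last m) t : ℤ) := by
  induction C using peel_right_induction with
  | h0 => simp [xMon_zero, normExp_zero]
  | h C s t hl ih =>
    have hC' : ∀ (i : Fin m) j, C i.castSucc j = 0 := fun i j => by
      have := hC i j
      rw [Matrix.add_apply] at this
      omega
    have hs : s = Fin.last m := by
      by_contra hs
      obtain ⟨s', rfl⟩ := Fin.exists_castSucc_eq.mpr hs
      have := hC s' t
      rw [Matrix.add_apply, unitMat_apply, if_pos ⟨rfl, rfl⟩] at this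
      omega
    subst hs
    obtain ⟨h1, h2⟩ := ih hC'
    constructor
    · rw [← add_assoc, xMon_add_right hl, xMon_add_right, h1, mul_assoc]
      rintro a b (h | ⟨rfl, h⟩)
      · exact absurd h (not_lt.mpr (Fin.le_last a))
      · rw [Matrix.add_apply, hT, hl _ _ (Or.inr ⟨rfl, h⟩)]
    · rw [← add_assoc, normExp_add_unitMat, normExp_add_unitMat, h2]
      have e1 : ∑ i, (if i = Fin.last m then 0 else ((T + C) i t : ℤ)) = (∑ i, T i t : ℕ) := by
        rw [Nat.cast_sum]
        refine Finset.sum_congr rfl fun i _ => ?_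
        split_ifs with hi
        · rw [hi, hT, Nat.cast_zero]
        · obtain ⟨i, rfl⟩ := Fin.exists_castSucc_eq.mpr hi
          rw [Matrix.add_apply, hC', add_zero]
      have e2 : ∑ i, (if i = Fin.last m then 0 else (C i t : ℤ)) = 0 := by
        refine Finset.sum_eq_zero fun i _ => ?_
        split_ifs with hi
        · rfl
        · obtain ⟨i, rfl⟩ := Fin.exists_castSucc_eq.mpr hi
          rw [hC', Nat.cast_zero]
      have e3 : ∀ l, ((T + C) (Fin.last m) l : ℤ) = C (Fin.last m) l := fun l => by
        rw [Matrix.add_apply, hT, zero_add]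
      have e4 : ∑ l, (-1 : ℤ) ^ par l * ((∑ i, T i l : ℕ) *
          ((C + unitMat (Fin.last m) t) (Fin.last m) l : ℕ) : ℤ) =
          ∑ l, (-1 : ℤ) ^ par l * ((∑ i, T i l : ℕ) * (C (Fin.last m) l : ℕ) : ℤ) +
          (-1 : ℤ) ^ par t * (∑ i, T i t : ℕ) := by
        have : ∀ l, (-1 : ℤ) ^ par l * ((∑ i, T i l : ℕ) *
            ((C + unitMat (Fin.last m) t) (Fin.last m) l : ℕ) : ℤ) =
            (-1 : ℤ) ^ par l * ((∑ i, T i l : ℕ) * (C (Fin.last m) l : ℕ) : ℤ) +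
            if l = t then (-1 : ℤ) ^ par t * (∑ i, T i t : ℕ) else 0 := by
          intro l
          rw [Matrix.add_apply, unitMat_apply]
          by_cases h : l = t
          · subst h; simp; ring
          · simp [h, Ne.symm h]
        rw [Finset.sum_congr rfl fun l _ => this l, Finset.sum_add_distrib, Finset.sum_ite_eq',
          if_pos (Finset.mem_univ t)]
      rw [e1, e2, e4]
      simp only [e3]
      ring

lemma topRows_add_bottomRow (M : Mat m) : topRows M + bottomRow M = M := by
  ext i j
  rw [Matrix.add_apply, topRows, bottomRow]
  split_ifs <;> simp

lemma topRows_mem {M : Mat m} (hM : M ∈ indexABC m) : topRows M ∈ indexAB m := by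
  refine ⟨fun i j h => ?_, fun j => if_pos rfl⟩
  rw [topRows]; split_ifs
  exacts [Nat.zero_le _, hM.1 i j h]

lemma bottomRow_mem {M : Mat m} (hM : M ∈ indexABC m) : bottomRow M ∈ indexC m := by
  refine ⟨fun i j h => ?_, fun i j => if_neg (Fin.castSucc_lt_last i).ne, ?_⟩
  · rw [bottomRow]; split_ifs
    exacts [hM.1 i j h, Nat.zero_le _]
  · rw [bottomRow, if_pos rfl]; exact hM.2

omit [CharZero k] in
/-- The exponent in the definition of `N(M)` turns the product of normalized monomials into a normalized
monomial. -/
lemma smul_xNorm_mul_bottomRow {M T : Mat m} (hM : M ∈ indexABC m) (hT : T ∈ indexAB m)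
    (hcol : ∀ j, ∑ i, T i j = ∑ i, topRows M i j) :
    q k ^ exponentABC M • (xNorm k T * xNorm k (bottomRow M)) = xNorm k (T + bottomRow M) := by
  obtain ⟨h1, h2⟩ := xMon_normExp_add_bottom (k := k) hT.2 (bottomRow M) (bottomRow_mem hM).2.1
  have he : ∑ t, (-1 : ℤ) ^ par t * ((∑ i, T i t : ℕ) * bottomRow M (Fin.last m) t : ℤ) =
      -exponentABC M := by
    rw [Fin.sum_univ_castSucc, (bottomRow_mem hM).2.2, Nat.cast_zero, mul_zero, mul_zero, add_zero,
      exponentABC, neg_neg]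
    refine Finset.sum_congr rfl fun j _ => ?_
    rw [par_castSucc, pow_zero, one_mul, hcol, Fin.sum_univ_castSucc]
    simp [topRows, bottomRow, (Fin.castSucc_lt_last _).ne]
  rw [xNorm, xNorm, xNorm, smul_mul_smul_comm, smul_smul, ← h1, ← zpow_add₀ (q_ne_zero k),
    ← zpow_add₀ (q_ne_zero k), h2, he]
  congr 2
  ring

/-- The family `N(M)` is unitriangular over the normalized monomials. -/
lemma nABC_sub_mem {M : Mat m} (hM : M ∈ indexABC m) :
    nABC k M - xNorm k M ∈ Pos (xNorm k) M := by
  obtain ⟨-, v, hv, h⟩ := isCanonical_omegaAB (k := k) (topRows_mem hM)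
  have h1 := smul_xNorm_mul_bottomRow (k := k) hM (topRows_mem hM) fun _ => rfl
  rw [topRows_add_bottomRow] at h1
  rw [nABC, omegaC_eq (bottomRow_mem hM), h, add_mul, smul_add, h1, add_sub_cancel_left,
    Finsupp.sum, Finset.sum_mul, Finset.smul_sum]
  refine sum_mem fun T hT => ?_
  obtain ⟨hT1, hT2, hT3⟩ := hv T hT
  rw [smul_mul_assoc, smul_comm, smul_xNorm_mul_bottomRow hM hT1 hT2.col_sum]
  refine smul_mem_Pos_of_below ⟨fun i j hij => ?_, ?_⟩ ?_ hT3
  · rw [Matrix.add_apply, bottomRow]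
    split_ifs with hi
    · rw [hi, hT1.2, zero_add, ← hi]; exact hM.1 i j hij
    · rw [add_zero]; exact hT1.1 i j hij
  · rw [Matrix.add_apply, hT1.2, zero_add]; exact (bottomRow_mem hM).2.2
  · have := hT2.add (bottomRow M)
    rwa [topRows_add_bottomRow] at this

/-- The element `Ω_q(M₁ M₂; M₃ 0)` is the canonical element relative to the normalized
monomials. -/
theorem omegaABC_spec {M : Mat m} (hM : M ∈ indexABC m) :
    bar k (omegaABC k M) = omegaABC k M ∧ omegaABC k M - xNorm k M ∈ Pos (xNorm k) M := by
  obtain ⟨b, hb⟩ := exists_canonical (k := k) (m := m)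
  have hN : ∀ T ∈ indexABC m, nABC k T - xNorm k T ∈ Pos (xNorm k) T := fun T hT => nABC_sub_mem hT
  have hN' := sub_mem_Pos_symm hN
  have h1 : IsCanonical k (indexABC m) Below (qZq k) (nABC k) M (b M) := by
    refine isCanonical_of_sub_mem_Pos (fun T hT _ => hT) (hb M hM).1 ?_
    rw [← sub_add_sub_cancel _ (xNorm k M)]
    exact add_mem (Pos_le_of_sub hN' M (hb M hM).2) (hN' M hM)
  have h2 : IsCanonical k (indexABC m) Below (qZq k) (nABC k) M (omegaABC k M) :=
    Classical.epsilon_spec ⟨b M, h1⟩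
  refine ⟨h2.1, ?_⟩
  rw [← sub_add_sub_cancel _ (nABC k M)]
  exact add_mem (Pos_le_of_sub hN M (h2.sub_mem_Pos fun _ h => h)) (hN M hM)

end Existence

/-! ### The bar involution and the action -/

section BarAction

variable {k : Type u} [Field k] {m : ℕ}

lemma barScalar_kappa (p : Fin m) (i : Fin (m + 1)) :
    barScalar k (kappa k p i) = ((kappa k p i)⁻¹ : (Kq k)ˣ) := by
  rw [Units.val_inv_eq_inv_val]
  by_cases h1 : i = p.castSucc
  · rw [h1, kappa_castSucc, map_pow, barScalar_q, inv_pow]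
  · by_cases h2 : i = p.succ
    · subst h2
      rcases par_cases p.succ with h | h
      · rw [kappa_succ_even p h, map_inv₀, map_pow, barScalar_q, inv_pow]
      · rw [kappa_succ_odd p h, map_pow, barScalar_q, inv_pow]
    · rw [kappa_eq_one p h1 h2, Units.val_one, map_one, inv_one]

lemma IsHomog.scale {e : ℕ} {f : O k m} (hf : IsHomog e f) (r c : Fin (m + 1) → (Kq k)ˣ) :
    IsHomog e (QuantumGL.scale r c f) := by
  rw [IsHomog, parAut, scale_comm, ← parAut, hf, map_smul]

lemma IsHomog.opE {e : ℕ} {f : O k m} (hf : IsHomog e f) (p : Fin m) :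
    IsHomog (e + par p.succ) (QuantumGL.opE p f) := by
  rw [IsHomog, parAut, scale_opE, ← parAut, hf, map_smul, smul_smul, pow_add, mul_comm]
  congr 1
  rcases par_cases p.succ with h | h <;> simp [par_castSucc, h]

lemma IsHomog.opF {e : ℕ} {f : O k m} (hf : IsHomog e f) (p : Fin m) :
    IsHomog (e + par p.succ) (QuantumGL.opF p f) := by
  rw [IsHomog, parAut, scale_opF, ← parAut, hf, map_smul, smul_smul, pow_add, mul_comm]
  congr 1
  rcases par_cases p.succ with h | h <;> simp [par_castSucc, h]

lemma IsHomog.opP {e : ℕ} {f : O k m} (hf : IsHomog e f) (p : Fin m) :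
    QuantumGL.opP p f = (-1 : Kq k) ^ (e * par p.succ) • f := by
  rcases par_cases p.succ with h | h
  · rw [opP_even p h, h, mul_zero, pow_zero, one_smul]
  · rw [opP_eq_parAut p h, hf, h, mul_one]

/-- Compatibility of the bar involution with the action of `E_p` and of its Cartan element. -/
structure BarCompatE (p : Fin m) (f : O k m) : Prop where
  homog : ∃ e, IsHomog e f
  cartan : bar k (opKKinv p f) = opKK p (bar k f)
  op : bar k (opE p f) = (q k ^ 2)⁻¹ • opKK p (opE p (bar k f))

lemma barCompatE_x (p : Fin m) (i j : Fin (m + 1)) : BarCompatE p (x k i j) := by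
  refine ⟨⟨_, isHomog_x i j⟩, ?_, ?_⟩
  · rw [opKKinv_x, bar_smul, bar_x, opKK_x, ← barScalar_kappa, barScalar_barScalar]
  · rw [bar_x, opE_x]
    split_ifs
    · rw [bar_x, opKK_x, kappa_castSucc, inv_smul_smul₀ (pow_ne_zero _ (q_ne_zero k))]
    · rw [bar_zero, map_zero, smul_zero]

/-- Compatibility of the bar involution with the action of an even `F_p` and of its Cartan
element. -/
structure BarCompatF (p : Fin m) (f : O k m) : Prop where
  homog : ∃ e, IsHomog e f
  cartan : bar k (opKK p f) = opKKinv p (bar k f)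
  op : bar k (opF p f) = (q k ^ 2)⁻¹ • opKKinv p (opF p (bar k f))

lemma barCompatF_x (p : Fin m) (hp : par p.succ = 0) (i j : Fin (m + 1)) :
    BarCompatF p (x k i j) := by
  refine ⟨⟨_, isHomog_x i j⟩, ?_, ?_⟩
  · rw [opKK_x, bar_smul, bar_x, opKKinv_x, barScalar_kappa]
  · rw [bar_x, opF_x]
    split_ifs
    · rw [bar_x, opKKinv_x, Units.val_inv_eq_inv_val, kappa_succ_even p hp, inv_inv,
        inv_smul_smul₀ (pow_ne_zero _ (q_ne_zero k))]
    · rw [bar_zero, map_zero, smul_zero]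

variable [CharZero k]

lemma BarCompatE.mul {p : Fin m} {f g : O k m} (hf : BarCompatE p f) (hg : BarCompatE p g) :
    BarCompatE p (f * g) := by
  obtain ⟨⟨e, he⟩, hf1, hf2⟩ := hf
  obtain ⟨⟨e', he'⟩, hg1, hg2⟩ := hg
  have hK : ∀ {e : ℕ} {f : O k m}, IsHomog e f → IsHomog e (opKKinv p f) := fun h => h.scale _ _
  refine ⟨⟨e + e', he.mul he'⟩, ?_, ?_⟩
  · rw [map_mul, (hK he).bar_mul (hK he'), he.bar_mul he', map_smul, map_mul, hf1, hg1]
  · rw [opE_mul, he.opP, bar_add, smul_mul_assoc, bar_smul, he.bar_mul (he'.opE p),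
      (he.opE p).bar_mul (hK he'), he.bar_mul he', map_smul, map_smul, opE_mul,
      he'.bar.opP, map_add, map_mul, map_mul, opKK_opKKinv, map_smul, map_pow, map_neg, map_one,
      hf2, hg2, hg1]
    rw [smul_smul, ← pow_add, mul_add e e', add_mul e, smul_add]
    have h1 : (-1 : Kq k) ^ (e * par p.succ + (e * e' + e * par p.succ)) = (-1) ^ (e * e') := by
      rw [← add_assoc, add_comm (e * par p.succ), add_assoc, pow_add, ← two_mul, pow_mul]
      simp
    rw [h1, pow_add, mul_comm (par p.succ) e']
    simp only [smul_mul_assoc, mul_smul_comm, smul_smul, smul_add]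
    rw [add_comm]
    congr 2 <;> ring

lemma barCompatE_xMon (p : Fin m) (M : Mat m) : BarCompatE p (xMon k M) := by
  induction M using peel_left_induction with
  | h0 =>
    rw [xMon_zero]
    exact ⟨⟨0, by simp [IsHomog]⟩, by simp [bar_one], by simp [bar_one, opE_one, bar_zero]⟩
  | h M i j hl ih =>
    rw [xMon_add_left hl]
    exact (barCompatE_x p i j).mul ih

lemma BarCompatF.mul {p : Fin m} (hp : par p.succ = 0) {f g : O k m} (hf : BarCompatF p f)
    (hg : BarCompatF p g) : BarCompatF p (f * g) := by
  obtain ⟨⟨e, he⟩, hf1, hf2⟩ := hf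
  obtain ⟨⟨e', he'⟩, hg1, hg2⟩ := hg
  have hF : ∀ {e : ℕ} {f : O k m}, IsHomog e f → IsHomog e (opF p f) := fun h => by
    have := h.opF p
    rwa [hp, add_zero] at this
  have hK : ∀ {e : ℕ} {f : O k m}, IsHomog e f → IsHomog e (opKK p f) := fun h => h.scale _ _
  refine ⟨⟨e + e', he.mul he'⟩, ?_, ?_⟩
  · rw [map_mul, (hK he).bar_mul (hK he'), he.bar_mul he', map_smul, map_mul, hf1, hg1]
  · rw [opF_mul, opP_even p hp, bar_add, (hK he).bar_mul (hF he'), (hF he).bar_mul he',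
      he.bar_mul he', map_smul, map_smul, opF_mul, opP_even p hp, map_add, map_mul, map_mul,
      opKKinv_opKK, hf2, hg2, hf1]
    simp only [smul_mul_assoc, mul_smul_comm, smul_smul, smul_add]
    rw [add_comm]
    congr 2 <;> ring

lemma barCompatF_xMon (p : Fin m) (hp : par p.succ = 0) (M : Mat m) :
    BarCompatF p (xMon k M) := by
  induction M using peel_left_induction with
  | h0 =>
    rw [xMon_zero]
    exact ⟨⟨0, by simp [IsHomog]⟩, by simp [bar_one], by simp [bar_one, opF_one, bar_zero]⟩
  | h M i j hl ih =>
    rw [xMon_add_left hl]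
    exact (barCompatF_x p hp i j).mul hp ih

/-- On the ordered monomials, the kernel of `E_p` is stable under the bar involution. -/
lemma opE_bar_eq_zero (p : Fin m) {f : O k m}
    (hf : f ∈ Submodule.span (Kq k) (Set.range (xMon k : Mat m → O k m))) (h0 : opE p f = 0) :
    opE p (bar k f) = 0 := by
  have h : bar k (opE p f) = (q k ^ 2)⁻¹ • opKK p (opE p (bar k f)) := by
    clear h0
    induction hf using Submodule.span_induction with
    | mem f hf => obtain ⟨M, rfl⟩ := hf; exact (barCompatE_xMon p M).op
    | zero => simp [bar_zero]
    | add f g _ _ hf hg => rw [map_add, bar_add, bar_add, map_add, map_add, smul_add, hf, hg]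
    | smul c f _ hf => rw [map_smul, bar_smul, bar_smul, map_smul, map_smul, hf, smul_comm]
  rw [h0, bar_zero] at h
  have h1 := (smul_eq_zero.mp h.symm).resolve_left (inv_ne_zero (pow_ne_zero _ (q_ne_zero k)))
  rw [← opKKinv_opKK p (opE p (bar k f)), h1, map_zero]

/-- On the ordered monomials, the kernel of an even `F_p` is stable under the bar involution. -/
lemma opF_bar_eq_zero (p : Fin m) (hp : par p.succ = 0) {f : O k m}
    (hf : f ∈ Submodule.span (Kq k) (Set.range (xMon k : Mat m → O k m))) (h0 : opF p f = 0) :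
    opF p (bar k f) = 0 := by
  have h : bar k (opF p f) = (q k ^ 2)⁻¹ • opKKinv p (opF p (bar k f)) := by
    clear h0
    induction hf using Submodule.span_induction with
    | mem f hf => obtain ⟨M, rfl⟩ := hf; exact (barCompatF_xMon p hp M).op
    | zero => simp [bar_zero]
    | add f g _ _ hf hg => rw [map_add, bar_add, bar_add, map_add, map_add, smul_add, hf, hg]
    | smul c f _ hf => rw [map_smul, bar_smul, bar_smul, map_smul, map_smul, hf, smul_comm]
  rw [h0, bar_zero] at h
  have h1 := (smul_eq_zero.mp h.symm).resolve_left (inv_ne_zero (pow_ne_zero _ (q_ne_zero k)))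
  rw [← opKK_opKKinv p (opF p (bar k f)), h1, map_zero]

end BarAction

/-! ### Kernels of the generators and the canonical basis -/

section Kernel

variable {k : Type u} [Field k] {m : ℕ}

lemma HasLead.mem_span_xMon {f : O k m} {M : Mat m} (h : HasLead f M) :
    f ∈ Submodule.span (Kq k) (Set.range (xMon k : Mat m → O k m)) := by
  refine Submodule.span_induction (R := ZQ k)
    (p := fun f _ => f ∈ Submodule.span (Kq k) (Set.range (xMon k : Mat m → O k m))) ?_
    (zero_mem _) (fun _ _ _ _ => add_mem) (fun c f _ hf => Submodule.smul_mem _ (c : Kq k) hf)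
    h.mem_LowEq
  rintro _ ⟨S, -, rfl⟩
  exact Submodule.subset_span ⟨S, rfl⟩

variable [CharZero k]

/-- The data by which the kernel of `G` is described by the subset `L` of the index set: leading
terms of kernel vectors belong to `L`, each element of `L` leads a kernel vector, and the kernel is
stable under the bar involution. -/
structure HasCrystalKernel (G : O k m →ₗ[Kq k] O k m) (L : Set (Mat m)) : Prop where
  leading : ∀ v : Mat m →₀ Kq k, IsRegular v → G (evalMon k m v) = 0 →
    ∀ T, co k (v T) 0 ≠ 0 → T ∈ L
  vector : ∀ M ∈ indexABC m, M ∈ L → ∃ w, HasLead w M ∧ G w = 0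
  bar_stable : ∀ f ∈ Submodule.span (Kq k) (Set.range (xMon k : Mat m → O k m)), G f = 0 →
    G (bar k f) = 0

/-- The coordinates of a canonical element in the normalized monomials. -/
lemma exists_coords_omegaABC : ∃ h : Mat m → Mat m →₀ Kq k, ∀ M ∈ indexABC m,
    (∀ T, h M T ∈ qZq k) ∧ (∀ T ∈ (h M).support, T ∈ indexABC m) ∧
      omegaABC k M = evalMon k m (Finsupp.single M 1 + h M) := by
  have h1 : ∀ M : Mat m, ∃ v : Mat m →₀ Kq k, M ∈ indexABC m → (∀ T, v T ∈ qZq k) ∧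
      (∀ T ∈ v.support, T ∈ indexABC m) ∧
      omegaABC k M = evalMon k m (Finsupp.single M 1 + v) := by
    intro M
    by_cases hM : M ∈ indexABC m
    · obtain ⟨v, h1, h2, h3⟩ := exists_finsupp_of_mem_Pos (omegaABC_spec (k := k) hM).2
      refine ⟨v, fun _ => ⟨h1, fun T hT => (h2 T hT).1, ?_⟩⟩
      rw [map_add, evalMon, Finsupp.linearCombination_single, one_smul]
      exact sub_eq_iff_eq_add'.mp h3
    · exact ⟨0, fun h => absurd h hM⟩
  exact ⟨fun M => (h1 M).choose, fun M hM => (h1 M).choose_spec hM⟩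

variable {G : O k m →ₗ[Kq k] O k m} {L : Set (Mat m)}

/-- The leading terms of kernel vectors in the coordinates of the canonical basis. -/
lemma HasCrystalKernel.leading_omegaABC (hG : HasCrystalKernel G L) {z : Mat m →₀ Kq k}
    (hz : IsRegular z) (h0 : G (Finsupp.linearCombination (Kq k) (omegaABC k) z) = 0) {T : Mat m}
    (hT : co k (z T) 0 ≠ 0) : T ∈ L := by
  classical
  obtain ⟨h, hh⟩ := exists_coords_omegaABC (k := k) (m := m)
  have hval : ∀ S, (∑ M ∈ z.support, z M • (Finsupp.single M (1 : Kq k) + h M)) S =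
      z S + ∑ M ∈ z.support, z M * h M S := by
    intro S
    rw [Finsupp.finsetSum_apply]
    simp only [Finsupp.smul_apply, Finsupp.add_apply, smul_eq_mul, mul_add, Finset.sum_add_distrib]
    congr 1
    simp only [Finsupp.single_apply, mul_ite, mul_one, mul_zero]
    rw [Finset.sum_ite_eq' z.support S]
    split_ifs with hS
    · rfl
    · exact (Finsupp.notMem_support_iff.mp hS).symm
  have hco : ∀ S, ∀ i ≤ 0, co k ((∑ M ∈ z.support, z M • (Finsupp.single M (1 : Kq k) + h M)) S) i
      = co k (z S) i := by
    intro S i hi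
    rw [hval, co_add, co_sum, Finset.sum_eq_zero, add_zero]
    intro M hM
    rw [mul_comm]
    exact co_mul_of_local (fun i hi => co_qZq ((hh M (hz.support M hM)).1 S) i hi) (hz.coeff M) i hi
  refine hG.leading (∑ M ∈ z.support, z M • (Finsupp.single M (1 : Kq k) + h M)) ⟨?_, ?_⟩ ?_ T ?_
  · intro S hS
    by_contra hn
    rw [Finsupp.mem_support_iff, hval] at hS
    refine hS ?_
    rw [Finset.sum_eq_zero, add_zero]
    · by_contra hc
      exact hn (hz.support S (Finsupp.mem_support_iff.mpr hc))
    · intro M hM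
      by_contra hc
      exact hn ((hh M (hz.support M hM)).2.1 S (Finsupp.mem_support_iff.mpr (right_ne_zero_of_mul hc)))
  · intro S i hi
    rw [hco S i hi.le]; exact hz.coeff S i hi
  · rw [← h0, map_sum, Finsupp.linearCombination_apply, Finsupp.sum]
    congr 1
    refine Finset.sum_congr rfl fun M hM => ?_
    rw [map_smul, ← (hh M (hz.support M hM)).2.2]
  · rwa [hco T 0 le_rfl]

/-- A kernel vector without coordinates in `L` vanishes. -/
lemma HasCrystalKernel.eq_zero (hG : HasCrystalKernel G L) {z : Mat m →₀ Kq k}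
    (hz : ∀ T ∈ z.support, T ∈ indexABC m ∧ T ∉ L)
    (h0 : G (Finsupp.linearCombination (Kq k) (omegaABC k) z) = 0) : z = 0 := by
  by_contra hne
  obtain ⟨n, h1, ⟨T, hT⟩, -, h2⟩ := exists_regular_rescale (fun T hT => (hz T hT).1) hne
  have hTL := hG.leading_omegaABC h1 (by rw [map_smul, map_smul, h0, smul_zero])
    (T := T) (by rwa [h2])
  refine (hz T ?_).2 hTL
  rw [Finsupp.mem_support_iff]
  intro h
  rw [h, co_zero] at hT
  exact hT rfl

/-- The canonical elements indexed by `L` belong to the kernel. -/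
theorem HasCrystalKernel.omegaABC_mem (hG : HasCrystalKernel G L) {M : Mat m}
    (hM : M ∈ indexABC m) (hML : M ∈ L) : G (omegaABC k M) = 0 := by
  classical
  induction hn : pot M using Nat.strong_induction_on generalizing M with
  | _ n ih =>
    obtain ⟨w, ⟨c, hc, hc', hc0, hw⟩, hGw⟩ := hG.vector M hM hML
    have hspan := HasLead.mem_span_xMon ⟨c, hc, hc', hc0, hw⟩
    -- normalize `w` to `Ω(M)` plus lower canonical elements
    have hlow : (q k ^ normExp M * c⁻¹) • w - omegaABC k M ∈
        Submodule.span (ZQ k) (omegaABC k '' {T | T ∈ indexABC m ∧ Below T M}) := by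
      have h1 : (q k ^ normExp M * c⁻¹) • w - xNorm k M ∈ Low k M := by
        have := smul_mem_of_ZQ (mul_mem (q_zpow_mem_ZQ (normExp M)) hc') hw
        rwa [smul_sub, smul_smul, mul_assoc, inv_mul_cancel₀ hc0, mul_one] at this
      have h2 := sub_mem h1 (Pos_xNorm_le_Low (omegaABC_spec (k := k) hM).2)
      rw [sub_sub_sub_cancel_right] at h2
      exact Low_le_span (fun T hT => (omegaABC_spec hT).2) hM h2
    obtain ⟨l, hl, hl2⟩ := (Finsupp.mem_span_image_iff_linearCombination (ZQ k)).mp hlow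
    have hl' : ∀ T ∈ l.support, T ∈ indexABC m ∧ Below T M := fun T hT => hl hT
    -- drop the terms already known to lie in the kernel
    let a : Mat m →₀ Kq k := Finsupp.onFinset l.support (fun T => if T ∈ L then 0 else (l T : Kq k))
      (fun T hT => by
        rw [Finsupp.mem_support_iff]
        intro h
        simp [h] at hT)
    have ha : ∀ T, a T = if T ∈ L then 0 else (l T : Kq k) := fun T => Finsupp.onFinset_apply
    have haZ : ∀ T, a T ∈ ZQ k := fun T => by
      rw [ha]; split_ifs; exacts [zero_mem _, (l T).2]
    have hasup : ∀ T ∈ a.support, (T ∈ indexABC m ∧ Below T M) ∧ T ∉ L := fun T hT => by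
      rw [Finsupp.mem_support_iff, ha] at hT
      split_ifs at hT with h
      · exact absurd rfl hT
      · refine ⟨hl' T (Finsupp.mem_support_iff.mpr fun h0 => hT (by rw [h0]; rfl)), h⟩
    let u : O k m := omegaABC k M + Finsupp.linearCombination (Kq k) (omegaABC k) a
    have hu : G u = 0 := by
      have h1 : Finsupp.linearCombination (ZQ k) (omegaABC k) l -
          Finsupp.linearCombination (Kq k) (omegaABC k) a =
          ∑ T ∈ l.support, (if T ∈ L then (l T : Kq k) else 0) • omegaABC k T := by
        rw [Finsupp.linearCombination_apply, Finsupp.linearCombination_apply,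
          Finsupp.onFinset_sum _ (fun T => zero_smul _ (omegaABC k T)), Finsupp.sum,
          ← Finset.sum_sub_distrib]
        refine Finset.sum_congr rfl fun T _ => ?_
        rw [Subring.smul_def, ← sub_smul]
        congr 1
        split_ifs <;> simp
      have h2 : G (∑ T ∈ l.support, (if T ∈ L then (l T : Kq k) else 0) • omegaABC k T) = 0 := by
        rw [map_sum]
        refine Finset.sum_eq_zero fun T hT => ?_
        rw [map_smul]
        split_ifs with h
        · rw [ih _ (hn ▸ (hl' T hT).2.pot_lt) (hl' T hT).1 h rfl, smul_zero]
        · rw [zero_smul]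
      rw [← h1, hl2] at h2
      have h3 : u = (q k ^ normExp M * c⁻¹) • w - ((q k ^ normExp M * c⁻¹) • w - omegaABC k M -
          Finsupp.linearCombination (Kq k) (omegaABC k) a) := by
        simp only [u]; abel
      rw [h3, map_sub, h2, map_smul, hGw, smul_zero, sub_zero]
    have hmem : ∀ T ∈ indexABC m, omegaABC k T ∈
        Submodule.span (Kq k) (Set.range (xMon k : Mat m → O k m)) := fun T hT =>
      (hasLead_of_sub_mem_Pos (omegaABC_spec hT).2).mem_span_xMon
    have humem : u ∈ Submodule.span (Kq k) (Set.range (xMon k : Mat m → O k m)) := by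
      refine add_mem (hmem M hM) ?_
      rw [Finsupp.linearCombination_apply]
      exact sum_mem fun T hT => Submodule.smul_mem _ _ (hmem T (hasup T hT).1.1)
    -- the difference with the bar conjugate has no component in `L`
    have hfix : ∀ T, barScalar k (a T) = a T := by
      let z : Mat m →₀ Kq k := a - a.mapRange (barScalar k) (map_zero _)
      have hz : z = 0 := by
        refine hG.eq_zero (fun T hT => ?_) ?_
        · have hT' : a T ≠ 0 := by
            intro h0
            rw [Finsupp.mem_support_iff] at hT
            simp [z, h0] at hT
          have := hasup T (Finsupp.mem_support_iff.mpr hT')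
          exact ⟨this.1.1, this.2⟩
        · have h1 : Finsupp.linearCombination (Kq k) (omegaABC k) z = u - bar k u := by
            simp only [u]
            rw [map_sub, bar_add, (omegaABC_spec hM).1, add_sub_add_left_eq_sub,
              bar_linearCombination a fun T hT => (omegaABC_spec (hasup T hT).1.1).1]
            congr 1
            rw [Finsupp.linearCombination_apply, Finsupp.sum_mapRange_index fun T => zero_smul (Kq k) (omegaABC k T)]
            rfl
          rw [h1, map_sub, hu, hG.bar_stable u humem hu, sub_zero]
      intro T
      have := DFunLike.congr_fun hz T
      simp only [z, Finsupp.sub_apply, Finsupp.mapRange_apply, Finsupp.zero_apply] at this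
      exact (sub_eq_zero.mp this).symm
    -- a nonzero bar-invariant coefficient has a coefficient in degree `≤ 0`, which would lead `u`
    -- outside `L`, since the coefficient of `Ω(M)` is `1`
    have ha0 : a = 0 := by
      by_contra hne
      obtain ⟨T, hT⟩ := Finsupp.support_nonempty_iff.mpr hne
      obtain ⟨i, hi, hTi⟩ := exists_co_of_barScalar_fixed (haZ T) (hfix T)
        (Finsupp.mem_support_iff.mp hT)
      have haM : a M = 0 := by
        rw [ha, if_pos hML]
      let z : Mat m →₀ Kq k := Finsupp.single M 1 + a
      have hzT : ∀ S, S ≠ M → z S = a S := fun S hS => by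
        simp [z, Finsupp.single_eq_of_ne hS]
      have hzM : z M = 1 := by simp [z, haM]
      have hzne : z ≠ 0 := fun h => by rw [h] at hzM; exact zero_ne_one hzM
      have hzG : G (Finsupp.linearCombination (Kq k) (omegaABC k) z) = 0 := by
        rw [map_add, Finsupp.linearCombination_single, one_smul]; exact hu
      have hzI : ∀ S ∈ z.support, S ∈ indexABC m := fun S hS => by
        by_cases h : S = M
        · rw [h]; exact hM
        · rw [Finsupp.mem_support_iff, hzT S h] at hS
          exact (hasup S (Finsupp.mem_support_iff.mpr hS)).1.1
      obtain ⟨N, h1, ⟨S, hS⟩, h2, h3⟩ := exists_regular_rescale hzI hzne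
      have hlead : ∀ S, co k (z S) N ≠ 0 → S ∈ L := fun S hS =>
        hG.leading_omegaABC h1 (by rw [map_smul, map_smul, hzG, smul_zero]) (by rwa [h3])
      have hTM : T ≠ M := fun h => by
        rw [Finsupp.mem_support_iff, h, haM] at hT; exact hT rfl
      have hSM : S = M := by
        by_contra h
        have h4 := hlead S hS
        rw [hzT S h] at hS
        exact (hasup S (Finsupp.mem_support_iff.mpr fun h0 => hS (by rw [h0, co_zero]))).2 h4
      rw [hSM, hzM, ← zpow_zero (q k), co_zpow] at hS
      have hN : N = 0 := by by_contra hN; exact hS (if_neg hN)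
      have hi0 : i = 0 := by
        by_contra h
        exact hTi (by rw [← hzT T hTM]; exact h2 T i (by omega))
      refine (hasup T hT).2 (hlead T ?_)
      rw [hzT T hTM, hN, ← hi0]
      exact hTi
    have : u = omegaABC k M := by simp [u, ha0]
    rw [← this]
    exact hu

/-- The kernel is spanned by the canonical elements indexed by `L`. -/
theorem HasCrystalKernel.support_subset (hG : HasCrystalKernel G L) {z : Mat m →₀ Kq k}
    (hz : ∀ T ∈ z.support, T ∈ indexABC m)
    (h0 : G (Finsupp.linearCombination (Kq k) (omegaABC k) z) = 0) : ∀ T ∈ z.support, T ∈ L := by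
  classical
  have h1 : Finsupp.linearCombination (Kq k) (omegaABC k) z =
      Finsupp.linearCombination (Kq k) (omegaABC k) (z.filter (· ∈ L)) +
      Finsupp.linearCombination (Kq k) (omegaABC k) (z.filter (· ∉ L)) := by
    rw [← map_add, Finsupp.filter_add_filter_not]
  have h2 : G (Finsupp.linearCombination (Kq k) (omegaABC k) (z.filter (· ∈ L))) = 0 := by
    rw [Finsupp.linearCombination_apply, Finsupp.sum, map_sum]
    refine Finset.sum_eq_zero fun T hT => ?_
    rw [Finsupp.support_filter, Finset.mem_filter] at hT
    rw [map_smul, hG.omegaABC_mem (hz T hT.1) hT.2, smul_zero]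
  rw [h1, map_add, h2, zero_add] at h0
  have h3 := hG.eq_zero (fun T hT => by
    rw [Finsupp.support_filter, Finset.mem_filter] at hT
    exact ⟨hz T hT.1, hT.2⟩) h0
  intro T hT
  by_contra hTL
  have := DFunLike.congr_fun h3 T
  rw [Finsupp.filter_apply_pos (· ∉ L) z hTL] at this
  exact (Finsupp.mem_support_iff.mp hT) this

end Kernel

/-! ### Kernel vectors with prescribed leading terms -/

section KernelVectors

variable {k : Type u} [Field k] {m : ℕ}

lemma movable_congr {n : ℕ} {o : Fin n → Prop} {a b a' b' : Fin n → ℕ} {j : Fin n}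
    (ha : a j = a' j) (hb : b j = b' j) : movable o a b j = movable o a' b' j := by
  rw [movable, movable, hb]
  congr 1
  rw [ha]

lemma movable_of_not {n : ℕ} {o : Fin n → Prop} {a b : Fin n → ℕ} {j : Fin n}
    (h : ¬ (o j ∧ a j = 1)) : movable o a b j = b j := by
  simp only [movable, if_neg h]

/-- If the signature of `(a, b)` is nowhere positive, but some letter is movable, then one letter
of `a` and a later letter of `b` can be cancelled against each other. -/
lemma exists_cancelling_pair {n : ℕ} {o : Fin n → Prop} {a b : Fin n → ℕ}
    (h : RowsAdmissible o a b) (hs : ∀ j, signature o a b j ≤ 0)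
    (hm : ∃ j, movable o a b j ≠ 0) :
    ∃ l j, l < j ∧ a l ≠ 0 ∧ b j ≠ 0 ∧
      ∀ i, signature o (fun t => a t - if t = l then 1 else 0)
        (fun t => b t - if t = j then 1 else 0) i ≤ 0 := by
  obtain ⟨j, hj, hmin⟩ := wellFounded_lt.has_min {j | movable o a b j ≠ 0} hm
  have hj' : movable o a b j ≠ 0 := hj
  have h0 : ∀ t < j, movable o a b t = 0 := fun t ht => by
    by_contra h; exact hmin t h ht
  have hle : ∀ t < j, (b t : ℤ) - a t ≤ 0 := fun t ht => (sub_le_movable h t).trans (h0 t ht).le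
  have hpos : 0 < movable o a b j := lt_of_le_of_ne (movable_nonneg o a b j) (Ne.symm hj')
  have hbj : movable o a b j = b j ∧ ¬ (o j ∧ a j = 1) := by
    unfold movable at hpos ⊢
    split_ifs at hpos ⊢ with h1
    · exact absurd hpos (lt_irrefl _)
    · exact ⟨rfl, h1⟩
  have hpre : pre (fun t => (b t : ℤ) - a t) j < 0 := by
    have := hs j
    rw [signature] at this
    omega
  obtain ⟨l, -, hl⟩ : ∃ l ∈ Finset.univ, (if l < j then (b l : ℤ) - a l else 0) < 0 := by
    by_contra! hcon
    exact absurd (Finset.sum_nonneg hcon) (not_le.mpr hpre)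
  have hlj : l < j := by
    by_contra hlj
    rw [if_neg hlj] at hl
    exact lt_irrefl _ hl
  rw [if_pos hlj] at hl
  have hbl : b l = 0 := by
    by_contra hb
    have h1 := h0 l hlj
    rw [movable] at h1
    split_ifs at h1 with h2 <;> omega
  -- `j` is the first column with a movable letter, `l` an earlier column with a surplus in `a`
  refine ⟨l, j, hlj, by omega, by omega, fun i => ?_⟩
  have hp : pre (fun t => ((b t - if t = j then 1 else 0 : ℕ) : ℤ) -
      (a t - if t = l then 1 else 0 : ℕ)) i = pre (fun t => (b t : ℤ) - a t) i +
        (if l < i then 1 else 0) - (if j < i then 1 else 0) := by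
    have e : (fun t => ((b t - if t = j then 1 else 0 : ℕ) : ℤ) -
        (a t - if t = l then 1 else 0 : ℕ)) = fun t => (((b t : ℤ) - a t) +
          (if t = l then 1 else 0)) + (if t = j then -1 else 0) := by
      funext t
      by_cases h1 : t = l
      · subst h1
        rw [if_neg hlj.ne, if_neg hlj.ne, if_pos rfl, if_pos rfl]
        omega
      · by_cases h2 : t = j
        · subst h2
          rw [if_neg h1, if_neg h1, if_pos rfl, if_pos rfl]
          omega
        · simp [h1, h2]
    rw [e, pre_update, pre_update]
    split_ifs <;> ring
  rw [signature, hp]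
  have hsi := hs i
  rw [signature] at hsi
  rcases lt_trichotomy i j with hij | rfl | hij
  · rw [if_neg hij.not_gt]
    rcases lt_trichotomy i l with hil | rfl | hil
    · rw [if_neg hil.not_gt]
      have : movable o (fun t => a t - if t = l then 1 else 0)
          (fun t => b t - if t = j then 1 else 0) i = movable o a b i :=
        movable_congr (by simp only [if_neg hil.ne, Nat.sub_zero])
          (by simp only [if_neg hij.ne, Nat.sub_zero])
      omega
    · have := movable_le o (fun t => a t - if t = i then 1 else 0)
          (fun t => b t - if t = j then 1 else 0) i
      simp only [hbl, if_neg hij.ne] at this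
      rw [if_neg (lt_irrefl _)]
      have := h0 i hij
      omega
    · have h1 : movable o (fun t => a t - if t = l then 1 else 0)
          (fun t => b t - if t = j then 1 else 0) i = movable o a b i :=
        movable_congr (by simp only [if_neg hil.ne', Nat.sub_zero])
          (by simp only [if_neg hij.ne, Nat.sub_zero])
      have h2 : pre (fun t => (b t : ℤ) - a t) i ≤ (b l : ℤ) - a l := by
        have h3 : ∀ t ∈ Finset.univ, (if t < i then (b t : ℤ) - a t else 0) ≤
            if t = l then (b l : ℤ) - a l else 0 := by
          intro t _
          by_cases htl : t = l
          · rw [htl, if_pos hil, if_pos rfl]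
          · rw [if_neg htl]
            split_ifs with hti
            · exact hle t (hti.trans hij)
            · exact le_rfl
        have := Finset.sum_le_sum h3
        rwa [Finset.sum_ite_eq', if_pos (Finset.mem_univ _)] at this
      rw [h1, h0 i hij, if_pos hil]
      omega
  · have h1 : movable o (fun t => a t - if t = l then 1 else 0)
          (fun t => b t - if t = i then 1 else 0) i = movable o a b i - 1 := by
      rw [hbj.1, movable_of_not, if_pos rfl]
      · omega
      · rw [if_neg hlj.ne', Nat.sub_zero]; exact hbj.2
    rw [h1, if_pos hlj, if_neg (lt_irrefl _)]
    omega
  · have h1 : movable o (fun t => a t - if t = l then 1 else 0)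
          (fun t => b t - if t = j then 1 else 0) i = movable o a b i :=
      movable_congr (by simp only [if_neg (hlj.trans hij).ne', Nat.sub_zero])
        (by simp only [if_neg hij.ne', Nat.sub_zero])
    rw [h1, if_pos (hlj.trans hij), if_pos hij]
    omega

/-- An even generator which kills suitable two-letter elements kills a vector with leading term
`M` for each `M` of nowhere positive signature. -/
lemma exists_kernel_vector {G : O k m →ₗ[Kq k] O k m} {P Q : Fin (m + 1)}
    {c : Fin (m + 1) → Mat m → Kq k} (h : IsMove G P Q c) (hP : par P = 0) (hQ : par Q = 0)
    (σ : Fin (m + 1) ≃ Fin (m + 1))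
    (hpair : ∀ l j, l < j →
      ∃ w, HasLead w (unitMat P (σ l) + unitMat Q (σ j) : Mat m) ∧ G w = 0)
    (hmul : ∀ f g, G f = 0 → G g = 0 → G (f * g) = 0) {M : Mat m} (hM : M ∈ indexABC m)
    (hs : M ∈ signatureSet m σ P Q) : ∃ w, HasLead w M ∧ G w = 0 := by
  induction hn : pot M using Nat.strong_induction_on generalizing M with
  | _ n ih =>
  by_cases hm : ∃ j, movable (fun l => par (σ l) = 1) (fun l => M P (σ l)) (fun l => M Q (σ l)) j ≠ 0
  · have hadm : RowsAdmissible (fun l => par (σ l) = 1) (fun l => M P (σ l))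
        (fun l => M Q (σ l)) := fun j hj =>
      ⟨hM.1 _ _ (by rw [hP, hj]), hM.1 _ _ (by rw [hQ, hj])⟩
    obtain ⟨l, j, hlj, hl, hj, hs'⟩ := exists_cancelling_pair hadm hs hm
    obtain ⟨N, rfl⟩ := exists_eq_add_unitMat hl
    have hPQ : ¬ (P = Q ∧ σ l = σ j) := fun e => h.ne e.1
    rw [Matrix.add_apply, unitMat_apply, if_neg hPQ, add_zero] at hj
    obtain ⟨N, rfl⟩ := exists_eq_add_unitMat hj
    have hN : N ∈ indexABC m :=
      ⟨fun s t hst => (by have := hM.1 s t hst; simp only [Matrix.add_apply] at this; omega), by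
        have := hM.2; simp only [Matrix.add_apply] at this; omega⟩
    obtain ⟨w, hw, hw0⟩ := ih (pot N) (by
      rw [← hn]
      exact (pot_lt_add_unitMat _ _ _).trans (pot_lt_add_unitMat _ _ _)) hN (fun i => by
        convert hs' i using 2
        · funext t
          simp only [Matrix.add_apply, unitMat_apply, σ.injective.eq_iff, true_and, eq_comm (a := l),
            h.ne.symm, false_and, if_false, add_zero]
          omega
        · funext t
          simp only [Matrix.add_apply, unitMat_apply, σ.injective.eq_iff, true_and, eq_comm (a := j),
            h.ne, false_and, if_false, add_zero]
          omega) rfl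
    obtain ⟨v, hv, hv0⟩ := hpair l j hlj
    refine ⟨w * v, ?_, hmul w v hw0 hv0⟩
    have := hw.mul hv
    rwa [add_comm (unitMat P (σ l)), ← add_assoc] at this
  · push Not at hm
    refine ⟨xNorm k M, hasLead_xNorm M, ?_⟩
    rw [h.apply M hM]
    refine Finset.sum_eq_zero fun j _ => ?_
    by_cases hj : M Q j = 0
    · rw [h.zero j M hj, zero_smul]
    · have h1 := hm (σ.symm j)
      rw [movable] at h1
      simp only [Equiv.apply_symm_apply] at h1
      split_ifs at h1 with h2
      · rw [xNorm_eq_zero, smul_zero]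
        intro hadm
        obtain ⟨N, rfl⟩ := exists_eq_add_unitMat hj
        have h3 := hadm P j (by rw [hP, h2.1])
        have h4 := h2.2
        rw [mv_add, Matrix.add_apply, unitMat_apply, if_pos ⟨rfl, rfl⟩] at h3
        rw [Matrix.add_apply, unitMat_apply, if_neg fun e => h.ne e.1.symm] at h4
        omega
      · omega

/-- The quantum minor of the rows `p`, `p + 1` and the columns `l < j`. -/
def minor (p : Fin m) (l j : Fin (m + 1)) : O k m :=
  x k p.castSucc l * x k p.succ j - q k ^ 2 • (x k p.castSucc j * x k p.succ l)

lemma xMon_pair (p : Fin m) (l j : Fin (m + 1)) :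
    xMon k (unitMat p.castSucc l + unitMat p.succ j : Mat m) =
      x k p.castSucc l * x k p.succ j := by
  rw [add_comm, xMon_add_left, xMon_unitMat]
  intro s t hst
  rw [unitMat_apply, if_neg]
  rintro ⟨rfl, rfl⟩
  have : p.castSucc < p.succ := Fin.castSucc_lt_succ
  rcases hst with h | h
  · exact h.not_gt this
  · exact this.ne h.1.symm

lemma hasLead_minor (p : Fin m) {l j : Fin (m + 1)} (h : l < j) :
    HasLead (minor p l j : O k m) (unitMat p.castSucc l + unitMat p.succ j) := by
  rw [minor, ← xMon_pair, ← xMon_pair, sub_eq_add_neg]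
  refine (hasLead_xMon _).add_low (neg_mem (smul_mem_of_ZQ (q_pow_mem_ZQ 2)
    (Submodule.subset_span ⟨_, ?_, rfl⟩)))
  have := step_units (0 : Mat m) (Fin.castSucc_lt_succ (i := p)) h
  rwa [zero_add, zero_add] at this

lemma opE_minor (p : Fin m) (hp : par p.succ = 0) {l j : Fin (m + 1)} (h : l < j) :
    opE p (minor p l j : O k m) = 0 := by
  have hne : p.castSucc ≠ p.succ := Fin.castSucc_lt_succ.ne
  rw [minor, map_sub, map_smul, opE_mul, opE_mul, opE_x, opE_x, opE_x, opE_x, if_neg hne,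
    if_neg hne, if_pos rfl, if_pos rfl, zero_mul, zero_mul, add_zero, add_zero, opP_even p hp,
    opP_even p hp, (isQSuperMatrix_x k).row_even (par_castSucc p) h, sub_self]

lemma opF_minor (p : Fin m) (hp : par p.succ = 0) {l j : Fin (m + 1)} (h : l < j) :
    opF p (minor p l j : O k m) = 0 := by
  have hne : p.succ ≠ p.castSucc := Fin.castSucc_lt_succ.ne'
  rw [minor, map_sub, map_smul, opF_mul, opF_mul, opF_x, opF_x, opF_x, opF_x, if_neg hne,
    if_neg hne, if_pos rfl, if_pos rfl, mul_zero, mul_zero, zero_add, zero_add,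
    (isQSuperMatrix_x k).row_even hp h, sub_self]

lemma mCoef_mem_ZQ (p : Fin m) (j : Fin (m + 1)) (T : Mat m) : mCoef k p j T ∈ ZQ k := by
  rw [mCoef]
  split_ifs
  · exact zero_mem _
  · exact mul_mem (neg_one_pow_mem_ZQ _) (q_zpow_mem_ZQ _)

/-- A kernel vector of the odd generator `E_m` with leading term `M`. As `E_m² = 0`, it suffices to apply
`E_m` to the monomial in which the first letter of the last two rows is moved down. -/
lemma exists_kernel_vector_odd (p : Fin m) (hp : par p.succ = 1) {M : Mat m} (hM : M ∈ indexABC m)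
    (hs : M ∈ oddSet m p.castSucc p.succ) : ∃ w : O k m, HasLead w M ∧ opE p w = 0 := by
  classical
  have hPQ : p.castSucc < p.succ := Fin.castSucc_lt_succ
  have hQ := par_eq_one hp
  have hmove := isMove_E_odd (k := k) p hp
  by_cases h0 : ∀ j, M p.succ j = 0
  · refine ⟨xNorm k M, hasLead_xNorm M, ?_⟩
    rw [hmove.apply M hM]
    exact Finset.sum_eq_zero fun j _ => by rw [hmove.zero j M (h0 j), zero_smul]
  obtain ⟨j, hlt, hPj, hQj⟩ := hs.resolve_left h0
  push Not at h0
  obtain ⟨j1, hj1⟩ := h0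
  have hj1j : j < j1 := by
    rcases lt_trichotomy j j1 with h | rfl | h
    · exact h
    · exact absurd hQj hj1
    · exact absurd (hlt j1 h).2 hj1
  have hj : par j = 0 := par_lt hj1j
  have hjl : j ≠ Fin.last m := (hj1j.trans_le (Fin.le_last _)).ne
  obtain ⟨N, rfl⟩ := exists_eq_add_unitMat hPj
  have hPQj : ∀ t, ¬ (p.castSucc = p.succ ∧ j = t) := fun t e => hPQ.ne e.1
  have hNQ : ∀ t, (N + unitMat p.castSucc j) p.succ t = N p.succ t := fun t => by
    rw [Matrix.add_apply, unitMat_apply, if_neg (hPQj t), add_zero]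
  rw [hNQ] at hQj
  have hNle : ∀ s t, N s t ≤ (N + unitMat p.castSucc j) s t := fun s t => by
    rw [Matrix.add_apply]; omega
  -- apply the generator to the matrix with the letter of column `j` moved to the last row
  have hS : N + unitMat p.succ j ∈ indexABC m := by
    refine ⟨fun s t hst => ?_, ?_⟩
    · rw [Matrix.add_apply, unitMat_apply]
      split_ifs with h
      · rw [← h.1, ← h.2, hQj]
      · exact (hNle s t).trans (hM.1 s t hst)
    · rw [Matrix.add_apply, unitMat_apply, if_neg fun e => hjl e.2]
      have := hNle (Fin.last m) (Fin.last m)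
      have := hM.2
      omega
  refine ⟨opE p (xNorm k (N + unitMat p.succ j)), ?_, LinearMap.congr_fun (act_E_sq p hp) _⟩
  rw [hmove.apply _ hS, ← Finset.add_sum_erase _ _ (Finset.mem_univ j), mv_add]
  obtain ⟨s, hs⟩ := normCoef_E_odd (k := k) p hp hj hS.1
  rw [hs]
  have hsign : (-1 : Kq k) ^ s ≠ 0 := pow_ne_zero _ (neg_ne_zero.mpr one_ne_zero)
  refine ((hasLead_xNorm _).smul (mul_mem (neg_one_pow_mem_ZQ s) (q_zpow_mem_ZQ _)) ?_
    (mul_ne_zero hsign (zpow_ne_zero _ (q_ne_zero k)))).add_low (sum_mem fun t ht => ?_)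
  · rw [mul_inv, ← zpow_neg, ← inv_pow, inv_neg, inv_one]
    exact mul_mem (neg_one_pow_mem_ZQ s) (q_zpow_mem_ZQ _)
  · have htj : t ≠ j := Finset.ne_of_mem_erase ht
    by_cases h0 : (N + unitMat p.succ j) p.succ t = 0
    · rw [hmove.zero t _ h0, zero_smul]; exact zero_mem _
    rw [Matrix.add_apply, unitMat_apply, if_neg fun e => htj e.2.symm, add_zero] at h0
    have hjt : j < t := by
      refine lt_of_le_of_ne (not_lt.mp fun h => h0 ?_) htj.symm
      rw [← hNQ]; exact (hlt t h).2
    obtain ⟨N, rfl⟩ := exists_eq_add_unitMat h0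
    rw [add_right_comm N (unitMat p.succ t) (unitMat p.succ j), mv_add]
    refine smul_mem_of_ZQ (mul_mem (mCoef_mem_ZQ _ _ _) (q_zpow_mem_ZQ _))
      (LowEq_le_Low (M := N + unitMat p.succ t + unitMat p.castSucc j) ?_ (xNorm_mem_LowEq _))
    have := step_units N hPQ hjt
    rwa [add_right_comm N (unitMat p.castSucc t), add_right_comm N (unitMat p.castSucc j)] at this

end KernelVectors

/-! ### The crystal kernels of the generators -/

section CrystalKernels

variable {k : Type u} [Field k] {m : ℕ}

lemma leading_of_isMove {G : O k m →ₗ[Kq k] O k m} {P Q : Fin (m + 1)}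
    {c : Fin (m + 1) → Mat m → Kq k} {L : Set (Mat m)} (h : IsMove G P Q c)
    (hL : Leading c P Q L) (v : Mat m →₀ Kq k) (hv : IsRegular v) (h0 : G (evalMon k m v) = 0)
    (T : Mat m) (hT : co k (v T) 0 ≠ 0) : T ∈ L := by
  refine hL v hv (eq_zero_of_evalMon_eq_zero _ (fun S hS => ?_) ?_) T hT
  · exact (formalMove_support h v hv.support hS).1
  · rw [evalMon_formalMove h v hv.support, h0]

variable [CharZero k]

lemma hasCrystalKernel_E (p : Fin m) (hp : par p.succ = 0) :
    HasCrystalKernel (opE p : O k m →ₗ[Kq k] O k m)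
      (signatureSet m (Equiv.refl _) p.castSucc p.succ) where
  leading := leading_of_isMove (isMove_E p hp) (leading_E p hp)
  vector M hM hs := exists_kernel_vector (isMove_E p hp) (par_castSucc p) hp (Equiv.refl _)
    (fun l j hlj => ⟨minor p l j, hasLead_minor p hlj, opE_minor p hp hlj⟩)
    (fun f g hf hg => by rw [opE_mul, hf, hg, mul_zero, zero_mul, add_zero]) hM hs
  bar_stable _ := opE_bar_eq_zero p

lemma hasCrystalKernel_F (p : Fin m) (hp : par p.succ = 0) :
    HasCrystalKernel (opF p : O k m →ₗ[Kq k] O k m)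
      (signatureSet m Fin.revPerm p.succ p.castSucc) where
  leading := leading_of_isMove (isMove_F p hp) (leading_F p hp)
  vector M hM hs := exists_kernel_vector (isMove_F p hp) hp (par_castSucc p) Fin.revPerm
    (fun l j hlj => ⟨minor p j.rev l.rev, by
      have := hasLead_minor (k := k) p (Fin.rev_lt_rev.mpr hlj)
      rwa [add_comm (unitMat p.castSucc j.rev)] at this,
      opF_minor p hp (Fin.rev_lt_rev.mpr hlj)⟩)
    (fun f g hf hg => by rw [opF_mul, hf, hg, mul_zero, zero_mul, add_zero]) hM hs
  bar_stable _ := opF_bar_eq_zero p hp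

lemma hasCrystalKernel_E_odd (p : Fin m) (hp : par p.succ = 1) :
    HasCrystalKernel (opE p : O k m →ₗ[Kq k] O k m) (oddSet m p.castSucc p.succ) where
  leading := leading_of_isMove (isMove_E_odd p hp) (leading_E_odd p hp)
  vector _ hM hs := exists_kernel_vector_odd p hp hM hs
  bar_stable _ := opE_bar_eq_zero p

end CrystalKernels

/-! ### Stability of the index sets under multiplication by the determinant -/

section Stability

variable {m : ℕ}

/-- Adding a letter of `a` and a letter of `b` in the next column does not change the signature. -/
lemma signature_add {n : ℕ} {o : Fin n → Prop} (a b : Fin n → ℕ) {s t : Fin n}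
    (hst : (t : ℕ) = s + 1) (hs : ¬ o s) (ht : ¬ o t) (c : ℕ) (j : Fin n) :
    signature o (fun l => a l + if l = s then c else 0) (fun l => b l + if l = t then c else 0) j =
      signature o a b j := by
  have hp : pre (fun l => ((b l + if l = t then c else 0 : ℕ) : ℤ) -
      (a l + if l = s then c else 0 : ℕ)) j = pre (fun l => (b l : ℤ) - a l) j +
        (if t < j then (c : ℤ) else 0) + (if s < j then -(c : ℤ) else 0) := by
    rw [← pre_update, ← pre_update]
    congr 1
    funext l
    split_ifs <;> push_cast <;> ring
  rw [signature, hp, signature]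
  have hsj : s < j ↔ t < j ∨ j = t := by
    rw [Fin.lt_def, Fin.lt_def, Fin.ext_iff]; omega
  by_cases h1 : j = t
  · subst h1
    have h2 : j ≠ s := fun h => by rw [Fin.ext_iff] at h; omega
    rw [movable_of_not fun e => ht e.1, movable_of_not fun e => ht e.1, if_pos rfl,
      if_neg (lt_irrefl _), if_pos (hsj.mpr (Or.inr rfl))]
    push_cast
    ring
  · have hm : movable o (fun l => a l + if l = s then c else 0)
        (fun l => b l + if l = t then c else 0) j = movable o a b j := by
      by_cases h2 : j = s
      · subst h2
        rw [movable_of_not fun e => hs e.1, movable_of_not fun e => hs e.1, if_neg h1, add_zero]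
      · exact movable_congr (by rw [if_neg h2, add_zero]) (by rw [if_neg h1, add_zero])
    rw [hm]
    have : s < j ↔ t < j := by rw [hsj]; simp [h1]
    simp only [this]
    split_ifs <;> ring

variable (m) in
/-- The diagonal matrix with all entries `n`, except for a zero in the last position. -/
def diagMat (n : ℕ) : Mat m := n • permMat (1 : Equiv.Perm (Fin m))

lemma add_diagMat_apply (M : Mat m) (n : ℕ) {i : Fin (m + 1)} (hi : i ≠ Fin.last m)
    (j : Fin (m + 1)) : (M + diagMat m n) i j = M i j + if j = i then n else 0 := by
  rw [Matrix.add_apply, diagMat, Matrix.smul_apply, smul_eq_mul]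
  congr 1
  induction i using Fin.lastCases with
  | last => exact absurd rfl hi
  | cast i =>
    induction j using Fin.lastCases with
    | last => rw [permMat_last_col, mul_zero, if_neg (Fin.castSucc_lt_last i).ne']
    | cast j =>
      rw [permMat_apply, Equiv.Perm.one_apply]
      by_cases hij : i = j
      · rw [if_pos hij, if_pos (congrArg Fin.castSucc hij.symm), mul_one]
      · rw [if_neg hij, if_neg fun e => hij (Fin.castSucc_injective m e).symm, mul_zero]

lemma add_diagMat_last (M : Mat m) (n : ℕ) (j : Fin (m + 1)) :
    (M + diagMat m n) (Fin.last m) j = M (Fin.last m) j := by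
  rw [Matrix.add_apply, diagMat, Matrix.smul_apply, permMat_last_row, smul_zero, add_zero]

/-- The letters added to the rows `p` and `p + 1` cancel in the signature. -/
lemma signatureSet_E_add_diagMat (p : Fin m) (hp : par p.succ = 0) {M : Mat m} {n : ℕ}
    (h : M + diagMat m n ∈ signatureSet m (Equiv.refl _) p.castSucc p.succ) :
    M ∈ signatureSet m (Equiv.refl _) p.castSucc p.succ := by
  intro j
  have := h j
  simp only [Equiv.refl_apply, add_diagMat_apply M n (Fin.castSucc_lt_last p).ne,
    add_diagMat_apply M n (succ_ne_last hp)] at this ⊢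
  rwa [signature_add (s := p.castSucc) (t := p.succ) _ _ rfl (by simp [par_castSucc])
    (by simp [hp])] at this

lemma signatureSet_F_add_diagMat (p : Fin m) (hp : par p.succ = 0) {M : Mat m} {n : ℕ}
    (h : M + diagMat m n ∈ signatureSet m Fin.revPerm p.succ p.castSucc) :
    M ∈ signatureSet m Fin.revPerm p.succ p.castSucc := by
  intro j
  have := h j
  simp only [Fin.revPerm_apply, add_diagMat_apply M n (Fin.castSucc_lt_last p).ne,
    add_diagMat_apply M n (succ_ne_last hp), Fin.rev_eq_iff] at this ⊢
  rwa [signature_add (s := p.succ.rev) (t := p.castSucc.rev) _ _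
    (by simp [Fin.val_rev]; omega) (by simp [hp])
    (by simp [par_castSucc])] at this

/-- If the witness column of `oddSet` is the one where the diagonal letter was added, no letter can
remain in the last row. -/
lemma oddSet_add_diagMat (p : Fin m) (hp : par p.succ = 1) {M : Mat m} (hM : M ∈ indexABC m)
    {n : ℕ} (h : M + diagMat m n ∈ oddSet m p.castSucc p.succ) :
    M ∈ oddSet m p.castSucc p.succ := by
  have hQ : p.succ = Fin.last m := par_eq_one hp
  have hPapp := add_diagMat_apply M n (Fin.castSucc_lt_last p).ne
  have hQapp : ∀ j, (M + diagMat m n) p.succ j = M p.succ j := fun j => by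
    rw [hQ, add_diagMat_last]
  rcases h with h | ⟨j, h1, h2, h3⟩
  · exact Or.inl fun j => by rw [← hQapp]; exact h j
  · have hlt : ∀ l < j, M p.castSucc l = 0 ∧ M p.succ l = 0 := fun l hl => by
      have := h1 l hl
      rw [hPapp, hQapp] at this
      exact ⟨(Nat.add_eq_zero_iff.mp this.1).1, this.2⟩
    rw [hQapp] at h3
    by_cases h4 : M p.castSucc j = 0
    · left
      rw [hPapp, h4, zero_add] at h2
      have hj : j = p.castSucc := by
        by_contra hj
        exact h2 (if_neg hj)
      intro l
      rcases lt_trichotomy l j with hl | rfl | hl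
      · exact (hlt l hl).2
      · exact h3
      · have : l = Fin.last m := by
          rw [← hQ, Fin.ext_iff]
          have h5 := l.isLt
          have h6 := congrArg Fin.val hQ
          rw [hj, Fin.lt_def] at hl
          simp at h6 hl ⊢
          omega
        rw [this, hQ]
        exact hM.2
    · exact Or.inr ⟨j, hlt, h4, h3⟩

end Stability

/-! ### The span of the ordered monomials -/

section PolyPart

variable {k : Type u} [Field k] {m : ℕ}

variable (k m) in
/-- The span of the normalized monomials in all letters but the last one. -/
def polyPart : Submodule (Kq k) (O k m) := Submodule.span (Kq k) (xNorm k '' indexABC m)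

lemma xNorm_mem_polyPart {T : Mat m} (h : T ∈ indexABC m) : xNorm k T ∈ polyPart k m :=
  Submodule.subset_span ⟨T, h, rfl⟩

lemma xMon_mem_polyPart {T : Mat m} (h : T (Fin.last m) (Fin.last m) = 0) :
    xMon k T ∈ polyPart k m := by
  by_cases hT : Admissible T
  · rw [xMon_eq]
    exact Submodule.smul_mem _ _ (xNorm_mem_polyPart ⟨hT, h⟩)
  · rw [xMon_eq_zero hT]
    exact zero_mem _

lemma HasLead.mem_polyPart {f : O k m} {M : Mat m} (hf : HasLead f M)
    (h : M (Fin.last m) (Fin.last m) = 0) : f ∈ polyPart k m := by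
  refine Submodule.span_induction (R := ZQ k) (p := fun f _ => f ∈ polyPart k m) ?_
    (zero_mem _) (fun _ _ _ _ => add_mem) (fun c f _ hf => Submodule.smul_mem _ (c : Kq k) hf)
    hf.mem_LowEq
  rintro _ ⟨S, rfl | hS, rfl⟩
  · exact xMon_mem_polyPart h
  · exact xMon_mem_polyPart (Nat.le_zero.mp (hS.last_le.trans h.le))

lemma x_mul_mem_polyPart {i j : Fin (m + 1)} (hij : ¬ (i = Fin.last m ∧ j = Fin.last m)) {f : O k m}
    (hf : f ∈ polyPart k m) : x k i j * f ∈ polyPart k m := by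
  induction hf using Submodule.span_induction with
  | mem f hf =>
    obtain ⟨T, hT, rfl⟩ := hf
    refine ((hasLead_xNorm T).letter_mul i j).mem_polyPart ?_
    rw [Matrix.add_apply, unitMat_apply, if_neg hij, hT.2]
  | zero => rw [mul_zero]; exact zero_mem _
  | add f g _ _ hf hg => rw [mul_add]; exact add_mem hf hg
  | smul c f _ hf => rw [mul_smul_comm]; exact Submodule.smul_mem _ _ hf

lemma diagMat_last (n : ℕ) : diagMat m n (Fin.last m) (Fin.last m) = 0 := by
  have := add_diagMat_last (0 : Mat m) n (Fin.last m)
  rwa [zero_add] at this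

lemma hasLead_detA_pow (n : ℕ) : HasLead (detA k m ^ n) (diagMat m n) := by
  induction n with
  | zero =>
    rw [pow_zero, diagMat, zero_smul, ← xMon_zero]
    exact hasLead_xMon 0
  | succ n ih =>
    rw [pow_succ, diagMat, succ_nsmul]
    exact ih.mul hasLead_detA

/-- The span of a family of elements with prescribed leading terms. -/
lemma span_image_of_hasLead {b : Mat m → O k m} (hb : ∀ T ∈ indexABC m, HasLead (b T) T) :
    Submodule.span (Kq k) (b '' indexABC m) = polyPart k m := by
  rw [polyPart, Set.image_eq_range, Set.image_eq_range]
  exact (isTriangular_of_hasLead (b := fun T : indexABC m => b T) fun T => hb T T.2).span_eq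

/-- A unit commutes with the even letters, and `q ^ 2`-commutes with the odd ones. -/
def ScalesOdd (u : (O k m)ˣ) : Prop :=
  ∀ i j, ¬ (i = Fin.last m ∧ j = Fin.last m) →
    (u : O k m) * x k i j = q k ^ (2 * (par i + par j)) • (x k i j * u)

lemma zpow_mul_eq_smul {A : Type*} [Ring A] [Algebra (Kq k) A] {u : Aˣ} {z : A} {c : Kq k}
    (hc : c ≠ 0) (h : (u : A) * z = c • (z * u)) (n : ℤ) :
    ((u ^ n : Aˣ) : A) * z = c ^ n • (z * ((u ^ n : Aˣ) : A)) := by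
  have hinv : ((u⁻¹ : Aˣ) : A) * z = c⁻¹ • (z * ((u⁻¹ : Aˣ) : A)) := by
    have h1 := congrArg (fun w => ((u⁻¹ : Aˣ) : A) * w * ((u⁻¹ : Aˣ) : A)) h
    simp only [mul_smul_comm, smul_mul_assoc, mul_assoc, Units.inv_mul_cancel_left,
      Units.mul_inv, mul_one] at h1
    rw [h1, smul_smul, inv_mul_cancel₀ hc, one_smul]
  induction n with
  | zero => simp
  | succ n ih =>
    rw [zpow_add_one, zpow_add_one₀ hc, Units.val_mul, mul_assoc, h, mul_smul_comm, ← mul_assoc,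
      ih, smul_mul_assoc, smul_smul, mul_assoc, mul_comm]
  | pred n ih =>
    rw [zpow_sub_one, zpow_sub_one₀ hc, Units.val_mul, mul_assoc, hinv, mul_smul_comm, ← mul_assoc,
      ih, smul_mul_assoc, smul_smul, mul_assoc, mul_comm]

lemma ScalesOdd.mul_xMon {u : (O k m)ˣ} (hu : ScalesOdd u) {T : Mat m}
    (hT : T (Fin.last m) (Fin.last m) = 0) :
    (u : O k m) * xMon k T = q k ^ (2 * oddDeg T) • (xMon k T * u) := by
  induction T using peel_left_induction with
  | h0 => simp [xMon_zero, oddDeg]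
  | h M i j hl ih =>
    rw [Matrix.add_apply, unitMat_apply] at hT
    have hij : ¬ (i = Fin.last m ∧ j = Fin.last m) := fun h => by rw [if_pos h] at hT; omega
    rw [xMon_add_left hl, ← mul_assoc, hu i j hij, smul_mul_assoc, mul_assoc, ih (by omega),
      mul_smul_comm, smul_smul, ← pow_add, mul_assoc, oddDeg_add, oddDeg_unitMat]
    congr 2
    ring

lemma ScalesOdd.zpow_mul {u : (O k m)ˣ} (hu : ScalesOdd u) (n : ℤ) {T : Mat m}
    (hT : T (Fin.last m) (Fin.last m) = 0) {f : O k m} (hf : f ∈ LowEq k T) :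
    ((u ^ n : (O k m)ˣ) : O k m) * f =
      q k ^ (2 * n * oddDeg T) • (f * ((u ^ n : (O k m)ˣ) : O k m)) := by
  refine Submodule.span_induction (R := ZQ k) (p := fun f _ =>
    ((u ^ n : (O k m)ˣ) : O k m) * f =
      q k ^ (2 * n * oddDeg T) • (f * ((u ^ n : (O k m)ˣ) : O k m))) ?_ ?_ ?_ ?_ hf
  · rintro _ ⟨S, hS, rfl⟩
    have h : S (Fin.last m) (Fin.last m) = 0 ∧ oddDeg S = oddDeg T := by
      rcases hS with rfl | hS
      · exact ⟨hT, rfl⟩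
      · exact ⟨Nat.le_zero.mp (hS.last_le.trans hT.le), oddDeg_below hS⟩
    rw [zpow_mul_eq_smul (pow_ne_zero _ (q_ne_zero k)) (hu.mul_xMon h.1) n, h.2, ← zpow_natCast,
      ← _root_.zpow_mul, show ((2 * oddDeg T : ℕ) : ℤ) * n = 2 * n * oddDeg T by push_cast; ring]
  · simp
  · intro f g _ _ hf hg
    rw [mul_add, add_mul, smul_add, hf, hg]
  · intro c f _ hf
    change _ * ((c : Kq k) • f) = _ • (((c : Kq k) • f) * _)
    rw [mul_smul_comm, hf, smul_mul_assoc, smul_comm]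

lemma scalesOdd_detUnit : ScalesOdd (detUnit k m) := detA_comm_x

lemma oddSum_eq {T : Mat m} (hT : T (Fin.last m) (Fin.last m) = 0) : oddSum T = oddDeg T := by
  rw [oddDeg, oddSum, Fin.sum_univ_castSucc]
  simp [Fin.sum_univ_castSucc, par_castSucc, par_last, hT]

end PolyPart

/-! ### A spanning set of the coordinate algebra -/

section Spanning

variable {k : Type u} [Field k] [CharZero k] {m : ℕ}

lemma scalesOdd_yUnit : ScalesOdd (yUnit k m) := by
  intro i j hij
  rw [val_yUnit]
  rcases Fin.eq_castSucc_or_eq_last i with ⟨i, rfl⟩ | rfl <;>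
    rcases Fin.eq_castSucc_or_eq_last j with ⟨j, rfl⟩ | rfl
  · rw [par_castSucc, par_castSucc, pow_zero, one_smul]
    exact y_mul_xA i j
  · rw [par_castSucc, par_last]
    exact y_mul_xB i
  · rw [par_castSucc, par_last]
    exact y_mul_xC j
  · exact absurd ⟨rfl, rfl⟩ hij

variable (k m) in
/-- The span of the products `D^a r y^d`, with `r` in the span of the ordered monomials. -/
def triSpan : Submodule (Kq k) (O k m) :=
  Submodule.span (Kq k) {f | ∃ (a d : ℤ), ∃ T ∈ indexABC m,
    f = ((detUnit k m ^ a : (O k m)ˣ) : O k m) * xNorm k T * ((yUnit k m ^ d : (O k m)ˣ) : O k m)}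

lemma mem_triSpan (a d : ℤ) {f : O k m} (hf : f ∈ polyPart k m) :
    ((detUnit k m ^ a : (O k m)ˣ) : O k m) * f * ((yUnit k m ^ d : (O k m)ˣ) : O k m) ∈
      triSpan k m := by
  induction hf using Submodule.span_induction with
  | mem f hf =>
    obtain ⟨T, hT, rfl⟩ := hf
    exact Submodule.subset_span ⟨a, d, T, hT, rfl⟩
  | zero => rw [mul_zero, zero_mul]; exact zero_mem _
  | add f g _ _ hf hg => rw [mul_add, add_mul]; exact add_mem hf hg
  | smul c f _ hf => rw [mul_smul_comm, smul_mul_assoc]; exact Submodule.smul_mem _ _ hf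

/-- The elements which stabilize a subspace from the left. -/
def leftStabilizer (W : Submodule (Kq k) (O k m)) : Subalgebra (Kq k) (O k m) where
  carrier := {a | ∀ w ∈ W, a * w ∈ W}
  mul_mem' {a b} ha hb w hw := by rw [mul_assoc]; exact ha _ (hb w hw)
  add_mem' {a b} ha hb w hw := by rw [add_mul]; exact add_mem (ha w hw) (hb w hw)
  algebraMap_mem' c w hw := by rw [← Algebra.smul_def]; exact W.smul_mem c hw

lemma mem_leftStabilizer_triSpan {z : O k m}
    (h : ∀ (a d : ℤ), ∀ T ∈ indexABC m, z * (((detUnit k m ^ a : (O k m)ˣ) : O k m) * xNorm k T *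
      ((yUnit k m ^ d : (O k m)ˣ) : O k m)) ∈ triSpan k m) :
    z ∈ leftStabilizer (triSpan k m) := by
  intro w hw
  induction hw using Submodule.span_induction with
  | mem f hf =>
    obtain ⟨a, d, T, hT, rfl⟩ := hf
    exact h a d T hT
  | zero => rw [mul_zero]; exact zero_mem _
  | add f g _ _ hf hg => rw [mul_add]; exact add_mem hf hg
  | smul c f _ hf => rw [mul_smul_comm]; exact Submodule.smul_mem _ _ hf

lemma x_mem_leftStabilizer {i j : Fin (m + 1)} (hij : ¬ (i = Fin.last m ∧ j = Fin.last m)) :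
    x k i j ∈ leftStabilizer (triSpan k m) := by
  refine mem_leftStabilizer_triSpan fun a d T hT => ?_
  have hq : q k ^ (2 * (par i + par j)) ≠ 0 := pow_ne_zero _ (q_ne_zero k)
  have h := zpow_mul_eq_smul hq (scalesOdd_detUnit (k := k) i j hij) a
  have h' : x k i j * ((detUnit k m ^ a : (O k m)ˣ) : O k m) = ((q k ^ (2 * (par i + par j))) ^ a)⁻¹ •
      (((detUnit k m ^ a : (O k m)ˣ) : O k m) * x k i j) := by
    rw [h, inv_smul_smul₀ (zpow_ne_zero _ hq)]
  rw [← mul_assoc, ← mul_assoc, h', smul_mul_assoc, smul_mul_assoc, mul_assoc _ (x k i j)]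
  exact Submodule.smul_mem _ _ (mem_triSpan a d (x_mul_mem_polyPart hij (xNorm_mem_polyPart hT)))

lemma detInv_mem_leftStabilizer : detInv k m ∈ leftStabilizer (triSpan k m) := by
  refine mem_leftStabilizer_triSpan fun a d T hT => ?_
  have h : detInv k m * ((detUnit k m ^ a : (O k m)ˣ) : O k m) =
      ((detUnit k m ^ (-1 + a) : (O k m)ˣ) : O k m) := by
    rw [zpow_add, zpow_neg_one, Units.val_mul]
    rfl
  rw [← mul_assoc, ← mul_assoc, h]
  exact mem_triSpan _ d (xNorm_mem_polyPart hT)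

lemma commute_zpow (a d : ℤ) :
    Commute ((yUnit k m ^ d : (O k m)ˣ) : O k m) ((detUnit k m ^ a : (O k m)ˣ) : O k m) :=
  congrArg Units.val (commute_yUnit_detUnit.zpow_zpow d a)

lemma yUnit_zpow_mem_leftStabilizer (n : ℤ) :
    ((yUnit k m ^ n : (O k m)ˣ) : O k m) ∈ leftStabilizer (triSpan k m) := by
  refine mem_leftStabilizer_triSpan fun a d T hT => ?_
  rw [← mul_assoc, ← mul_assoc, (commute_zpow a n).eq, mul_assoc _ _ (xNorm k T),
    scalesOdd_yUnit.zpow_mul n hT.2 (xNorm_mem_LowEq T), mul_smul_comm, smul_mul_assoc,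
    ← mul_assoc, mul_assoc _ _ ((yUnit k m ^ d : (O k m)ˣ) : O k m), ← Units.val_mul, ← zpow_add]
  exact Submodule.smul_mem _ _ (mem_triSpan a _ (xNorm_mem_polyPart hT))

lemma cab_mem_leftStabilizer : cab k m ∈ leftStabilizer (triSpan k m) := by
  have hne : ∀ i : Fin m, i.castSucc ≠ Fin.last m := fun i => (Fin.castSucc_lt_last i).ne
  have heven : evenPart k m ≤ leftStabilizer (triSpan k m) := by
    rw [evenPart, Algebra.adjoin_le_iff]
    rintro _ (rfl | ⟨p, rfl⟩)
    · exact detInv_mem_leftStabilizer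
    · exact x_mem_leftStabilizer fun h => hne _ h.1
  exact sum_mem fun a _ => mul_mem (x_mem_leftStabilizer fun h => hne _ h.2) (sum_mem fun j _ =>
    mul_mem (heven (inverse_mem_evenPart a j)) (x_mem_leftStabilizer fun h => hne _ h.1))

/-- The inverse of the last entry is `(1 + n)⁻¹ y⁻¹`, where `n = y⁻¹ C A⁻¹ B` is nilpotent. -/
lemma lastInv_mem_leftStabilizer : lastInv k m ∈ leftStabilizer (triSpan k m) := by
  have hy := yUnit_zpow_mem_leftStabilizer (k := k) (m := m) (-1)
  rw [zpow_neg_one] at hy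
  let n : O k m := ((yUnit k m)⁻¹ : (O k m)ˣ) * cab k m
  have hn : -n ∈ leftStabilizer (triSpan k m) := neg_mem (mul_mem hy cab_mem_leftStabilizer)
  obtain ⟨N, hN⟩ : IsNilpotent (-n) := (isNilpotent_inv_mul_cab (yUnit k m) fun l => y_mul_xC l).neg
  have hD : xD k m = yUnit k m * (1 - -n) := by
    rw [sub_neg_eq_add, mul_add, mul_one, Units.mul_inv_cancel_left, val_yUnit, y_eq,
      sub_add_cancel]
  have hinv : xD k m * ((∑ i ∈ Finset.range N, (-n) ^ i) * ((yUnit k m)⁻¹ : (O k m)ˣ)) = 1 := by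
    rw [hD, mul_assoc, ← mul_assoc (1 - -n), mul_neg_geom_sum, hN, sub_zero, one_mul, Units.mul_inv]
  have : lastInv k m = (∑ i ∈ Finset.range N, (-n) ^ i) * ((yUnit k m)⁻¹ : (O k m)ˣ) := by
    calc lastInv k m = lastInv k m * (xD k m * _) := by rw [hinv, mul_one]
      _ = _ := by rw [← mul_assoc, xD, lastInv_mul_last, one_mul]
  rw [this]
  exact mul_mem (sum_mem fun i _ => pow_mem hn i) hy

/-- The products `D^a r y^d` span the coordinate algebra. -/
theorem triSpan_eq_top : triSpan k m = ⊤ := by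
  have h1 : (1 : O k m) ∈ triSpan k m := by
    have := mem_triSpan (k := k) (m := m) 0 0 (xMon_mem_polyPart (T := 0) rfl)
    rwa [xMon_zero, zpow_zero, zpow_zero, Units.val_one, one_mul, one_mul] at this
  have h : ∀ f : O k m, f ∈ leftStabilizer (triSpan k m) := by
    intro f
    induction f using O_induction with
    | h1 a => exact Subalgebra.algebraMap_mem _ a
    | hx i j =>
      by_cases hij : i = Fin.last m ∧ j = Fin.last m
      · rw [hij.1, hij.2]
        have := add_mem (yUnit_zpow_mem_leftStabilizer (k := k) (m := m) 1) cab_mem_leftStabilizer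
        rwa [zpow_one, val_yUnit, y_eq, sub_add_cancel] at this
      · exact x_mem_leftStabilizer hij
    | hd => exact detInv_mem_leftStabilizer
    | hl => exact lastInv_mem_leftStabilizer
    | hmul f g hf hg => exact mul_mem hf hg
    | hadd f g hf hg => exact add_mem hf hg
  rw [eq_top_iff]
  intro f _
  have := h f 1 h1
  rwa [mul_one] at this

/-- Each index in `indexABC m` is obtained from one with a zero in the even diagonal by adding a
multiple of the identity matrix. -/
lemma exists_reduction (hm : 0 < m) {T : Mat m} (hT : T ∈ indexABC m) :
    ∃ n M, M ∈ indexABC m ∧ (∃ i : Fin m, M i.castSucc i.castSucc = 0) ∧ T = M + diagMat m n := by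
  obtain ⟨i0, -, hi0⟩ := Finset.exists_min_image Finset.univ
    (fun i : Fin m => T i.castSucc i.castSucc) ⟨⟨0, hm⟩, Finset.mem_univ _⟩
  let n := T i0.castSucc i0.castSucc
  let M : Mat m := T - diagMat m n
  have hle : ∀ i j, diagMat m n i j ≤ T i j := by
    intro i j
    have h : diagMat m n i j = (0 + diagMat m n) i j := by rw [zero_add]
    rw [h]
    rcases Fin.eq_castSucc_or_eq_last i with ⟨i, rfl⟩ | rfl
    · rw [add_diagMat_apply _ _ (Fin.castSucc_lt_last i).ne]
      by_cases hij : j = i.castSucc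
      · rw [if_pos hij, hij, Matrix.zero_apply, zero_add]
        exact hi0 i (Finset.mem_univ i)
      · rw [if_neg hij]
        exact Nat.zero_le _
    · rw [add_diagMat_last]
      exact Nat.zero_le _
  have hMT : M + diagMat m n = T := by
    ext i j
    have := hle i j
    simp only [M, Matrix.add_apply, Matrix.sub_apply]
    omega
  have hMle : ∀ i j, M i j ≤ T i j := fun i j => by rw [← hMT, Matrix.add_apply]; omega
  refine ⟨n, M, ⟨fun i j hij => (hMle i j).trans (hT.1 i j hij),
    Nat.le_zero.mp ((hMle _ _).trans hT.2.le)⟩, ⟨i0, ?_⟩, hMT.symm⟩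
  have h1 := congrFun (congrFun hMT i0.castSucc) i0.castSucc
  rw [add_diagMat_apply _ _ (Fin.castSucc_lt_last i0).ne, if_pos rfl] at h1
  simp only [n] at h1
  omega

lemma reduction_unique {M M' : Mat m} {n n' : ℕ} (hM : ∃ i : Fin m, M i.castSucc i.castSucc = 0)
    (hM' : ∃ i : Fin m, M' i.castSucc i.castSucc = 0) (h : M + diagMat m n = M' + diagMat m n') :
    n = n' ∧ M = M' := by
  have h1 : ∀ i : Fin m, M i.castSucc i.castSucc + n = M' i.castSucc i.castSucc + n' := fun i => by
    have := congrFun (congrFun h i.castSucc) i.castSucc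
    rwa [add_diagMat_apply _ _ (Fin.castSucc_lt_last i).ne, if_pos rfl,
      add_diagMat_apply _ _ (Fin.castSucc_lt_last i).ne, if_pos rfl] at this
  obtain ⟨i, hi⟩ := hM
  obtain ⟨j, hj⟩ := hM'
  have hn : n = n' := by
    have := h1 i
    have := h1 j
    omega
  refine ⟨hn, ?_⟩
  ext i j
  have := congrFun (congrFun h i) j
  rw [hn, Matrix.add_apply, Matrix.add_apply] at this
  omega

lemma nGL_eq (a d : ℤ) (M : Mat m) : nGL k (a, d, M) = q k ^ ((d - a) * (oddSum M : ℤ)) •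
    (((detUnit k m ^ a : (O k m)ˣ) : O k m) * omegaABC k M *
      ((yUnit k m ^ d : (O k m)ˣ) : O k m)) := by
  rw [nGL, yPow_eq]

lemma hasLead_omegaABC {M : Mat m} (hM : M ∈ indexABC m) : HasLead (omegaABC k M) M :=
  hasLead_of_sub_mem_Pos (omegaABC_spec hM).2

/-- A choice of the reductions, with the corresponding products of powers of the determinant and
canonical elements. -/
lemma exists_shifted_basis (hm : 0 < m) : ∃ (N : Mat m → ℕ) (R : Mat m → Mat m),
    (∀ T ∈ indexABC m, R T ∈ indexABC m ∧ (∃ i : Fin m, R T i.castSucc i.castSucc = 0) ∧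
      T = R T + diagMat m (N T)) ∧
    ∀ T ∈ indexABC m, HasLead (detA k m ^ N T * omegaABC k (R T)) T := by
  have h : ∀ T : Mat m, ∃ (n : ℕ) (M : Mat m), T ∈ indexABC m → M ∈ indexABC m ∧
      (∃ i : Fin m, M i.castSucc i.castSucc = 0) ∧ T = M + diagMat m n := by
    intro T
    by_cases hT : T ∈ indexABC m
    · obtain ⟨n, M, h⟩ := exists_reduction hm hT
      exact ⟨n, M, fun _ => h⟩
    · exact ⟨0, 0, fun h => absurd h hT⟩
  choose N R hNR using h
  refine ⟨N, R, hNR, fun T hT => ?_⟩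
  obtain ⟨h1, -, h2⟩ := hNR T hT
  have := (hasLead_detA_pow (N T)).mul (hasLead_omegaABC (k := k) h1)
  rwa [add_comm, ← h2] at this

/-- The elements `N_{a,d}(M)` span the coordinate algebra. -/
theorem span_nGL (hm : 0 < m) : Submodule.span (Kq k) (nGL k '' indexGL m) = ⊤ := by
  obtain ⟨N, R, hNR, hlead⟩ := exists_shifted_basis (k := k) hm
  rw [eq_top_iff, ← triSpan_eq_top, triSpan, Submodule.span_le]
  rintro _ ⟨a, d, T, hT, rfl⟩
  have hmem := xNorm_mem_polyPart (k := k) hT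
  rw [← span_image_of_hasLead hlead] at hmem
  generalize xNorm k T = f at hmem
  induction hmem using Submodule.span_induction with
  | mem f hf =>
    obtain ⟨T, hT, rfl⟩ := hf
    obtain ⟨h1, h2, -⟩ := hNR T hT
    have h3 : nGL k (a + N T, d, R T) ∈ Submodule.span (Kq k) (nGL k '' indexGL m) :=
      Submodule.subset_span ⟨_, ⟨h1.1, h2, h1.2⟩, rfl⟩
    have h4 := Submodule.smul_mem _ (q k ^ ((d - (a + N T)) * (oddSum (R T) : ℤ)))⁻¹ h3
    rw [nGL_eq, inv_smul_smul₀ (zpow_ne_zero _ (q_ne_zero k)), zpow_add, Units.val_mul,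
      zpow_natCast, Units.val_pow_eq_pow_val, mul_assoc _ _ (omegaABC k (R T))] at h4
    exact h4
  | zero => rw [mul_zero, zero_mul]; exact zero_mem _
  | add f g _ _ hf hg => rw [mul_add, add_mul]; exact add_mem hf hg
  | smul c f _ hf => rw [mul_smul_comm, smul_mul_assoc]; exact Submodule.smul_mem _ _ hf

lemma bar_detA : bar k (detA k m) = detA k m := by
  have hodd : barOdd (detInv k m) = 0 :=
    IsHomog.barOdd_eq_zero (e := 0) (by rw [IsHomog, parAut_detInv, pow_zero, one_smul]) Even.zero
  have h := congrArg (bar k) (detA_mul_detInv k (m := m))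
  rw [bar_mul_even_right _ hodd, bar_detInv, bar_one] at h
  calc bar k (detA k m) = detA k m * (detInv k m * bar k (detA k m)) := by
        rw [← mul_assoc, detA_mul_detInv, one_mul]
    _ = _ := by rw [h, mul_one]

/-- The factor `q^{(d-a)(S(M₂)+S(M₃))}` compensates for reversing the order of the three factors. -/
lemma bar_nGL {t : ℤ × ℤ × Mat m} (ht : t ∈ indexGL m) : bar k (nGL k t) = nGL k t := by
  obtain ⟨a, d, M⟩ := t
  have hM : M ∈ indexABC m := ⟨ht.1, ht.2.2⟩
  have hD := bar_unit_zpow (w := detUnit k m) parAut_detA bar_detA a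
  have hy := bar_unit_zpow (w := yUnit k m) parAut_y bar_y d
  have hDodd : barOdd ((detUnit k m ^ a : (O k m)ˣ) : O k m) = 0 :=
    IsHomog.barOdd_eq_zero (e := 0) (by rw [IsHomog, hD.1, pow_zero, one_smul]) Even.zero
  have hyodd : barOdd ((yUnit k m ^ d : (O k m)ˣ) : O k m) = 0 :=
    IsHomog.barOdd_eq_zero (e := 0) (by rw [IsHomog, hy.1, pow_zero, one_smul]) Even.zero
  have hlow := (hasLead_omegaABC (k := k) hM).mem_LowEq
  rw [nGL_eq, bar_smul, bar_mul_even_right _ hyodd, bar_mul_even_left _ hDodd, hD.2, hy.2,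
    (omegaABC_spec hM).1, barScalar_zpow, ← mul_assoc,
    scalesOdd_yUnit.zpow_mul d hM.2 hlow, smul_mul_assoc, mul_assoc (omegaABC k M),
    (commute_zpow a d).eq, ← mul_assoc (omegaABC k M)]
  have h1 := scalesOdd_detUnit.zpow_mul a hM.2 hlow
  have h2 : omegaABC k M * ((detUnit k m ^ a : (O k m)ˣ) : O k m) = q k ^ (-(2 * a * oddDeg M)) •
      (((detUnit k m ^ a : (O k m)ˣ) : O k m) * omegaABC k M) := by
    rw [h1, smul_smul, ← zpow_add₀ (q_ne_zero k), neg_add_cancel, zpow_zero, one_smul]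
  rw [h2, smul_mul_assoc, smul_smul, smul_smul, ← zpow_add₀ (q_ne_zero k),
    ← zpow_add₀ (q_ne_zero k), oddSum_eq hM.2]
  congr 2
  ring

/-- The elements `N_{a,d}(M)` are bar invariant, hence belong to the dual canonical basis. -/
theorem nGL_mem_dualCanonicalBasis {t : ℤ × ℤ × Mat m} (ht : t ∈ indexGL m) :
    nGL k t ∈ dualCanonicalBasis k m :=
  ⟨t, ht, bar_nGL ht, 0, by simp, by simp⟩

end Spanning

/-! ### Separating the powers of the determinant and of `y` -/

section Separation

variable {k : Type u} [Field k] [CharZero k] {m : ℕ}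

/-- A linear operator which commutes with the multiplication by the determinant, commutes up to a
scalar with the multiplication by `y`, and maps the ordered monomials to fixed points of
`theta`. -/
structure IsTriLinear (G : O k m →ₗ[Kq k] O k m) : Prop where
  det_mul : ∀ f, G (detA k m * f) = detA k m * G f
  mul_y : ∃ c : Kq k, c ≠ 0 ∧ ∀ f, G (f * y k m) = c • (G f * y k m)
  theta : ∀ f ∈ polyPart k m, QuantumGL.theta k m (G f) = G f

variable {G : O k m →ₗ[Kq k] O k m}

lemma IsTriLinear.det_pow_mul (h : IsTriLinear G) (n : ℕ) (f : O k m) :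
    G (detA k m ^ n * f) = detA k m ^ n * G f := by
  induction n with
  | zero => rw [pow_zero, one_mul, one_mul]
  | succ n ih => rw [pow_succ', mul_assoc, h.det_mul, ih, mul_assoc]

lemma IsTriLinear.det_zpow_mul (h : IsTriLinear G) (a : ℤ) (f : O k m) :
    G (((detUnit k m ^ a : (O k m)ˣ) : O k m) * f) =
      ((detUnit k m ^ a : (O k m)ˣ) : O k m) * G f := by
  have hinv : ∀ f, G (((detUnit k m)⁻¹ : (O k m)ˣ) * f) = ((detUnit k m)⁻¹ : (O k m)ˣ) * G f := by
    intro f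
    rw [Units.eq_inv_mul_iff_mul_eq]
    have := h.det_mul (((detUnit k m)⁻¹ : (O k m)ˣ) * f)
    rw [show detA k m = detUnit k m from rfl, Units.mul_inv_cancel_left] at this
    exact this.symm
  induction a generalizing f with
  | zero => rw [zpow_zero, Units.val_one, one_mul, one_mul]
  | succ n ih =>
    have h1 : ∀ f, G (detUnit k m * f) = detUnit k m * G f := h.det_mul
    rw [zpow_add_one, Units.val_mul, mul_assoc, ih, h1, mul_assoc]
  | pred n ih => rw [zpow_sub_one, Units.val_mul, mul_assoc, ih, hinv, mul_assoc]

lemma IsTriLinear.exists_mul_y_zpow (h : IsTriLinear G) : ∃ c : Kq k, c ≠ 0 ∧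
    ∀ (d : ℤ) (f : O k m), G (f * ((yUnit k m ^ d : (O k m)ˣ) : O k m)) =
      c ^ d • (G f * ((yUnit k m ^ d : (O k m)ˣ) : O k m)) := by
  obtain ⟨c, hc, hy⟩ := h.mul_y
  have h1 : ∀ f, G (f * yUnit k m) = c • (G f * yUnit k m) := hy
  have hinv : ∀ f, G (f * ((yUnit k m)⁻¹ : (O k m)ˣ)) =
      c⁻¹ • (G f * ((yUnit k m)⁻¹ : (O k m)ˣ)) := by
    intro f
    rw [← smul_mul_assoc, Units.eq_mul_inv_iff_mul_eq]
    have := h1 (f * ((yUnit k m)⁻¹ : (O k m)ˣ))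
    rw [Units.inv_mul_cancel_right] at this
    rw [this, inv_smul_smul₀ hc]
  refine ⟨c, hc, fun d => ?_⟩
  induction d with
  | zero => intro f; rw [zpow_zero, zpow_zero, Units.val_one, one_smul, mul_one, mul_one]
  | succ n ih =>
    intro f
    rw [zpow_add_one, zpow_add_one₀ hc, Units.val_mul, ← mul_assoc, h1, ih, smul_mul_assoc,
      smul_smul, mul_assoc, mul_comm c]
  | pred n ih =>
    intro f
    rw [zpow_sub_one, zpow_sub_one₀ hc, Units.val_mul, ← mul_assoc, hinv, ih, smul_mul_assoc,
      smul_smul, mul_assoc, mul_comm c⁻¹]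

lemma detA_pow_mul_omegaABC_mem_polyPart (n : ℕ) {M : Mat m} (hM : M ∈ indexABC m) :
    detA k m ^ n * omegaABC k M ∈ polyPart k m := by
  refine ((hasLead_detA_pow n).mul (hasLead_omegaABC hM)).mem_polyPart ?_
  rw [Matrix.add_apply, diagMat_last, hM.2]

/-- The relation `G f = 0` splits into relations between the products of non-negative powers of
the determinant with canonical elements, one for each power of `y`. -/
lemma IsTriLinear.separate (h : IsTriLinear G) {z : ℤ × ℤ × Mat m →₀ Kq k}
    (hz : ∀ t ∈ z.support, t ∈ indexGL m)
    (h0 : G (Finsupp.linearCombination (Kq k) (nGL k) z) = 0) :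
    ∃ N : ℤ, (∀ t ∈ z.support, 0 ≤ t.1 + N) ∧ ∀ d : ℤ,
      G (∑ t ∈ z.support.filter (fun t => t.2.1 = d),
        (z t * q k ^ ((t.2.1 - t.1) * (oddSum t.2.2 : ℤ))) •
          (detA k m ^ (t.1 + N).toNat * omegaABC k t.2.2)) = 0 := by
  classical
  -- multiplication by `D^B` makes all powers of the determinant non-negative
  obtain ⟨B, hB⟩ := (z.support.image fun t => -t.1).exists_le
  obtain ⟨c, hc, hy⟩ := h.exists_mul_y_zpow
  have hN : ∀ t ∈ z.support, 0 ≤ t.1 + B := fun t ht => by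
    have := hB _ (Finset.mem_image_of_mem (fun t => -t.1) ht)
    omega
  refine ⟨B, hN, ?_⟩
  let g : ℤ → O k m := fun d => ∑ t ∈ z.support.filter (fun t => t.2.1 = d),
    (z t * q k ^ ((t.2.1 - t.1) * (oddSum t.2.2 : ℤ))) •
      (detA k m ^ (t.1 + B).toNat * omegaABC k t.2.2)
  change ∀ d, G (g d) = 0
  have hg : ∀ d, g d ∈ polyPart k m := fun d => sum_mem fun t ht => by
    have := hz t (Finset.mem_filter.mp ht).1
    exact Submodule.smul_mem _ _ (detA_pow_mul_omegaABC_mem_polyPart _ ⟨this.1, this.2.2⟩)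
  have hsum : ((detUnit k m ^ B : (O k m)ˣ) : O k m) *
      Finsupp.linearCombination (Kq k) (nGL k) z =
      ∑ d ∈ z.support.image (fun t => t.2.1), g d * ((yUnit k m ^ d : (O k m)ˣ) : O k m) := by
    rw [Finsupp.linearCombination_apply, Finsupp.sum, Finset.mul_sum,
      ← Finset.sum_fiberwise_of_maps_to fun t ht => Finset.mem_image_of_mem (fun t => t.2.1) ht]
    refine Finset.sum_congr rfl fun d _ => ?_
    simp only [g]
    rw [Finset.sum_mul]
    refine Finset.sum_congr rfl fun t ht => ?_
    obtain ⟨hts, rfl⟩ := Finset.mem_filter.mp ht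
    obtain ⟨a, d, M⟩ := t
    have h1 : detA k m ^ (a + B).toNat = ((detUnit k m ^ (B + a) : (O k m)ˣ) : O k m) := by
      have h2 : B + a = ((a + B).toNat : ℤ) := by
        have := hN _ hts
        simp only at this
        omega
      rw [h2, zpow_natCast, Units.val_pow_eq_pow_val]
      rfl
    rw [nGL_eq, h1, zpow_add, Units.val_mul]
    simp only [mul_smul_comm, smul_mul_assoc, smul_smul, mul_assoc]
  have h1 := h.det_zpow_mul B (Finsupp.linearCombination (Kq k) (nGL k) z)
  rw [h0, mul_zero, hsum, map_sum] at h1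
  simp only [hy] at h1
  have h2 := eq_zero_of_sum_theta _
    (fun d => c ^ d • (G (g d) * ((yUnit k m ^ d : (O k m)ˣ) : O k m))) (fun d => by
      rw [map_smul, map_mul, h.theta _ (hg d), theta_yUnit_zpow, mul_smul_comm, smul_comm]) h1
  intro d
  by_cases hd : d ∈ z.support.image fun t => t.2.1
  · have h3 := (smul_eq_zero.mp (h2 d hd)).resolve_left (zpow_ne_zero _ hc)
    exact (Units.mul_left_eq_zero _).mp h3
  · have : g d = 0 := by
      refine Finset.sum_eq_zero fun t ht => absurd ?_ hd
      obtain ⟨hts, rfl⟩ := Finset.mem_filter.mp ht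
      exact Finset.mem_image_of_mem (fun t => t.2.1) hts
    rw [this, map_zero]

section Shifted

variable {ι : Type*} {n : ι → ℕ} {M : ι → Mat m}

lemma shifted_mem_indexABC (hM : ∀ t, M t ∈ indexABC m) (t : ι) :
    M t + diagMat m (n t) ∈ indexABC m := by
  refine ⟨fun i j hij => ?_, by rw [add_diagMat_last, (hM t).2]⟩
  rcases Fin.eq_castSucc_or_eq_last i with ⟨i, rfl⟩ | rfl
  · rw [add_diagMat_apply _ _ (Fin.castSucc_lt_last i).ne, if_neg]
    · exact (hM t).1 _ _ hij
    · rintro rfl; omega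
  · rw [add_diagMat_last]
    exact (hM t).1 _ _ hij

lemma shifted_injective (hM' : ∀ t, ∃ i : Fin m, M t i.castSucc i.castSucc = 0)
    (hinj : ∀ s t, n s = n t → M s = M t → s = t) {s t : ι}
    (h : M s + diagMat m (n s) = M t + diagMat m (n t)) : s = t := by
  obtain ⟨h1, h2⟩ := reduction_unique (hM' s) (hM' t) h
  exact hinj s t h1 h2

/-- The products `D^n Ω(M)`, with a zero on the even diagonal of `M`, form a family indexed by their
leading terms `M + n I`. -/
lemma exists_shifted_family (hm : 0 < m) : ∃ b : Mat m → O k m,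
    (∀ T ∈ indexABC m, HasLead (b T) T) ∧
    (∀ T ∈ indexABC m, ∃ (n : ℕ) (M : Mat m), M ∈ indexABC m ∧ T = M + diagMat m n ∧
      b T = detA k m ^ n * omegaABC k M) ∧
    ∀ (n : ℕ) (M : Mat m), M ∈ indexABC m → (∃ i : Fin m, M i.castSucc i.castSucc = 0) →
      b (M + diagMat m n) = detA k m ^ n * omegaABC k M := by
  obtain ⟨N, R, hNR, hlead⟩ := exists_shifted_basis (k := k) hm
  refine ⟨fun T => detA k m ^ N T * omegaABC k (R T), hlead,
    fun T hT => ⟨N T, R T, (hNR T hT).1, (hNR T hT).2.2, rfl⟩, fun n M hM hM' => ?_⟩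
  have hT := shifted_mem_indexABC (ι := Unit) (n := fun _ => n) (M := fun _ => M) (fun _ => hM) ()
  obtain ⟨h1, h2, h3⟩ := hNR _ hT
  obtain ⟨h4, h5⟩ := reduction_unique hM' h2 h3
  simp only [← h4, ← h5]

/-- Distinct products `D^n Ω(M)`, with a zero on the even diagonal of each `M`, are independent. -/
lemma linearIndependent_shifted (hm : 0 < m) (hM : ∀ t, M t ∈ indexABC m)
    (hM' : ∀ t, ∃ i : Fin m, M t i.castSucc i.castSucc = 0)
    (hinj : ∀ s t, n s = n t → M s = M t → s = t) :
    LinearIndependent (Kq k) fun t => detA k m ^ n t * omegaABC k (M t) := by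
  obtain ⟨b, hlead, -, hb⟩ := exists_shifted_family (k := k) hm
  have h1 : LinearIndependent (Kq k) fun T : indexABC m => b T := linearIndepOn_of_hasLead hlead
  have h2 := h1.comp (fun t => ⟨_, shifted_mem_indexABC (n := n) hM t⟩) fun s t hst =>
    shifted_injective hM' hinj (congrArg Subtype.val hst)
  convert h2 using 2 with t
  exact (hb _ _ (hM t) (hM' t)).symm

variable {L : Set (Mat m)}

lemma HasCrystalKernel.mem_span (hG : HasCrystalKernel G L) {f : O k m} (hf : f ∈ polyPart k m)
    (h0 : G f = 0) : f ∈ Submodule.span (Kq k) (omegaABC k '' (indexABC m ∩ L)) := by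
  rw [← span_image_of_hasLead fun T hT => hasLead_omegaABC hT,
    Finsupp.mem_span_image_iff_linearCombination] at hf
  obtain ⟨z, hz, rfl⟩ := hf
  exact (Finsupp.mem_span_image_iff_linearCombination _).mpr
    ⟨z, fun T hT => ⟨hz hT, hG.support_subset (fun T hT => hz hT) h0 T hT⟩, rfl⟩

/-- The kernel of `G` on the products of powers of the determinant with canonical elements. -/
lemma HasCrystalKernel.shifted (hG : HasCrystalKernel G L) (h : IsTriLinear G)
    (hL : ∀ T ∈ indexABC m, ∀ n, T + diagMat m n ∈ L → T ∈ L) (hm : 0 < m) [Fintype ι]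
    (hM : ∀ t, M t ∈ indexABC m) (hM' : ∀ t, ∃ i : Fin m, M t i.castSucc i.castSucc = 0)
    (hinj : ∀ s t, n s = n t → M s = M t → s = t) (c : ι → Kq k)
    (h0 : G (∑ t, c t • (detA k m ^ n t * omegaABC k (M t))) = 0) (t : ι) (ht : c t ≠ 0) :
    G (omegaABC k (M t)) = 0 := by
  obtain ⟨b, hlead, hb', hb⟩ := exists_shifted_family (k := k) hm
  let e : ι → indexABC m := fun t => ⟨_, shifted_mem_indexABC (n := n) hM t⟩
  have he : Function.Injective e := fun s t hst =>
    shifted_injective hM' hinj (congrArg Subtype.val hst)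
  have hbe : ∀ t, b (e t) = detA k m ^ n t * omegaABC k (M t) := fun t => hb _ _ (hM t) (hM' t)
  have himage : (fun T : indexABC m => omegaABC k (T : Mat m)) '' {T | (T : Mat m) ∈ L} =
      omegaABC k '' (indexABC m ∩ L) := by
    ext f
    constructor
    · rintro ⟨T, hT, rfl⟩
      exact ⟨T, ⟨T.2, hT⟩, rfl⟩
    · rintro ⟨T, hT, rfl⟩
      exact ⟨⟨T, hT.1⟩, hT.2, rfl⟩
  -- the families `Ω` and `D^n Ω(M)` have the same leading terms, and the members of the second with
  -- leading terms in `L` lie in the span of the members of the first with the same property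
  have key := (isTriangular_of_hasLead (b := fun T : indexABC m => omegaABC k (T : Mat m))
    fun T => hasLead_omegaABC T.2).support_subset
    (isTriangular_of_hasLead (b := fun T : indexABC m => b T) fun T => hlead T T.2)
    linearIndependent_xNorm {T | (T : Mat m) ∈ L} (fun T hT => ?_)
    ((Finsupp.equivFunOnFinite.symm c).mapDomain e) ?_ (e t) ?_
  · exact hG.omegaABC_mem (hM t) (hL _ (hM t) _ key)
  · rw [himage]
    refine hG.mem_span ((hlead T T.2).mem_polyPart T.2.2) ?_
    obtain ⟨n, M, hM, hT', hbT⟩ := hb' T T.2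
    have hML : M ∈ L := hL M hM n (by rw [← hT']; exact hT)
    rw [hbT, h.det_pow_mul, hG.omegaABC_mem hM hML, mul_zero]
  · rw [himage, Finsupp.sum_mapDomain_index_inj he, Finsupp.sum_fintype _ _ fun t => zero_smul (Kq k) (b (e t))]
    simp only [hbe, Finsupp.equivFunOnFinite_symm_apply_apply]
    refine hG.mem_span (sum_mem fun t _ => Submodule.smul_mem _ _
      (detA_pow_mul_omegaABC_mem_polyPart _ (hM t))) h0
  · rw [Finsupp.mem_support_iff, Finsupp.mapDomain_apply he]
    exact ht

end Shifted

lemma isTriLinear_id : IsTriLinear (LinearMap.id : O k m →ₗ[Kq k] O k m) where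
  det_mul _ := rfl
  mul_y := ⟨1, one_ne_zero, fun f => by rw [one_smul]; rfl⟩
  theta f hf := by
    change QuantumGL.theta k m f = f
    induction hf using Submodule.span_induction with
    | mem f hf =>
      obtain ⟨T, hT, rfl⟩ := hf
      rw [xNorm, map_smul, theta_xMon hT.2]
    | zero => exact map_zero _
    | add f g _ _ hf hg => rw [map_add, hf, hg]
    | smul c f _ hf => rw [map_smul, hf]

/-- The elements `N_{a,d}(M)` are linearly independent. -/
theorem linearIndepOn_nGL (hm : 0 < m) : LinearIndepOn (Kq k) (nGL k) (indexGL m) := by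
  rw [linearIndepOn_iff]
  intro z hz h0
  obtain ⟨N, hN, h1⟩ := isTriLinear_id.separate (fun t ht => hz ht) h0
  ext t
  by_contra ht
  have ht' : t ∈ z.support := Finsupp.mem_support_iff.mpr ht
  have h2 := h1 t.2.1
  rw [LinearMap.id_apply, ← Finset.sum_coe_sort] at h2
  have hind := linearIndependent_shifted (k := k) hm
    (ι := z.support.filter fun s => s.2.1 = t.2.1) (n := fun s => (s.1.1 + N).toNat)
    (M := fun s => s.1.2.2) (fun s => ?_) (fun s => ?_) fun s s' h3 h4 => ?_
  · have h3 := Fintype.linearIndependent_iff.mp hind _ h2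
      ⟨t, Finset.mem_filter.mpr ⟨ht', rfl⟩⟩
    exact ht ((mul_eq_zero.mp h3).resolve_right (zpow_ne_zero _ (q_ne_zero k)))
  · have := hz (Finset.mem_filter.mp s.2).1
    exact ⟨this.1, this.2.2⟩
  · exact (hz (Finset.mem_filter.mp s.2).1).2.1
  · obtain ⟨h5, h6⟩ := Finset.mem_filter.mp s.2
    obtain ⟨h7, h8⟩ := Finset.mem_filter.mp s'.2
    have := hN _ h5
    have := hN _ h7
    exact Subtype.ext (Prod.ext (by omega) (Prod.ext (h6.trans h8.symm) h4))

/-- The kernel of `G` is spanned by elements `N_{a,d}(M)`. -/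
theorem HasCrystalKernel.nGL_eq_zero {L : Set (Mat m)} (hG : HasCrystalKernel G L)
    (h : IsTriLinear G) (hL : ∀ T ∈ indexABC m, ∀ n, T + diagMat m n ∈ L → T ∈ L) (hm : 0 < m)
    {z : ℤ × ℤ × Mat m →₀ Kq k} (hz : ∀ t ∈ z.support, t ∈ indexGL m)
    (h0 : G (Finsupp.linearCombination (Kq k) (nGL k) z) = 0) (t : ℤ × ℤ × Mat m)
    (ht : t ∈ z.support) : G (nGL k t) = 0 := by
  obtain ⟨N, hN, h1⟩ := h.separate hz h0
  have h2 := h1 t.2.1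
  rw [← Finset.sum_coe_sort] at h2
  have hker := hG.shifted h hL hm
    (ι := z.support.filter fun s => s.2.1 = t.2.1) (n := fun s => (s.1.1 + N).toNat)
    (M := fun s => s.1.2.2) (fun s => ?_) (fun s => ?_) (fun s s' h3 h4 => ?_) _ h2
    ⟨t, Finset.mem_filter.mpr ⟨ht, rfl⟩⟩
    (mul_ne_zero (Finsupp.mem_support_iff.mp ht) (zpow_ne_zero _ (q_ne_zero k)))
  · obtain ⟨c, -, hy⟩ := h.exists_mul_y_zpow
    obtain ⟨a, d, M⟩ := t
    rw [nGL_eq, map_smul, hy, h.det_zpow_mul, hker, mul_zero, zero_mul, smul_zero, smul_zero]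
  · have := hz s (Finset.mem_filter.mp s.2).1
    exact ⟨this.1, this.2.2⟩
  · exact (hz s (Finset.mem_filter.mp s.2).1).2.1
  · obtain ⟨h5, h6⟩ := Finset.mem_filter.mp s.2
    obtain ⟨h7, h8⟩ := Finset.mem_filter.mp s'.2
    have := hN _ h5
    have := hN _ h7
    exact Subtype.ext (Prod.ext (by omega) (Prod.ext (h6.trans h8.symm) h4))

end Separation

/-! ### The invariants of the generators -/

section Invariants

variable {k : Type u} [Field k] [CharZero k] {m : ℕ}

/-- A move operator maps the ordered monomials to combinations of ordered monomials. -/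
lemma theta_of_isMove {G : O k m →ₗ[Kq k] O k m} {P Q : Fin (m + 1)}
    {c : Fin (m + 1) → Mat m → Kq k} (h : IsMove G P Q c) (f : O k m) (hf : f ∈ polyPart k m) :
    theta k m (G f) = G f := by
  induction hf using Submodule.span_induction with
  | mem f hf =>
    obtain ⟨T, hT, rfl⟩ := hf
    rw [h.apply T hT, map_sum]
    refine Finset.sum_congr rfl fun j _ => ?_
    by_cases hj : T Q j = 0
    · rw [h.zero j T hj, zero_smul, map_zero]
    · rw [map_smul, xNorm, map_smul, theta_xMon (h.last j T hT hj)]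
  | zero => rw [map_zero, map_zero]
  | add f g _ _ hf hg => rw [map_add, map_add, hf, hg]
  | smul c f _ hf => rw [map_smul, map_smul, hf]

lemma isTriLinear_E (p : Fin m) : IsTriLinear (opE p : O k m →ₗ[Kq k] O k m) where
  det_mul f := by
    have h : opP p (detA k m) = detA k m := by
      rcases par_cases p.succ with hp | hp
      · rw [opP_even p hp]
      · rw [opP_eq_parAut p hp, parAut_detA]
    rw [opE_mul, opE_detA, zero_mul, add_zero, h]
  mul_y := by
    obtain ⟨c, h⟩ : ∃ c : (Kq k)ˣ, opKKinv p (y k m) = c • y k m := ⟨_, scale_y _ _⟩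
    refine ⟨c, c.ne_zero, fun f => ?_⟩
    rw [opE_mul, opE_y, mul_zero, zero_add, h, mul_smul_comm]
    rfl
  theta := by
    rcases par_cases p.succ with hp | hp
    · exact theta_of_isMove (isMove_E p hp)
    · exact theta_of_isMove (isMove_E_odd p hp)

lemma isTriLinear_F (p : Fin m) (hp : par p.succ = 0) :
    IsTriLinear (opF p : O k m →ₗ[Kq k] O k m) where
  det_mul f := by rw [opF_mul, opF_detA p hp, zero_mul, add_zero, opKK_detA p hp,
    opP_even p hp]
  mul_y := ⟨1, one_ne_zero, fun f => by rw [opF_mul, opF_y p hp, mul_zero, zero_add, one_smul]⟩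
  theta := theta_of_isMove (isMove_F p hp)

/-- The elements `N_{a,d}(M)` are weight vectors. -/
lemma exists_scale_nGL (r : Fin (m + 1) → (Kq k)ˣ) {t : ℤ × ℤ × Mat m} (ht : t ∈ indexGL m) :
    ∃ c : Kq k, scale r 1 (nGL k t) = c • nGL k t := by
  obtain ⟨a, d, M⟩ := t
  have hM : M ∈ indexABC m := ⟨ht.1, ht.2.2⟩
  obtain ⟨c1, h1⟩ : ∃ c : (Kq k)ˣ, scale r 1 (detA k m) = c • detA k m := ⟨_, scale_detA _ _⟩
  obtain ⟨c2, h2⟩ : ∃ c : (Kq k)ˣ, scale r 1 (y k m) = c • y k m := ⟨_, scale_y _ _⟩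
  have h3 : scale r 1 (omegaABC k M) = (wt r 1 M : Kq k) • omegaABC k M := by
    refine Submodule.span_induction (R := ZQ k)
      (p := fun f _ => scale r 1 f = (wt r 1 M : Kq k) • f) ?_ ?_ ?_ ?_
      (hasLead_omegaABC (k := k) hM).mem_LowEq
    · rintro _ ⟨T, hT, rfl⟩
      rw [scale_xMon]
      rcases hT with rfl | hT
      · rfl
      · rw [wt_below r 1 hT]
    · rw [map_zero, smul_zero]
    · intro f g _ _ hf hg
      rw [map_add, hf, hg, smul_add]
    · intro c f _ hf
      change scale r 1 ((c : Kq k) • f) = _ • (c : Kq k) • f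
      rw [map_smul, hf, smul_comm]
  have h4 := map_unit_zpow (scale r 1) (u := detUnit k m) c1.ne_zero h1 a
  have h5 := map_unit_zpow (scale r 1) (u := yUnit k m) c2.ne_zero h2 d
  refine ⟨(c1 : Kq k) ^ a * (wt r 1 M : Kq k) * (c2 : Kq k) ^ d, ?_⟩
  rw [nGL_eq, map_smul, map_mul, map_mul, h3, h4, h5, smul_mul_smul_comm, smul_mul_smul_comm,
    smul_comm]

/-- In an eigenvector of the torus, all terms `N_{a,d}(M)` are eigenvectors. -/
lemma scale_nGL_of_mem_support (hm : 0 < m) (r : Fin (m + 1) → (Kq k)ˣ)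
    {z : ℤ × ℤ × Mat m →₀ Kq k} (hz : ∀ t ∈ z.support, t ∈ indexGL m)
    (h0 : scale r 1 (Finsupp.linearCombination (Kq k) (nGL k) z) =
      Finsupp.linearCombination (Kq k) (nGL k) z) (t : ℤ × ℤ × Mat m) (ht : t ∈ z.support) :
    scale r 1 (nGL k t) = nGL k t := by
  classical
  have hex : ∀ t : ℤ × ℤ × Mat m, ∃ c : Kq k, t ∈ indexGL m →
      scale r 1 (nGL k t) = c • nGL k t := fun t => by
    by_cases ht : t ∈ indexGL m
    · obtain ⟨c, hc⟩ := exists_scale_nGL (k := k) r ht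
      exact ⟨c, fun _ => hc⟩
    · exact ⟨0, fun h => absurd h ht⟩
  choose c hc using hex
  let w : ℤ × ℤ × Mat m →₀ Kq k := Finsupp.onFinset z.support (fun t => z t * (c t - 1))
    fun t ht => Finsupp.mem_support_iff.mpr (left_ne_zero_of_mul ht)
  have hw := linearIndepOn_iff.mp (linearIndepOn_nGL (k := k) hm) w
    (fun t ht => hz t (Finsupp.support_onFinset_subset ht)) (by
      rw [Finsupp.linearCombination_apply, Finsupp.onFinset_sum _ fun t => zero_smul (Kq k) (nGL k t)]
      rw [← sub_eq_zero, Finsupp.linearCombination_apply, Finsupp.sum, map_sum,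
        ← Finset.sum_sub_distrib] at h0
      rw [← h0]
      refine Finset.sum_congr rfl fun t ht => ?_
      rw [map_smul, hc t (hz t ht), smul_smul, ← sub_smul, mul_sub, mul_one])
  have := DFunLike.congr_fun hw t
  rw [Finsupp.onFinset_apply, Finsupp.zero_apply] at this
  rw [hc t (hz t ht), sub_eq_zero.mp ((mul_eq_zero.mp this).resolve_left
    (Finsupp.mem_support_iff.mp ht)), one_smul]

/-- If a combination of the elements `N_{a,d}(M)` is invariant under a generator other than the odd
generator `F_m`, then so are the elements which occur in it. -/
theorem actGen_nGL (hm : 0 < m) {g : UGen m} (hg : ∀ p : Fin m, g = UGen.F p → par p.succ = 0)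
    {z : ℤ × ℤ × Mat m →₀ Kq k} (hz : ∀ t ∈ z.support, t ∈ indexGL m)
    (h0 : actGen k g (Finsupp.linearCombination (Kq k) (nGL k) z) =
      counitGen k g • Finsupp.linearCombination (Kq k) (nGL k) z) (t : ℤ × ℤ × Mat m)
    (ht : t ∈ z.support) : actGen k g (nGL k t) = counitGen k g • nGL k t := by
  cases g with
  | E p =>
    simp only [actGen, counitGen, zero_smul] at h0 ⊢
    rcases par_cases p.succ with hp | hp
    · exact (hasCrystalKernel_E p hp).nGL_eq_zero (isTriLinear_E p)
        (fun T _ n h => signatureSet_E_add_diagMat p hp h) hm hz h0 t ht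
    · exact (hasCrystalKernel_E_odd p hp).nGL_eq_zero (isTriLinear_E p)
        (fun T hT n h => oddSet_add_diagMat p hp hT h) hm hz h0 t ht
  | F p =>
    simp only [actGen, counitGen, zero_smul] at h0 ⊢
    have hp := hg p rfl
    exact (hasCrystalKernel_F p hp).nGL_eq_zero (isTriLinear_F p hp)
      (fun T _ n h => signatureSet_F_add_diagMat p hp h) hm hz h0 t ht
  | K a =>
    simp only [actGen, counitGen, one_smul] at h0 ⊢
    exact scale_nGL_of_mem_support hm _ hz h0 t ht
  | Kinv a =>
    simp only [actGen, counitGen, one_smul] at h0 ⊢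
    exact scale_nGL_of_mem_support hm _ hz h0 t ht

end Invariants

end QuantumGL

end

theorem theorem5 (k : Type*) [Field k] [CharZero k] (m : ℕ) (hm : 0 < m)
    (S : Set (QuantumGL.UGen m)) (hS : QuantumGL.UGen.F ⟨m - 1, Nat.sub_lt hm one_pos⟩ ∉ S) :
    ∃ T ⊆ QuantumGL.dualCanonicalBasis k m,
      Submodule.span (QuantumGL.Kq k) T =
        Subalgebra.toSubmodule (QuantumGL.invariants k S) := by
  have hF : ∀ g ∈ S, ∀ p : Fin m, g = QuantumGL.UGen.F p → QuantumGL.par p.succ = 0 := by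
    rintro _ hg p rfl
    rcases QuantumGL.par_cases p.succ with hp | hp
    · exact hp
    · refine absurd hg ?_
      have h := congrArg Fin.val (QuantumGL.par_eq_one hp)
      have : p = ⟨m - 1, Nat.sub_lt hm one_pos⟩ := by
        rw [Fin.ext_iff]
        simp at h ⊢
        omega
      rwa [this]
  refine ⟨QuantumGL.nGL k '' {t | t ∈ QuantumGL.indexGL m ∧ ∀ g ∈ S,
    QuantumGL.actGen k g (QuantumGL.nGL k t) = QuantumGL.counitGen k g • QuantumGL.nGL k t},
    ?_, le_antisymm ?_ fun f hf => ?_⟩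
  · rintro _ ⟨t, ht, rfl⟩
    exact QuantumGL.nGL_mem_dualCanonicalBasis ht.1
  · rw [Submodule.span_le]
    rintro _ ⟨t, ht, rfl⟩
    exact (QuantumGL.US_invariant_iff S _).mpr ht.2
  · have hinv := (QuantumGL.US_invariant_iff S f).mp hf
    have htop : f ∈ Submodule.span (QuantumGL.Kq k) (QuantumGL.nGL k '' QuantumGL.indexGL m) := by
      rw [QuantumGL.span_nGL hm]
      exact Submodule.mem_top
    obtain ⟨z, hz, rfl⟩ := (Finsupp.mem_span_image_iff_linearCombination _).mp htop
    exact (Finsupp.mem_span_image_iff_linearCombination _).mpr ⟨z, fun t ht =>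
      ⟨hz ht, fun g hg => QuantumGL.actGen_nGL hm (hF g hg) (fun t ht => hz ht) (hinv g hg) t ht⟩,
      rfl⟩
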